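/- Let $M$ be a complex manifold (of pure finite dimension) with sheaf of holomorphic functions $\mathcal O_M$ and sheaf of differential operators $\mathcal D_M$. For a sheaf of rings, "module" without further specification means sheaf of left modules. Let $n\ge 0$ and $R=\mathbb C[\hbar]/(\hbar^{n+1})$. *Differential operators.* If $\mathcal S,\mathcal T$ are sheaves of rings with a given correspondence between sections of $\mathcal S$ and of $\mathcal T$, an additive morphism of sheaves $A:\mathcal S\to\mathcal T$ is a differential operator if every point has a neighbourhood $U$ and an $N$ such that for all open $V\subset U$ and all corresponding sections $f'_k\in\mathcal S(V)$, $f_k\in\mathcal T(V)$ ($0\le k\le N$) the maps $A_{-1}=A|_V$, $A_k=f_kA_{k-1}-A_{k-1}f'_k$ satisfy $A_N=0$. Operators between sheaves of $\mathbb C$-algebras (resp. $R$-algebras) are required to be $\mathbb C$-linear (resp. $R$-linear); $\mathcal D{iff}(\mathcal S;\mathcal T)$ is the sheaf of these operators. *Coalgebras and comodules.* Let $\mathcal O$ be $\mathcal O_M$ or $\mathcal O_M\otimes_{\mathbb C}R$, and $\mathcal D=\mathcal D_M$ or $\mathcal D_M\otimes_{\mathbb C}R$. Left $\mathcal D$-modules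 form a tensor category under $\otimes_{\mathcal O}$ (vector fields act by the Leibniz rule), which acts on right $\mathcal D$-modules: for a left $\mathcal D$-module $\mathcal A$ and a right $\mathcal D$-module $G$, $\mathcal A\otimes_{\mathcal O}G$ is a right $\mathcal D$-module by $(a\otimes g)f=fa\otimes g$, $(a\otimes g)\tau=a\otimes g\tau-\tau a\otimes g$ for functions $f$ and vector fields $\tau$. Coalgebras (coassociative and counital) are taken in left $\mathcal D$-modules. A left comodule over $\mathcal A$ is a right $\mathcal D$-module $G$ with a counital coaction $\Delta_G:G\to\mathcal A\otimes_{\mathcal O}G$ of right $\mathcal D$-modules such that $(\Delta_{\mathcal A}\otimes 1)\Delta_G=(1\otimes\Delta_G)\Delta_G$; for a right comodule (with the coaction written in the same way) the two factors $\mathcal A$ are interchanged on the right-hand side of this equality. For cocommutative $\mathcal A$ the two notions agree. **(a)** $\mathcal D_M$ has a unique structure of coalgebra in left $\mathcal D_M$-modules with counit $A\mapsto A(1)$ whose coproduct sends $A$ to the section $\sum_i b_i\otimes c_i$ with $A(f_1f_2)=\sum_i b_i(f_1)c_i(f_2)$. For an $\mathcal O_M$-module $P$ let $P_{\mathcal D}=P\otimes_{\mathcal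 O_M}\mathcal D_M$ be the induced right $\mathcal D_M$-module (left $\mathcal O_M$-structure of $\mathcal D_M$ used in the tensor product). There is a unique coaction $\Delta_P:P_{\mathcal D}\to\mathcal D_M\otimes_{\mathcal O_M}P_{\mathcal D}$ with $\Delta_P(p\otimes b)=\sum_i a_i\otimes(p\otimes b_i)$ whenever $\sum_i b_i(a_i(f)g)=f\,b(g)$ for all local $f,g\in\mathcal O_M$. The functor $P\mapsto(P_{\mathcal D},\Delta_P)$ is an equivalence between $\mathcal O_M$-modules and left $\mathcal D_M$-comodules in the category of right $\mathcal D_M$-modules. **(b)** Let $\widetilde M$ be a neutralized $\star$-quantization of $M$ over $R$: a sheaf $\mathcal O_{\widetilde M}$ of $R$-algebras on $M$ that is locally isomorphic to $\mathcal O_M\otimes_{\mathbb C}R$ with an associative $R$-bilinear product $f\star g=\sum_i B_i(f,g)\hbar^i$, where the $B_i$ are bidifferential operators and $B_0(f,g)=fg$. In differential operators between $\mathcal O_{\widetilde M}$ and $\mathcal O_M\otimes R$, sections correspond if they are equal modulo $\hbar$. Then $\mathcal A_{\widetilde M}=\mathcal D{iff}(\mathcal O_{\widetilde M};\mathcal O_M\otimes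 R)$ has a unique structure of coalgebra in left $\mathcal D_M\otimes R$-modules with counit $a\mapsto a(1)$ whose coproduct sends $a$ to the section $\sum_i b_i\otimes c_i$ with $a(f_1f_2)=\sum_i b_i(f_1)c_i(f_2)$. Let $\mathcal B=\mathcal D{iff}(\mathcal O_M\otimes R;\mathcal O_{\widetilde M})$, a right $\mathcal D_M\otimes R$-module by composition, with the commuting right action $(bh)(g)=b(g)h$ of $\mathcal O_{\widetilde M}$. For a left $\mathcal O_{\widetilde M}$-module $P$, the right $\mathcal D_M\otimes R$-module $P_{\mathcal D}=\mathcal B\otimes_{\mathcal O_{\widetilde M}}P$ has a unique structure $\Delta_P$ of right $\mathcal A_{\widetilde M}$-comodule with $\Delta_P(b\otimes p)=\sum_i a_i\otimes(b_i\otimes p)$ whenever $\sum_i b_i(a_i(f)g)=f\,b(g)$ for all local $f\in\mathcal O_{\widetilde M}$, $g\in\mathcal O_M\otimes R$. The functor $P\mapsto(P_{\mathcal D},\Delta_P)$ is an equivalence between left $\mathcal O_{\widetilde M}$-modules and right $\mathcal A_{\widetilde M}$-comodules (equivalently, left comodules over the opposite coalgebra) in the category of right $\mathcal D_M\otimes R$-modules.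 **(Relative form)** Let $p:Z\to X$ be a submersion of complex manifolds, let $\mathcal D_{Z/X}\subset\mathcal D_Z$ be the sheaf of $p^{-1}\mathcal O_X$-linear differential operators. The operators $f\circ p\mapsto P(f)\circ p$ ($P\in\mathcal D_X$) induce an isomorphism $p^*\mathcal D_X\cong\mathcal D{iff}(p^{-1}\mathcal O_X;\mathcal O_Z)$ of $\mathcal O_Z$-modules, where $p^*$ is the inverse image of $\mathcal O$-modules and a section of $p^{-1}\mathcal O_X$ corresponds to itself in $\mathcal O_Z$. This left $\mathcal D_Z$-module has a unique structure of coalgebra with counit $a\mapsto a(1)$ whose coproduct sends $a$ to the section $\sum_i b_i\otimes c_i$ with $a(f_1f_2)=\sum_i b_i(f_1)c_i(f_2)$. For a right $\mathcal D_{Z/X}$-module $F$ there is a unique coaction $\Delta_F$ of $p^*\mathcal D_X$ on the right $\mathcal D_Z$-module $F\otimes_{\mathcal D_{Z/X}}\mathcal D_Z$ with $\Delta_F(s\otimes b)=\sum_i a_i\otimes(s\otimes b_i)$ whenever $\sum_i b_i(a_i(f)g)=f\,b(g)$ for all local $f\in p^{-1}\mathcal O_X$, $g\in\mathcal O_Z$.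 The functor $F\mapsto(F\otimes_{\mathcal D_{Z/X}}\mathcal D_Z,\Delta_F)$ is an equivalence between right $\mathcal D_{Z/X}$-modules and left $p^*\mathcal D_X$-comodules in the category of right $\mathcal D_Z$-modules. -/

import Mathlib

open CategoryTheory TopologicalSpace Opposite
open scoped Manifold ContDiff TensorProduct

universe u v w

noncomputable section

namespace DCom
/-- Sheaves of (not necessarily commutative) rings on `X`. -/
abbrev RSh (X : TopCat.{u}) := Sheaf (Opens.grothendieckTopology X) RingCat.{u}

section Sections
variable {X : TopCat.{u}}

/-- The ring of sections of `S` on `U`. -/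
abbrev rsec (S : RSh X) (U : Opens X) : Type u := S.obj.obj (op U)

/-- Restriction of sections of a sheaf of rings. -/
def rres (S : RSh X) {U V : Opens X} (h : V ≤ U) : rsec S U →+* rsec S V :=
  (S.obj.map (homOfLE h).op).hom

/-- The sections of a sheaf of modules on `U`. -/
abbrev msec {S : RSh X} (P : SheafOfModules.{u} S) (U : Opens X) : Type u := P.val.obj (op U)

/-- Restriction of sections of a sheaf of modules. -/
def mres {S : RSh X} (P : SheafOfModules.{u} S) {U V : Opens X} (h : V ≤ U) :
    msec P U →+ msec P V :=
  (P.val.presheaf.map (homOfLE h).op).hom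

theorem rres_rres (S : RSh X) {U V W : Opens X} (h : V ≤ U) (h' : W ≤ V) (s : rsec S U) :
    rres S h' (rres S h s) = rres S (h'.trans h) s := by
  have := S.obj.map_comp (homOfLE h).op (homOfLE h').op
  exact (congrArg (fun f => f.hom s) this).symm

theorem rres_self (S : RSh X) {U : Opens X} (h : U ≤ U) (s : rsec S U) :
    rres S h s = s := by
  have := S.obj.map_id (op U)
  exact congrArg (fun f => f.hom s) this

theorem mres_mres {S : RSh X} (P : SheafOfModules.{u} S) {U V W : Opens X} (h : V ≤ U)
    (h' : W ≤ V) (s : msec P U) :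
    mres P h' (mres P h s) = mres P (h'.trans h) s := by
  have := P.val.presheaf.map_comp (homOfLE h).op (homOfLE h').op
  exact (congrArg (fun f => f.hom s) this).symm

theorem mres_self {S : RSh X} (P : SheafOfModules.{u} S) {U : Opens X} (h : U ≤ U)
    (s : msec P U) : mres P h s = s := by
  have := P.val.presheaf.map_id (op U)
  exact congrArg (fun f => f.hom s) this

theorem mres_smul {S : RSh X} (P : SheafOfModules.{u} S) {U V : Opens X} (h : V ≤ U)
    (r : rsec S U) (s : msec P U) : mres P h (r • s) = rres S h r • mres P h s :=
  P.val.map_smul (homOfLE h).op r s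

theorem msec_ext {S : RSh X} (P : SheafOfModules.{u} S) {U : Opens X} {s t : msec P U}
    (h : ∀ x ∈ U, ∃ (V : Opens X) (hV : V ≤ U), x ∈ V ∧ mres P hV s = mres P hV t) : s = t := by
  choose V hV hx he using h
  refine TopCat.Sheaf.eq_of_locally_eq' (X := X) (C := AddCommGrpCat.{u})
    ⟨P.val.presheaf, P.isSheaf⟩ (fun x : U => V x.1 x.2) U
    (fun x => homOfLE (hV x.1 x.2)) ?_ s t (fun x => he x.1 x.2)
  intro x hxU
  exact Opens.mem_iSup.2 ⟨⟨x, hxU⟩, hx x hxU⟩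

theorem msec_glue {S : RSh X} (P : SheafOfModules.{u} S) {ι : Type u} {U : Opens X}
    (V : ι → Opens X) (hV : ∀ i, V i ≤ U) (hc : ∀ x ∈ U, ∃ i, x ∈ V i)
    (s : ∀ i, msec P (V i))
    (hs : ∀ i j, mres P (inf_le_left : V i ⊓ V j ≤ V i) (s i) =
      mres P (inf_le_right : V i ⊓ V j ≤ V j) (s j)) :
    ∃ t : msec P U, ∀ i, mres P (hV i) t = s i := by
  obtain ⟨t, ht, -⟩ := TopCat.Sheaf.existsUnique_gluing' (X := X) (C := AddCommGrpCat.{u})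
    ⟨P.val.presheaf, P.isSheaf⟩ V U (fun i => homOfLE (hV i))
    (fun x hxU => Opens.mem_iSup.2 (hc x hxU)) s (fun i j => hs i j)
  exact ⟨t, ht⟩

end Sections

section Diff
variable {X : TopCat.{u}}

/-- A relation between sections of two sheaves of rings, stable under restriction. -/
structure Corr (S T : RSh X) where
  rel : ∀ U : Opens X, rsec S U → rsec T U → Prop
  rel_res : ∀ {U V : Opens X} (h : V ≤ U) (s : rsec S U) (t : rsec T U),
    rel U s t → rel V (rres S h s) (rres T h t)

/-- The relation of equality. -/
def Corr.eq (S : RSh X) : Corr S S where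
  rel _ a b := a = b
  rel_res h s t e := by rw [e]

variable {S T : RSh X}

/-- Families of additive maps `S(V) → P(V)` for the open subsets `V ⊆ U`. -/
abbrev Fam (S : RSh X) (P : SheafOfModules.{u} T) (U : Opens X) : Type u :=
  ∀ V : {V : Opens X // V ≤ U}, rsec S V.1 →+ msec P V.1

variable {P : SheafOfModules.{u} T}

/-- Restriction of a family to a smaller open subset. -/
def Fam.restrict {U W : Opens X} (h : W ≤ U) : Fam S P U →+ Fam S P W where
  toFun φ V := φ ⟨V.1, V.2.trans h⟩
  map_zero' := rfl
  map_add' _ _ := rfl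

/-- The commutator `a ↦ t • φ a - φ (s * a)`. -/
def Fam.commutator {U : Opens X} (s : rsec S U) (t : rsec T U) : Fam S P U →+ Fam S P U where
  toFun φ V := (DistribSMul.toAddMonoidHom (msec P V.1) (rres T V.2 t)).comp (φ V) -
    (φ V).comp (AddMonoidHom.mulLeft (rres S V.2 s))
  map_zero' := by
    funext V; ext a; simp
  map_add' φ ψ := by
    funext V; ext a
    simp only [AddMonoidHom.sub_apply, AddMonoidHom.comp_apply, Pi.add_apply,
      AddMonoidHom.add_apply, map_add]
    abel

/-- All `N`-fold iterated commutators of `φ`, formed on smaller and smaller open subsets with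
sections `s` of the source and `t` of the target that correspond to each other under `con`,
vanish. -/
def Fam.OrderLT (con : Corr S T) : ℕ → ∀ U : Opens X, Fam S P U → Prop
  | 0, _, φ => φ = 0
  | N + 1, U, φ => ∀ (V : Opens X) (h : V ≤ U) (s : rsec S V) (t : rsec T V),
      con.rel V s t → Fam.OrderLT con N V (Fam.commutator s t (Fam.restrict h φ))

theorem Fam.OrderLT.res {con : Corr S T} {N : ℕ} {U W : Opens X} (h : W ≤ U) {φ : Fam S P U}
    (hφ : Fam.OrderLT con N U φ) : Fam.OrderLT con N W (Fam.restrict h φ) := by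
  cases N with
  | zero => rw [show φ = 0 from hφ]; rfl
  | succ N => exact fun V hV s t r => hφ V (hV.trans h) s t r

theorem Fam.OrderLT.zero (con : Corr S T) (N : ℕ) (U : Opens X) :
    Fam.OrderLT con N U (0 : Fam S P U) := by
  induction N generalizing U with
  | zero => rfl
  | succ N ih =>
    intro V hV s t _
    rw [map_zero, map_zero]
    exact ih V

theorem Fam.OrderLT.succ {con : Corr S T} {N : ℕ} {U : Opens X} {φ : Fam S P U}
    (hφ : Fam.OrderLT con N U φ) : Fam.OrderLT con (N + 1) U φ := by
  induction N generalizing U with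
  | zero => rw [show φ = 0 from hφ]; exact Fam.OrderLT.zero con 1 U
  | succ N ih => exact fun V hV s t r => ih (hφ V hV s t r)

theorem Fam.OrderLT.mono {con : Corr S T} {N M : ℕ} (h : N ≤ M) {U : Opens X} {φ : Fam S P U}
    (hφ : Fam.OrderLT con N U φ) : Fam.OrderLT con M U φ := by
  induction h with
  | refl => exact hφ
  | step _ ih => exact ih.succ

theorem Fam.OrderLT.add {con : Corr S T} {N : ℕ} {U : Opens X} {φ ψ : Fam S P U}
    (hφ : Fam.OrderLT con N U φ) (hψ : Fam.OrderLT con N U ψ) :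
    Fam.OrderLT con N U (φ + ψ) := by
  induction N generalizing U with
  | zero => rw [show φ = 0 from hφ, show ψ = 0 from hψ, add_zero]; rfl
  | succ N ih =>
    intro V hV s t r
    rw [map_add, map_add]
    exact ih (hφ V hV s t r) (hψ V hV s t r)

theorem Fam.OrderLT.neg {con : Corr S T} {N : ℕ} {U : Opens X} {φ : Fam S P U}
    (hφ : Fam.OrderLT con N U φ) : Fam.OrderLT con N U (-φ) := by
  induction N generalizing U with
  | zero => rw [show φ = 0 from hφ, neg_zero]; rfl
  | succ N ih =>
    intro V hV s t r
    rw [map_neg, map_neg]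
    exact ih (hφ V hV s t r)

/-- A family `φ` is a differential operator on `U`: it is a morphism of sheaves, it is linear for
the pairs of scalars related by `lin`, and every point has a neighbourhood with a bound for the
order with respect to `con`. -/
structure IsDiffOp (lin con : Corr S T) {U : Opens X} (φ : Fam S P U) : Prop where
  natural : ∀ (V W : Opens X) (hV : V ≤ U) (hW : W ≤ V) (s : rsec S V),
    mres P hW (φ ⟨V, hV⟩ s) = φ ⟨W, hW.trans hV⟩ (rres S hW s)
  linear : ∀ (V : Opens X) (hV : V ≤ U) (s : rsec S V) (t : rsec T V) (a : rsec S V),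
    lin.rel V s t → φ ⟨V, hV⟩ (s * a) = t • φ ⟨V, hV⟩ a
  order : ∀ x ∈ U, ∃ (V : Opens X) (hV : V ≤ U) (N : ℕ), x ∈ V ∧
    Fam.OrderLT con N V (Fam.restrict hV φ)

/-- The group of differential operators `S → P` on `U`. -/
def diffOps (P : SheafOfModules.{u} T) (lin con : Corr S T) (U : Opens X) :
    AddSubgroup (Fam S P U) where
  carrier := {φ | IsDiffOp lin con φ}
  zero_mem' :=
    { natural := fun V W hV hW s => by simp
      linear := fun V hV s t a _ => by simp
      order := fun x hx => ⟨U, le_rfl, 0, hx, rfl⟩ }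
  add_mem' := fun {φ ψ} hφ hψ =>
    { natural := fun V W hV hW s => by
        simp only [Pi.add_apply, AddMonoidHom.add_apply, map_add, hφ.natural V W hV hW,
          hψ.natural V W hV hW]
      linear := fun V hV s t a r => by
        simp only [Pi.add_apply, AddMonoidHom.add_apply, hφ.linear V hV s t a r,
          hψ.linear V hV s t a r, smul_add]
      order := fun x hx => by
        obtain ⟨V, hV, N, hxV, h⟩ := hφ.order x hx
        obtain ⟨V', hV', N', hxV', h'⟩ := hψ.order x hx
        refine ⟨V ⊓ V', inf_le_left.trans hV, max N N', ⟨hxV, hxV'⟩, ?_⟩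
        exact ((h.res inf_le_left).mono (le_max_left N N')).add
          ((h'.res inf_le_right).mono (le_max_right N N')) }
  neg_mem' := fun {φ} hφ =>
    { natural := fun V W hV hW s => by
        simp only [Pi.neg_apply, AddMonoidHom.neg_apply, map_neg, hφ.natural V W hV hW]
      linear := fun V hV s t a r => by
        simp only [Pi.neg_apply, AddMonoidHom.neg_apply, hφ.linear V hV s t a r, smul_neg]
      order := fun x hx => by
        obtain ⟨V, hV, N, hxV, h⟩ := hφ.order x hx
        exact ⟨V, hV, N, hxV, h.neg⟩ }

/-- Restriction of differential operators. -/
def diffRes (P : SheafOfModules.{u} T) (lin con : Corr S T) {U W : Opens X} (h : W ≤ U) :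
    diffOps P lin con U →+ diffOps P lin con W where
  toFun φ := ⟨Fam.restrict h φ.1,
    { natural := fun V W' hV hW s => φ.2.natural V W' (hV.trans h) hW s
      linear := fun V hV s t a r => φ.2.linear V (hV.trans h) s t a r
      order := fun x hx => by
        obtain ⟨V, hV, N, hxV, h'⟩ := φ.2.order x (h hx)
        exact ⟨V ⊓ W, inf_le_right, N, ⟨hxV, hx⟩, h'.res inf_le_left⟩ }⟩
  map_zero' := rfl
  map_add' _ _ := rfl

theorem diff_ext {lin con : Corr S T} {U : Opens X} {φ ψ : diffOps P lin con U}
    (h : ∀ x ∈ U, ∃ (V : Opens X) (hV : V ≤ U), x ∈ V ∧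
      diffRes P lin con hV φ = diffRes P lin con hV ψ) : φ = ψ := by
  apply Subtype.ext
  funext V
  ext s
  refine msec_ext P fun x hx => ?_
  obtain ⟨W, hW, hxW, e⟩ := h x (V.2 hx)
  refine ⟨V.1 ⊓ W, inf_le_left, ⟨hx, hxW⟩, ?_⟩
  rw [φ.2.natural V.1 (V.1 ⊓ W) V.2 inf_le_left, ψ.2.natural V.1 (V.1 ⊓ W) V.2 inf_le_left]
  have := congrArg (fun χ => χ.1 ⟨V.1 ⊓ W, inf_le_right⟩) e
  exact DFunLike.congr_fun this (rres S inf_le_left s)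

theorem diff_glue {lin con : Corr S T} {ι : Type u} {U : Opens X}
    (V : ι → Opens X) (hV : ∀ i, V i ≤ U) (hc : ∀ x ∈ U, ∃ i, x ∈ V i)
    (φ : ∀ i, diffOps P lin con (V i))
    (hφ : ∀ i j, diffRes P lin con (inf_le_left : V i ⊓ V j ≤ V i) (φ i) =
      diffRes P lin con (inf_le_right : V i ⊓ V j ≤ V j) (φ j)) :
    ∃ ψ : diffOps P lin con U, ∀ i, diffRes P lin con (hV i) ψ = φ i := by
  have key : ∀ (W : {W : Opens X // W ≤ U}) (s : rsec S W.1), ∃ t : msec P W.1, ∀ i,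
      mres P (inf_le_left : W.1 ⊓ V i ≤ W.1) t =
        (φ i).1 ⟨W.1 ⊓ V i, inf_le_right⟩ (rres S inf_le_left s) := by
    intro W s
    refine msec_glue P (fun i => W.1 ⊓ V i) (fun i => inf_le_left)
      (fun x hx => (hc x (W.2 hx)).imp fun i hi => ⟨hx, hi⟩) _ fun i j => ?_
    rw [(φ i).2.natural, (φ j).2.natural, rres_rres, rres_rres]
    have := congrArg (fun χ => χ.1 ⟨(W.1 ⊓ V i) ⊓ (W.1 ⊓ V j),
      inf_le_inf inf_le_right inf_le_right⟩) (hφ i j)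
    exact DFunLike.congr_fun this _
  choose t ht using key
  have huniq : ∀ (W : {W : Opens X // W ≤ U}) (a b : msec P W.1),
      (∀ i, mres P (inf_le_left : W.1 ⊓ V i ≤ W.1) a = mres P inf_le_left b) → a = b := by
    intro W a b h
    refine msec_ext P fun x hx => ?_
    obtain ⟨i, hi⟩ := hc x (W.2 hx)
    exact ⟨W.1 ⊓ V i, inf_le_left, ⟨hx, hi⟩, h i⟩
  let ψ : Fam S P U := fun W => AddMonoidHom.mk' (t W) fun a b => huniq W _ _ fun i => by
    rw [ht, map_add, map_add, map_add, ht, ht]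
  have hψ : ∀ i, Fam.restrict (hV i) ψ = (φ i).1 := by
    intro i
    funext W
    ext s
    refine msec_ext P fun x hx => ⟨W.1 ⊓ V i, inf_le_left, ⟨hx, W.2 hx⟩, ?_⟩
    exact (ht ⟨W.1, W.2.trans (hV i)⟩ s i).trans ((φ i).2.natural W.1 _ W.2 inf_le_left s).symm
  refine ⟨⟨ψ, ⟨?_, ?_, ?_⟩⟩, fun i => Subtype.ext (hψ i)⟩
  · intro W W' hW hW' s
    refine huniq ⟨W', hW'.trans hW⟩ _ _ fun i => ?_
    have h1 := ht ⟨W', hW'.trans hW⟩ (rres S hW' s) i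
    have h2 := congrArg (mres P (inf_le_inf_right (V i) hW' : W' ⊓ V i ≤ W ⊓ V i))
      (ht ⟨W, hW⟩ s i)
    rw [mres_mres, (φ i).2.natural, rres_rres] at h2
    rw [rres_rres] at h1
    rw [mres_mres]
    exact h2.trans h1.symm
  · intro W hW s r a hr
    refine huniq ⟨W, hW⟩ _ _ fun i => ?_
    have h1 := ht ⟨W, hW⟩ (s * a) i
    rw [map_mul, (φ i).2.linear _ _ _ _ _ (lin.rel_res inf_le_left s r hr),
      ← ht ⟨W, hW⟩ a i, ← mres_smul] at h1
    exact h1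
  · intro x hx
    obtain ⟨i, hi⟩ := hc x hx
    obtain ⟨W, hW, N, hxW, h⟩ := (φ i).2.order x hi
    refine ⟨W, hW.trans (hV i), N, hxW, ?_⟩
    rw [← hψ i] at h
    exact h

/-- Sheaf criterion for presheaves of abelian groups. -/
theorem ab_isSheaf (F : (Opens X)ᵒᵖ ⥤ AddCommGrpCat.{u})
    (hext : ∀ (U : Opens X) (s t : F.obj (op U)), (∀ x ∈ U, ∃ (V : Opens X) (hV : V ≤ U), x ∈ V ∧
      (F.map (homOfLE hV).op).hom s = (F.map (homOfLE hV).op).hom t) → s = t)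
    (hglue : ∀ {ι : Type u} (U : Opens X) (V : ι → Opens X) (hV : ∀ i, V i ≤ U)
      (_ : ∀ x ∈ U, ∃ i, x ∈ V i) (s : ∀ i, F.obj (op (V i))),
      (∀ i j, (F.map (homOfLE (inf_le_left : V i ⊓ V j ≤ V i)).op).hom (s i) =
        (F.map (homOfLE (inf_le_right : V i ⊓ V j ≤ V j)).op).hom (s j)) →
      ∃ t : F.obj (op U), ∀ i, (F.map (homOfLE (hV i)).op).hom t = s i) :
    Presheaf.IsSheaf (Opens.grothendieckTopology X) F := by
  refine (TopCat.Presheaf.isSheaf_iff_isSheafUniqueGluing (X := X) F).2 fun ι V s hs => ?_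
  obtain ⟨t, ht⟩ := hglue (iSup V) V (fun i => le_iSup V i)
    (fun x hx => Opens.mem_iSup.1 hx) s (fun i j => hs i j)
  refine ⟨t, fun i => ht i, fun t' ht' => hext _ _ _ fun x hx => ?_⟩
  obtain ⟨i, hi⟩ := Opens.mem_iSup.1 hx
  exact ⟨V i, le_iSup V i, hi, (ht' i).trans (ht i).symm⟩

/-- Sheaf criterion for presheaves of rings. -/
theorem ring_isSheaf (F : (Opens X)ᵒᵖ ⥤ RingCat.{u})
    (hext : ∀ (U : Opens X) (s t : F.obj (op U)), (∀ x ∈ U, ∃ (V : Opens X) (hV : V ≤ U), x ∈ V ∧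
      (F.map (homOfLE hV).op).hom s = (F.map (homOfLE hV).op).hom t) → s = t)
    (hglue : ∀ {ι : Type u} (U : Opens X) (V : ι → Opens X) (hV : ∀ i, V i ≤ U)
      (_ : ∀ x ∈ U, ∃ i, x ∈ V i) (s : ∀ i, F.obj (op (V i))),
      (∀ i j, (F.map (homOfLE (inf_le_left : V i ⊓ V j ≤ V i)).op).hom (s i) =
        (F.map (homOfLE (inf_le_right : V i ⊓ V j ≤ V j)).op).hom (s j)) →
      ∃ t : F.obj (op U), ∀ i, (F.map (homOfLE (hV i)).op).hom t = s i) :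
    Presheaf.IsSheaf (Opens.grothendieckTopology X) F := by
  refine (TopCat.Presheaf.isSheaf_iff_isSheafUniqueGluing (X := X) F).2 fun ι V s hs => ?_
  obtain ⟨t, ht⟩ := hglue (iSup V) V (fun i => le_iSup V i)
    (fun x hx => Opens.mem_iSup.1 hx) s (fun i j => hs i j)
  refine ⟨t, fun i => ht i, fun t' ht' => hext _ _ _ fun x hx => ?_⟩
  obtain ⟨i, hi⟩ := Opens.mem_iSup.1 hx
  exact ⟨V i, le_iSup V i, hi, (ht' i).trans (ht i).symm⟩

/-- The presheaf (in fact sheaf) of differential operators `S → P`. -/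
def diffPre (P : SheafOfModules.{u} T) (lin con : Corr S T) :
    (Opens X)ᵒᵖ ⥤ AddCommGrpCat.{u} where
  obj U := AddCommGrpCat.of (diffOps P lin con U.unop)
  map h := AddCommGrpCat.ofHom (diffRes P lin con h.unop.le)
  map_id _ := rfl
  map_comp _ _ := rfl

theorem diffPre_isSheaf (P : SheafOfModules.{u} T) (lin con : Corr S T) :
    Presheaf.IsSheaf (Opens.grothendieckTopology X) (diffPre P lin con) :=
  ab_isSheaf _ (fun _ _ _ h => diff_ext h) (fun _ V hV hc s hs => diff_glue V hV hc s hs)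

end Diff

section Comp
variable {X : TopCat.{u}} {S T T' : RSh X} {P : SheafOfModules.{u} T'}

abbrev unitMod (S : RSh X) : SheafOfModules.{u} S := SheafOfModules.unit S

/-- Sections of a sheaf of rings as sections of the sheaf as a module over itself. -/
def toUnit (S : RSh X) (U : Opens X) : msec (unitMod S) U ≃+ rsec S U := AddEquiv.refl _

/-- Composition of families of maps. -/
def Fam.comp {U : Opens X} (ψ : Fam T P U) (φ : Fam S (unitMod T) U) : Fam S P U :=
  fun V => (ψ V).comp ((toUnit T V.1).toAddMonoidHom.comp (φ V))

theorem Fam.comp_add {U : Opens X} (ψ : Fam T P U) (φ φ' : Fam S (unitMod T) U) :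
    ψ.comp (φ + φ') = ψ.comp φ + ψ.comp φ' := by
  funext V; ext a
  exact map_add (ψ V) _ _

theorem Fam.commutator_comp {U : Opens X} (ψ : Fam T P U) (φ : Fam S (unitMod T) U)
    (s : rsec S U) (t : rsec T U) (t' : rsec T' U) :
    Fam.commutator s t' (ψ.comp φ) =
      (Fam.commutator t t' ψ).comp φ + ψ.comp (Fam.commutator s t φ) := by
  funext V; ext a
  have h : ψ V (toUnit T V.1 (rres T V.2 t • φ V a - φ V (rres S V.2 s * a))) =
      ψ V (rres T V.2 t * toUnit T V.1 (φ V a)) -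
        ψ V (toUnit T V.1 (φ V (rres S V.2 s * a))) := map_sub (ψ V) _ _
  change rres T' V.2 t' • ψ V (toUnit T V.1 (φ V a)) -
      ψ V (toUnit T V.1 (φ V (rres S V.2 s * a))) =
    (rres T' V.2 t' • ψ V (toUnit T V.1 (φ V a)) -
      ψ V (rres T V.2 t * toUnit T V.1 (φ V a))) +
    ψ V (toUnit T V.1 (rres T V.2 t • φ V a - φ V (rres S V.2 s * a)))
  rw [h]
  abel

theorem Fam.OrderLT.comp {c₁ : Corr S T} {c₂ : Corr T T'} {c₃ : Corr S T'}
    (hc : ∀ (U : Opens X) (s : rsec S U) (t' : rsec T' U), c₃.rel U s t' →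
      ∃ t : rsec T U, c₁.rel U s t ∧ c₂.rel U t t')
    {k N M : ℕ} (hk : N + M ≤ k) {U : Opens X} {ψ : Fam T P U} {φ : Fam S (unitMod T) U}
    (hψ : Fam.OrderLT c₂ M U ψ) (hφ : Fam.OrderLT c₁ N U φ) :
    Fam.OrderLT c₃ k U (ψ.comp φ) := by
  induction k generalizing N M U with
  | zero =>
    obtain rfl : M = 0 := by omega
    rw [show ψ = 0 from hψ]; rfl
  | succ k ih =>
    cases M with
    | zero => rw [show ψ = 0 from hψ]; exact Fam.OrderLT.zero c₃ (k + 1) U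
    | succ m =>
      cases N with
      | zero =>
        rw [show φ = 0 from hφ]
        have : ψ.comp (0 : Fam S (unitMod T) U) = 0 := by
          funext V; ext a; exact map_zero (ψ V)
        rw [this]; exact Fam.OrderLT.zero c₃ (k + 1) U
      | succ n =>
        intro V hV s t' r
        obtain ⟨t, h1, h2⟩ := hc V s t' r
        have e : Fam.restrict hV (ψ.comp φ) =
          (Fam.restrict hV ψ).comp (Fam.restrict hV φ) := rfl
        rw [e, Fam.commutator_comp _ _ s t t']
        exact (ih (N := n + 1) (M := m) (by omega) (hψ V hV t t' h2)
            (Fam.OrderLT.res (N := n + 1) hV hφ)).add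
          (ih (N := n) (M := m + 1) (by omega) (Fam.OrderLT.res (N := m + 1) hV hψ)
            (hφ V hV s t h1))

theorem IsDiffOp.comp {l₁ c₁ : Corr S T} {l₂ c₂ : Corr T T'} {l₃ c₃ : Corr S T'}
    (hc : ∀ (U : Opens X) (s : rsec S U) (t' : rsec T' U), c₃.rel U s t' →
      ∃ t : rsec T U, c₁.rel U s t ∧ c₂.rel U t t')
    (hl : ∀ (U : Opens X) (s : rsec S U) (t' : rsec T' U), l₃.rel U s t' →
      ∃ t : rsec T U, l₁.rel U s t ∧ l₂.rel U t t')
    {U : Opens X} {ψ : Fam T P U} {φ : Fam S (unitMod T) U}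
    (hψ : IsDiffOp l₂ c₂ ψ) (hφ : IsDiffOp l₁ c₁ φ) : IsDiffOp l₃ c₃ (ψ.comp φ) where
  natural V W hV hW s :=
    (hψ.natural V W hV hW (toUnit T V (φ ⟨V, hV⟩ s))).trans
      (congrArg (fun a => ψ ⟨W, hW.trans hV⟩ (toUnit T W a)) (hφ.natural V W hV hW s))
  linear V hV s t' a r := by
    obtain ⟨t, h1, h2⟩ := hl V s t' r
    have e := congrArg (fun a => ψ ⟨V, hV⟩ (toUnit T V a)) (hφ.linear V hV s t a h1)
    exact e.trans (hψ.linear V hV t t' (toUnit T V (φ ⟨V, hV⟩ a)) h2)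
  order x hx := by
    obtain ⟨V, hV, N, hxV, h⟩ := hψ.order x hx
    obtain ⟨V', hV', N', hxV', h'⟩ := hφ.order x hx
    exact ⟨V ⊓ V', inf_le_left.trans hV, N' + N, ⟨hxV, hxV'⟩,
      Fam.OrderLT.comp hc le_rfl (h.res inf_le_left) (h'.res inf_le_right)⟩

end Comp

section Ring
variable {X : TopCat.{u}}

/-- A linearity condition for operators of a sheaf of rings to itself. -/
structure Lin (S : RSh X) extends Corr S S where
  eq_of_rel : ∀ (U : Opens X) (s t : rsec S U), rel U s t → s = t

variable (S : RSh X) (L : Lin S)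

/-- The differential operators `S → S` on `U` that are linear over the scalars given by `L`. -/
def DSec (U : Opens X) : Type u := diffOps (unitMod S) L.toCorr (Corr.eq S) U

instance (U : Opens X) : AddCommGroup (DSec S L U) :=
  inferInstanceAs (AddCommGroup (diffOps (unitMod S) L.toCorr (Corr.eq S) U))

variable {S L}

/-- The value of an operator on a section. -/
def DSec.ev {U V : Opens X} (A : DSec S L U) (h : V ≤ U) (f : rsec S V) : rsec S V :=
  toUnit S V (A.1 ⟨V, h⟩ f)

theorem DSec.ext {U : Opens X} {A B : DSec S L U}
    (h : ∀ (V : Opens X) (hV : V ≤ U) (f : rsec S V), A.ev hV f = B.ev hV f) : A = B := by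
  apply Subtype.ext
  funext V; ext f
  exact h V.1 V.2 f

theorem DSec.comp_mem {U : Opens X} (A B : DSec S L U) :
    IsDiffOp L.toCorr (Corr.eq S) (Fam.comp A.1 B.1) :=
  IsDiffOp.comp (fun _ s t h => ⟨s, rfl, h⟩)
    (fun U s t h => ⟨t, h, by obtain rfl := L.eq_of_rel U s t h; exact h⟩) A.2 B.2

/-- The family of identity maps. -/
def Fam.id (S : RSh X) (U : Opens X) : Fam S (unitMod S) U :=
  fun V => (toUnit S V.1).symm.toAddMonoidHom

theorem Fam.id_mem (L : Lin S) (U : Opens X) :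
    IsDiffOp L.toCorr (Corr.eq S) (Fam.id S U) where
  natural _ _ _ _ _ := rfl
  linear V hV s t a r := by
    obtain rfl := L.eq_of_rel V s t r
    rfl
  order x hx := ⟨U, le_rfl, 1, hx, fun V hV s t r => by
    obtain rfl : s = t := r
    funext W; ext a
    exact sub_self _⟩

/-- Multiplication of differential operators is composition. -/
instance (U : Opens X) : Ring (DSec S L U) where
  __ := (inferInstance : AddCommGroup (DSec S L U))
  mul A B := ⟨Fam.comp A.1 B.1, DSec.comp_mem A B⟩
  one := ⟨Fam.id S U, Fam.id_mem L U⟩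
  mul_assoc _ _ _ := rfl
  one_mul _ := rfl
  mul_one _ := rfl
  left_distrib A B C := Subtype.ext (Fam.comp_add A.1 B.1 C.1)
  right_distrib _ _ _ := rfl
  zero_mul _ := rfl
  mul_zero A := Subtype.ext (by funext V; ext a; exact map_zero (A.1 V))

theorem DSec.mul_ev {U V : Opens X} (A B : DSec S L U) (h : V ≤ U) (f : rsec S V) :
    (A * B).ev h f = A.ev h (B.ev h f) := rfl

/-- Restriction of differential operators. -/
def DSec.res {U W : Opens X} (h : W ≤ U) : DSec S L U →+* DSec S L W where
  __ := diffRes (unitMod S) L.toCorr (Corr.eq S) h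
  map_one' := rfl
  map_mul' _ _ := rfl

variable (S L) in
/-- The sheaf of rings of differential operators `S → S`, linear over the scalars given by `L`. -/
def DSheaf : RSh X where
  obj :=
    { obj U := RingCat.of (DSec S L U.unop)
      map h := RingCat.ofHom (DSec.res h.unop.le)
      map_id _ := rfl
      map_comp _ _ := rfl }
  property := ring_isSheaf _ (fun _ _ _ h => diff_ext h)
    (fun _ V hV hc s hs => diff_glue V hV hc s hs)

/-- The opposite sheaf of rings. -/
def opSheaf (R : RSh X) : RSh X where
  obj :=
    { obj U := RingCat.of (rsec R U.unop)ᵐᵒᵖ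
      map h := RingCat.ofHom (rres R h.unop.le).op
      map_id U := by
        ext a
        exact congrArg MulOpposite.op (rres_self R le_rfl a.unop)
      map_comp f g := by
        ext a
        exact congrArg MulOpposite.op (rres_rres R f.unop.le g.unop.le a.unop).symm }
  property := ring_isSheaf _
    (fun U s t h => MulOpposite.unop_injective <| msec_ext (unitMod R) fun x hx => by
      obtain ⟨V, hV, hxV, e⟩ := h x hx
      exact ⟨V, hV, hxV, congrArg MulOpposite.unop e⟩)
    (fun U V hV hc s hs => by
      obtain ⟨t, ht⟩ := msec_glue (unitMod R) V hV hc (fun i => MulOpposite.unop (s i))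
        (fun i j => congrArg MulOpposite.unop (hs i j))
      exact ⟨MulOpposite.op t, fun i => congrArg MulOpposite.op (ht i)⟩)

end Ring

section Modules
variable {X : TopCat.{u}}

/-- A sheaf of (not necessarily commutative) `K`-algebras on `X`. -/
structure AlgSheaf (K : Type) [CommRing K] (X : TopCat.{u}) where
  ring : RSh X
  scalar : ∀ U : Opens X, K →+* rsec ring U
  scalar_res : ∀ {U V : Opens X} (h : V ≤ U) (k : K), rres ring h (scalar U k) = scalar V k
  scalar_comm : ∀ (U : Opens X) (k : K) (s : rsec ring U), scalar U k * s = s * scalar U k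

variable {K : Type} [CommRing K]

/-- The pairs of sections of `S` and `T` given by one and the same scalar in `K`; linearity for
these pairs is `K`-linearity. -/
def AlgSheaf.lin (S T : AlgSheaf K X) : Corr S.ring T.ring where
  rel U s t := ∃ k : K, s = S.scalar U k ∧ t = T.scalar U k
  rel_res := by
    rintro U V h _ _ ⟨k, rfl, rfl⟩
    exact ⟨k, S.scalar_res h k, T.scalar_res h k⟩

/-- `K`-linearity for operators of `S` to itself. -/
def AlgSheaf.selfLin (S : AlgSheaf K X) : Lin S.ring where
  toCorr := S.lin S
  eq_of_rel := by
    rintro U _ _ ⟨k, rfl, rfl⟩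
    rfl

/-- The sheaf of rings of `K`-linear differential operators `O → O`. -/
abbrev AlgSheaf.D (O : AlgSheaf K X) : RSh X := DSheaf O.ring O.selfLin

variable (O S : AlgSheaf K X)

/-- The differential operators `S → O` are a left module over the differential operators `O → O`. -/
instance leftModule (con : Corr S.ring O.ring) (U : Opens X) :
    Module (DSec O.ring O.selfLin U) (diffOps (unitMod O.ring) (S.lin O) con U) where
  smul A a := ⟨Fam.comp A.1 a.1, IsDiffOp.comp (fun _ s t h => ⟨t, h, rfl⟩)
    (by rintro U _ _ ⟨k, rfl, rfl⟩; exact ⟨O.scalar U k, ⟨k, rfl, rfl⟩, ⟨k, rfl, rfl⟩⟩) A.2 a.2⟩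
  one_smul _ := rfl
  mul_smul _ _ _ := rfl
  smul_zero A := Subtype.ext (by funext V; ext a; exact map_zero (A.1 V))
  smul_add A a b := Subtype.ext (Fam.comp_add A.1 a.1 b.1)
  add_smul _ _ _ := rfl
  zero_smul _ := rfl

/-- The differential operators `O → P` are a right module over the differential operators `O → O`. -/
instance rightModule (con : Corr O.ring S.ring) (P : SheafOfModules.{u} S.ring) (U : Opens X) :
    Module (DSec O.ring O.selfLin U)ᵐᵒᵖ (diffOps P (O.lin S) con U) where
  smul A a := ⟨Fam.comp a.1 A.unop.1, IsDiffOp.comp (fun _ s t h => ⟨s, rfl, h⟩)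
    (by rintro U _ _ ⟨k, rfl, rfl⟩; exact ⟨O.scalar U k, ⟨k, rfl, rfl⟩, ⟨k, rfl, rfl⟩⟩) a.2 A.unop.2⟩
  one_smul _ := rfl
  mul_smul _ _ _ := rfl
  smul_zero A := rfl
  smul_add A a b := rfl
  add_smul A B a := Subtype.ext (Fam.comp_add a.1 A.unop.1 B.unop.1)
  zero_smul a := Subtype.ext (by funext V; ext f; exact map_zero (a.1 V))

instance (con : Corr S.ring O.ring) (U : (Opens X)ᵒᵖ) :
    Module (O.D.obj.obj U) ((diffPre (unitMod O.ring) (S.lin O) con).obj U) :=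
  leftModule O S con U.unop

instance (con : Corr O.ring S.ring) (P : SheafOfModules.{u} S.ring) (U : (Opens X)ᵒᵖ) :
    Module ((opSheaf O.D).obj.obj U) ((diffPre P (O.lin S) con).obj U) :=
  rightModule O S con P U.unop

/-- The left module of differential operators `S → O` over the differential operators of `O`. -/
def leftDiff (con : Corr S.ring O.ring) : SheafOfModules.{u} O.D where
  val := PresheafOfModules.ofPresheaf (diffPre (unitMod O.ring) (S.lin O) con)
    (fun _ _ _ _ _ => rfl)
  isSheaf := diffPre_isSheaf _ _ _

/-- The right module of differential operators `O → P` over the differential operators of `O`. -/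
def rightDiffObj (con : Corr O.ring S.ring) (P : SheafOfModules.{u} S.ring) :
    SheafOfModules.{u} (opSheaf O.D) where
  val := PresheafOfModules.ofPresheaf (diffPre P (O.lin S) con) (fun _ _ _ _ _ => rfl)
  isSheaf := diffPre_isSheaf _ _ _

end Modules

section Comm
variable {X : TopCat.{u}}

/-- A sheaf of rings is commutative. -/
class CommSheaf (S : RSh X) : Prop where
  mul_comm : ∀ (U : Opens X) (a b : rsec S U), a * b = b * a

instance (S : RSh X) [CommSheaf S] (U : Opens X) : CommRing (rsec S U) where
  mul_comm := CommSheaf.mul_comm U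

variable (S : RSh X) [CommSheaf S]

theorem Fam.mul_mem (L : Lin S) {U : Opens X} (f : rsec S U) :
    IsDiffOp L.toCorr (Corr.eq S) (fun V => (toUnit S V.1).symm.toAddMonoidHom.comp
      (AddMonoidHom.mulLeft (rres S V.2 f)) : Fam S (unitMod S) U) where
  natural V W hV hW s := by
    change rres S hW (rres S hV f * s) = rres S (hW.trans hV) f * rres S hW s
    rw [map_mul, rres_rres]
  linear V hV s t a r := by
    obtain rfl := L.eq_of_rel V s t r
    change rres S hV f * (s * a) = s * (rres S hV f * a)
    ring
  order x hx := ⟨U, le_rfl, 1, hx, fun V hV s t r => by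
    obtain rfl : s = t := r
    funext W; ext a
    change rres S W.2 s * (rres S (W.2.trans hV) f * a) -
      rres S (W.2.trans hV) f * (rres S W.2 s * a) = 0
    ring⟩

/-- A section `f` as the operator of multiplication by `f`. -/
def mulOp (L : Lin S) (U : Opens X) : rsec S U →+* DSec S L U where
  toFun f := ⟨_, Fam.mul_mem S L f⟩
  map_one' := DSec.ext fun V hV a => by
    change rres S hV 1 * a = a
    rw [map_one, one_mul]
  map_mul' f g := DSec.ext fun V hV a => by
    change rres S hV (f * g) * a = rres S hV f * (rres S hV g * a)
    rw [map_mul, mul_assoc]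
  map_zero' := DSec.ext fun V hV a => by
    change rres S hV 0 * a = 0
    rw [map_zero, zero_mul]
  map_add' f g := DSec.ext fun V hV a => by
    change rres S hV (f + g) * a = rres S hV f * a + rres S hV g * a
    rw [map_add, add_mul]

theorem mulOp_res (L : Lin S) {U V : Opens X} (h : V ≤ U) (f : rsec S U) :
    mulOp S L V (rres S h f) = DSec.res h (mulOp S L U f) :=
  DSec.ext fun W hW a => by
    change rres S hW (rres S h f) * a = rres S (hW.trans h) f * a
    rw [rres_rres]

/-- The inclusion of a commutative sheaf of rings in its differential operators. -/
def toD (L : Lin S) : S ⟶ DSheaf S L :=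
  ObjectProperty.homMk
    { app U := RingCat.ofHom (mulOp S L U.unop)
      naturality := fun U V h => by
        ext f
        exact mulOp_res S L h.unop.le f }

/-- The inclusion of a commutative sheaf of rings in the opposite of its differential operators. -/
def toDOp (L : Lin S) : S ⟶ opSheaf (DSheaf S L) :=
  ObjectProperty.homMk
    { app U := RingCat.ofHom ((mulOp S L U.unop).toOpposite
        (fun a b => by rw [Commute, SemiconjBy, ← map_mul, mul_comm, map_mul]))
      naturality := fun U V h => by
        ext f
        exact congrArg MulOpposite.op (mulOp_res S L h.unop.le f) }

end Comm
section BiMod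
variable {X : TopCat.{u}}

/-- A right action of `S` on an `E`-module `B`, commuting with `E`. -/
structure RAct {E : RSh X} (S : RSh X) (B : SheafOfModules.{u} E) where
  act : ∀ U : Opens X, (rsec S U)ᵐᵒᵖ →+* Module.End (rsec E U) (msec B U)
  act_res : ∀ {U V : Opens X} (h : V ≤ U) (s : rsec S U) (b : msec B U),
    mres B h (act U (.op s) b) = act V (.op (rres S h s)) (mres B h b)

variable {S E : RSh X} {B₀ : SheafOfModules.{u} E} (B : RAct S B₀) (P : SheafOfModules.{u} S)

/-- The relations `b s ⊗ p = b ⊗ s p`. -/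
def balRel (U : Opens X) : Submodule (rsec E U) (msec B₀ U ⊗[ℤ] msec P U) :=
  Submodule.span (rsec E U) {z | ∃ (b : msec B₀ U) (s : rsec S U) (p : msec P U),
    z = (B.act U (.op s) b) ⊗ₜ[ℤ] p - b ⊗ₜ[ℤ] (s • p)}

/-- The tensor product `B(U) ⊗ P(U)` over the sections of `S` on `U`, with its structure of module
over the sections of `E`. -/
abbrev balTens (U : Opens X) : Type u := (msec B₀ U ⊗[ℤ] msec P U) ⧸ balRel B P U

/-- Restriction before passing to the quotient. -/
def balRes₀ {U V : Opens X} (h : V ≤ U) :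
    msec B₀ U ⊗[ℤ] msec P U →+ msec B₀ V ⊗[ℤ] msec P V :=
  (TensorProduct.map (mres B₀ h).toIntLinearMap (mres P h).toIntLinearMap).toAddMonoidHom

theorem balRes₀_smul {U V : Opens X} (h : V ≤ U) (e : rsec E U)
    (z : msec B₀ U ⊗[ℤ] msec P U) :
    balRes₀ (B₀ := B₀) P h (e • z) = rres E h e • balRes₀ (B₀ := B₀) P h z := by
  induction z using TensorProduct.induction_on with
  | zero => rw [smul_zero, map_zero, smul_zero]
  | tmul b p =>
    rw [TensorProduct.smul_tmul']
    change mres B₀ h (e • b) ⊗ₜ[ℤ] mres P h p = rres E h e • (mres B₀ h b ⊗ₜ[ℤ] mres P h p)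
    rw [TensorProduct.smul_tmul', mres_smul]
  | add a b ha hb => rw [smul_add, map_add, map_add, ha, hb, smul_add]

theorem balRes₀_rel {U V : Opens X} (h : V ≤ U) :
    (balRel B P U).toAddSubgroup ≤ (balRel B P V).toAddSubgroup.comap (balRes₀ (B₀ := B₀) P h) := by
  intro z hz
  change balRes₀ (B₀ := B₀) P h z ∈ balRel B P V
  refine Submodule.span_induction ?_ ?_ ?_ ?_ (show z ∈ balRel B P U from hz)
  · rintro _ ⟨b, s, p, rfl⟩
    refine Submodule.subset_span ⟨mres B₀ h b, rres S h s, mres P h p, ?_⟩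
    rw [← B.act_res, ← mres_smul, map_sub]
    rfl
  · rw [map_zero]; exact zero_mem _
  · intro a b _ _ ha hb
    rw [map_add]; exact add_mem ha hb
  · intro e a _ ha
    rw [balRes₀_smul]; exact Submodule.smul_mem _ _ ha

/-- Restriction of tensors. -/
def balRes {U V : Opens X} (h : V ≤ U) : balTens B P U →+ balTens B P V :=
  QuotientAddGroup.map (balRel B P U).toAddSubgroup (balRel B P V).toAddSubgroup
    (balRes₀ (B₀ := B₀) P h) (balRes₀_rel B P h)

/-- The tensor `b ⊗ p`. -/
def balMk (U : Opens X) (b : msec B₀ U) (p : msec P U) : balTens B P U :=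
  Submodule.Quotient.mk (b ⊗ₜ[ℤ] p)

theorem balRes_mk {U V : Opens X} (h : V ≤ U) (b : msec B₀ U) (p : msec P U) :
    balRes B P h (balMk B P U b p) = balMk B P V (mres B₀ h b) (mres P h p) := rfl

theorem balTens_hom_ext {U : Opens X} {A : Type*} [AddGroup A] (f g : balTens B P U →+ A)
    (h : ∀ b q, f (balMk B P U b q) = g (balMk B P U b q)) (z : balTens B P U) : f z = g z := by
  obtain ⟨z, rfl⟩ := Submodule.Quotient.mk_surjective _ z
  induction z using TensorProduct.induction_on with
  | zero => exact (map_zero f).trans (map_zero g).symm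
  | tmul b q => exact h b q
  | add a b ha hb => exact (map_add f _ _).trans ((congrArg₂ _ ha hb).trans (map_add g _ _).symm)

theorem balRes_smul {U V : Opens X} (h : V ≤ U) (e : rsec E U) (z : balTens B P U) :
    balRes B P h (e • z) = rres E h e • balRes B P h z := by
  obtain ⟨z, rfl⟩ := Submodule.Quotient.mk_surjective _ z
  exact congrArg (Submodule.Quotient.mk (p := balRel B P V)) (balRes₀_smul (B₀ := B₀) P h e z)

/-- The presheaf of abelian groups `U ↦ B(U) ⊗ P(U)`. -/
def balAb : (Opens X)ᵒᵖ ⥤ AddCommGrpCat.{u} where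
  obj U := AddCommGrpCat.of (balTens B P U.unop)
  map h := AddCommGrpCat.ofHom (balRes B P h.unop.le)
  map_id U := by
    ext z
    refine balTens_hom_ext B P (balRes B P le_rfl) (AddMonoidHom.id _) (fun b q => ?_) z
    rw [balRes_mk, mres_self, mres_self]
    rfl
  map_comp {U V W} f g := by
    ext z
    refine balTens_hom_ext B P (balRes B P (f ≫ g).unop.le)
      ((balRes B P g.unop.le).comp (balRes B P f.unop.le)) (fun b q => ?_) z
    rw [AddMonoidHom.comp_apply, balRes_mk, balRes_mk, balRes_mk, mres_mres, mres_mres]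

instance (U : (Opens X)ᵒᵖ) : Module (E.obj.obj U) ((balAb B P).obj U) :=
  inferInstanceAs (Module (rsec E U.unop) (balTens B P U.unop))

/-- The presheaf of `E`-modules `U ↦ B(U) ⊗ P(U)`. -/
def balPre : PresheafOfModules.{u} E.obj :=
  PresheafOfModules.ofPresheaf (balAb B P) (fun _ _ f e z => balRes_smul B P f.unop.le e z)

variable {P} in
/-- The map `b ⊗ p ↦ b ⊗ f p`. -/
def balMap₀ {P' : SheafOfModules.{u} S} (f : P ⟶ P') (U : Opens X) :
    balTens B P U →ₗ[rsec E U] balTens B P' U :=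
  Submodule.mapQ _ _ (TensorProduct.AlgebraTensorModule.lTensor (rsec E U) (msec B₀ U)
      (f.val.app (op U)).hom.toAddMonoidHom.toIntLinearMap) (by
    rw [balRel, Submodule.span_le]
    rintro _ ⟨b, s, p, rfl⟩
    refine Submodule.subset_span ⟨b, s, (f.val.app (op U)).hom p, ?_⟩
    rw [map_sub]
    refine congrArg₂ _ rfl ?_
    exact congrArg (fun q => b ⊗ₜ[ℤ] q) (map_smul (f.val.app (op U)).hom s p))

/-- The functor that sends `P` to the presheaf `U ↦ B(U) ⊗ P(U)`. -/
def balPreFunctor : SheafOfModules.{u} S ⥤ PresheafOfModules.{u} E.obj where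
  obj P := balPre B P
  map {P P'} f := PresheafOfModules.homMk
    { app U := AddCommGrpCat.ofHom (balMap₀ B f U.unop).toAddMonoidHom
      naturality := fun U V h => by
        ext z
        refine balTens_hom_ext B P
          ((balMap₀ B f V.unop).toAddMonoidHom.comp (balRes B P h.unop.le))
          ((balRes B P' h.unop.le).comp (balMap₀ B f U.unop).toAddMonoidHom) (fun b q => ?_) z
        change balMk B P' V.unop (mres B₀ h.unop.le b) ((f.val.app V).hom (mres P h.unop.le q)) =
          balMk B P' V.unop (mres B₀ h.unop.le b) (mres P' h.unop.le ((f.val.app U).hom q))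
        exact congrArg _ (PresheafOfModules.naturality_apply f.val h q) }
    (fun U e z => map_smul (balMap₀ B f U.unop) e z)
  map_id P := by
    ext U z
    exact balTens_hom_ext B P (balMap₀ B (𝟙 P) U.unop).toAddMonoidHom (AddMonoidHom.id _)
      (fun b q => rfl) z
  map_comp {P P' P''} f g := by
    ext U z
    exact balTens_hom_ext B P (balMap₀ B (f ≫ g) U.unop).toAddMonoidHom
      ((balMap₀ B g U.unop).toAddMonoidHom.comp (balMap₀ B f U.unop).toAddMonoidHom)
      (fun b q => rfl) z

/-- The functor `P ↦ B ⊗ P` (tensor product over `S`) from `S`-modules to `E`-modules: the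
sheafification of the presheaf `U ↦ B(U) ⊗ P(U)`. -/
def RAct.tensor : SheafOfModules.{u} S ⥤ SheafOfModules.{u} E :=
  balPreFunctor B ⋙ PresheafOfModules.sheafification (𝟙 E.obj)

/-- The section `b ⊗ p` of `B ⊗ P`. -/
def RAct.pure {P : SheafOfModules.{u} S} {U : Opens X} (b : msec B₀ U) (p : msec P U) :
    msec (B.tensor.obj P) U :=
  ((toSheafify (Opens.grothendieckTopology X) (balAb B P)).app (op U)).hom (balMk B P U b p)

end BiMod
section Otimes
variable {X : TopCat.{u}} {S : RSh X} [CommSheaf S]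

/-- Over a commutative sheaf of rings, left modules are right modules. -/
def commAct (M : SheafOfModules.{u} S) : RAct S M where
  act U :=
    { toFun s :=
        { toFun m := (s.unop • m : msec M U)
          map_add' := smul_add _
          map_smul' := fun r m => by
            change (s.unop • r • m : msec M U) = r • s.unop • m
            rw [smul_smul, smul_smul, mul_comm] }
      map_one' := LinearMap.ext fun m => one_smul (rsec S U) m
      map_mul' := fun s t => LinearMap.ext fun m => by
        change ((t.unop * s.unop) • m : msec M U) = s.unop • t.unop • m
        rw [smul_smul, mul_comm]
      map_zero' := LinearMap.ext fun m => zero_smul (rsec S U) m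
      map_add' := fun s t => LinearMap.ext fun m => add_smul s.unop t.unop m }
  act_res h s b := mres_smul M h s b

/-- The tensor product `M ⊗ N` of sheaves of modules over a commutative sheaf of rings. -/
def otimes (M N : SheafOfModules.{u} S) : SheafOfModules.{u} S := (commAct M).tensor.obj N

/-- The section `m ⊗ n` of `M ⊗ N`. -/
def tmul {M N : SheafOfModules.{u} S} {U : Opens X} (m : msec M U) (n : msec N U) :
    msec (otimes M N) U :=
  (commAct M).pure m n

/-- The value of a morphism of modules on a section. -/
def app {R : RSh X} {M N : SheafOfModules.{u} R} (φ : M ⟶ N) {U : Opens X} :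
    msec M U →ₗ[rsec R U] msec N U :=
  (φ.val.app (op U)).hom

end Otimes

section Coalg
variable {X : TopCat.{u}} {K : Type} [CommRing K] {O : AlgSheaf K X} [CommSheaf O.ring]

/-- The `O`-module underlying a left `D`-module. -/
def leftO (A : SheafOfModules.{u} O.D) : SheafOfModules.{u} O.ring :=
  (SheafOfModules.restrictScalars (toD O.ring O.selfLin)).obj A

/-- The `O`-module underlying a right `D`-module. -/
def rightO (G : SheafOfModules.{u} (opSheaf O.D)) : SheafOfModules.{u} O.ring :=
  (SheafOfModules.restrictScalars (toDOp O.ring O.selfLin)).obj G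

/-- Sections of a left `D`-module as sections of the underlying `O`-module. -/
def toL (A : SheafOfModules.{u} O.D) {U : Opens X} : msec A U ≃+ msec (leftO A) U :=
  AddEquiv.refl _

/-- Sections of a right `D`-module as sections of the underlying `O`-module. -/
def toR (G : SheafOfModules.{u} (opSheaf O.D)) {U : Opens X} : msec G U ≃+ msec (rightO G) U :=
  AddEquiv.refl _

/-- An operator as a section of the opposite sheaf. -/
def opSec {U : Opens X} (P : DSec O.ring O.selfLin U) : rsec (opSheaf O.D) U :=
  (MulOpposite.op P : (DSec O.ring O.selfLin U)ᵐᵒᵖ)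

/-- The left action of an operator on a section. -/
def lact (A : SheafOfModules.{u} O.D) {U : Opens X} (P : rsec O.D U) :
    msec (leftO A) U →+ msec (leftO A) U :=
  (toL A).toAddMonoidHom.comp
    ((DistribSMul.toAddMonoidHom (msec A U) P).comp (toL A).symm.toAddMonoidHom)

/-- The right action of an operator on a section. -/
def ract (G : SheafOfModules.{u} (opSheaf O.D)) {U : Opens X} (P : rsec (opSheaf O.D) U) :
    msec (rightO G) U →+ msec (rightO G) U :=
  (toR G).toAddMonoidHom.comp
    ((DistribSMul.toAddMonoidHom (msec G U) P).comp (toR G).symm.toAddMonoidHom)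


/-- An operator is a vector field (a derivation). -/
def DSec.IsDer {U : Opens X} (τ : DSec O.ring O.selfLin U) : Prop :=
  ∀ (V : Opens X) (h : V ≤ U) (f g : rsec O.ring V),
    τ.ev h (f * g) = τ.ev h f * g + f * τ.ev h g

/-- A structure of (coassociative and counital) coalgebra on a left `D`-module `A`, in the tensor
category of left `D`-modules, whose tensor product is `⊗` over `O` with vector fields acting by the
Leibniz rule. The coproduct and the counit are morphisms of `O`-modules that are compatible with the
action of vector fields, i.e. morphisms of `D`-modules. Since every section of a tensor product is
locally a finite sum of sections `b ⊗ c`, the axioms are stated for such sums. -/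
@[ext]
structure CoalgStr (A : SheafOfModules.{u} O.D) where
  coprod : leftO A ⟶ otimes (leftO A) (leftO A)
  counit : leftO A ⟶ unitMod O.ring
  coprod_der : ∀ (U : Opens X) (τ : DSec O.ring O.selfLin U), τ.IsDer →
    ∀ (a : msec (leftO A) U) (m : ℕ) (b c : Fin m → msec (leftO A) U),
      app coprod a = ∑ i, tmul (b i) (c i) →
      app coprod (lact A τ a) = ∑ i, (tmul (lact A τ (b i)) (c i) + tmul (b i) (lact A τ (c i)))
  counit_der : ∀ (U : Opens X) (τ : DSec O.ring O.selfLin U), τ.IsDer →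
    ∀ a : msec (leftO A) U,
      toUnit O.ring U (app counit (lact A τ a)) = τ.ev le_rfl (toUnit O.ring U (app counit a))
  counit_left : ∀ (U : Opens X) (a : msec (leftO A) U) (m : ℕ) (b c : Fin m → msec (leftO A) U),
    app coprod a = ∑ i, tmul (b i) (c i) → ∑ i, toUnit O.ring U (app counit (b i)) • c i = a
  counit_right : ∀ (U : Opens X) (a : msec (leftO A) U) (m : ℕ) (b c : Fin m → msec (leftO A) U),
    app coprod a = ∑ i, tmul (b i) (c i) → ∑ i, toUnit O.ring U (app counit (c i)) • b i = a
  coassoc : ∀ (U : Opens X) (a : msec (leftO A) U) (m n : ℕ) (b c : Fin m → msec (leftO A) U)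
      (b' b'' c' c'' : Fin m → Fin n → msec (leftO A) U),
    app coprod a = ∑ i, tmul (b i) (c i) →
    (∀ i, app coprod (b i) = ∑ j, tmul (b' i j) (b'' i j)) →
    (∀ i, app coprod (c i) = ∑ j, tmul (c' i j) (c'' i j)) →
    ∑ i, ∑ j, tmul (b' i j) (tmul (b'' i j) (c i)) = ∑ i, ∑ j, tmul (b i) (tmul (c' i j) (c'' i j))

/-- The two kinds of comodules. -/
inductive Side
  | left
  | right

/-- A coaction `G → A ⊗ G` of a coalgebra `A` on a right `D`-module `G`: a morphism of right
`D`-modules, where a function `f` acts on `A ⊗ G` by `(a ⊗ g) f = f a ⊗ g` and a vector field `τ` acts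
by `(a ⊗ g) τ = a ⊗ g τ - τ a ⊗ g`, which is counital and coassociative. For a left comodule,
coassociativity is the equality of the two maps `(Δ ⊗ 1) ∘ Δ` and `(1 ⊗ Δ) ∘ Δ` from `G` to
`A ⊗ A ⊗ G`. For a right comodule (its coaction `G → G ⊗ A` being written with the factors
interchanged), the two factors `A` of the second map are interchanged. The two notions coincide
when `A` is cocommutative. -/
@[ext]
structure Coaction {A : SheafOfModules.{u} O.D} (C : CoalgStr A) (side : Side)
    (G : SheafOfModules.{u} (opSheaf O.D)) where
  coact : rightO G ⟶ otimes (leftO A) (rightO G)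
  coact_der : ∀ (U : Opens X) (τ : DSec O.ring O.selfLin U), τ.IsDer →
    ∀ (s : msec (rightO G) U) (m : ℕ) (a : Fin m → msec (leftO A) U)
      (g : Fin m → msec (rightO G) U),
      app coact s = ∑ i, tmul (a i) (g i) →
      app coact (ract G (opSec τ) s) = ∑ i, (tmul (a i) (ract G (opSec τ) (g i)) - tmul (lact A τ (a i)) (g i))
  counit : ∀ (U : Opens X) (s : msec (rightO G) U) (m : ℕ) (a : Fin m → msec (leftO A) U)
      (g : Fin m → msec (rightO G) U),
    app coact s = ∑ i, tmul (a i) (g i) → ∑ i, toUnit O.ring U (app C.counit (a i)) • g i = s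
  coassoc : ∀ (U : Opens X) (s : msec (rightO G) U) (m n : ℕ) (a : Fin m → msec (leftO A) U)
      (g : Fin m → msec (rightO G) U) (b c a' : Fin m → Fin n → msec (leftO A) U)
      (g' : Fin m → Fin n → msec (rightO G) U),
    app coact s = ∑ i, tmul (a i) (g i) →
    (∀ i, app C.coprod (a i) = ∑ j, tmul (b i j) (c i j)) →
    (∀ i, app coact (g i) = ∑ j, tmul (a' i j) (g' i j)) →
    ∑ i, ∑ j, tmul (b i j) (tmul (c i j) (g i)) =
      match side with
      | .left => ∑ i, ∑ j, tmul (a i) (tmul (a' i j) (g' i j))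
      | .right => ∑ i, ∑ j, tmul (a' i j) (tmul (a i) (g' i j))

variable {A : SheafOfModules.{u} O.D}

/-- Comodules over `C` in the category of right `D`-modules. -/
structure Comod (C : CoalgStr A) (side : Side) where
  mod : SheafOfModules.{u} (opSheaf O.D)
  coaction : Coaction C side mod

/-- A morphism of right `D`-modules is compatible with coactions. -/
def IsComodHom {C : CoalgStr A} {side : Side} {G G' : SheafOfModules.{u} (opSheaf O.D)}
    (δ : Coaction C side G) (δ' : Coaction C side G') (φ : G ⟶ G') : Prop :=
  ∀ (U : Opens X) (s : msec (rightO G) U) (m : ℕ) (a : Fin m → msec (leftO A) U)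
      (g : Fin m → msec (rightO G) U),
    app δ.coact s = ∑ i, tmul (a i) (g i) →
    app δ'.coact (toR G' (app φ ((toR G).symm s))) =
      ∑ i, tmul (a i) (toR G' (app φ ((toR G).symm (g i))))

/-- Morphisms of comodules. -/
@[ext]
structure Comod.Hom {C : CoalgStr A} {side : Side} (F G : Comod C side) where
  hom : F.mod ⟶ G.mod
  isComodHom : IsComodHom F.coaction G.coaction hom

/-- The category of comodules over `C`. -/
instance (C : CoalgStr A) (side : Side) : Category (Comod C side) where
  Hom F G := Comod.Hom F G
  id F := ⟨𝟙 _, fun _ _ _ _ _ h => h⟩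
  comp f g := ⟨f.hom ≫ g.hom, fun U s m a t h =>
    g.isComodHom U _ m a _ (f.isComodHom U s m a t h)⟩

/-- The functor `P ↦ (ind P, δ P)` to comodules, for a functor `ind` to right `D`-modules and
coactions `δ P` that are compatible with the morphisms `ind f`. -/
def Comod.lift {𝒞 : Type*} [Category 𝒞] {C : CoalgStr A} {side : Side}
    (ind : 𝒞 ⥤ SheafOfModules.{u} (opSheaf O.D)) (δ : ∀ P, Coaction C side (ind.obj P))
    (h : ∀ {P P' : 𝒞} (f : P ⟶ P'), IsComodHom (δ P) (δ P') (ind.map f)) :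
    𝒞 ⥤ Comod C side where
  obj P := ⟨ind.obj P, δ P⟩
  map f := ⟨ind.map f, h f⟩
  map_id P := Comod.Hom.ext (ind.map_id P)
  map_comp f g := Comod.Hom.ext (ind.map_comp f g)

end Coalg
section Std
variable {X : TopCat.{u}} {K : Type} [CommRing K]

/-- Right multiplication of the values of an operator `O → T` by a section of `T`. -/
def postMul (O T : AlgSheaf K X) (con : Corr O.ring T.ring) {U : Opens X} (t : rsec T.ring U) :
    diffOps (unitMod T.ring) (O.lin T) con U →+ diffOps (unitMod T.ring) (O.lin T) con U where
  toFun b := ⟨fun V => (toUnit T.ring V.1).symm.toAddMonoidHom.comp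
      ((AddMonoidHom.mulRight (rres T.ring V.2 t)).comp
        ((toUnit T.ring V.1).toAddMonoidHom.comp (b.1 V))),
    { natural := fun V W hV hW s => by
        change rres T.ring hW (toUnit T.ring V (b.1 ⟨V, hV⟩ s) * rres T.ring hV t) =
          toUnit T.ring W (b.1 ⟨W, hW.trans hV⟩ (rres O.ring hW s)) * rres T.ring (hW.trans hV) t
        rw [map_mul, rres_rres]
        exact congrArg (· * rres T.ring (hW.trans hV) t) (b.2.natural V W hV hW s)
      linear := fun V hV s t' a r =>
        (congrArg (fun c => toUnit T.ring V c * rres T.ring hV t)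
          (b.2.linear V hV s t' a r)).trans (mul_assoc t' _ _)
      order := fun x hx => by
        obtain ⟨V, hV, N, hxV, h⟩ := b.2.order x hx
        refine ⟨V, hV, N, hxV, ?_⟩
        have key : ∀ (N : ℕ) (W : Opens X) (hW : W ≤ U) (φ : Fam O.ring (unitMod T.ring) W),
            Fam.OrderLT con N W φ → Fam.OrderLT con N W
              (fun V => (toUnit T.ring V.1).symm.toAddMonoidHom.comp
                ((AddMonoidHom.mulRight (rres T.ring (V.2.trans hW) t)).comp
                  ((toUnit T.ring V.1).toAddMonoidHom.comp (φ V))) :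
                Fam O.ring (unitMod T.ring) W) := by
          intro N
          induction N with
          | zero =>
            intro W hW φ hφ
            rw [show φ = 0 from hφ]
            funext V; ext a
            exact zero_mul (rres T.ring (V.2.trans hW) t)
          | succ N ih =>
            intro W hW φ hφ V hV s t' r
            have := ih V (hV.trans hW) _ (hφ V hV s t' r)
            convert this using 1
            funext V'; ext a
            change rres T.ring V'.2 t' * (toUnit T.ring V'.1 (φ ⟨V'.1, V'.2.trans hV⟩ a) *
                  rres T.ring ((V'.2.trans hV).trans hW) t) -
                toUnit T.ring V'.1 (φ ⟨V'.1, V'.2.trans hV⟩ (rres O.ring V'.2 s * a)) *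
                  rres T.ring ((V'.2.trans hV).trans hW) t =
              (rres T.ring V'.2 t' * toUnit T.ring V'.1 (φ ⟨V'.1, V'.2.trans hV⟩ a) -
                toUnit T.ring V'.1 (φ ⟨V'.1, V'.2.trans hV⟩ (rres O.ring V'.2 s * a))) *
                  rres T.ring ((V'.2.trans hV).trans hW) t
            rw [sub_mul, mul_assoc]
        exact key N V hV _ h }⟩
  map_zero' := Subtype.ext (by
    funext V; ext a; exact zero_mul (rres T.ring V.2 t))
  map_add' b c := Subtype.ext (by
    funext V; ext a
    exact add_mul (toUnit T.ring V.1 (b.1 V a)) (toUnit T.ring V.1 (c.1 V a)) _)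

/-- The right module of differential operators `O → T` with the commuting right action of `T`
given by `(b t)(g) = b(g) t`. -/
def postAct (O T : AlgSheaf K X) (con : Corr O.ring T.ring) :
    RAct T.ring (rightDiffObj O T con (unitMod T.ring)) where
  act U :=
    { toFun t :=
        { toFun b := postMul O T con t.unop (U := U) b
          map_add' := map_add (postMul O T con t.unop (U := U))
          map_smul' := fun _ _ => rfl }
      map_one' := LinearMap.ext fun (b : diffOps (unitMod T.ring) (O.lin T) con U) =>
        Subtype.ext (by
          funext V; ext a
          change toUnit T.ring V.1 (b.1 V a) * rres T.ring V.2 1 = _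
          rw [map_one, mul_one]
          rfl)
      map_mul' := fun s t => LinearMap.ext
        fun (b : diffOps (unitMod T.ring) (O.lin T) con U) => Subtype.ext (by
          funext V; ext a
          change toUnit T.ring V.1 (b.1 V a) * rres T.ring V.2 (t.unop * s.unop) =
            toUnit T.ring V.1 (b.1 V a) * rres T.ring V.2 t.unop * rres T.ring V.2 s.unop
          rw [map_mul, mul_assoc])
      map_zero' := LinearMap.ext fun (b : diffOps (unitMod T.ring) (O.lin T) con U) =>
        Subtype.ext (by
          funext V; ext a
          change toUnit T.ring V.1 (b.1 V a) * rres T.ring V.2 0 = 0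
          rw [map_zero, mul_zero])
      map_add' := fun s t => LinearMap.ext
        fun (b : diffOps (unitMod T.ring) (O.lin T) con U) => Subtype.ext (by
          funext V; ext a
          change toUnit T.ring V.1 (b.1 V a) * rres T.ring V.2 (s.unop + t.unop) =
            toUnit T.ring V.1 (b.1 V a) * rres T.ring V.2 s.unop +
              toUnit T.ring V.1 (b.1 V a) * rres T.ring V.2 t.unop
          rw [map_add, mul_add]) }
  act_res {U V} h t b := Subtype.ext (by
    funext W; ext a
    have b' : diffOps (unitMod T.ring) (O.lin T) con U := b
    change toUnit T.ring W.1 ((show diffOps (unitMod T.ring) (O.lin T) con U from b).1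
        ⟨W.1, W.2.trans h⟩ a) * rres T.ring (W.2.trans h) t =
      toUnit T.ring W.1 ((show diffOps (unitMod T.ring) (O.lin T) con U from b).1
        ⟨W.1, W.2.trans h⟩ a) * rres T.ring W.2 (rres T.ring h t)
    rw [rres_rres])

/-- Operators that are linear over a larger class of scalars are linear over a smaller one. -/
def DSec.incl {S : RSh X} {L L' : Lin S} (hL : ∀ U s t, L'.rel U s t → L.rel U s t)
    (U : Opens X) : DSec S L U →+* DSec S L' U where
  toFun A := ⟨A.1, ⟨A.2.natural, fun V hV s t a r => A.2.linear V hV s t a (hL V s t r),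
    A.2.order⟩⟩
  map_one' := rfl
  map_mul' _ _ := rfl
  map_zero' := rfl
  map_add' _ _ := rfl

/-- The differential operators of `O`, as a right module over themselves, with the commuting left
action (by composition) of the operators that are linear over the larger class of scalars `L`. -/
def preAct (O : AlgSheaf K X) (L : Lin O.ring) (hL : ∀ U s t, O.selfLin.rel U s t → L.rel U s t) :
    RAct (opSheaf (DSheaf O.ring L)) (rightDiffObj O O (Corr.eq O.ring) (unitMod O.ring)) where
  act U :=
    { toFun δ :=
        { toFun b := AddMonoidHom.mulLeft (DSec.incl hL U δ.unop.unop) b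
          map_add' := fun (b c : DSec O.ring O.selfLin U) =>
            mul_add (DSec.incl hL U δ.unop.unop) b c
          map_smul' := fun _ _ => rfl }
      map_one' := rfl
      map_mul' := fun _ _ => rfl
      map_zero' := rfl
      map_add' := fun _ _ => rfl }
  act_res _ _ _ := rfl

variable {O S T : AlgSheaf K X}

/-- The value of an operator `S → O`. -/
def lev [CommSheaf O.ring] {con : Corr S.ring O.ring} {U V : Opens X} (h : V ≤ U)
    (a : msec (leftO (leftDiff O S con)) U) (f : rsec S.ring V) : rsec O.ring V :=
  toUnit O.ring V ((show diffOps (unitMod O.ring) (S.lin O) con U from a).1 ⟨V, h⟩ f)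

/-- The value of an operator `O → T`. -/
def rev {con : Corr O.ring T.ring} {U V : Opens X} (h : V ≤ U)
    (b : msec (rightDiffObj O T con (unitMod T.ring)) U) (f : rsec O.ring V) : rsec T.ring V :=
  toUnit T.ring V ((show diffOps (unitMod T.ring) (O.lin T) con U from b).1 ⟨V, h⟩ f)

/-- The coalgebra structure on the differential operators `S → O` induced by the product of `S`:
the counit is `a ↦ a(1)`, and the coproduct of `a` is the bidifferential operator
`(f₁, f₂) ↦ a(f₁ f₂)`, where `b ⊗ c` is identified with `(f₁, f₂) ↦ b(f₁) c(f₂)`. -/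
structure IsStdCoalg [CommSheaf O.ring] {con : Corr S.ring O.ring}
    (C : CoalgStr (leftDiff O S con)) : Prop where
  counit : ∀ (U : Opens X) (a : msec (leftO (leftDiff O S con)) U),
    toUnit O.ring U (app C.counit a) = lev le_rfl a 1
  coprod : ∀ (U : Opens X) (a : msec (leftO (leftDiff O S con)) U) (m : ℕ)
      (b c : Fin m → msec (leftO (leftDiff O S con)) U),
    app C.coprod a = ∑ i, tmul (b i) (c i) →
    ∀ (V : Opens X) (h : V ≤ U) (f₁ f₂ : rsec S.ring V),
      lev h a (f₁ * f₂) = ∑ i, lev h (b i) f₁ * lev h (c i) f₂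

/-- Let `B` be the module of operators `O → T` and `S` a sheaf of rings acting on `T` from the left
(by multiplication, through the correspondence `inc` of sections of `S` and `T`). The natural coaction
on `B ⊗ P` of the coalgebra `A` of operators `S → O` sends `b ⊗ p` to `∑ aᵢ ⊗ (bᵢ ⊗ p)`, where
`∑ aᵢ ⊗ bᵢ` is the section of `A ⊗ B` that corresponds to the bidifferential operator
`(f, g) ↦ f b(g)`, with `a ⊗ b` identified with the operator `(f, g) ↦ b(a(f) g)`. -/
def IsStdCoaction [CommSheaf O.ring] {con : Corr S.ring O.ring} {con' : Corr O.ring T.ring}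
    (inc : Corr S.ring T.ring) {R : RSh X}
    (B : RAct R (rightDiffObj O T con' (unitMod T.ring))) {P : SheafOfModules.{u} R}
    {C : CoalgStr (leftDiff O S con)} {side : Side} (δ : Coaction C side (B.tensor.obj P)) :
    Prop :=
  ∀ (U : Opens X) (b : msec (rightDiffObj O T con' (unitMod T.ring)) U) (m : ℕ)
    (a : Fin m → msec (leftO (leftDiff O S con)) U)
    (b' : Fin m → msec (rightDiffObj O T con' (unitMod T.ring)) U),
    (∀ (V : Opens X) (h : V ≤ U) (f : rsec S.ring V) (t : rsec T.ring V) (g : rsec O.ring V),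
      inc.rel V f t → ∑ i, rev h (b' i) (lev h (a i) f * g) = t * rev h b g) →
    ∀ p : msec P U, app δ.coact (toR _ (B.pure b p)) = ∑ i, tmul (a i) (toR _ (B.pure (b' i) p))

/-- The operators `A` from `S` to `O` carry exactly one coalgebra structure induced by the product of
`S`; for every `R`-module `P` the right module `B ⊗ P` (tensor product over `R`) carries exactly one
natural coaction of `A`; and `P ↦ B ⊗ P` with these coactions is a functor to `A`-comodules which is
an equivalence of categories. -/
def InducesEquivalence [CommSheaf O.ring] (con : Corr S.ring O.ring) (con' : Corr O.ring T.ring)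
    (inc : Corr S.ring T.ring) {R : RSh X}
    (B : RAct R (rightDiffObj O T con' (unitMod T.ring))) (side : Side) : Prop :=
  (∃! C : CoalgStr (leftDiff O S con), IsStdCoalg C) ∧
  ∀ C : CoalgStr (leftDiff O S con), IsStdCoalg C →
    (∀ P, ∃! δ : Coaction C side (B.tensor.obj P), IsStdCoaction inc B δ) ∧
    ∀ δ : ∀ P, Coaction C side (B.tensor.obj P), (∀ P, IsStdCoaction inc B (δ P)) →
      ∃ h : ∀ {P P' : SheafOfModules.{u} R} (f : P ⟶ P'),
          IsComodHom (δ P) (δ P') (B.tensor.map f),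
        (Comod.lift B.tensor δ h).IsEquivalence

end Std

section Functions
variable {X : TopCat.{u}} {K : Type} [CommRing K]

/-- Functions on `U` that near every point `x` agree with an element of `𝒢 x`. -/
def germSub (𝒢 : X → Subalgebra K (X → K)) (U : Opens X) : Subalgebra K (U → K) where
  carrier := {f | ∀ x : U, ∃ g ∈ 𝒢 x.1, ∃ V : Opens X, x.1 ∈ V ∧ ∀ y : U, y.1 ∈ V → f y = g y.1}
  mul_mem' := by
    intro f f' hf hf' x
    obtain ⟨g, hg, V, hV, h⟩ := hf x
    obtain ⟨g', hg', V', hV', h'⟩ := hf' x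
    exact ⟨g * g', mul_mem hg hg', V ⊓ V', ⟨hV, hV'⟩, fun y hy =>
      congrArg₂ (· * ·) (h y hy.1) (h' y hy.2)⟩
  add_mem' := by
    intro f f' hf hf' x
    obtain ⟨g, hg, V, hV, h⟩ := hf x
    obtain ⟨g', hg', V', hV', h'⟩ := hf' x
    exact ⟨g + g', add_mem hg hg', V ⊓ V', ⟨hV, hV'⟩, fun y hy =>
      congrArg₂ (· + ·) (h y hy.1) (h' y hy.2)⟩
  algebraMap_mem' k x := ⟨algebraMap K _ k, Subalgebra.algebraMap_mem _ k, ⊤, trivial,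
    fun _ _ => rfl⟩

variable (𝒢 : X → Subalgebra K (X → K))

/-- Restriction of functions. -/
def germRes {U V : Opens X} (h : V ≤ U) : germSub 𝒢 U →+* germSub 𝒢 V where
  toFun f := ⟨fun y => f.1 ⟨y.1, h y.2⟩, fun x => by
    obtain ⟨g, hg, W, hW, e⟩ := f.2 ⟨x.1, h x.2⟩
    exact ⟨g, hg, W, hW, fun y hy => e ⟨y.1, h y.2⟩ hy⟩⟩
  map_one' := rfl
  map_mul' _ _ := rfl
  map_zero' := rfl
  map_add' _ _ := rfl

/-- The sheaf of functions that near every point `x` agree with an element of `𝒢 x`. -/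
def germSheaf : AlgSheaf K X where
  ring :=
    { obj :=
        { obj U := RingCat.of (germSub 𝒢 U.unop)
          map h := RingCat.ofHom (germRes 𝒢 h.unop.le)
          map_id _ := rfl
          map_comp _ _ := rfl }
      property := ring_isSheaf _
        (fun U s t h => Subtype.ext (funext fun x => by
          obtain ⟨V, hV, hx, e⟩ := h x.1 x.2
          exact congrFun (congrArg Subtype.val e) ⟨x.1, hx⟩))
        (fun {ι} U V hV hc s hs => by
          have s' : ∀ i, germSub 𝒢 (V i) := s
          choose i hi using fun x : U => hc x.1 x.2
          have key : ∀ (x : U) (j : ι) (hj : x.1 ∈ V j),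
              (s (i x) : germSub 𝒢 (V (i x))).1 ⟨x.1, hi x⟩ =
                (s j : germSub 𝒢 (V j)).1 ⟨x.1, hj⟩ := fun x j hj =>
            congrFun (congrArg Subtype.val (hs (i x) j)) ⟨x.1, hi x, hj⟩
          refine ⟨(⟨fun x => (s (i x) : germSub 𝒢 (V (i x))).1 ⟨x.1, hi x⟩, fun x => ?_⟩ :
            germSub 𝒢 U), fun j => Subtype.ext (funext fun x => key ⟨x.1, hV j x.2⟩ j x.2)⟩
          obtain ⟨g, hg, W, hW, e⟩ := (s (i x) : germSub 𝒢 (V (i x))).2 ⟨x.1, hi x⟩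
          exact ⟨g, hg, W ⊓ V (i x), ⟨hW, hi x⟩, fun y hy =>
            (key y (i x) hy.2).trans (e ⟨y.1, hy.2⟩ hy.1)⟩) }
  scalar U := algebraMap K (germSub 𝒢 U)
  scalar_res _ _ := rfl
  scalar_comm U k s := mul_comm (algebraMap K (germSub 𝒢 U) k) (s : germSub 𝒢 U)

instance : CommSheaf (germSheaf 𝒢).ring where
  mul_comm U := mul_comm (G := germSub 𝒢 U)

/-- The function underlying a section. -/
def fn {U : Opens X} (s : rsec (germSheaf 𝒢).ring U) : U → K := (show germSub 𝒢 U from s).1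

/-- Two sections correspond to each other if they are the same function. -/
def sameFn (𝒢 𝒢' : X → Subalgebra K (X → K)) : Corr (germSheaf 𝒢).ring (germSheaf 𝒢').ring where
  rel _ s t := fn 𝒢 s = fn 𝒢' t
  rel_res h _ _ e := funext fun y => congrFun e ⟨y.1, h y.2⟩

/-- Linearity over those functions that near every point `x` agree with an element of `𝒢' x`. -/
def overLin (𝒢 𝒢' : X → Subalgebra K (X → K)) : Lin (germSheaf 𝒢).ring where
  rel U s t := s = t ∧ fn 𝒢 s ∈ germSub 𝒢' U
  rel_res {_ V} h s t := by
    rintro ⟨rfl, hs⟩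
    exact ⟨rfl, (germRes 𝒢' h ⟨_, hs⟩).2⟩
  eq_of_rel _ _ _ h := h.1

theorem overLin_scalar (𝒢 𝒢' : X → Subalgebra K (X → K)) (U : Opens X)
    (s t : rsec (germSheaf 𝒢).ring U) (h : (germSheaf 𝒢).selfLin.rel U s t) :
    (overLin 𝒢 𝒢').rel U s t := by
  obtain ⟨k, rfl, rfl⟩ := h
  exact ⟨rfl, Subalgebra.algebraMap_mem (germSub 𝒢' U) k⟩

/-- Composition of functions with a continuous map. -/
def germPull {Z : TopCat.{u}} {𝒢 : X → Subalgebra K (X → K)} {𝒢' : Z → Subalgebra K (Z → K)}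
    (p : Z ⟶ X) (h : ∀ (z : Z), ∀ g ∈ 𝒢 (p z), (fun y => g (p y)) ∈ 𝒢' z) (U : Opens X) :
    rsec (germSheaf 𝒢).ring U →+* rsec (germSheaf 𝒢').ring ((Opens.map p).obj U) where
  toFun f := (⟨fun y => fn 𝒢 f ⟨p y.1, y.2⟩, fun x => by
    obtain ⟨g, hg, V, hV, e⟩ := (show germSub 𝒢 U from f).2 ⟨p x.1, x.2⟩
    exact ⟨_, h x.1 g hg, (Opens.map p).obj V, hV, fun y hy => e ⟨p y.1, y.2⟩ hy⟩⟩ :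
    germSub 𝒢' ((Opens.map p).obj U))
  map_one' := rfl
  map_mul' _ _ := rfl
  map_zero' := rfl
  map_add' _ _ := rfl

/-- Composition with a continuous map `p : Z → X` as a morphism from a sheaf of functions on `X` to
the direct image of a sheaf of functions on `Z`. -/
def germPullHom {Z : TopCat.{u}} {𝒢 : X → Subalgebra K (X → K)} {𝒢' : Z → Subalgebra K (Z → K)}
    (p : Z ⟶ X) (h : ∀ (z : Z), ∀ g ∈ 𝒢 (p z), (fun y => g (p y)) ∈ 𝒢' z) :
    (germSheaf 𝒢).ring ⟶ ((Opens.map p).sheafPushforwardContinuous RingCat.{u}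
      (Opens.grothendieckTopology X) (Opens.grothendieckTopology Z)).obj (germSheaf 𝒢').ring :=
  ObjectProperty.homMk
    { app U := RingCat.ofHom (germPull p h U.unop)
      naturality := fun _ _ _ => rfl }

end Functions

section Holomorphic
variable (E : Type v) [NormedAddCommGroup E] [NormedSpace ℂ E] (M : Type u) [TopologicalSpace M]
  [ChartedSpace E M] (K : Type) [CommRing K] [Algebra ℂ K]

/-- The functions `M → K` that are `K`-linear combinations of functions holomorphic near `x`. -/
def holGerms (x : M) : Subalgebra K (M → K) :=
  Algebra.adjoin K {g | ∃ h : M → ℂ, ContMDiffAt 𝓘(ℂ, E) 𝓘(ℂ) ω h x ∧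
    g = fun y => algebraMap ℂ K (h y)}

/-- The sheaf `O_M ⊗ K`, realized as the sheaf of functions with values in `K` that are locally
`K`-linear combinations of holomorphic functions. For `K = ℂ` it is the sheaf `O_M` of holomorphic
functions. -/
abbrev holSheaf : AlgSheaf K (TopCat.of M) := germSheaf (X := TopCat.of M) (holGerms E M K)

variable {M} in
/-- The functions on `Z` of the form `g ∘ p` with `g` holomorphic near `p z`. The sheaf of functions
that are locally of this form is `p⁻¹ O_M`, as a subsheaf of the functions on `Z`. -/
def pullGerms {Z : Type u} (p : Z → M) (z : Z) : Subalgebra K (Z → K) :=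
  (holGerms E M K (p z)).map (AlgHom.pi fun z => Pi.evalAlgHom K (fun _ => K) (p z))

end Holomorphic

section Quantization
variable {X : TopCat.{u}}

/-- A bidifferential operator `O × O → O` on `U`: a `ℂ`-bilinear morphism of sheaves that, locally,
is a differential operator of bounded order in each argument when the other one is fixed, the bound
not depending on the fixed argument. -/
structure BidiffOp (O : AlgSheaf ℂ X) (U : Opens X) where
  toFun : ∀ V : {V : Opens X // V ≤ U}, rsec O.ring V.1 →+ rsec O.ring V.1 →+ rsec O.ring V.1
  natural : ∀ (V W : Opens X) (hV : V ≤ U) (hW : W ≤ V) (f g : rsec O.ring V),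
    rres O.ring hW (toFun ⟨V, hV⟩ f g) =
      toFun ⟨W, hW.trans hV⟩ (rres O.ring hW f) (rres O.ring hW g)
  linear_left : ∀ (V : {V : Opens X // V ≤ U}) (k : ℂ) (f g : rsec O.ring V.1),
    toFun V (O.scalar V.1 k * f) g = O.scalar V.1 k * toFun V f g
  linear_right : ∀ (V : {V : Opens X // V ≤ U}) (k : ℂ) (f g : rsec O.ring V.1),
    toFun V f (O.scalar V.1 k * g) = O.scalar V.1 k * toFun V f g
  order : ∀ x ∈ U, ∃ (V : Opens X) (hV : V ≤ U) (N : ℕ), x ∈ V ∧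
    ∀ (W : Opens X) (hW : W ≤ V) (f : rsec O.ring W),
      Fam.OrderLT (Corr.eq O.ring) N W (fun W' =>
        (toUnit O.ring W'.1).symm.toAddMonoidHom.comp
          (toFun ⟨W'.1, (W'.2.trans hW).trans hV⟩ (rres O.ring W'.2 f)) :
            Fam O.ring (unitMod O.ring) W) ∧
      Fam.OrderLT (Corr.eq O.ring) N W (fun W' =>
        (toUnit O.ring W'.1).symm.toAddMonoidHom.comp
          ((toFun ⟨W'.1, (W'.2.trans hW).trans hV⟩).flip (rres O.ring W'.2 f)) :
            Fam O.ring (unitMod O.ring) W)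

/-- The ring `ℂ[ħ]/(ħ^(n+1))`. -/
abbrev DefRing (n : ℕ) : Type := Polynomial ℂ ⧸ Ideal.span {(Polynomial.X ^ (n + 1) : Polynomial ℂ)}

/-- The element `ħ`. -/
def hbar (n : ℕ) : DefRing n := Ideal.Quotient.mk _ Polynomial.X

variable (E : Type v) [NormedAddCommGroup E] [NormedSpace ℂ E] (M : Type u) [TopologicalSpace M]
  [ChartedSpace E M] (n : ℕ)

variable {M} in
/-- A holomorphic function as a section of `O_M ⊗ ℂ[ħ]/(ħ^(n+1))`. -/
def holLift {U : Opens (TopCat.of M)} (f : rsec (holSheaf E M ℂ).ring U) :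
    rsec (holSheaf E M (DefRing n)).ring U :=
  (⟨fun y => algebraMap ℂ (DefRing n) (fn (X := TopCat.of M) _ f y), fun x => by
    obtain ⟨g, hg, V, hV, e⟩ := (show germSub (X := TopCat.of M) (holGerms E M ℂ) U from f).2 x
    refine ⟨fun y => algebraMap ℂ (DefRing n) (g y), ?_, V, hV,
      fun y hy => congrArg (algebraMap ℂ (DefRing n)) (e y hy)⟩
    exact Algebra.adjoin_induction
      (p := fun g _ => (fun y => algebraMap ℂ (DefRing n) (g y)) ∈ holGerms E M (DefRing n) x.1)
      (by
        rintro g ⟨h, hh, rfl⟩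
        exact Algebra.subset_adjoin ⟨h, hh, rfl⟩)
      (fun r => Subalgebra.algebraMap_mem _ (algebraMap ℂ (DefRing n) r))
      (fun a b _ _ ha hb => by
        convert add_mem ha hb using 1
        funext y; exact map_add (algebraMap ℂ (DefRing n)) (a y) (b y))
      (fun a b _ _ ha hb => by
        convert mul_mem ha hb using 1
        funext y; exact map_mul (algebraMap ℂ (DefRing n)) (a y) (b y)) hg⟩ :
    germSub (X := TopCat.of M) (holGerms E M (DefRing n)) U)

variable {M n}

/-- An isomorphism `θ` over `U` from `O_M ⊗ ℂ[ħ]/(ħ^(n+1))` with a star product to `Q`. The star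
product is the bilinear extension of `f ⋆ g = ∑ ħ^i B_i(f, g)`, where the `B_i` are bidifferential
operators and `B_0(f, g) = f g`. -/
structure StarTriv (Q : AlgSheaf (DefRing n) (TopCat.of M)) (U : Opens (TopCat.of M)) where
  θ : ∀ V : {V : Opens (TopCat.of M) // V ≤ U},
    rsec (holSheaf E M (DefRing n)).ring V.1 ≃+ rsec Q.ring V.1
  natural : ∀ (V W : Opens (TopCat.of M)) (hV : V ≤ U) (hW : W ≤ V)
    (f : rsec (holSheaf E M (DefRing n)).ring V),
    rres Q.ring hW (θ ⟨V, hV⟩ f) = θ ⟨W, hW.trans hV⟩ (rres _ hW f)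
  linear : ∀ (V : {V : Opens (TopCat.of M) // V ≤ U}) (k : DefRing n)
    (f : rsec (holSheaf E M (DefRing n)).ring V.1),
    θ V ((holSheaf E M (DefRing n)).scalar V.1 k * f) = Q.scalar V.1 k * θ V f
  B : Fin (n + 1) → BidiffOp (holSheaf E M ℂ) U
  B_zero : ∀ (V : {V : Opens (TopCat.of M) // V ≤ U}) (f g : rsec (holSheaf E M ℂ).ring V.1),
    (B 0).toFun V f g = f * g
  mul : ∀ (V : {V : Opens (TopCat.of M) // V ≤ U}) (f g : rsec (holSheaf E M ℂ).ring V.1),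
    θ V (holLift E n f) * θ V (holLift E n g) = θ V (∑ i : Fin (n + 1),
      (holSheaf E M (DefRing n)).scalar V.1 (hbar n ^ (i : ℕ)) * holLift E n ((B i).toFun V f g))

/-- The sheaf of algebras `Q` is (the structure sheaf of) a neutralized star quantization of `M`: it
is locally isomorphic to `O_M ⊗ ℂ[ħ]/(ħ^(n+1))` with a star product. -/
def IsStarQuantization (Q : AlgSheaf (DefRing n) (TopCat.of M)) : Prop :=
  ∀ x : M, ∃ U : Opens (TopCat.of M), x ∈ U ∧ Nonempty (StarTriv E Q U)

/-- Equality modulo `ħ` of sections of `O_M ⊗ ℂ[ħ]/(ħ^(n+1))` and of `Q`, in terms of the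
identification of `Q / ħ Q` with `O_M` by local trivializations. -/
def modHbar (Q : AlgSheaf (DefRing n) (TopCat.of M)) :
    Corr (holSheaf E M (DefRing n)).ring Q.ring where
  rel V s t := ∀ x ∈ V, ∃ (U W : Opens (TopCat.of M)) (hU : W ≤ U) (hV : W ≤ V)
    (τ : StarTriv E Q U) (r : rsec (holSheaf E M (DefRing n)).ring W), x ∈ W ∧
    rres Q.ring hV t = τ.θ ⟨W, hU⟩ r ∧
    ∀ y : W, hbar n ∣ fn (X := TopCat.of M) _ r y - fn (X := TopCat.of M) _ s ⟨y.1, hV y.2⟩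
  rel_res {V V'} h s t H x hx := by
    obtain ⟨U, W, hU, hV, τ, r, hxW, e, hr⟩ := H x (h hx)
    refine ⟨U, W ⊓ V', inf_le_left.trans hU, inf_le_right, τ, rres _ inf_le_left r, ⟨hxW, hx⟩,
      ?_, fun y => hr ⟨y.1, y.2.1⟩⟩
    rw [← τ.natural W (W ⊓ V') hU inf_le_left, ← e, rres_rres, rres_rres]

/-- The reversed relation. -/
def Corr.flip {S T : RSh X} (c : Corr S T) : Corr T S where
  rel U t s := c.rel U s t
  rel_res h t s r := c.rel_res h s t r

end Quantization

section Pullback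
variable {E : Type v} {F : Type w} {Z X : Type u} [NormedAddCommGroup E] [NormedSpace ℂ E]
  [TopologicalSpace Z] [ChartedSpace E Z] [NormedAddCommGroup F] [NormedSpace ℂ F] [TopologicalSpace X]
  [ChartedSpace F X] {p : Z → X} (hp : ContMDiff 𝓘(ℂ, E) 𝓘(ℂ, F) ω p)

theorem comp_mem_holGerms (hp : ContMDiff 𝓘(ℂ, E) 𝓘(ℂ, F) ω p) (z : Z) (g : X → ℂ)
    (hg : g ∈ holGerms F X ℂ (p z)) : (fun y => g (p y)) ∈ holGerms E Z ℂ z :=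
  Algebra.adjoin_induction (p := fun g _ => (fun y => g (p y)) ∈ holGerms E Z ℂ z)
    (by
      rintro g ⟨h, hh, rfl⟩
      exact Algebra.subset_adjoin ⟨fun y => h (p y), hh.comp z (hp z), rfl⟩)
    (fun r => Subalgebra.algebraMap_mem _ r)
    (fun a b _ _ ha hb => add_mem ha hb)
    (fun a b _ _ ha hb => mul_mem ha hb) hg

/-- A holomorphic map as a continuous map. -/
def topHom : TopCat.of Z ⟶ TopCat.of X := TopCat.ofHom ⟨p, hp.continuous⟩

instance germPullHom_isRightAdjoint {X Z : TopCat.{u}} {K : Type} [CommRing K]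
    {𝒢 : X → Subalgebra K (X → K)} {𝒢' : Z → Subalgebra K (Z → K)}
    (p : Z ⟶ X) (h : ∀ (z : Z), ∀ g ∈ 𝒢 (p z), (fun y => g (p y)) ∈ 𝒢' z) :
    (SheafOfModules.pushforward.{u} (germPullHom p h)).IsRightAdjoint := by
  have : ∀ ψ : (germSheaf 𝒢).ring.obj ⟶ (Opens.map p).op ⋙ (germSheaf 𝒢').ring.obj,
      (PresheafOfModules.pushforward.{u} ψ).IsRightAdjoint := fun ψ => inferInstance
  have : (PresheafOfModules.pushforward.{u} (germPullHom p h).hom).IsRightAdjoint := this _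
  infer_instance

/-- The inverse image functor of sheaves of modules. -/
def germInverseImage {X Z : TopCat.{u}} {K : Type} [CommRing K]
    {𝒢 : X → Subalgebra K (X → K)} {𝒢' : Z → Subalgebra K (Z → K)}
    (p : Z ⟶ X) (h : ∀ (z : Z), ∀ g ∈ 𝒢 (p z), (fun y => g (p y)) ∈ 𝒢' z) :
    SheafOfModules.{u} (germSheaf 𝒢).ring ⥤ SheafOfModules.{u} (germSheaf 𝒢').ring :=
  SheafOfModules.pullback.{u} (germPullHom p h)

/-- The section `1 ⊗ s` over `p⁻¹ U` of the inverse image. -/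
def germInverseImageSec {X Z : TopCat.{u}} {K : Type} [CommRing K]
    {𝒢 : X → Subalgebra K (X → K)} {𝒢' : Z → Subalgebra K (Z → K)}
    (p : Z ⟶ X) (h : ∀ (z : Z), ∀ g ∈ 𝒢 (p z), (fun y => g (p y)) ∈ 𝒢' z)
    (N : SheafOfModules.{u} (germSheaf 𝒢).ring) {U : Opens X} (s : msec N U) :
    msec ((germInverseImage p h).obj N) ((Opens.map p).obj U) :=
  app ((SheafOfModules.pullbackPushforwardAdjunction.{u}
    (germPullHom p h)).unit.app N) s

/-- The inverse image functor from `O_X`-modules to `O_Z`-modules. -/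
def inverseImage : SheafOfModules.{u} (holSheaf F X ℂ).ring ⥤
    SheafOfModules.{u} (holSheaf E Z ℂ).ring :=
  germInverseImage (topHom hp) (comp_mem_holGerms hp)

/-- The section `1 ⊗ s` over `p⁻¹ U` of the inverse image. -/
def inverseImageSec (N : SheafOfModules.{u} (holSheaf F X ℂ).ring) {U : Opens (TopCat.of X)}
    (s : msec N U) : msec ((inverseImage hp).obj N) ((Opens.map (topHom hp)).obj U) :=
  germInverseImageSec (topHom hp) (comp_mem_holGerms hp) N s

/-- The left `D_Z`-module of differential operators `p⁻¹ O_X → O_Z`. -/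
abbrev relDiff (p : Z → X) : SheafOfModules.{u} (holSheaf E Z ℂ).D :=
  leftDiff (holSheaf E Z ℂ) (germSheaf (X := TopCat.of Z) (pullGerms F ℂ p))
    (sameFn (X := TopCat.of Z) (pullGerms F ℂ p) (holGerms E Z ℂ))

/-- The section `f ∘ p` of `p⁻¹ O_X`. -/
def pullInv {U : Opens (TopCat.of X)} (f : rsec (holSheaf F X ℂ).ring U) :
    rsec (germSheaf (X := TopCat.of Z) (pullGerms F ℂ p)).ring ((Opens.map (topHom hp)).obj U) :=
  germPull (topHom hp) (𝒢' := pullGerms F ℂ p) (fun _ g hg => ⟨g, hg, rfl⟩) U f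

/-- The section `f ∘ p` of `O_Z`. -/
def pullHol {U : Opens (TopCat.of X)} (f : rsec (holSheaf F X ℂ).ring U) :
    rsec (holSheaf E Z ℂ).ring ((Opens.map (topHom hp)).obj U) :=
  germPull (topHom hp) (comp_mem_holGerms hp) U f

/-- The differential operators `p⁻¹ O_X → O_Z` are the inverse image `p^* D_X`: there is an isomorphism
of `O_Z`-modules that sends `1 ⊗ P` to the operator `f ∘ p ↦ P(f) ∘ p`. -/
def IsInverseImageOfD (hp : ContMDiff 𝓘(ℂ, E) 𝓘(ℂ, F) ω p) : Prop :=
  ∃ j : (inverseImage hp).obj (leftO (leftDiff (holSheaf F X ℂ) (holSheaf F X ℂ) (Corr.eq _))) ≅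
      leftO (relDiff (E := E) (F := F) p),
    ∀ (U V : Opens (TopCat.of X)) (h : V ≤ U)
      (P : msec (leftO (leftDiff (holSheaf F X ℂ) (holSheaf F X ℂ) (Corr.eq _))) U)
      (f : rsec (holSheaf F X ℂ).ring V),
      lev (O := holSheaf E Z ℂ) (S := germSheaf (X := TopCat.of Z) (pullGerms F ℂ p))
        (U := (Opens.map (topHom hp)).obj U)
        (V := (Opens.map (topHom hp)).obj V)
        ((Opens.map (topHom hp)).monotone h) (app j.hom (inverseImageSec hp _ P)) (pullInv hp f) =
      pullHol hp (lev h P f)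

end Pullback
end DCom

end

open DCom

/-!
Write `O` for the structure sheaf, `D` for its differential operators, `S` for the algebra whose
modules are to be described, `A` for the operators `S → O` and `B` for the operators `O → T`. In the
three cases `(S, T)` is `(O_M, O_M)`, `(O_Q, O_Q)` for a quantization `Q`, and `(p⁻¹ O_X, O_Z)`; the
functor is `P ↦ B ⊗ P` over a sheaf of rings `R`, which is `T` in the first two cases and, up to
passing to the opposite ring, `D_{Z/X}` in the last one.

A section of `A ⊗ N` is determined by its values on the sections of `S`
(`HasEvalBasis.ev_ext`). Hence there is exactly one coproduct dual to the product of `S`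
(`existsUnique_stdCoalg`), and a coaction of `A` on a right `D`-module `G` is the same as an action
of `S` on `G` by `D`-linear maps such that `f ↦ f s` is locally a differential operator
(`isDiffAction_coactAct`, `coactionOfAction`, `isComodHom_iff`). In these terms the coaction on
`B ⊗ P` is left multiplication on `B`, and the inverse functor sends `G` to the `R`-module of
morphisms `B → G` that are linear over `D` and `S` (`invMod`).

What remains is local and uses a `Frame`: sections `eA γ` that form a basis of `A` over `O`, and
sections `eB α` that generate `B` over `R`, one of which, `eB 0`, is a basis of `B` over `D`, such
that `f · eB α = ∑ eB 0 ∘ M α γ ∘ eA γ (f)` with an invertible matrix `M` over `D`. Since `M` is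
invertible, the maps `f ↦ f · eB α` are linearly independent over every right `D`-module
(`Frame.eq_zero_of_sum_q`), and in a module on which `S` acts by differential operators `f ↦ f s`
is a combination of them (`Frame.exists_sum_q`). Comparison of coefficients in `(g f) s = g (f s)`
shows that the evaluation of the morphisms `B → G` is an isomorphism (`isIso_invCounit`), and that
every comodule morphism `B ⊗ P → B ⊗ P'` comes from `P → P'` (`exists_pure_eq`); this is
`inducesEquivalence`.

In coordinates, `eA γ = ∂^γ / γ!` and `eB α = (-1)^|α| ∂^α / α!`. The Taylor formula, a consequence
of Hadamard's lemma, gives the basis property, and the Leibniz rule gives the matrix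
`M α γ = (-1)^|α - γ| ∂^(α - γ) / (α - γ)!` (`Chart.frame`). A submersion is a projection in
suitable charts, with `eA` and `eB` made of the base derivatives (`submersionChart`); that `A` is
the inverse image of `D_X` then follows as the derivatives on the base are mapped to a basis of `A`
(`exists_inverseImage_iso`). For a quantization, `ħ` is nilpotent. Hence the perturbation of the
multiplication by multiples of `ħ` does not change the class of differential operators
(`TwOrd.perturbed`, `TwOrd.of_perturbed`), the matrix stays invertible (`StarData.exists_matrix`),
and the sections `eB α` still generate `B` (`StarData.exists_gensum`).
-/
open Finsupp (single)
open Finset (sum_congr mul_sum sum_mul smul_sum)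
noncomputable section
namespace DCom
set_option linter.unusedSectionVars false
variable {X : TopCat.{u}} {K : Type} [CommRing K] {O S T : AlgSheaf K X}
  {𝒢 𝒢' : X → Subalgebra K (X → K)} {hle : ∀ x, 𝒢' x ≤ 𝒢 x} {U V W U₀ : Opens X}

/-- The differential operators of the algebra `O` over an open subset. -/
notation:max "𝒟[" O "]" => DSec (AlgSheaf.ring O) (AlgSheaf.selfLin O)

/-- The sections of the sheaf of functions with germs in `𝒢`. -/
notation:max "𝒪[" 𝒢 "]" => rsec (AlgSheaf.ring (germSheaf 𝒢))

/-! ### Pure tensors -/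

section Tensor
variable {S E : RSh X} {B₀ : SheafOfModules.{u} E} (B : RAct S B₀) {P : SheafOfModules.{u} S}

/-- The canonical map from the tensor product of sections to the sections of the tensor product. -/
def RAct.img (U : Opens X) : balTens B P U →+ msec (B.tensor.obj P) U :=
  ((toSheafify (Opens.grothendieckTopology X) (balAb B P)).app (op U)).hom

theorem RAct.img_mk (b : msec B₀ U) (p : msec P U) :
    B.img U (balMk B P U b p) = B.pure b p := rfl

theorem RAct.mres_img (h : V ≤ U) (z : balTens B P U) :
    mres (B.tensor.obj P) h (B.img U z) = B.img V (balRes B P h z) := by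
  have := (toSheafify (Opens.grothendieckTopology X) (balAb B P)).naturality (homOfLE h).op
  exact (congrArg (fun f => f.hom z) this).symm

theorem balMk_add_left (b b' : msec B₀ U) (p : msec P U) :
    balMk B P U (b + b') p = balMk B P U b p + balMk B P U b' p :=
  congrArg (Submodule.Quotient.mk (p := balRel B P U)) (TensorProduct.add_tmul b b' p)

theorem balMk_add_right (b : msec B₀ U) (p p' : msec P U) :
    balMk B P U b (p + p') = balMk B P U b p + balMk B P U b p' :=
  congrArg (Submodule.Quotient.mk (p := balRel B P U)) (TensorProduct.tmul_add b p p')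

theorem balMk_act (b : msec B₀ U) (s : rsec S U) (p : msec P U) :
    balMk B P U (B.act U (.op s) b) p = balMk B P U b (s • p) :=
  (Submodule.Quotient.eq _).2 (Submodule.subset_span ⟨b, s, p, rfl⟩)

theorem RAct.pure_add_left (b b' : msec B₀ U) (p : msec P U) :
    B.pure (b + b') p = B.pure b p + B.pure b' p := by
  rw [← B.img_mk, balMk_add_left, map_add]; rfl

theorem RAct.pure_add_right (b : msec B₀ U) (p p' : msec P U) :
    B.pure b (p + p') = B.pure b p + B.pure b p' := by
  rw [← B.img_mk, balMk_add_right, map_add]; rfl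

/-- `b ⊗ p` as a biadditive map. -/
def RAct.pureHom (U : Opens X) : msec B₀ U →+ msec P U →+ msec (B.tensor.obj P) U :=
  AddMonoidHom.mk' (fun b => AddMonoidHom.mk' (fun p => B.pure b p) (B.pure_add_right b))
    fun b b' => AddMonoidHom.ext fun p => B.pure_add_left b b' p

theorem RAct.pure_act (b : msec B₀ U) (s : rsec S U) (p : msec P U) :
    B.pure (B.act U (.op s) b) p = B.pure b (s • p) := by
  rw [← B.img_mk, balMk_act]; rfl

theorem RAct.mres_pure (h : V ≤ U) (b : msec B₀ U) (p : msec P U) :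
    mres (B.tensor.obj P) h (B.pure b p) = B.pure (mres B₀ h b) (mres P h p) := by
  rw [← B.img_mk, B.mres_img, balRes_mk]; rfl

theorem RAct.img_smul (e : rsec E U) (z : balTens B P U) :
    B.img U (e • z) = e • B.img U z :=
  ((PresheafOfModules.toSheafify (𝟙 E.obj)
    (toSheafify (Opens.grothendieckTopology X) (balPre B P).presheaf)).app (op U)).hom.map_smul e z

theorem RAct.smul_pure (e : rsec E U) (b : msec B₀ U) (p : msec P U) :
    e • B.pure b p = B.pure (e • b) p := by
  rw [← B.img_mk, ← B.img_smul]; rfl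

theorem balTens_exists_sum (z : balTens B P U) :
    ∃ (m : ℕ) (b : Fin m → msec B₀ U) (p : Fin m → msec P U),
      z = ∑ i, balMk B P U (b i) (p i) := by
  obtain ⟨z, rfl⟩ := Submodule.Quotient.mk_surjective _ z
  induction z using TensorProduct.induction_on with
  | zero => exact ⟨0, Fin.elim0, Fin.elim0, by simp⟩
  | tmul b q => exact ⟨1, fun _ => b, fun _ => q, by simp; rfl⟩
  | add a b ha hb =>
    obtain ⟨m, f, g, e⟩ := ha
    obtain ⟨m', f', g', e'⟩ := hb
    refine ⟨m + m', Fin.append f f', Fin.append g g', ?_⟩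
    rw [Fin.sum_univ_add, Submodule.Quotient.mk_add, e, e']
    simp

/-- Every section of a tensor product is locally a finite sum of pure tensors. -/
theorem RAct.exists_sum (z : msec (B.tensor.obj P) U) {x : X} (hx : x ∈ U) :
    ∃ (V : Opens X) (hV : V ≤ U) (m : ℕ) (b : Fin m → msec B₀ V) (p : Fin m → msec P V), x ∈ V ∧
      mres (B.tensor.obj P) hV z = ∑ i, B.pure (b i) (p i) := by
  have h := Presheaf.imageSieve_mem (Opens.grothendieckTopology X)
    (toSheafify (Opens.grothendieckTopology X) (balAb B P)) (U := op U) z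
  obtain ⟨V, f, ⟨y, hy⟩, hxV⟩ := h x hx
  obtain ⟨m, b, p, e⟩ := balTens_exists_sum B (show balTens B P V from y)
  refine ⟨V, f.le, m, b, p, hxV, ?_⟩
  have hy' : B.img V y = mres (B.tensor.obj P) f.le z := hy
  rw [← hy', e, map_sum]
  rfl

theorem RAct.img_eq_zero {z : balTens B P U} (hz : B.img U z = 0) {x : X}
    (hx : x ∈ U) : ∃ (V : Opens X) (hV : V ≤ U), x ∈ V ∧ balRes B P hV z = 0 := by
  have h := Presheaf.equalizerSieve_mem (Opens.grothendieckTopology X)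
    (toSheafify (Opens.grothendieckTopology X) (balAb B P)) (X := op U) z 0
    (hz.trans (map_zero (B.img U)).symm)
  obtain ⟨V, f, hf, hxV⟩ := h x hx
  refine ⟨V, f.le, hxV, ?_⟩
  have hf' : balRes B P f.le z = balRes B P f.le 0 := hf
  rw [hf', map_zero]

/-- Two additive maps on the sections of a tensor product that are compatible with restriction agree
if they agree on pure tensors. -/
theorem RAct.tensor_hom_ext {S' : RSh X} {H : SheafOfModules.{u} S'}
    (f g : ∀ W : Opens X, W ≤ U → (msec (B.tensor.obj P) W →+ msec H W))
    (hf : ∀ V W (hV : V ≤ U) (hW : W ≤ V) z,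
      mres H hW (f V hV z) = f W (hW.trans hV) (mres _ hW z))
    (hg : ∀ V W (hV : V ≤ U) (hW : W ≤ V) z,
      mres H hW (g V hV z) = g W (hW.trans hV) (mres _ hW z))
    (h : ∀ W (hW : W ≤ U) b p, f W hW (B.pure b p) = g W hW (B.pure b p))
    (hW : W ≤ U) (z : msec (B.tensor.obj P) W) : f W hW z = g W hW z := by
  refine msec_ext H fun x hx => ?_
  obtain ⟨V, hV, m, b, p, hxV, e⟩ := B.exists_sum z hx
  refine ⟨V, hV, hxV, ?_⟩
  rw [hf, hg, e, map_sum, map_sum]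
  exact sum_congr rfl fun i _ => h V _ _ _

end Tensor

/-! ### Sections and morphisms given locally -/

section Glue
variable {S : RSh X}

/-- A property of sections that is stable under restriction, and that locally holds for exactly one
section, singles out a global section. -/
theorem msec_exists_of_local (N : SheafOfModules.{u} S)
    (Q : ∀ V : Opens X, V ≤ U → msec N V → Prop)
    (hres : ∀ V W (hV : V ≤ U) (hW : W ≤ V) (n : msec N V), Q V hV n →
      Q W (hW.trans hV) (mres N hW n))
    (huniq : ∀ V (hV : V ≤ U) (n n' : msec N V), Q V hV n → Q V hV n' → n = n')
    (hex : ∀ x ∈ U, ∃ (V : Opens X) (hV : V ≤ U) (n : msec N V), x ∈ V ∧ Q V hV n) :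
    ∃ n : msec N U, ∀ V (hV : V ≤ U) (n' : msec N V), Q V hV n' →
      mres N hV n = n' := by
  choose V hV s hx hs using fun x : U => hex x.1 x.2
  obtain ⟨t, ht⟩ := msec_glue N V hV (fun x hxU => ⟨⟨x, hxU⟩, hx ⟨x, hxU⟩⟩) s fun i j =>
    huniq _ (inf_le_left.trans (hV i)) _ _ (hres _ _ _ inf_le_left _ (hs i))
      (hres _ _ _ inf_le_right _ (hs j))
  refine ⟨t, fun W hW n' hn' => msec_ext N fun x hxW => ?_⟩
  refine ⟨W ⊓ V ⟨x, hW hxW⟩, inf_le_left, ⟨hxW, hx ⟨x, hW hxW⟩⟩, ?_⟩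
  rw [mres_mres, ← mres_mres N (hV ⟨x, hW hxW⟩) inf_le_right, ht]
  exact huniq _ (inf_le_left.trans hW) _ _ (hres _ _ _ inf_le_right _ (hs _))
    (hres _ _ _ inf_le_left _ hn')

/-- A local property of sections that locally holds for exactly one section holds for exactly one
global section. -/
theorem msec_exists_of_local' (N : SheafOfModules.{u} S)
    (Q : ∀ V : Opens X, V ≤ U → msec N V → Prop)
    (hres : ∀ V W (hV : V ≤ U) (hW : W ≤ V) (n : msec N V), Q V hV n →
      Q W (hW.trans hV) (mres N hW n))
    (hloc : ∀ V (hV : V ≤ U) (n : msec N V), (∀ x ∈ V, ∃ (W : Opens X) (hW : W ≤ V),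
      x ∈ W ∧ Q W (hW.trans hV) (mres N hW n)) → Q V hV n)
    (huniq : ∀ V (hV : V ≤ U) (n n' : msec N V), Q V hV n → Q V hV n' → n = n')
    (hex : ∀ x ∈ U, ∃ (V : Opens X) (hV : V ≤ U) (n : msec N V), x ∈ V ∧ Q V hV n) :
    ∃ n : msec N U, Q U le_rfl n := by
  obtain ⟨n, hn⟩ := msec_exists_of_local N Q hres huniq hex
  refine ⟨n, hloc _ _ _ fun x hx => ?_⟩
  obtain ⟨V, hV, n', hxV, h⟩ := hex x hx
  exact ⟨V, hV, hxV, (hn V hV n' h).symm ▸ h⟩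

/-- A morphism of sheaves of modules from its values on sections. -/
def mkHom {M N : SheafOfModules.{u} S} (f : ∀ U : Opens X, msec M U →+ msec N U)
    (hn : ∀ U V (h : V ≤ U) (s : msec M U), mres N h (f U s) = f V (mres M h s))
    (hs : ∀ (U : Opens X) (r : rsec S U) (s : msec M U), f U (r • s) = r • f U s) : M ⟶ N :=
  ⟨PresheafOfModules.homMk
    { app U := AddCommGrpCat.ofHom (f U.unop)
      naturality := fun U V h => by
        ext s
        exact (hn _ _ h.unop.le s).symm }
    (fun U r s => hs U.unop r s)⟩

theorem app_mkHom {M N : SheafOfModules.{u} S} (f : ∀ U : Opens X, msec M U →+ msec N U)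
    (hn : ∀ U V (h : V ≤ U) (s : msec M U), mres N h (f U s) = f V (mres M h s))
    (hs : ∀ (U : Opens X) (r : rsec S U) (s : msec M U), f U (r • s) = r • f U s)
    (s : msec M U) : app (mkHom f hn hs) s = f U s := rfl

theorem mres_app {M N : SheafOfModules.{u} S} (φ : M ⟶ N) (h : V ≤ U)
    (s : msec M U) : mres N h (app φ s) = app φ (mres M h s) :=
  (PresheafOfModules.naturality_apply φ.val (homOfLE h).op s).symm

theorem hom_ext_app {M N : SheafOfModules.{u} S} {φ ψ : M ⟶ N}
    (h : ∀ (U : Opens X) (s : msec M U), app φ s = app ψ s) : φ = ψ := by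
  ext U s
  exact h U.unop s

theorem app_comp {M N N' : SheafOfModules.{u} S} (φ : M ⟶ N) (ψ : N ⟶ N')
    (s : msec M U) : app (φ ≫ ψ) s = app ψ (app φ s) := rfl

theorem app_id {M : SheafOfModules.{u} S} (s : msec M U) : app (𝟙 M) s = s := rfl

theorem isIso_of_app_bijective {M N : SheafOfModules.{u} S} (φ : M ⟶ N)
    (h : ∀ U : Opens X, Function.Bijective (app φ : msec M U → msec N U)) : IsIso φ := by
  let e : ∀ U : Opens X, msec M U ≃+ msec N U := fun U =>
    AddEquiv.ofBijective (app φ).toAddMonoidHom (h U)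
  have he : ∀ (U : Opens X) (s : msec M U), e U s = app φ s := fun _ _ => rfl
  refine ⟨mkHom (fun U => (e U).symm.toAddMonoidHom) (fun U V hV s => ?_) (fun U r s => ?_),
    hom_ext_app fun U s => (e U).symm_apply_apply s, hom_ext_app fun U s =>
      (e U).apply_symm_apply s⟩
  · obtain ⟨t, rfl⟩ := (e U).surjective s
    apply (e V).injective
    change e V (mres M hV ((e U).symm (e U t))) = e V ((e V).symm _)
    rw [AddEquiv.symm_apply_apply, AddEquiv.apply_symm_apply, he, he, mres_app]
  · obtain ⟨t, rfl⟩ := (e U).surjective s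
    apply (e U).injective
    change e U ((e U).symm _) = e U (r • (e U).symm (e U t))
    rw [AddEquiv.symm_apply_apply, AddEquiv.apply_symm_apply, he, he, map_smul]

end Glue

/-! ### The universal property of the tensor product -/

section Lift
variable {S E S' : RSh X} {B₀ : SheafOfModules.{u} E} (B : RAct S B₀) (P : SheafOfModules.{u} S)
  (U : Opens X) (H : SheafOfModules.{u} S')

/-- Balanced biadditive maps `B × P → H` over the open subset `U`, with values in a sheaf of modules
over any sheaf of rings. -/
structure BalMap where
  toFun : ∀ W : Opens X, W ≤ U → (msec B₀ W →+ msec P W →+ msec H W)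
  natural : ∀ V W (hV : V ≤ U) (hW : W ≤ V) (b : msec B₀ V) (p : msec P V),
    mres H hW (toFun V hV b p) = toFun W (hW.trans hV) (mres B₀ hW b) (mres P hW p)
  bal : ∀ W (hW : W ≤ U) (b : msec B₀ W) (s : rsec S W) (p : msec P W),
    toFun W hW (B.act W (.op s) b) p = toFun W hW b (s • p)

variable {B P U H} (μ : BalMap B P U H)

/-- The map induced on the tensor product of sections. -/
def BalMap.pre (W : Opens X) (hW : W ≤ U) : balTens B P W →+ msec H W :=
  QuotientAddGroup.lift (balRel B P W).toAddSubgroup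
    (TensorProduct.liftAddHom (μ.toFun W hW) (fun n b p => by simp)) (by
      have key : ∀ z ∈ balRel B P W, ∀ e : rsec E W,
          TensorProduct.liftAddHom (μ.toFun W hW) (fun n b p => by simp) (e • z) = 0 := by
        intro z hz
        refine Submodule.span_induction ?_ ?_ ?_ ?_ hz
        · rintro _ ⟨b, s, p, rfl⟩ e
          rw [smul_sub, TensorProduct.smul_tmul', TensorProduct.smul_tmul', map_sub,
            TensorProduct.liftAddHom_tmul, TensorProduct.liftAddHom_tmul, ← map_smul, μ.bal,
            sub_self]
        · intro e; rw [smul_zero, map_zero]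
        · intro a b _ _ ha hb e; rw [smul_add, map_add, ha, hb, add_zero]
        · intro e' a _ ha e; rw [smul_smul]; exact ha _
      intro z hz
      have := key z hz 1
      rw [one_smul] at this
      exact this)

theorem BalMap.mres_pre (V W : Opens X) (hV : V ≤ U) (hW : W ≤ V) (z : balTens B P V) :
    mres H hW (μ.pre V hV z) = μ.pre W (hW.trans hV) (balRes B P hW z) :=
  balTens_hom_ext B P ((mres H hW).comp (μ.pre V hV))
    ((μ.pre W (hW.trans hV)).comp (balRes B P hW)) (fun b p => μ.natural V W hV hW b p) z

/-- The relation between a section of `B ⊗ P` and its image in `H`. -/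
def BalMap.Graph (W : Opens X) (hW : W ≤ U) (z : msec (B.tensor.obj P) W) (h : msec H W) : Prop :=
  ∀ x ∈ W, ∃ (V : Opens X) (hV : V ≤ W) (y : balTens B P V), x ∈ V ∧
    mres _ hV z = B.img V y ∧ mres H hV h = μ.pre V (hV.trans hW) y

theorem BalMap.Graph.res {μ : BalMap B P U H} {hV : V ≤ U} (hW : W ≤ V)
    {z : msec (B.tensor.obj P) V} {h : msec H V} (H₁ : μ.Graph V hV z h) :
    μ.Graph W (hW.trans hV) (mres _ hW z) (mres H hW h) := by
  intro x hx
  obtain ⟨V', hV', y, hxV, e, e'⟩ := H₁ x (hW hx)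
  refine ⟨V' ⊓ W, inf_le_right, balRes B P inf_le_left y, ⟨hxV, hx⟩, ?_, ?_⟩
  · rw [mres_mres, ← mres_mres _ hV' inf_le_left, e, B.mres_img]
  · rw [mres_mres, ← mres_mres _ hV' inf_le_left, e', μ.mres_pre]

theorem BalMap.Graph.add {μ : BalMap B P U H} {hW : W ≤ U}
    {z z' : msec (B.tensor.obj P) W} {h h' : msec H W} (H₁ : μ.Graph W hW z h)
    (H₂ : μ.Graph W hW z' h') : μ.Graph W hW (z + z') (h + h') := by
  intro x hx
  obtain ⟨V, hV, y, hxV, e, e'⟩ := H₁ x hx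
  obtain ⟨V', hV', y', hxV', f, f'⟩ := H₂ x hx
  refine ⟨V ⊓ V', inf_le_left.trans hV, balRes B P inf_le_left y + balRes B P inf_le_right y',
    ⟨hxV, hxV'⟩, ?_, ?_⟩
  · rw [map_add, map_add, ← B.mres_img, ← B.mres_img, ← e, ← f, mres_mres, mres_mres]
  · rw [map_add, map_add, ← μ.mres_pre V _ (hV.trans hW) inf_le_left,
      ← μ.mres_pre V' _ (hV'.trans hW) inf_le_right, ← e', ← f', mres_mres, mres_mres]

theorem BalMap.Graph.eq_zero {μ : BalMap B P U H} {hW : W ≤ U}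
    {h : msec H W} (H₁ : μ.Graph W hW 0 h) : h = 0 := by
  refine msec_ext H fun x hx => ?_
  obtain ⟨V, hV, y, hxV, e, e'⟩ := H₁ x hx
  rw [map_zero] at e
  obtain ⟨V', hV', hxV', e₂⟩ := B.img_eq_zero e.symm hxV
  refine ⟨V', hV'.trans hV, hxV', ?_⟩
  rw [← mres_mres _ hV hV', e', μ.mres_pre, e₂, map_zero, map_zero]

theorem BalMap.Graph.neg {μ : BalMap B P U H} {hW : W ≤ U}
    {z : msec (B.tensor.obj P) W} {h : msec H W} (H₁ : μ.Graph W hW z h) :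
    μ.Graph W hW (-z) (-h) := by
  intro x hx
  obtain ⟨V, hV, y, hxV, e, e'⟩ := H₁ x hx
  exact ⟨V, hV, -y, hxV, by rw [map_neg, map_neg, e], by rw [map_neg, map_neg, e']⟩

theorem BalMap.Graph.unique {μ : BalMap B P U H} {hW : W ≤ U}
    {z : msec (B.tensor.obj P) W} {h h' : msec H W} (H₁ : μ.Graph W hW z h)
    (H₂ : μ.Graph W hW z h') : h = h' := by
  have := H₁.add H₂.neg
  rw [add_neg_cancel] at this
  exact add_neg_eq_zero.1 this.eq_zero

theorem BalMap.graph_pure (W : Opens X) (hW : W ≤ U) (b : msec B₀ W) (p : msec P W) :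
    μ.Graph W hW (B.pure b p) (μ.toFun W hW b p) := fun _ hx =>
  ⟨W, le_rfl, balMk B P W b p, hx, mres_self _ _ _, mres_self _ _ _⟩

theorem BalMap.exists_graph (W : Opens X) (hW : W ≤ U) (z : msec (B.tensor.obj P) W) :
    ∃ h, μ.Graph W hW z h := by
  obtain ⟨h, hh⟩ := msec_exists_of_local H
    (fun V (hV : V ≤ W) n => μ.Graph V (hV.trans hW) (mres _ hV z) n)
    (fun V V' hV hV' n hn => by
      have := hn.res hV'
      rw [mres_mres] at this
      exact this)
    (fun V hV n n' h₁ h₂ => h₁.unique h₂)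
    (fun _ hx => by
      obtain ⟨V, hV, m, b, p, hxV, e⟩ := B.exists_sum z hx
      refine ⟨V, hV, μ.pre V (hV.trans hW) (∑ i, balMk B P V (b i) (p i)), hxV,
        fun y hy => ⟨V, le_rfl, ∑ i, balMk B P V (b i) (p i), hy, ?_, mres_self _ _ _⟩⟩
      rw [mres_self, e, map_sum]; rfl)
  refine ⟨h, fun x hx => ?_⟩
  obtain ⟨V, hV, m, b, p, hxV, e⟩ := B.exists_sum z hx
  refine ⟨V, hV, ∑ i, balMk B P V (b i) (p i), hxV, ?_, hh V hV _ fun y hy =>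
    ⟨V, le_rfl, ∑ i, balMk B P V (b i) (p i), hy, ?_, mres_self _ _ _⟩⟩
  · rw [e, map_sum]; rfl
  · rw [mres_self, e, map_sum]; rfl

/-- The map induced on the tensor product of sheaves. -/
def BalMap.lift (W : Opens X) (hW : W ≤ U) : msec (B.tensor.obj P) W →+ msec H W :=
  AddMonoidHom.mk' (fun z => (μ.exists_graph W hW z).choose) fun a b =>
    (μ.exists_graph W hW (a + b)).choose_spec.unique
      ((μ.exists_graph W hW a).choose_spec.add (μ.exists_graph W hW b).choose_spec)

theorem BalMap.graph_lift (W : Opens X) (hW : W ≤ U) (z : msec (B.tensor.obj P) W) :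
    μ.Graph W hW z (μ.lift W hW z) := (μ.exists_graph W hW z).choose_spec

@[simp]
theorem BalMap.lift_pure (W : Opens X) (hW : W ≤ U) (b : msec B₀ W) (p : msec P W) :
    μ.lift W hW (B.pure b p) = μ.toFun W hW b p :=
  (μ.graph_lift W hW _).unique (μ.graph_pure W hW b p)

theorem BalMap.mres_lift (V W : Opens X) (hV : V ≤ U) (hW : W ≤ V)
    (z : msec (B.tensor.obj P) V) :
    mres H hW (μ.lift V hV z) = μ.lift W (hW.trans hV) (mres _ hW z) :=
  ((μ.graph_lift V hV z).res hW).unique (μ.graph_lift W _ _)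

end Lift

/-! ### Right modules over the differential operators -/

section Act
variable {G : SheafOfModules.{u} (opSheaf O.D)}

/-- The right action of a differential operator on a section of a right `D`-module. -/
def rsm (g : msec G U) (d : 𝒟[O] U) : msec G U :=
  (opSec d : rsec (opSheaf O.D) U) • g

infixl:73 " ◂ " => rsm

theorem rsm_mul (g : msec G U) (d d' : 𝒟[O] U) :
    g ◂ (d * d') = g ◂ d ◂ d' := mul_smul (opSec d' : rsec (opSheaf O.D) U) (opSec d) g

theorem rsm_one (g : msec G U) : g ◂ (1 : 𝒟[O] U) = g :=
  one_smul (rsec (opSheaf O.D) U) g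

theorem add_rsm (g g' : msec G U) (d : 𝒟[O] U) :
    (g + g') ◂ d = g ◂ d + g' ◂ d := smul_add _ _ _

theorem zero_rsm (d : 𝒟[O] U) : (0 : msec G U) ◂ d = 0 :=
  smul_zero _

theorem rsm_add (g : msec G U) (d d' : 𝒟[O] U) :
    g ◂ (d + d') = g ◂ d + g ◂ d' := add_smul (opSec d : rsec (opSheaf O.D) U) (opSec d') g

theorem rsm_zero (g : msec G U) : g ◂ (0 : 𝒟[O] U) = 0 :=
  zero_smul (rsec (opSheaf O.D) U) g

theorem rsm_neg (g : msec G U) (d : 𝒟[O] U) :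
    g ◂ (-d) = -(g ◂ d) := neg_smul (opSec d : rsec (opSheaf O.D) U) g

theorem rsm_neg_left (g : msec G U) (d : 𝒟[O] U) :
    (-g) ◂ d = -(g ◂ d) := smul_neg (opSec d : rsec (opSheaf O.D) U) g

theorem sum_rsm {ι : Type*} (F : Finset ι) (g : ι → msec G U)
    (d : 𝒟[O] U) : (∑ i ∈ F, g i) ◂ d = ∑ i ∈ F, g i ◂ d := smul_sum

theorem rsm_sum {ι : Type*} (F : Finset ι) (g : msec G U)
    (d : ι → 𝒟[O] U) : g ◂ (∑ i ∈ F, d i) = ∑ i ∈ F, g ◂ d i :=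
  map_sum (AddMonoidHom.mk' (fun d => g ◂ d) (rsm_add g)) d F

theorem mres_rsm (h : V ≤ U) (g : msec G U) (d : 𝒟[O] U) :
    mres G h (g ◂ d) = mres G h g ◂ DSec.res h d := mres_smul G h _ g

theorem app_rsm {G' : SheafOfModules.{u} (opSheaf O.D)} (φ : G ⟶ G')
    (g : msec G U) (d : 𝒟[O] U) : app φ (g ◂ d) = app φ g ◂ d :=
  map_smul (app φ) _ g

variable [CommSheaf O.ring]

theorem smul_toR (o : rsec O.ring U) (g : msec G U) :
    o • toR G g = toR G (g ◂ mulOp O.ring O.selfLin U o) := rfl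

theorem toR_symm_smul (o : rsec O.ring U) (g : msec (rightO G) U) :
    (toR G).symm (o • g) = (toR G).symm g ◂ mulOp O.ring O.selfLin U o := rfl

theorem IsDer_mul {τ : 𝒟[O] U} (hτ : τ.IsDer)
    (f : rsec O.ring U) : τ * mulOp O.ring O.selfLin U f =
      mulOp O.ring O.selfLin U f * τ + mulOp O.ring O.selfLin U (τ.ev le_rfl f) :=
  DSec.ext fun V hV g => by
    change τ.ev hV (rres O.ring hV f * g) =
      rres O.ring hV f * τ.ev hV g + rres O.ring hV (τ.ev le_rfl f) * g
    rw [hτ, add_comm]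
    congr 2
    exact (τ.2.natural U V le_rfl hV f).symm

end Act

/-! ### Values of tensors of operators -/

section Eval
variable [CommSheaf O.ring] {con : Corr S.ring O.ring}

/-- The `O`-module of differential operators `S → O`. -/
abbrev AMod (O S : AlgSheaf K X) [CommSheaf O.ring] (con : Corr S.ring O.ring) :
    SheafOfModules.{u} O.ring := leftO (leftDiff O S con)

theorem lev_mres (h : V ≤ U) (h' : W ≤ V) (a : msec (AMod O S con) U)
    (f : rsec S.ring W) : lev h' (mres _ h a) f = lev (h'.trans h) a f := rfl

theorem rres_lev (h : V ≤ U) (h' : W ≤ V) (a : msec (AMod O S con) U)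
    (f : rsec S.ring V) : rres O.ring h' (lev h a f) = lev (h'.trans h) a (rres S.ring h' f) :=
  (show diffOps (unitMod O.ring) (S.lin O) con U from a).2.natural V W h h' f

theorem lev_smul (h : V ≤ U) (o : rsec O.ring U) (a : msec (AMod O S con) U)
    (f : rsec S.ring V) : lev h (o • a) f = rres O.ring h o * lev h a f := rfl

/-- The value on `f` as an additive map. -/
def levHom (h : V ≤ U) (f : rsec S.ring V) :
    msec (AMod O S con) U →+ rsec O.ring V :=
  AddMonoidHom.mk' (fun a => lev h a f) fun _ _ => rfl

theorem lev_add (h : V ≤ U) (a b : msec (AMod O S con) U)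
    (f : rsec S.ring V) : lev h (a + b) f = lev h a f + lev h b f := rfl

theorem lev_sum (h : V ≤ U) {ι : Type*} (F : Finset ι)
    (a : ι → msec (AMod O S con) U) (f : rsec S.ring V) :
    lev h (∑ i ∈ F, a i) f = ∑ i ∈ F, lev h (a i) f := map_sum (levHom h f) a F

theorem lev_add_right (h : V ≤ U) (a : msec (AMod O S con) U)
    (f g : rsec S.ring V) : lev h a (f + g) = lev h a f + lev h a g :=
  map_add ((show diffOps (unitMod O.ring) (S.lin O) con U from a).1 ⟨V, h⟩) f g

theorem lev_ext {a b : msec (AMod O S con) U}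
    (h : ∀ V (hV : V ≤ U) (f : rsec S.ring V), lev hV a f = lev hV b f) : a = b := by
  apply Subtype.ext
  funext V; ext f
  exact h V.1 V.2 f

theorem lev_lact (h : V ≤ U) (d : 𝒟[O] U)
    (a : msec (AMod O S con) U) (f : rsec S.ring V) :
    lev h (lact (leftDiff O S con) d a) f = d.ev h (lev h a f) := rfl

variable (con) in
/-- Evaluation at `f` of the tensors `a ⊗ n`. -/
def evBal (N : SheafOfModules.{u} O.ring) (f : rsec S.ring U) :
    BalMap (commAct (AMod O S con)) N U N where
  toFun W hW := AddMonoidHom.mk' (fun a =>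
      DistribSMul.toAddMonoidHom (msec N W) (lev le_rfl a (rres S.ring hW f))) fun a b =>
    AddMonoidHom.ext fun n => add_smul (lev le_rfl a (rres S.ring hW f)) _ n
  natural V W hV hW a n := by
    change mres N hW (lev le_rfl a (rres S.ring hV f) • n) =
      lev le_rfl (mres _ hW a) (rres S.ring (hW.trans hV) f) • mres N hW n
    rw [mres_smul, rres_lev, lev_mres, rres_rres]
  bal W hW a s n := by
    change lev le_rfl (s • a) (rres S.ring hW f) • n = lev le_rfl a (rres S.ring hW f) • s • n
    rw [lev_smul, rres_self, smul_smul, mul_comm]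

/-- The map `a ⊗ n ↦ a(f) n`. -/
def ev {N : SheafOfModules.{u} O.ring} (f : rsec S.ring U) :
    msec (otimes (AMod O S con) N) U →+ msec N U :=
  (evBal con N f).lift U le_rfl

variable {N : SheafOfModules.{u} O.ring}

theorem ev_tmul (f : rsec S.ring U) (a : msec (AMod O S con) U) (n : msec N U) :
    ev f (tmul a n) = lev le_rfl a f • n := by
  refine ((evBal con N f).lift_pure U le_rfl a n).trans ?_
  change lev le_rfl a (rres S.ring le_rfl f) • n = _
  rw [rres_self]

theorem ev_sum_tmul (f : rsec S.ring U) {m : ℕ} (a : Fin m → msec (AMod O S con) U)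
    (n : Fin m → msec N U) : ev f (∑ i, tmul (a i) (n i)) = ∑ i, lev le_rfl (a i) f • n i := by
  rw [map_sum]
  exact sum_congr rfl fun i _ => ev_tmul f _ _

theorem mres_tmul {M N : SheafOfModules.{u} O.ring} (h : V ≤ U) (m : msec M U)
    (n : msec N U) : mres (otimes M N) h (tmul m n) = tmul (mres M h m) (mres N h n) :=
  (commAct M).mres_pure h m n

theorem mres_sum_tmul {M N : SheafOfModules.{u} O.ring} (h : V ≤ U) {m : ℕ}
    (a : Fin m → msec M U) (n : Fin m → msec N U) :
    mres (otimes M N) h (∑ i, tmul (a i) (n i)) = ∑ i, tmul (mres M h (a i)) (mres N h (n i)) := by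
  rw [map_sum]
  exact sum_congr rfl fun i _ => mres_tmul h _ _

theorem mres_ev (h : V ≤ U) (f : rsec S.ring U)
    (z : msec (otimes (AMod O S con) N) U) :
    mres N h (ev f z) = ev (rres S.ring h f) (mres _ h z) := by
  refine ((evBal con N f).mres_lift U V le_rfl h z).trans ?_
  refine (commAct (AMod O S con)).tensor_hom_ext (U := V)
    (fun W hW => (evBal con N f).lift W (hW.trans h))
    (fun W hW => (evBal con N (rres S.ring h f)).lift W hW)
    (fun _ _ _ _ _ => BalMap.mres_lift _ _ _ _ _ _) (fun _ _ _ _ _ => BalMap.mres_lift _ _ _ _ _ _)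
    (fun W hW a n => ?_) le_rfl (mres _ h z)
  rw [BalMap.lift_pure, BalMap.lift_pure]
  change lev le_rfl a (rres S.ring _ f) • n = lev le_rfl a (rres S.ring _ (rres S.ring h f)) • n
  rw [rres_rres]

theorem tmul_smul {M N : SheafOfModules.{u} O.ring} (o : rsec O.ring U)
    (m : msec M U) (n : msec N U) : tmul m (o • n) = o • tmul m n := by
  refine ((commAct M).pure_act m o n).symm.trans ?_
  exact ((commAct M).smul_pure o m n).symm

theorem smul_tmul {M N : SheafOfModules.{u} O.ring} (o : rsec O.ring U)
    (m : msec M U) (n : msec N U) : tmul (o • m) n = o • tmul m n :=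
  ((commAct M).smul_pure o m n).symm

/-- The section `m ⊗ n` as a biadditive map. -/
def tmulHom {M N : SheafOfModules.{u} O.ring} (U : Opens X) :
    msec M U →+ msec N U →+ msec (otimes M N) U := (commAct M).pureHom U

theorem tmulHom_apply {M N : SheafOfModules.{u} O.ring} (m : msec M U)
    (n : msec N U) : tmulHom U m n = tmul m n := rfl

theorem otimes_exists_sum {M N : SheafOfModules.{u} O.ring}
    (z : msec (otimes M N) U) {x : X} (hx : x ∈ U) :
    ∃ (V : Opens X) (hV : V ≤ U) (m : ℕ) (b : Fin m → msec M V) (p : Fin m → msec N V), x ∈ V ∧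
      mres (otimes M N) hV z = ∑ i, tmul (b i) (p i) :=
  (commAct M).exists_sum z hx

theorem ev_smul (f : rsec S.ring U) (o : rsec O.ring U)
    (z : msec (otimes (AMod O S con) N) U) : ev f (o • z) = o • ev f z := by
  refine msec_ext N fun x hx => ?_
  obtain ⟨V, hV, m, b, p, hxV, e⟩ := otimes_exists_sum z hx
  refine ⟨V, hV, hxV, ?_⟩
  rw [mres_ev, mres_smul, mres_smul, mres_ev, e, smul_sum, map_sum, map_sum,
    smul_sum]
  refine sum_congr rfl fun i _ => ?_
  rw [← smul_tmul, ev_tmul, ev_tmul, lev_smul, rres_self, mul_smul]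

variable (con) in
/-- Near every point, the `O`-module of operators `S → O` is spanned by sections `e γ`, with
coefficients that are obtained from the values of the operators by universal formulas. -/
def HasEvalBasis : Prop :=
  ∀ x : X, ∃ U₀ : Opens X, x ∈ U₀ ∧ ∃ (I : Type) (e : I → msec (AMod O S con) U₀) (m : I → ℕ)
    (o : ∀ γ, Fin (m γ) → rsec O.ring U₀) (f : ∀ γ, Fin (m γ) → rsec S.ring U₀),
    ∀ V (hV : V ≤ U₀) (a : msec (AMod O S con) V), ∀ y ∈ V,
      ∃ (W : Opens X) (hW : W ≤ V) (F₀ : Finset I), y ∈ W ∧ ∀ F, F₀ ⊆ F → mres _ hW a =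
        ∑ γ ∈ F, (∑ j, rres O.ring (hW.trans hV) (o γ j) *
          lev hW a (rres S.ring (hW.trans hV) (f γ j))) • mres _ (hW.trans hV) (e γ)

/-- A section of `A ⊗ N` is determined by its values. -/
theorem HasEvalBasis.ev_injective (hA : HasEvalBasis con)
    {z : msec (otimes (AMod O S con) N) U}
    (hz : ∀ V (hV : V ≤ U) (f : rsec S.ring V), ev f (mres _ hV z) = 0) : z = 0 := by
  refine msec_ext _ fun x hx => ?_
  obtain ⟨U₀, hxU₀, I, e, m, o, f, h⟩ := hA x
  obtain ⟨V, hV, k, b, p, hxV, ez⟩ := otimes_exists_sum z hx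
  have key : ∀ i : Fin k, ∃ (W : Opens X) (hW : W ≤ U₀) (hWV : W ≤ V) (F₀ : Finset I), x ∈ W ∧
      ∀ F, F₀ ⊆ F → mres _ hWV (b i) = ∑ γ ∈ F, (∑ j, rres O.ring hW (o γ j) *
          lev hWV (b i) (rres S.ring hW (f γ j))) • mres _ hW (e γ) := by
    intro i
    obtain ⟨W, hW, F, hxW, eq⟩ := h (V ⊓ U₀) inf_le_right (mres _ inf_le_left (b i)) x ⟨hxV, hxU₀⟩
    refine ⟨W, hW.trans inf_le_right, hW.trans inf_le_left, F, hxW, fun F' hF' => ?_⟩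
    rw [← mres_mres _ inf_le_left hW, eq F' hF']
    rfl
  choose W hW hWV F hxW key using key
  classical
  let W' : Opens X := (Finset.univ.inf W) ⊓ (V ⊓ U₀)
  have hW' : ∀ i, W' ≤ W i := fun i => inf_le_left.trans (Finset.inf_le (Finset.mem_univ i))
  have hWV' : W' ≤ V := inf_le_right.trans inf_le_left
  have hWU' : W' ≤ U₀ := inf_le_right.trans inf_le_right
  have hx' : x ∈ W' := by
    refine ⟨?_, hxV, hxU₀⟩
    change x ∈ Finset.univ.inf W
    rw [← SetLike.mem_coe, Opens.coe_finset_inf]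
    simpa using fun i => hxW i
  refine ⟨W', hWV'.trans hV, hx', ?_⟩
  have key' : ∀ i, mres _ hWV' (b i) = ∑ γ ∈ Finset.univ.biUnion F,
      (∑ j, rres O.ring hWU' (o γ j) *
        lev hWV' (b i) (rres S.ring hWU' (f γ j))) • mres _ hWU' (e γ) := by
    intro i
    rw [← mres_mres _ (hWV i) (hW' i),
      key i _ (Finset.subset_biUnion_of_mem F (Finset.mem_univ i)), map_sum]
    refine sum_congr rfl fun γ hγ => ?_
    rw [mres_smul, mres_mres, map_sum]
    congr 1
    refine sum_congr rfl fun j _ => ?_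
    rw [map_mul, rres_rres, rres_lev, rres_rres]
  -- The coefficients of `b i` in the basis `e` are combinations of its values at the `f γ j`, so
  -- that regrouping expresses the whole tensor by its values at the `f γ j`.
  have hz' : ∀ γ j, ∑ i, lev hWV' (b i) (rres S.ring hWU' (f γ j)) • mres N hWV' (p i) = 0 := by
    intro γ j
    have := hz W' (hWV'.trans hV) (rres S.ring hWU' (f γ j))
    rw [← mres_mres _ hV hWV', ez, mres_sum_tmul, ev_sum_tmul] at this
    exact this
  rw [← mres_mres _ hV hWV', ez, mres_sum_tmul, map_zero]
  calc _ = ∑ i, ∑ γ ∈ Finset.univ.biUnion F, tmul (mres _ hWU' (e γ))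
        (∑ j, rres O.ring hWU' (o γ j) • lev hWV' (b i) (rres S.ring hWU' (f γ j)) •
          mres N hWV' (p i)) := by
        refine sum_congr rfl fun i _ => ?_
        rw [key', ← tmulHom_apply, map_sum, AddMonoidHom.finsetSum_apply]
        refine sum_congr rfl fun γ _ => ?_
        rw [tmulHom_apply, smul_tmul, ← tmul_smul, Finset.sum_smul]
        congr 1
        exact sum_congr rfl fun j _ => mul_smul _ _ _
    _ = ∑ γ ∈ Finset.univ.biUnion F, tmul (mres _ hWU' (e γ))
        (∑ j, rres O.ring hWU' (o γ j) • ∑ i, lev hWV' (b i) (rres S.ring hWU' (f γ j)) •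
          mres N hWV' (p i)) := by
        rw [Finset.sum_comm]
        refine sum_congr rfl fun γ _ => ?_
        simp only [← tmulHom_apply]
        rw [← map_sum, Finset.sum_comm]
        congr 1
        exact sum_congr rfl fun j _ => smul_sum.symm
    _ = 0 := by
        refine Finset.sum_eq_zero fun γ _ => ?_
        simp only [hz', smul_zero, Finset.sum_const_zero]
        exact map_zero (tmulHom W' _)

/-- Sections of `A ⊗ N` are equal if they have the same values. -/
theorem HasEvalBasis.ev_ext (hA : HasEvalBasis con)
    {z z' : msec (otimes (AMod O S con) N) U}
    (hz : ∀ V (hV : V ≤ U) (f : rsec S.ring V),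
      ev f (mres _ hV z) = ev f (mres _ hV z')) : z = z' := by
  refine sub_eq_zero.1 (hA.ev_injective fun V hV f => ?_)
  rw [map_sub, map_sub, hz, sub_self]

end Eval

/-! ### The coproduct dual to a product -/

section Coalgebra
variable [CommSheaf O.ring] {con : Corr S.ring O.ring}

theorem rres_ext {R : RSh X} {s t : rsec R U}
    (h : ∀ x ∈ U, ∃ (V : Opens X) (hV : V ≤ U), x ∈ V ∧ rres R hV s = rres R hV t) : s = t :=
  msec_ext (unitMod R) h

variable (con) in
/-- Locally, the operators `(f₁, f₂) ↦ a(f₁ f₂)` are finite sums of operators `b(f₁) c(f₂)`. -/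
def HasCoproduct : Prop :=
  ∀ (U : Opens X) (a : msec (AMod O S con) U), ∀ x ∈ U, ∃ (V : Opens X) (hV : V ≤ U) (m : ℕ)
    (b c : Fin m → msec (AMod O S con) V), x ∈ V ∧ ∀ W (hW : W ≤ V)
      (f₁ f₂ : rsec S.ring W), lev (hW.trans hV) a (f₁ * f₂) =
        ∑ i, lev hW (b i) f₁ * lev hW (c i) f₂

theorem lev_ev_sum (h : V ≤ U) {m : ℕ} (b c : Fin m → msec (AMod O S con) U)
    (f₁ f₂ : rsec S.ring V) :
    lev le_rfl (ev f₁ (mres _ h (∑ i, tmul (b i) (c i)))) f₂ =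
      ∑ i, lev h (b i) f₁ * lev h (c i) f₂ := by
  rw [mres_sum_tmul, ev_sum_tmul, lev_sum]
  refine sum_congr rfl fun i _ => ?_
  rw [lev_smul, rres_self]
  rfl

/-- The section `z` of `A ⊗ A` represents `(f₁, f₂) ↦ a(f₁ f₂)`. -/
def IsCoproduct (a : msec (AMod O S con) U)
    (z : msec (otimes (AMod O S con) (AMod O S con)) U) : Prop :=
  ∀ V (h : V ≤ U) (f₁ f₂ : rsec S.ring V),
    lev le_rfl (ev f₁ (mres _ h z)) f₂ = lev h a (f₁ * f₂)

theorem IsCoproduct.unique (hA : HasEvalBasis con) {a : msec (AMod O S con) U}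
    {z z' : msec (otimes (AMod O S con) (AMod O S con)) U} (hz : IsCoproduct a z)
    (hz' : IsCoproduct a z') : z = z' := by
  refine hA.ev_ext fun V hV f => lev_ext fun W hW g => ?_
  have h := hz W (hW.trans hV) (rres _ hW f) g
  have h' := hz' W (hW.trans hV) (rres _ hW f) g
  rw [← mres_mres _ hV hW, ← mres_ev, lev_mres] at h h'
  rw [h, h']

theorem IsCoproduct.res (h : V ≤ U) {a : msec (AMod O S con) U}
    {z : msec (otimes (AMod O S con) (AMod O S con)) U} (hz : IsCoproduct a z) :
    IsCoproduct (mres _ h a) (mres _ h z) := fun W hW f₁ f₂ => by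
  rw [mres_mres, hz, lev_mres]

theorem IsCoproduct.of_local {a : msec (AMod O S con) U}
    {z : msec (otimes (AMod O S con) (AMod O S con)) U}
    (H : ∀ x ∈ U, ∃ (V : Opens X) (hV : V ≤ U), x ∈ V ∧ IsCoproduct (mres _ hV a) (mres _ hV z)) :
    IsCoproduct a z := fun V hV f₁ f₂ => by
  refine rres_ext fun x hx => ?_
  obtain ⟨W, hW, hxW, e⟩ := H x (hV hx)
  refine ⟨V ⊓ W, inf_le_left, ⟨hx, hxW⟩, ?_⟩
  have := e (V ⊓ W) inf_le_right (rres _ inf_le_left f₁) (rres _ inf_le_left f₂)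
  rw [mres_mres, ← mres_mres _ hV inf_le_left, ← mres_ev, lev_mres, lev_mres, ← map_mul,
    ← rres_lev hV inf_le_left] at this
  rw [← this, rres_lev]

theorem isCoproduct_sum {a : msec (AMod O S con) U} {m : ℕ}
    {b c : Fin m → msec (AMod O S con) U} (h : ∀ W (hW : W ≤ U)
      (f₁ f₂ : rsec S.ring W), lev hW a (f₁ * f₂) = ∑ i, lev hW (b i) f₁ * lev hW (c i) f₂) :
    IsCoproduct a (∑ i, tmul (b i) (c i)) := fun V hV f₁ f₂ => by
  rw [lev_ev_sum, h]

theorem exists_isCoproduct (hA : HasEvalBasis con) (hc : HasCoproduct con)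
    (a : msec (AMod O S con) U) : ∃ z, IsCoproduct a z := by
  have := msec_exists_of_local' (otimes (AMod O S con) (AMod O S con)) (U := U)
    (fun V hV z => IsCoproduct (mres _ hV a) z)
    (fun V W hV hW n hn => by have := hn.res hW; rwa [mres_mres] at this)
    (fun V hV n H => .of_local fun x hx => by
      obtain ⟨W, hW, hxW, e⟩ := H x hx
      exact ⟨W, hW, hxW, by rwa [mres_mres]⟩)
    (fun V hV n n' h h' => h.unique hA h')
    (fun x hx => by
      obtain ⟨V, hV, m, b, c, hxV, e⟩ := hc U a x hx
      exact ⟨V, hV, _, hxV, isCoproduct_sum e⟩)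
  obtain ⟨z, hz⟩ := this
  rw [mres_self] at hz
  exact ⟨z, hz⟩

/-- The section of `A ⊗ A` that represents `(f₁, f₂) ↦ a(f₁ f₂)`. -/
def coprodSec (hA : HasEvalBasis con) (hc : HasCoproduct con) (U : Opens X) :
    msec (AMod O S con) U →+ msec (otimes (AMod O S con) (AMod O S con)) U :=
  AddMonoidHom.mk' (fun a => (exists_isCoproduct hA hc a).choose) fun a b => by
    refine (exists_isCoproduct hA hc (a + b)).choose_spec.unique hA fun V h f₁ f₂ => ?_
    rw [map_add, map_add, lev_add, (exists_isCoproduct hA hc a).choose_spec V h,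
      (exists_isCoproduct hA hc b).choose_spec V h, lev_add]

theorem coprodSec_spec (hA : HasEvalBasis con) (hc : HasCoproduct con)
    (a : msec (AMod O S con) U) : IsCoproduct a (coprodSec hA hc U a) :=
  (exists_isCoproduct hA hc a).choose_spec

/-- The coproduct dual to the product of `S`. -/
def coprodHom (hA : HasEvalBasis con) (hc : HasCoproduct con) :
    AMod O S con ⟶ otimes (AMod O S con) (AMod O S con) :=
  mkHom (coprodSec hA hc)
    (fun U V h a => ((coprodSec_spec hA hc a).res h).unique hA (coprodSec_spec hA hc _))
    (fun U r a => (coprodSec_spec hA hc _).unique hA fun V h f₁ f₂ => by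
      rw [mres_smul, ev_smul, lev_smul, lev_smul, coprodSec_spec hA hc a V h, rres_self])

theorem coprodHom_spec (hA : HasEvalBasis con) (hc : HasCoproduct con)
    (a : msec (AMod O S con) U) : IsCoproduct a (app (coprodHom hA hc) a) :=
  coprodSec_spec hA hc a

variable (O S con) in
/-- The counit `a ↦ a(1)`. -/
def counitHom : AMod O S con ⟶ unitMod O.ring :=
  mkHom (fun U => (toUnit O.ring U).symm.toAddMonoidHom.comp (levHom le_rfl 1))
    (fun U V h a => (rres_lev le_rfl h a 1).trans (by rw [map_one]; rfl))
    (fun U r a => (lev_smul le_rfl r a 1).trans (by rw [rres_self]; rfl))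

theorem counitHom_spec (a : msec (AMod O S con) U) :
    toUnit O.ring U (app (counitHom O S con) a) = lev le_rfl a 1 := rfl

/-- If `φ a = ∑ b ⊗ c`, where `φ` is dual to the product of `S`, then `a(f₁ f₂) = ∑ b(f₁) c(f₂)`. -/
theorem IsCoproduct.lev_mul {a : msec (AMod O S con) U}
    {z : msec (otimes (AMod O S con) (AMod O S con)) U} (hz : IsCoproduct a z) {m : ℕ}
    {b c : Fin m → msec (AMod O S con) U} (e : z = ∑ i, tmul (b i) (c i)) (h : V ≤ U)
    (f₁ f₂ : rsec S.ring V) :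
    lev h a (f₁ * f₂) = ∑ i, lev h (b i) f₁ * lev h (c i) f₂ := by
  rw [← hz V h, e, lev_ev_sum]

theorem DSec.ev_sum (d : 𝒟[O] U) (h : V ≤ U) {ι : Type*}
    (F : Finset ι) (f : ι → rsec O.ring V) : d.ev h (∑ i ∈ F, f i) = ∑ i ∈ F, d.ev h (f i) :=
  map_sum ((toUnit O.ring V).toAddMonoidHom.comp (d.1 ⟨V, h⟩)) f F

/-- The coalgebra structure on the differential operators `S → O` dual to the product of `S`. -/
def stdCoalg (hA : HasEvalBasis con) (hc : HasCoproduct con) :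
    CoalgStr (leftDiff O S con) where
  coprod := coprodHom hA hc
  counit := counitHom O S con
  coprod_der U τ hτ a m b c e := by
    refine (coprodHom_spec hA hc _).unique hA fun V h f₁ f₂ => ?_
    rw [Finset.sum_add_distrib, map_add, map_add, lev_add, lev_ev_sum, lev_ev_sum, lev_lact,
      (coprodHom_spec hA hc a).lev_mul e, DSec.ev_sum, ← Finset.sum_add_distrib]
    exact sum_congr rfl fun i _ => (hτ V h _ _).symm
  counit_der U τ hτ a := rfl
  counit_left U a m b c e := by
    refine lev_ext fun V h f => ?_
    have := (coprodHom_spec hA hc a).lev_mul e h 1 f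
    rw [one_mul] at this
    rw [this, lev_sum]
    refine sum_congr rfl fun i _ => ?_
    rw [counitHom_spec, lev_smul, rres_lev, map_one]
  counit_right U a m b c e := by
    refine lev_ext fun V h f => ?_
    have := (coprodHom_spec hA hc a).lev_mul e h f 1
    rw [mul_one] at this
    rw [this, lev_sum]
    refine sum_congr rfl fun i _ => ?_
    rw [counitHom_spec, lev_smul, rres_lev, map_one, mul_comm]
  coassoc U a m n b c b' b'' c' c'' e eb ec := by
    refine hA.ev_ext fun V hV f => hA.ev_ext fun W hW g => lev_ext fun W' hW' h => ?_
    have e₁ := fun i => (coprodHom_spec hA hc _).lev_mul (eb i) (hW'.trans (hW.trans hV))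
      (rres _ (hW'.trans hW) f) (rres _ hW' g)
    have e₂ := fun i => (coprodHom_spec hA hc _).lev_mul (ec i) (hW'.trans (hW.trans hV))
      (rres _ hW' g) h
    have e₃ := (coprodHom_spec hA hc a).lev_mul e (hW'.trans (hW.trans hV))
      (rres _ (hW'.trans hW) f * rres _ hW' g) h
    have e₄ := (coprodHom_spec hA hc a).lev_mul e (hW'.trans (hW.trans hV))
      (rres _ (hW'.trans hW) f) (rres _ hW' g * h)
    rw [← mul_assoc, e₃] at e₄
    simp only [map_sum, mres_tmul, ev_tmul, mres_smul, ev_smul, lev_sum, lev_smul, rres_lev,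
      lev_mres, rres_rres, mres_mres]
    simp only [e₁, e₂, sum_mul, mul_sum] at e₄
    simpa only [mul_assoc] using e₄

theorem stdCoalg_isStd (hA : HasEvalBasis con) (hc : HasCoproduct con) :
    IsStdCoalg (stdCoalg hA hc) where
  counit _ _ := rfl
  coprod _ a _ _ _ e _ h f₁ f₂ := (coprodHom_spec hA hc a).lev_mul e h f₁ f₂

theorem IsStdCoalg.isCoproduct {C : CoalgStr (leftDiff O S con)} (hC : IsStdCoalg C)
    (a : msec (AMod O S con) U) : IsCoproduct a (app C.coprod a) := by
  refine .of_local fun x hx => ?_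
  obtain ⟨V, hV, m, b, c, hxV, e⟩ := otimes_exists_sum (app C.coprod a) hx
  refine ⟨V, hV, hxV, ?_⟩
  rw [e]
  rw [mres_app] at e
  exact isCoproduct_sum fun W hW f₁ f₂ => hC.coprod V _ m b c e W hW f₁ f₂

/-- The coproduct is unique, as a section of `A ⊗ A` is determined by its values on pairs; counit
and coassociativity hold since the product of `S` is unital and associative. -/
theorem existsUnique_stdCoalg (hA : HasEvalBasis con) (hc : HasCoproduct con) :
    ∃! C : CoalgStr (leftDiff O S con), IsStdCoalg C := by
  refine ⟨stdCoalg hA hc, stdCoalg_isStd hA hc, fun C hC => CoalgStr.ext ?_ ?_⟩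
  · exact hom_ext_app fun U a => (hC.isCoproduct a).unique hA (coprodHom_spec hA hc a)
  · exact hom_ext_app fun U a => (toUnit O.ring U).injective (hC.counit U a)

end Coalgebra

/-! ### Coactions as actions by differential operators -/

section Comodule
variable [CommSheaf O.ring] {con : Corr S.ring O.ring} {G : SheafOfModules.{u} (opSheaf O.D)}

theorem exists_common_nhd {X : TopCat.{u}} {k : ℕ} {x : X} (V : Fin k → Opens X)
    (h : ∀ i, x ∈ V i) : ∃ W : Opens X, x ∈ W ∧ ∀ i, W ≤ V i := by
  refine ⟨Finset.univ.inf V, ?_, fun i => Finset.inf_le (Finset.mem_univ i)⟩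
  rw [← SetLike.mem_coe, Opens.coe_finset_inf]
  simpa using h

theorem sum_tmul_pad {M N : SheafOfModules.{u} O.ring} {m n : ℕ} (h : m ≤ n)
    (b : Fin m → msec M U) (p : Fin m → msec N U) : ∃ (b' : Fin n → msec M U)
      (p' : Fin n → msec N U), ∑ i, tmul (b i) (p i) = ∑ i, tmul (b' i) (p' i) := by
  obtain ⟨k, rfl⟩ := Nat.exists_eq_add_of_le h
  refine ⟨Fin.append b 0, Fin.append p 0, ?_⟩
  rw [Fin.sum_univ_add]
  simp only [Fin.append_left, Fin.append_right, Pi.zero_apply]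
  exact (add_zero _).symm.trans (congrArg _ (Finset.sum_eq_zero fun i _ =>
    map_zero (tmulHom U (0 : msec M U))).symm)

/-- Finitely many sections of a tensor product are locally sums of equally many pure tensors. -/
theorem otimes_exists_sum_uniform {M N : SheafOfModules.{u} O.ring} {k : ℕ}
    (z : Fin k → msec (otimes M N) U) {x : X} (hx : x ∈ U) :
    ∃ (V : Opens X) (hV : V ≤ U) (n₀ : ℕ), x ∈ V ∧ ∀ n, n₀ ≤ n →
      ∃ (b : Fin k → Fin n → msec M V) (p : Fin k → Fin n → msec N V),
      ∀ i, mres (otimes M N) hV (z i) = ∑ j, tmul (b i j) (p i j) := by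
  choose V hV m b p hxV e using fun i => otimes_exists_sum (z i) hx
  obtain ⟨W, hxW, hW⟩ := exists_common_nhd V hxV
  refine ⟨W ⊓ U, inf_le_right, Finset.univ.sup m, ⟨hxW, hx⟩, fun n hn => ?_⟩
  choose b' p' e' using fun i => sum_tmul_pad
    (((Finset.le_sup (Finset.mem_univ i)).trans hn : m i ≤ n))
    (fun j => mres _ (inf_le_left.trans (hW i) : W ⊓ U ≤ V i) (b i j))
    (fun j => mres _ (inf_le_left.trans (hW i) : W ⊓ U ≤ V i) (p i j))
  refine ⟨b', p', fun i => ?_⟩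
  rw [← e', ← mres_mres _ (hV i) (inf_le_left.trans (hW i)), e, mres_sum_tmul]

variable (O) in
/-- Locally, every differential operator is in the ring generated by functions and derivations. -/
def IsGenByDer : Prop :=
  ∀ (U : Opens X) (d : 𝒟[O] U), ∀ x ∈ U, ∃ (V : Opens X) (hV : V ≤ U), x ∈ V ∧
    DSec.res hV d ∈ Subring.closure
      (Set.range (mulOp O.ring O.selfLin V) ∪ {τ : 𝒟[O] V | τ.IsDer})

variable (con) in
/-- An action of `S` on a right `D`-module `G` by `D`-linear maps, such that locally the maps
`f ↦ f s` are differential operators in the sense that they are given by sections of `A ⊗ G`. -/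
structure IsDiffAction
    (act : ∀ U : Opens X, rsec S.ring U → msec G U →+ msec G U) : Prop where
  natural : ∀ U V (h : V ≤ U) (f : rsec S.ring U) (s : msec G U),
    mres G h (act U f s) = act V (rres S.ring h f) (mres G h s)
  one : ∀ (U : Opens X) (s : msec G U), act U 1 s = s
  mul : ∀ (U : Opens X) (f g : rsec S.ring U) (s : msec G U), act U (f * g) s = act U f (act U g s)
  linear : ∀ (U : Opens X) (f : rsec S.ring U) (s : msec G U) (d : 𝒟[O] U),
    act U f (s ◂ d) = act U f s ◂ d
  exists_sum : ∀ (U : Opens X) (s : msec G U), ∀ x ∈ U, ∃ (V : Opens X) (hV : V ≤ U) (m : ℕ)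
    (a : Fin m → msec (AMod O S con) V) (g : Fin m → msec G V), x ∈ V ∧
    ∀ W (hW : W ≤ V) (f : rsec S.ring W), act W f (mres G (hW.trans hV) s) =
      ∑ i, mres G hW (g i) ◂ mulOp O.ring O.selfLin W (lev hW (a i) f)

/-- The action of `S` on `G` given by a map `G → A ⊗ G`. -/
def coactAct
    (φ : rightO G ⟶ otimes (AMod O S con) (rightO G)) (U : Opens X) (f : rsec S.ring U) :
    msec G U →+ msec G U :=
  (toR G).symm.toAddMonoidHom.comp
    ((ev f).comp ((app φ).toAddMonoidHom.comp (toR G).toAddMonoidHom))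

theorem coactAct_apply
    (φ : rightO G ⟶ otimes (AMod O S con) (rightO G)) (f : rsec S.ring U)
    (s : msec G U) : coactAct φ U f s = (toR G).symm (ev f (app φ (toR G s))) := rfl

theorem mres_coactAct
    (φ : rightO G ⟶ otimes (AMod O S con) (rightO G)) (h : V ≤ U)
    (f : rsec S.ring U) (s : msec G U) :
    mres G h (coactAct φ U f s) = coactAct φ V (rres S.ring h f) (mres G h s) := by
  change mres (rightO G) h (ev f (app φ (toR G s))) = _
  rw [mres_ev, mres_app]
  rfl

theorem coactAct_of_sum
    {φ : rightO G ⟶ otimes (AMod O S con) (rightO G)} {s : msec G U}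
    {m : ℕ} {a : Fin m → msec (AMod O S con) U} {g : Fin m → msec (rightO G) U}
    (e : app φ (toR G s) = ∑ i, tmul (a i) (g i)) (h : V ≤ U) (f : rsec S.ring V) :
    coactAct φ V f (mres G h s) =
      ∑ i, mres G h ((toR G).symm (g i)) ◂ mulOp O.ring O.selfLin V (lev h (a i) f) := by
  change ev f (app φ (mres (rightO G) h (toR G s))) = _
  rw [← mres_app, e, mres_sum_tmul, ev_sum_tmul]
  rfl

theorem coactAct_of_sum_self
    {φ : rightO G ⟶ otimes (AMod O S con) (rightO G)} {s : msec G U}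
    {m : ℕ} {a : Fin m → msec (AMod O S con) U} {g : Fin m → msec (rightO G) U}
    (e : app φ (toR G s) = ∑ i, tmul (a i) (g i)) (f : rsec S.ring U) :
    coactAct φ U f s = (toR G).symm (∑ i, lev le_rfl (a i) f • g i) := by
  rw [coactAct_apply, e, ev_sum_tmul]

theorem coactAct_mulOp
    (φ : rightO G ⟶ otimes (AMod O S con) (rightO G)) (f : rsec S.ring U)
    (s : msec G U) (o : rsec O.ring U) :
    coactAct φ U f (s ◂ mulOp O.ring O.selfLin U o) =
      coactAct φ U f s ◂ mulOp O.ring O.selfLin U o := by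
  change ev f (app φ (o • toR G s)) = o • ev f (app φ (toR G s))
  rw [map_smul, ev_smul]

theorem coactAct_der {A : CoalgStr (leftDiff O S con)} {side : Side}
    (δ : Coaction A side G)
    (f : rsec S.ring U) (s : msec G U) {τ : 𝒟[O] U} (hτ : τ.IsDer) :
    coactAct δ.coact U f (s ◂ τ) = coactAct δ.coact U f s ◂ τ := by
  refine msec_ext G fun x hx => ?_
  obtain ⟨V, hV, m, a, g, hxV, e⟩ := otimes_exists_sum (app δ.coact (toR G s)) hx
  refine ⟨V, hV, hxV, ?_⟩
  rw [mres_coactAct, mres_rsm, mres_rsm, mres_coactAct]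
  rw [mres_app] at e
  have hτ' : (DSec.res hV τ).IsDer := fun W hW f g => hτ W (hW.trans hV) f g
  have e' := δ.coact_der V _ hτ' _ m a g e
  have h₁ := coactAct_of_sum_self (s := mres G hV s) e (rres _ hV f)
  have h₂ : coactAct δ.coact V (rres _ hV f) (mres G hV s ◂ DSec.res hV τ) = (toR G).symm
      (∑ i, (lev le_rfl (a i) (rres _ hV f) • ract G (opSec (DSec.res hV τ)) (g i) -
        (DSec.res hV τ).ev le_rfl (lev le_rfl (a i) (rres _ hV f)) • g i)) := by
    rw [coactAct_apply]
    congr 1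
    refine (congrArg (ev (rres _ hV f)) e').trans ?_
    rw [map_sum]
    refine sum_congr rfl fun i _ => ?_
    rw [map_sub, ev_tmul, ev_tmul, lev_lact]
  rw [h₁, h₂, map_sum, map_sum, sum_rsm]
  refine sum_congr rfl fun i _ => ?_
  rw [map_sub, toR_symm_smul, toR_symm_smul, toR_symm_smul, ← rsm_mul, sub_eq_iff_eq_add, ← rsm_add,
    ← IsDer_mul hτ', rsm_mul]
  rfl

/-- The action of `S` given by a coaction of the coalgebra dual to the product of `S`. -/
theorem isDiffAction_coactAct (hO : IsGenByDer O) {A : CoalgStr (leftDiff O S con)}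
    (hA : IsStdCoalg A) {side : Side}
    (hside : side = .right ∨ ∀ (U : Opens X) (f g : rsec S.ring U), f * g = g * f)
    (δ : Coaction A side G) :
    IsDiffAction con (coactAct δ.coact) where
  natural U V h f s := mres_coactAct _ h f s
  one U s := by
    refine msec_ext G fun x hx => ?_
    obtain ⟨V, hV, m, a, g, hxV, e⟩ := otimes_exists_sum (app δ.coact (toR G s)) hx
    refine ⟨V, hV, hxV, ?_⟩
    rw [mres_app] at e
    rw [mres_coactAct, map_one, coactAct_of_sum_self (s := mres G hV s) e]
    have := δ.counit V _ m a g e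
    simp only [hA.counit] at this
    rw [this]
    rfl
  mul U f f' s := by
    refine msec_ext G fun x hx => ?_
    obtain ⟨V, hV, m, a, g, hxV, e⟩ := otimes_exists_sum (app δ.coact (toR G s)) hx
    rw [mres_app] at e
    -- The form of coassociativity requires sums with the same number of terms for all `i`.
    obtain ⟨V₁, hV₁, n₁, hxV₁, h₁⟩ := otimes_exists_sum_uniform (fun i => app A.coprod (a i)) hxV
    obtain ⟨V₂, hV₂, n₂, hxV₂, h₂⟩ := otimes_exists_sum_uniform (fun i => app δ.coact (g i)) hxV
    obtain ⟨b, c, e₁⟩ := h₁ (max n₁ n₂) (le_max_left _ _)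
    obtain ⟨a', g', e₂⟩ := h₂ (max n₁ n₂) (le_max_right _ _)
    have hW : V₁ ⊓ V₂ ≤ V := inf_le_left.trans hV₁
    have hW₁ : V₁ ⊓ V₂ ≤ V₁ := inf_le_left
    have hW₂ : V₁ ⊓ V₂ ≤ V₂ := inf_le_right
    refine ⟨V₁ ⊓ V₂, hW.trans hV, ⟨hxV₁, hxV₂⟩, ?_⟩
    have e' : app δ.coact (toR G (mres G (hW.trans hV) s)) =
        ∑ i, tmul (mres _ hW (a i)) (mres _ hW (g i)) := by
      rw [← mres_sum_tmul, ← e, mres_app]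
      congr 1
      exact (mres_mres G hV hW s).symm
    have e₁' : ∀ i, app A.coprod (mres _ hW (a i)) =
        ∑ j, tmul (mres _ hW₁ (b i j)) (mres _ hW₁ (c i j)) := fun i => by
      rw [← mres_sum_tmul, ← e₁, mres_mres, mres_app]
    have e₂' : ∀ i, app δ.coact (mres _ hW (g i)) =
        ∑ j, tmul (mres _ hW₂ (a' i j)) (mres _ hW₂ (g' i j)) := fun i => by
      rw [← mres_sum_tmul, ← e₂, mres_mres, mres_app]
    have key := δ.coassoc _ _ m _ _ _ _ _ _ _ e' e₁' e₂'
    -- Evaluated at two sections, the two sides of coassociativity are the action of the product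
    -- and the composition of the actions, up to the order of the factors, which depends on `side`.
    have hl : ∀ k k' : rsec S.ring (V₁ ⊓ V₂), coactAct δ.coact _ (k * k') (mres G (hW.trans hV) s) =
        (toR G).symm (ev k' (ev k (∑ i, ∑ j, tmul (mres _ hW₁ (b i j))
          (tmul (mres _ hW₁ (c i j)) (mres _ hW (g i)))))) := by
      intro k k'
      rw [coactAct_of_sum_self e']
      congr 1
      simp only [map_sum, ev_tmul, ev_smul]
      refine sum_congr rfl fun i _ => ?_
      rw [hA.coprod _ _ _ _ _ (e₁' i) _ le_rfl, Finset.sum_smul]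
      exact sum_congr rfl fun j _ => mul_smul _ _ _
    have hr : ∀ k k' : rsec S.ring (V₁ ⊓ V₂),
        coactAct δ.coact _ k (coactAct δ.coact _ k' (mres G (hW.trans hV) s)) =
        (toR G).symm (∑ i, ∑ j, lev le_rfl (mres _ hW (a i)) k' •
          lev le_rfl (mres _ hW₂ (a' i j)) k • mres _ hW₂ (g' i j)) := by
      intro k k'
      rw [coactAct_of_sum_self e', map_sum, map_sum, map_sum]
      refine sum_congr rfl fun i _ => ?_
      rw [toR_symm_smul, coactAct_mulOp,
        coactAct_of_sum_self (s := (toR G).symm (mres (rightO G) hW (g i))) (e₂' i),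
          ← toR_symm_smul,
        smul_sum]
    rw [mres_coactAct, mres_coactAct, mres_coactAct, map_mul]
    cases side with
    | right =>
      rw [hl, key, hr]
      congr 1
      simp only [map_sum, ev_tmul, ev_smul]
      refine sum_congr rfl fun i _ => sum_congr rfl fun j _ => ?_
      rw [smul_smul, smul_smul, mul_comm]
    | left =>
      rw [(hside.resolve_left (by simp)) _ (rres S.ring _ f), hl, key, hr]
      congr 1
      simp only [map_sum, ev_tmul, ev_smul]
  linear U f s d := by
    refine msec_ext G fun x hx => ?_
    obtain ⟨V, hV, hxV, hd⟩ := hO U d x hx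
    refine ⟨V, hV, hxV, ?_⟩
    rw [mres_coactAct, mres_rsm, mres_rsm, mres_coactAct]
    -- Functions and derivations generate `D`, and a coaction is compatible with both.
    generalize mres G hV s = s
    generalize rres S.ring hV f = f
    generalize DSec.res hV d = d at hd
    induction hd using Subring.closure_induction generalizing s with
    | mem d hd =>
      rcases hd with ⟨o, rfl⟩ | hd
      · exact coactAct_mulOp _ _ _ _
      · exact coactAct_der δ f s hd
    | zero => rw [rsm_zero, rsm_zero, map_zero]
    | one => rw [rsm_one, rsm_one]
    | add d d' _ _ h h' => rw [rsm_add, rsm_add, map_add, h, h']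
    | neg d _ h => rw [rsm_neg, rsm_neg, map_neg, h]
    | mul d d' _ _ h h' => rw [rsm_mul, rsm_mul, h', h]
  exists_sum U s x hx := by
    obtain ⟨V, hV, m, a, g, hxV, e⟩ := otimes_exists_sum (app δ.coact (toR G s)) hx
    rw [mres_app] at e
    refine ⟨V, hV, m, a, fun i => (toR G).symm (g i), hxV, fun W hW f => ?_⟩
    rw [← mres_mres G hV hW]
    exact coactAct_of_sum e hW f

/-- A coaction is determined by the corresponding action of `S`. -/
theorem coact_ext (hA : HasEvalBasis con) {C : CoalgStr (leftDiff O S con)} {side : Side}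
    {δ δ' : Coaction C side G}
    (h : ∀ (U : Opens X) (f : rsec S.ring U) (s : msec G U),
      coactAct δ.coact U f s = coactAct δ'.coact U f s) : δ = δ' :=
  Coaction.ext (hom_ext_app fun U s => hA.ev_ext fun V hV f => by
    rw [mres_app, mres_app]
    exact h V f (mres G hV ((toR G).symm s)))

variable {act : ∀ U : Opens X, rsec S.ring U → msec G U →+ msec G U}

/-- The section `z` of `A ⊗ G` represents `f ↦ f s`. -/
def IsCoact (act : ∀ U : Opens X, rsec S.ring U → msec G U →+ msec G U)
    (s : msec G U) (z : msec (otimes (AMod O S con) (rightO G)) U) : Prop :=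
  ∀ V (h : V ≤ U) (f : rsec S.ring V), ev f (mres _ h z) = toR G (act V f (mres G h s))

theorem IsCoact.unique (hA : HasEvalBasis con) {s : msec G U}
    {z z' : msec (otimes (AMod O S con) (rightO G)) U} (hz : IsCoact act s z)
    (hz' : IsCoact act s z') : z = z' :=
  hA.ev_ext fun V hV f => by rw [hz, hz']

theorem exists_isCoact (hA : HasEvalBasis con) (ha : IsDiffAction con act)
    (s : msec G U) : ∃ z, IsCoact (con := con) act s z := by
  have := msec_exists_of_local' (otimes (AMod O S con) (rightO G)) (U := U)
    (fun V hV z => IsCoact act (mres G hV s) z)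
    (fun V W hV hW n hn W' hW' f => by
      rw [mres_mres, hn, mres_mres, mres_mres])
    (fun V hV n H W hW f => by
      refine msec_ext _ fun x hx => ?_
      obtain ⟨W', hW', hxW', e⟩ := H x (hW hx)
      refine ⟨W ⊓ W', inf_le_left, ⟨hx, hxW'⟩, ?_⟩
      have := e (W ⊓ W') inf_le_right (rres _ inf_le_left f)
      rw [mres_ev, mres_mres]
      rw [mres_mres] at this
      refine this.trans ?_
      refine Eq.trans ?_ (congrArg (toR G) (ha.natural _ _ inf_le_left _ _).symm)
      rw [mres_mres, mres_mres, mres_mres])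
    (fun V hV n n' h h' => h.unique hA h')
    (fun x hx => by
      obtain ⟨V, hV, m, a, g, hxV, e⟩ := ha.exists_sum U s x hx
      refine ⟨V, hV, ∑ i, tmul (a i) (toR G (g i)), hxV, fun W hW f => ?_⟩
      rw [mres_mres, e, mres_sum_tmul, ev_sum_tmul, map_sum]
      rfl)
  obtain ⟨z, hz⟩ := this
  rw [mres_self] at hz
  exact ⟨z, hz⟩

/-- The section of `A ⊗ G` that represents `f ↦ f s`. -/
def coactSec (hA : HasEvalBasis con) (ha : IsDiffAction con act) (U : Opens X) :
    msec (rightO G) U →+ msec (otimes (AMod O S con) (rightO G)) U :=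
  AddMonoidHom.mk' (fun s => (exists_isCoact hA ha ((toR G).symm s)).choose) fun s t => by
    refine (exists_isCoact hA ha _).choose_spec.unique hA fun V h f => ?_
    rw [map_add, map_add, (exists_isCoact hA ha ((toR G).symm s)).choose_spec V h,
      (exists_isCoact hA ha ((toR G).symm t)).choose_spec V h, map_add, map_add, map_add, map_add]

theorem coactSec_spec (hA : HasEvalBasis con) (ha : IsDiffAction con act)
    (s : msec (rightO G) U) : IsCoact act ((toR G).symm s) (coactSec hA ha U s) :=
  (exists_isCoact hA ha ((toR G).symm s)).choose_spec

/-- The coaction given by an action of `S`. -/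
def coactHom (hA : HasEvalBasis con) (ha : IsDiffAction con act) :
    rightO G ⟶ otimes (AMod O S con) (rightO G) :=
  mkHom (coactSec hA ha)
    (fun U V h s => IsCoact.unique hA (fun W hW f => by
        rw [mres_mres]
        refine (coactSec_spec hA ha s W (hW.trans h) f).trans ?_
        rw [← mres_mres G h hW]
        rfl) (coactSec_spec hA ha _))
    (fun U r s => (coactSec_spec hA ha _).unique hA fun V h f => by
      rw [mres_smul, ev_smul, coactSec_spec hA ha s V h, smul_toR, toR_symm_smul, mres_rsm,
        ← mulOp_res, ha.linear])

theorem coactAct_coactHom (hA : HasEvalBasis con) (ha : IsDiffAction con act)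
    (f : rsec S.ring U) (s : msec G U) : coactAct (coactHom hA ha) U f s = act U f s := by
  have := coactSec_spec hA ha (toR G s) U le_rfl f
  rw [mres_self] at this
  refine (congrArg (toR G).symm this).trans ?_
  change act U f (mres G le_rfl s) = _
  rw [mres_self]

/-- The coaction of the coalgebra dual to the product of `S` given by an action of `S`. -/
def coactionOfAction (hA : HasEvalBasis con) (ha : IsDiffAction con act)
    {C : CoalgStr (leftDiff O S con)} (hC : IsStdCoalg C) {side : Side}
    (hside : side = .right ∨ ∀ (U : Opens X) (f g : rsec S.ring U), f * g = g * f) :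
    Coaction C side G where
  coact := coactHom hA ha
  coact_der U τ hτ s m a g e := by
    refine hA.ev_ext fun V hV f => ?_
    have h₁ := coactAct_of_sum (s := (toR G).symm s) e hV f
    rw [coactAct_coactHom] at h₁
    have h₂ : ev f (mres _ hV (app (coactHom hA ha) (ract G (opSec τ) s))) =
        toR G (act V f (mres G hV ((toR G).symm s ◂ τ))) := coactSec_spec hA ha _ V hV f
    have hτ' : (DSec.res hV τ).IsDer := fun W hW f g => hτ W (hW.trans hV) f g
    rw [h₂, mres_rsm, ha.linear, h₁, map_sum, map_sum, sum_rsm, map_sum]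
    refine sum_congr rfl fun i _ => ?_
    rw [map_sub, map_sub, mres_tmul, mres_tmul, ev_tmul, ev_tmul, ← rsm_mul, eq_sub_iff_add_eq]
    refine (congrArg (toR G) (rsm_add (mres G hV ((toR G).symm (g i)))
      (mulOp O.ring O.selfLin V (lev hV (a i) f) * DSec.res hV τ)
      (mulOp O.ring O.selfLin V ((DSec.res hV τ).ev le_rfl (lev hV (a i) f)))).symm).trans ?_
    rw [← IsDer_mul hτ', rsm_mul, ← mres_rsm]
    rfl
  counit U s m a g e := by
    have h₁ := coactAct_of_sum_self (s := (toR G).symm s) e 1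
    rw [coactAct_coactHom, ha.one] at h₁
    simp only [hC.counit]
    exact h₁.symm
  coassoc U s m n a g b c a' g' e e₁ e₂ := by
    have hl : ∀ V (hV : V ≤ U) (k k' : rsec S.ring V),
        ev k' (ev k (mres _ hV (∑ i, ∑ j, tmul (b i j) (tmul (c i j) (g i))))) =
          toR G (act V (k * k') (mres G hV ((toR G).symm s))) := by
      intro V hV k k'
      have h₁ := coactAct_of_sum (s := (toR G).symm s) e hV (k * k')
      rw [coactAct_coactHom] at h₁
      rw [h₁]
      simp only [map_sum, mres_tmul, ev_tmul, ev_smul]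
      refine sum_congr rfl fun i _ => ?_
      rw [hC.coprod _ _ _ _ _ (e₁ i) _ hV, map_sum, rsm_sum, map_sum]
      refine sum_congr rfl fun j _ => ?_
      rw [smul_smul]
      rfl
    have hr : ∀ V (hV : V ≤ U) (k k' : rsec S.ring V),
        toR G (act V k (act V k' (mres G hV ((toR G).symm s)))) =
          ∑ i, ∑ j, lev hV (a i) k' • lev hV (a' i j) k • mres (rightO G) hV (g' i j) := by
      intro V hV k k'
      have h₁ := coactAct_of_sum (s := (toR G).symm s) e hV k'
      rw [coactAct_coactHom] at h₁
      rw [h₁, map_sum, map_sum]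
      refine sum_congr rfl fun i _ => ?_
      have h₂ := coactAct_of_sum (s := (toR G).symm (g i)) (e₂ i) hV k
      rw [coactAct_coactHom] at h₂
      rw [ha.linear, h₂, ← smul_toR, map_sum, smul_sum]
      rfl
    refine hA.ev_ext fun V hV k => hA.ev_ext fun W hW k' => ?_
    rw [mres_ev, mres_mres, mres_ev, mres_mres, hl, ha.mul]
    cases side with
    | right =>
      rw [hr]
      simp only [map_sum, mres_tmul, ev_tmul, ev_smul]
      refine sum_congr rfl fun i _ => sum_congr rfl fun j _ => ?_
      rw [smul_smul, smul_smul, mul_comm]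
      rfl
    | left =>
      rw [← ha.mul, hside.resolve_left (by simp), ha.mul, hr]
      simp only [map_sum, mres_tmul, ev_tmul, ev_smul]
      rfl

/-- A morphism of right `D`-modules is a morphism of comodules iff it is `S`-linear. -/
theorem isComodHom_iff (hA : HasEvalBasis con) {C : CoalgStr (leftDiff O S con)} {side : Side}
    {G' : SheafOfModules.{u} (opSheaf O.D)} {δ : Coaction C side G} {δ' : Coaction C side G'}
    {φ : G ⟶ G'} : IsComodHom δ δ' φ ↔ ∀ (U : Opens X) (f : rsec S.ring U) (s : msec G U),
      app φ (coactAct δ.coact U f s) = coactAct δ'.coact U f (app φ s) := by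
  constructor
  · intro h U f s
    refine msec_ext G' fun x hx => ?_
    obtain ⟨V, hV, m, a, g, hxV, e⟩ := otimes_exists_sum (app δ.coact (toR G s)) hx
    rw [mres_app] at e
    refine ⟨V, hV, hxV, ?_⟩
    rw [mres_app, mres_coactAct, mres_coactAct, mres_app]
    have e' := h V _ m a g e
    rw [coactAct_of_sum_self (s := mres G hV s) e,
      coactAct_of_sum_self (s := app φ (mres G hV s)) e', map_sum, map_sum, map_sum]
    refine sum_congr rfl fun i _ => ?_
    rw [toR_symm_smul, app_rsm]
    rfl
  · intro h U s m a g e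
    refine hA.ev_ext fun V hV f => ?_
    have h₁ := h V f (mres G hV ((toR G).symm s))
    rw [coactAct_of_sum (s := (toR G).symm s) e, ← mres_app] at h₁
    rw [mres_app]
    refine h₁.symm.trans ?_
    rw [map_sum, mres_sum_tmul, ev_sum_tmul]
    refine sum_congr rfl fun i _ => ?_
    rw [app_rsm, ← mres_app]
    rfl

end Comodule

/-! ### Operators `O → T` -/

section Rev
variable {con' : Corr O.ring T.ring}

/-- The right `D`-module of differential operators `O → T`. -/
abbrev BMod (O T : AlgSheaf K X) (con' : Corr O.ring T.ring) :
    SheafOfModules.{u} (opSheaf O.D) := rightDiffObj O T con' (unitMod T.ring)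

theorem rev_mres (h : V ≤ U) (h' : W ≤ V) (b : msec (BMod O T con') U)
    (g : rsec O.ring W) : rev h' (mres (BMod O T con') h b) g = rev (h'.trans h) b g := rfl

theorem rres_rev (h : V ≤ U) (h' : W ≤ V) (b : msec (BMod O T con') U)
    (g : rsec O.ring V) : rres T.ring h' (rev h b g) = rev (h'.trans h) b (rres O.ring h' g) :=
  (show diffOps (unitMod T.ring) (O.lin T) con' U from b).2.natural V W h h' g

theorem rev_rsm (h : V ≤ U) (b : msec (BMod O T con') U)
    (d : 𝒟[O] U) (g : rsec O.ring V) :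
    rev h (b ◂ d) g = rev h b (d.ev h g) := rfl

/-- The value on `g` as an additive map. -/
def revHom (h : V ≤ U) (g : rsec O.ring V) :
    msec (BMod O T con') U →+ rsec T.ring V :=
  AddMonoidHom.mk' (fun b => rev h b g) fun _ _ => rfl

theorem rev_add (h : V ≤ U) (b b' : msec (BMod O T con') U)
    (g : rsec O.ring V) : rev h (b + b') g = rev h b g + rev h b' g := rfl

theorem rev_sum (h : V ≤ U) {ι : Type*} (F : Finset ι)
    (b : ι → msec (BMod O T con') U) (g : rsec O.ring V) :
    rev h (∑ i ∈ F, b i) g = ∑ i ∈ F, rev h (b i) g := map_sum (revHom h g) b F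

theorem rev_ext {a b : msec (BMod O T con') U}
    (h : ∀ V (hV : V ≤ U) (g : rsec O.ring V), rev hV a g = rev hV b g) : a = b := by
  apply Subtype.ext
  funext V; ext f
  exact h V.1 V.2 f

end Rev

/-! ### Frames and the coaction on `B ⊗ P` -/

section Frame
variable [CommSheaf O.ring] {con : Corr S.ring O.ring} {con' : Corr O.ring T.ring}
  {inc : Corr S.ring T.ring} {R : RSh X}

/-- The left action of `S` on the operators `b : O → T` by `(f b)(g) = ι(f) b(g)`, where `ι : S → T`
is the morphism that defines the correspondence `inc`, commutes with the right action of `R`. -/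
structure IsLeftMul (inc : Corr S.ring T.ring) (B : RAct R (BMod O T con'))
    (ι : ∀ U : Opens X, rsec S.ring U →+* rsec T.ring U) : Prop where
  rel_iff : ∀ (U : Opens X) (f : rsec S.ring U) (t : rsec T.ring U), inc.rel U f t ↔ t = ι U f
  res : ∀ U V (h : V ≤ U) (f : rsec S.ring U),
    rres T.ring h (ι U f) = ι V (rres S.ring h f)
  act : ∀ (U : Opens X) (f : rsec S.ring U) (b b' : msec (BMod O T con') U) (r : rsec R U),
    (∀ V (h : V ≤ U) (g : rsec O.ring V),
      rev h b' g = ι V (rres S.ring h f) * rev h b g) →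
    ∀ V (h : V ≤ U) (g : rsec O.ring V),
      rev h (B.act U (.op r) b') g = ι V (rres S.ring h f) * rev h (B.act U (.op r) b) g

/-- Local data over `U₀` that trivialize the operators `A : S → O` and `B : O → T`: the sections `eA
γ` form a basis of `A` over `O`, with coefficients given by universal formulas in the values of the
operators; the sections `eB α` generate `B` over `R`; the section `eB zero` is a basis of `B` over
`D`; and the operators `f eB α` are expressed by the functions `eA γ (f)` by means of an invertible
matrix with coefficients in `D`. -/
structure Frame (con : Corr S.ring O.ring) (B : RAct R (BMod O T con'))
    (ι : ∀ U : Opens X, rsec S.ring U →+* rsec T.ring U) (U₀ : Opens X) where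
  I : Type
  dec : DecidableEq I
  zero : I
  eA : I → msec (AMod O S con) U₀
  len : I → ℕ
  o : ∀ γ, Fin (len γ) → rsec O.ring U₀
  f : ∀ γ, Fin (len γ) → rsec S.ring U₀
  basis : ∀ V (hV : V ≤ U₀) (a : msec (AMod O S con) V), ∀ y ∈ V,
    ∃ (W : Opens X) (hW : W ≤ V) (F₀ : Finset I), y ∈ W ∧ ∀ F, F₀ ⊆ F → mres _ hW a =
      ∑ γ ∈ F, (∑ j, rres O.ring (hW.trans hV) (o γ j) *
        lev hW a (rres S.ring (hW.trans hV) (f γ j))) • mres _ (hW.trans hV) (eA γ)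
  dual : ∀ γ δ, ∑ j, o γ j * lev le_rfl (eA δ) (f γ j) = if δ = γ then 1 else 0
  eB : I → msec (BMod O T con') U₀
  bijective : ∀ V (hV : V ≤ U₀), Function.Bijective
    (fun d : 𝒟[O] V => mres (BMod O T con') hV (eB zero) ◂ d)
  faithful : ∀ V (hV : V ≤ U₀) (r : rsec R V),
    B.act V (.op r) (mres (BMod O T con') hV (eB zero)) = 0 → r = 0
  gen : ∀ V (hV : V ≤ U₀) (b : msec (BMod O T con') V), ∀ y ∈ V,
    ∃ (W : Opens X) (hW : W ≤ V) (F : Finset I) (ρ : I → rsec R W), y ∈ W ∧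
      mres (BMod O T con') hW b =
        ∑ α ∈ F, B.act W (.op (ρ α)) (mres (BMod O T con') (hW.trans hV) (eB α))
  M : (I →₀ 𝒟[O] U₀) ≃ₗ[𝒟[O] U₀] (I →₀ 𝒟[O] U₀)
  mul : ∀ (α : I) (V : Opens X) (h : V ≤ U₀) (f : rsec S.ring V) (g : rsec O.ring V),
    ι V f * rev h (eB α) g = ∑ γ ∈ (M (single α 1)).support,
      rev h (eB zero) ((M (single α 1) γ).ev h (lev h (eA γ) f * g))

attribute [instance] Frame.dec

variable {B : RAct R (BMod O T con')} {ι : ∀ U : Opens X, rsec S.ring U →+* rsec T.ring U}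

variable (con B ι) in
/-- Frames exist near every point. -/
def HasFrames : Prop := ∀ x : X, ∃ U₀ : Opens X, x ∈ U₀ ∧ Nonempty (Frame con B ι U₀)

theorem HasFrames.hasEvalBasis (hF : HasFrames con B ι) : HasEvalBasis con := fun x => by
  obtain ⟨U₀, hx, ⟨F⟩⟩ := hF x
  exact ⟨U₀, hx, F.I, F.eA, F.len, F.o, F.f, F.basis⟩

theorem RAct.act_rsm (B : RAct R (BMod O T con')) (r : rsec R U)
    (b : msec (BMod O T con') U) (d : 𝒟[O] U) :
    B.act U (.op r) (b ◂ d) = B.act U (.op r) b ◂ d := map_smul (B.act U (.op r)) _ b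

variable (ι) in
/-- The operator `b'` is `f b`. -/
def IsLmul (f : rsec S.ring U) (b b' : msec (BMod O T con') U) : Prop :=
  ∀ V (h : V ≤ U) (g : rsec O.ring V),
    rev h b' g = ι V (rres S.ring h f) * rev h b g

theorem IsLmul.unique {f : rsec S.ring U} {b b' b'' : msec (BMod O T con') U}
    (h : IsLmul ι f b b') (h' : IsLmul ι f b b'') : b' = b'' :=
  rev_ext fun V hV g => by rw [h, h']

theorem IsLmul.res (hV : V ≤ U) {f : rsec S.ring U}
    {b b' : msec (BMod O T con') U} (h : IsLmul ι f b b') :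
    IsLmul ι (rres S.ring hV f) (mres _ hV b) (mres _ hV b') := fun W hW g => by
  rw [rev_mres, rev_mres, h, rres_rres]

theorem IsLmul.sum {f : rsec S.ring U} {J : Type*} (F : Finset J)
    {b b' : J → msec (BMod O T con') U} (h : ∀ j ∈ F, IsLmul ι f (b j) (b' j)) :
    IsLmul ι f (∑ j ∈ F, b j) (∑ j ∈ F, b' j) := fun V hV g => by
  rw [rev_sum, rev_sum, mul_sum]
  exact sum_congr rfl fun j hj => h j hj V hV g

theorem Frame.isLmul (Fr : Frame con B ι U₀) (α : Fr.I) (hV : V ≤ U₀)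
    (f : rsec S.ring V) : IsLmul ι f (mres _ hV (Fr.eB α))
      (∑ γ ∈ (Fr.M (single α 1)).support, mres _ hV (Fr.eB Fr.zero) ◂
        DSec.res hV (Fr.M (single α 1) γ) ◂
          mulOp O.ring O.selfLin V (lev hV (Fr.eA γ) f)) := fun W hW g => by
  rw [rev_mres, Fr.mul, rev_sum]
  refine sum_congr rfl fun γ _ => ?_
  rw [← rres_lev hV hW]
  rfl

/-- Near a point, `b` is a combination of the `eB α` over `R`, and the formula for `f eB α` shows
that `f b` is again a differential operator, with values that depend on `f` through operators in
`A`. -/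
theorem exists_isLmul_sum (hι : IsLeftMul inc B ι) (hF : HasFrames con B ι)
    (b : msec (BMod O T con') U) {x : X} (hx : x ∈ U) :
    ∃ (V : Opens X) (hV : V ≤ U) (J : Type) (F : Finset J) (a : J → msec (AMod O S con) V)
      (b' : J → msec (BMod O T con') V), x ∈ V ∧ ∀ W (hW : W ≤ V) (f : rsec S.ring W),
      IsLmul ι f (mres _ (hW.trans hV) b)
        (∑ j ∈ F, mres _ hW (b' j) ◂ mulOp O.ring O.selfLin W (lev hW (a j) f)) := by
  obtain ⟨U₀, hxU₀, ⟨Fr⟩⟩ := hF x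
  obtain ⟨V, hV, F, ρ, hxV, e⟩ := Fr.gen (U ⊓ U₀) inf_le_right (mres _ inf_le_left b) x ⟨hx, hxU₀⟩
  have hVU : V ≤ U := hV.trans inf_le_left
  have hVU₀ : V ≤ U₀ := hV.trans inf_le_right
  refine ⟨V, hVU, (_ : Fr.I) × Fr.I, F.sigma fun α => (Fr.M (single α 1)).support,
    fun j => mres _ hVU₀ (Fr.eA j.2), fun j => B.act V (.op (ρ j.1)) (mres _ hVU₀ (Fr.eB Fr.zero) ◂
      DSec.res hVU₀ (Fr.M (single j.1 1) j.2)), hxV, fun W hW f => ?_⟩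
  rw [mres_mres] at e
  rw [← mres_mres _ hVU hW, e, map_sum, Finset.sum_sigma]
  refine .sum F fun α _ => ?_
  rw [B.act_res, mres_mres]
  refine fun W' hW' g => (hι.act W f _ _ _ (Fr.isLmul α (hW.trans hVU₀) f) W' hW' g).symm ▸ ?_
  rw [map_sum]
  congr 1
  refine sum_congr rfl fun γ _ => ?_
  rw [B.act_rsm, B.act_res, mres_rsm, mres_mres]
  rfl

theorem exists_isLmul (hι : IsLeftMul inc B ι) (hF : HasFrames con B ι)
    (f : rsec S.ring U) (b : msec (BMod O T con') U) : ∃ b', IsLmul ι f b b' := by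
  have := msec_exists_of_local' (BMod O T con') (U := U)
    (fun V hV b' => IsLmul ι (rres S.ring hV f) (mres _ hV b) b')
    (fun V W hV hW n hn => by
      have := hn.res hW
      rwa [mres_mres, rres_rres] at this)
    (fun V hV n H W hW g => by
      refine rres_ext fun x hx => ?_
      obtain ⟨W', hW', hxW', e⟩ := H x (hW hx)
      refine ⟨W ⊓ W', inf_le_left, ⟨hx, hxW'⟩, ?_⟩
      have := e (W ⊓ W') inf_le_right (rres _ inf_le_left g)
      rw [rev_mres, rev_mres, rres_rres] at this
      rw [rres_rev, this, map_mul, rres_rev, rev_mres, hι.res, rres_rres, rres_rres])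
    (fun V hV n n' h h' => h.unique h')
    (fun x hx => by
      obtain ⟨V, hV, J, F, a, b', hxV, e⟩ := exists_isLmul_sum hι hF b hx
      exact ⟨V, hV, _, hxV, e V le_rfl (rres _ hV f)⟩)
  obtain ⟨z, hz⟩ := this
  rw [mres_self, rres_self] at hz
  exact ⟨z, hz⟩

/-- Left multiplication of an operator `O → T` by a section `f` of `S`. -/
def lmul (hι : IsLeftMul inc B ι) (hF : HasFrames con B ι) (f : rsec S.ring U) :
    msec (BMod O T con') U →+ msec (BMod O T con') U :=
  AddMonoidHom.mk' (fun b => (exists_isLmul hι hF f b).choose) fun b b' =>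
    (exists_isLmul hι hF f (b + b')).choose_spec.unique fun V h g => by
      rw [rev_add, rev_add, (exists_isLmul hι hF f b).choose_spec V h,
        (exists_isLmul hι hF f b').choose_spec V h, mul_add]

variable (hι : IsLeftMul inc B ι) (hF : HasFrames con B ι)

theorem isLmul_lmul (f : rsec S.ring U) (b : msec (BMod O T con') U) :
    IsLmul ι f b (lmul hι hF f b) := (exists_isLmul hι hF f b).choose_spec

theorem rev_lmul (h : V ≤ U) (f : rsec S.ring U) (b : msec (BMod O T con') U)
    (g : rsec O.ring V) : rev h (lmul hι hF f b) g = ι V (rres S.ring h f) * rev h b g :=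
  isLmul_lmul hι hF f b V h g

theorem mres_lmul (h : V ≤ U) (f : rsec S.ring U) (b : msec (BMod O T con') U) :
    mres _ h (lmul hι hF f b) = lmul hι hF (rres S.ring h f) (mres _ h b) :=
  ((isLmul_lmul hι hF f b).res h).unique (isLmul_lmul hι hF _ _)

theorem lmul_one (b : msec (BMod O T con') U) :
    lmul hι hF (1 : rsec S.ring U) b = b :=
  rev_ext fun V h g => by rw [rev_lmul, map_one, map_one, one_mul]

theorem lmul_mul (f f' : rsec S.ring U) (b : msec (BMod O T con') U) :
    lmul hι hF (f * f') b = lmul hι hF f (lmul hι hF f' b) :=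
  rev_ext fun V h g => by rw [rev_lmul, rev_lmul, rev_lmul, map_mul, map_mul, mul_assoc]

theorem lmul_rsm (f : rsec S.ring U) (b : msec (BMod O T con') U)
    (d : 𝒟[O] U) : lmul hι hF f (b ◂ d) = lmul hι hF f b ◂ d :=
  rev_ext fun V h g => by rw [rev_lmul, rev_rsm, rev_rsm, rev_lmul]

theorem lmul_act (f : rsec S.ring U) (b : msec (BMod O T con') U) (r : rsec R U) :
    lmul hι hF f (B.act U (.op r) b) = B.act U (.op r) (lmul hι hF f b) :=
  (isLmul_lmul hι hF f _).unique (hι.act U f _ _ r (isLmul_lmul hι hF f b))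

variable {P : SheafOfModules.{u} R}

/-- Left multiplication by `f` on `B ⊗ P`. -/
def lmulBal (P : SheafOfModules.{u} R) (f : rsec S.ring U) :
    BalMap B P U (B.tensor.obj P) where
  toFun W hW := (B.pureHom W).comp (lmul hι hF (rres S.ring hW f))
  natural V W hV hW b p := by
    change mres _ hW (B.pure (lmul hι hF (rres S.ring hV f) b) p) =
      B.pure (lmul hι hF (rres S.ring _ f) (mres _ hW b)) (mres P hW p)
    rw [B.mres_pure, mres_lmul, rres_rres]
  bal W hW b r p := by
    change B.pure (lmul hι hF (rres S.ring hW f) (B.act W (.op r) b)) p =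
      B.pure (lmul hι hF (rres S.ring hW f) b) (r • p)
    rw [lmul_act, B.pure_act]

/-- The action of `S` on `B ⊗ P`. -/
def tensorAct (P : SheafOfModules.{u} R) (U : Opens X) (f : rsec S.ring U) :
    msec (B.tensor.obj P) U →+ msec (B.tensor.obj P) U := (lmulBal hι hF P f).lift U le_rfl

theorem tensorAct_pure (f : rsec S.ring U) (b : msec (BMod O T con') U)
    (p : msec P U) : tensorAct hι hF P U f (B.pure b p) = B.pure (lmul hι hF f b) p := by
  refine ((lmulBal hι hF P f).lift_pure U le_rfl b p).trans ?_
  change B.pure (lmul hι hF (rres S.ring le_rfl f) b) p = _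
  rw [rres_self]

theorem mres_tensorAct (h : V ≤ U) (f : rsec S.ring U)
    (z : msec (B.tensor.obj P) U) : mres _ h (tensorAct hι hF P U f z) =
      tensorAct hι hF P V (rres S.ring h f) (mres _ h z) := by
  refine ((lmulBal hι hF P f).mres_lift U V le_rfl h z).trans ?_
  refine B.tensor_hom_ext (U := V)
    (fun W hW => (lmulBal hι hF P f).lift W (hW.trans h))
    (fun W hW => (lmulBal hι hF P (rres S.ring h f)).lift W hW)
    (fun _ _ _ _ _ => BalMap.mres_lift _ _ _ _ _ _) (fun _ _ _ _ _ => BalMap.mres_lift _ _ _ _ _ _)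
    (fun W hW a n => ?_) le_rfl (mres _ h z)
  rw [BalMap.lift_pure, BalMap.lift_pure]
  change B.pure (lmul hι hF (rres S.ring _ f) a) n =
    B.pure (lmul hι hF (rres S.ring _ (rres S.ring h f)) a) n
  rw [rres_rres]

theorem pure_rsm (b : msec (BMod O T con') U) (p : msec P U)
    (d : 𝒟[O] U) : (B.pure b p : msec (B.tensor.obj P) U) ◂ d = B.pure (b ◂ d) p :=
  B.smul_pure _ b p

theorem tensorAct_sum (f : rsec S.ring U) {m : ℕ} (b : Fin m → msec (BMod O T con') U)
    (p : Fin m → msec P U) : tensorAct hι hF P U f (∑ i, B.pure (b i) (p i)) =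
      ∑ i, B.pure (lmul hι hF f (b i)) (p i) := by
  rw [map_sum]
  exact sum_congr rfl fun i _ => tensorAct_pure hι hF f _ _

theorem isDiffAction_tensorAct : IsDiffAction con (tensorAct hι hF P) where
  natural U V h f s := mres_tensorAct hι hF h f s
  one U s := by
    refine msec_ext _ fun x hx => ?_
    obtain ⟨V, hV, m, b, p, hxV, e⟩ := B.exists_sum s hx
    refine ⟨V, hV, hxV, ?_⟩
    rw [mres_tensorAct, e, tensorAct_sum]
    exact sum_congr rfl fun i _ => by rw [map_one, lmul_one]
  mul U f g s := by
    refine msec_ext _ fun x hx => ?_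
    obtain ⟨V, hV, m, b, p, hxV, e⟩ := B.exists_sum s hx
    refine ⟨V, hV, hxV, ?_⟩
    rw [mres_tensorAct, mres_tensorAct, mres_tensorAct, e, tensorAct_sum, tensorAct_sum,
      tensorAct_sum]
    exact sum_congr rfl fun i _ => by rw [map_mul, lmul_mul]
  linear U f s d := by
    refine msec_ext _ fun x hx => ?_
    obtain ⟨V, hV, m, b, p, hxV, e⟩ := B.exists_sum s hx
    refine ⟨V, hV, hxV, ?_⟩
    rw [mres_tensorAct, mres_rsm, mres_rsm, mres_tensorAct, e, tensorAct_sum, sum_rsm, sum_rsm]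
    simp only [pure_rsm]
    rw [tensorAct_sum]
    exact sum_congr rfl fun i _ => by rw [lmul_rsm]
  exists_sum U s x hx := by
    obtain ⟨V, hV, m, b, p, hxV, e⟩ := B.exists_sum s hx
    choose W hW J F a b' hxW e' using fun i => exists_isLmul_sum hι hF (b i) hxV
    obtain ⟨W', hxW', hW'⟩ := exists_common_nhd W hxW
    have hl : ∀ i, W' ⊓ V ≤ W i := fun i => inf_le_left.trans (hW' i)
    let J' : Finset ((i : Fin m) × J i) := Finset.univ.sigma F
    let σ := J'.equivFin.symm
    refine ⟨W' ⊓ V, inf_le_right.trans hV, J'.card, fun k => mres _ (hl _) (a _ (σ k).1.2),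
      fun k => B.pure (mres _ (hl _) (b' _ (σ k).1.2)) (mres P inf_le_right (p (σ k).1.1)),
      ⟨hxW', hxV⟩, fun V' hV' f => ?_⟩
    rw [← mres_mres _ hV (hV'.trans inf_le_right), e, map_sum]
    simp only [B.mres_pure]
    rw [tensorAct_sum, σ.sum_comp fun k : J' => B.pure (mres _ hV' (mres _ (hl _) (b' _ k.1.2)))
      (mres P hV' (mres P inf_le_right (p k.1.1))) ◂
        mulOp O.ring O.selfLin V' (lev hV' (mres _ (hl _) (a _ k.1.2)) f),
      Finset.sum_coe_sort J' fun k => B.pure (mres _ hV' (mres _ (hl _) (b' _ k.2)))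
      (mres P hV' (mres P inf_le_right (p k.1))) ◂
        mulOp O.ring O.selfLin V' (lev hV' (mres _ (hl _) (a _ k.2)) f), Finset.sum_sigma]
    refine sum_congr rfl fun i _ => ?_
    have := e' i V' (hV'.trans (hl i)) f
    rw [(isLmul_lmul hι hF f _).unique this]
    change B.pureHom V' _ _ = _
    rw [map_sum, AddMonoidHom.finsetSum_apply]
    refine sum_congr rfl fun j _ => ?_
    rw [pure_rsm, mres_mres, mres_mres]
    rfl

/-- A coaction on `B ⊗ P` is the natural one iff the corresponding action of `S` is
`f (b ⊗ p) = f b ⊗ p`. -/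
theorem isStdCoaction_iff {C : CoalgStr (leftDiff O S con)} {side : Side}
    {δ : Coaction C side (B.tensor.obj P)} : IsStdCoaction inc B δ ↔
      ∀ (U : Opens X) (f : rsec S.ring U) (z : msec (B.tensor.obj P) U),
        coactAct δ.coact U f z = tensorAct hι hF P U f z := by
  constructor
  · intro h U f z
    refine msec_ext _ fun x hx => ?_
    obtain ⟨V, hV, m, b, p, hxV, e⟩ := B.exists_sum z hx
    choose W hW J F a b' hxW e' using fun i => exists_isLmul_sum hι hF (b i) hxV
    obtain ⟨W', hxW', hW'⟩ := exists_common_nhd W hxW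
    have hl : ∀ i, W' ⊓ V ≤ W i := fun i => inf_le_left.trans (hW' i)
    refine ⟨W' ⊓ V, inf_le_right.trans hV, ⟨hxW', hxV⟩, ?_⟩
    rw [mres_coactAct, mres_tensorAct, ← mres_mres _ hV inf_le_right, e, map_sum, map_sum, map_sum]
    refine sum_congr rfl fun i _ => ?_
    rw [B.mres_pure, tensorAct_pure]
    generalize rres S.ring _ f = f
    let σ := (F i).equivFin.symm
    have key := h (W' ⊓ V) (mres _ inf_le_right (b i)) (F i).card
      (fun k => mres _ (hl i) (a i (σ k))) (fun k => mres _ (hl i) (b' i (σ k)))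
      (fun V' hV' f t g hft => by
        rw [(hι.rel_iff _ _ _).1 hft]
        have h₁ := e' i V' (hV'.trans (hl i)) f V' le_rfl g
        rw [rres_self, rev_sum] at h₁
        rw [rev_mres]
        refine Eq.trans ?_ h₁
        refine (σ.sum_comp fun j : F i => rev hV' (mres _ (hl i) (b' i j))
          (lev hV' (mres _ (hl i) (a i j)) f * g)).trans ?_
        refine (Finset.sum_coe_sort (F i) fun j => rev hV' (mres _ (hl i) (b' i j))
          (lev hV' (mres _ (hl i) (a i j)) f * g)).trans ?_
        refine sum_congr rfl fun j _ => ?_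
        have : (mulOp O.ring O.selfLin V' (lev (hV'.trans (hl i)) (a i j) f)).ev le_rfl g =
          rres O.ring le_rfl (lev (hV'.trans (hl i)) (a i j) f) * g := rfl
        rw [rev_rsm, this, rres_self]
        rfl) (mres P inf_le_right (p i))
    have h₂ := e' i (W' ⊓ V) (hl i) f
    rw [coactAct_of_sum_self key, (isLmul_lmul hι hF f _).unique h₂, map_sum]
    change _ = B.pureHom _ _ _
    rw [map_sum, AddMonoidHom.finsetSum_apply]
    refine (σ.sum_comp fun j : F i => (toR _).symm (lev le_rfl (mres _ (hl i) (a i j)) f •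
      toR _ (B.pure (mres _ (hl i) (b' i j)) (mres P inf_le_right (p i))))).trans ?_
    refine (Finset.sum_coe_sort (F i) fun j => (toR _).symm (lev le_rfl (mres _ (hl i) (a i j)) f •
      toR _ (B.pure (mres _ (hl i) (b' i j)) (mres P inf_le_right (p i))))).trans ?_
    refine sum_congr rfl fun j _ => ?_
    rw [toR_symm_smul]
    exact pure_rsm _ _ _
  · intro h U b m a b' e p
    refine hF.hasEvalBasis.ev_ext fun V hV f => ?_
    have h₁ := h V f (mres _ hV (B.pure b p))
    rw [mres_app]
    refine (congrArg (toR (B.tensor.obj P)) h₁).trans ?_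
    rw [B.mres_pure, tensorAct_pure, mres_sum_tmul, ev_sum_tmul]
    have h₂ : lmul hι hF f (mres _ hV b) =
        ∑ i, mres _ hV (b' i) ◂ mulOp O.ring O.selfLin V (lev hV (a i) f) := by
      refine rev_ext fun W hW g => ?_
      rw [rev_lmul, rev_mres, ← e W (hW.trans hV) (rres _ hW f) _ g ((hι.rel_iff _ _ _).2 rfl),
        rev_sum]
      refine sum_congr rfl fun i _ => ?_
      rw [← rres_lev hV hW]
      rfl
    rw [h₂]
    change toR _ (B.pureHom V _ _) = _
    rw [map_sum, AddMonoidHom.finsetSum_apply, map_sum]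
    refine sum_congr rfl fun i _ => ?_
    change toR _ (B.pure _ _) = _ • toR _ (mres _ hV (B.pure (b' i) p))
    rw [smul_toR, B.mres_pure, pure_rsm]
    rfl

/-- The natural coaction on `B ⊗ P` comes from the action of `S` by left multiplication on `B`. -/
theorem existsUnique_stdCoaction (hι : IsLeftMul inc B ι) (hF : HasFrames con B ι)
    {C : CoalgStr (leftDiff O S con)} (hC : IsStdCoalg C) {side : Side}
    (hside : side = .right ∨ ∀ (U : Opens X) (f g : rsec S.ring U), f * g = g * f) :
    ∃! δ : Coaction C side (B.tensor.obj P), IsStdCoaction inc B δ := by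
  refine ⟨coactionOfAction hF.hasEvalBasis (isDiffAction_tensorAct hι hF) hC hside,
    (isStdCoaction_iff hι hF).2 fun U f z => coactAct_coactHom _ _ f z, fun δ hδ => ?_⟩
  refine coact_ext hF.hasEvalBasis fun U f z => ?_
  rw [(isStdCoaction_iff hι hF).1 hδ]
  exact (coactAct_coactHom _ _ f z).symm

end Frame

/-! ### Independence and generation -/

theorem map_linearMap_eq_sum {I D D' : Type*} [Ring D] [Ring D'] (ρ : D →+* D') (L : (I →₀ D) →+ D')
    (hL : ∀ d v, L (d • v) = ρ d * L v) (M : (I →₀ D) →ₗ[D] (I →₀ D)) (v : I →₀ D) :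
    L (M v) = v.sum fun α d => ρ d * L (M (single α 1)) := by
  classical
  induction v using Finsupp.induction_linear with
  | zero => simp
  | add v w hv hw =>
    rw [map_add, map_add, hv, hw, Finsupp.sum_add_index'] <;> simp [add_mul]
  | single α d =>
    rw [Finsupp.sum_single_index (by simp), ← hL, ← map_smul, Finsupp.smul_single_one]

section FrameCalc
variable [CommSheaf O.ring] {con : Corr S.ring O.ring} {con' : Corr O.ring T.ring}
  {inc : Corr S.ring T.ring} {R : RSh X} {B : RAct R (BMod O T con')}
  {ι : ∀ U : Opens X, rsec S.ring U →+* rsec T.ring U} (Fr : Frame con B ι U₀) (hV : V ≤ U₀)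

/-- The operator `d` with `b = eB zero ∘ d`. -/
def Frame.div : msec (BMod O T con') V →+ 𝒟[O] V :=
  (AddEquiv.ofBijective (AddMonoidHom.mk' (fun d : 𝒟[O] V =>
    mres (BMod O T con') hV (Fr.eB Fr.zero) ◂ d) (rsm_add _)) (Fr.bijective V
      hV)).symm.toAddMonoidHom

theorem Frame.rsm_div (b : msec (BMod O T con') V) :
    mres (BMod O T con') hV (Fr.eB Fr.zero) ◂ Fr.div hV b = b :=
  (AddEquiv.ofBijective (AddMonoidHom.mk' (fun d : 𝒟[O] V =>
    mres (BMod O T con') hV (Fr.eB Fr.zero) ◂ d) (rsm_add _)) (Fr.bijective V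
      hV)).apply_symm_apply b

theorem Frame.div_eq {b : msec (BMod O T con') V} {d : 𝒟[O] V}
    (h : mres (BMod O T con') hV (Fr.eB Fr.zero) ◂ d = b) : Fr.div hV b = d :=
  (Fr.bijective V hV).1 ((Fr.rsm_div hV b).trans h.symm)

theorem Frame.div_rsm (b : msec (BMod O T con') V) (d : 𝒟[O] V) :
    Fr.div hV (b ◂ d) = Fr.div hV b * d :=
  Fr.div_eq hV (by rw [rsm_mul, rsm_div])

theorem Frame.res_div (hW : W ≤ V) (b : msec (BMod O T con') V) :
    DSec.res hW (Fr.div hV b) = Fr.div (hW.trans hV) (mres _ hW b) :=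
  (Fr.div_eq _ (by rw [← mres_mres _ hV hW, ← mres_rsm, rsm_div])).symm

variable (hι : IsLeftMul inc B ι) (hF : HasFrames con B ι)

/-- The operator `d` with `f ∘ eB α = eB zero ∘ d`. -/
def Frame.q (α : Fr.I) (f : rsec S.ring V) : 𝒟[O] V :=
  Fr.div hV (lmul hι hF f (mres _ hV (Fr.eB α)))

/-- The function `eA γ (f)` as an operator. -/
def Frame.e (γ : Fr.I) (f : rsec S.ring V) : 𝒟[O] V :=
  mulOp O.ring O.selfLin V (lev hV (Fr.eA γ) f)

theorem Frame.q_mul (α : Fr.I) (f g : rsec S.ring V) :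
    Fr.q hV hι hF α (f * g) = Fr.q hV hι hF Fr.zero f * Fr.q hV hι hF α g := by
  unfold q
  rw [lmul_mul, ← Fr.div_rsm, ← lmul_rsm, rsm_div]

/-- The linear combination of the operators `eA γ (f)` with coefficients in `D`. -/
def Frame.comb (f : rsec S.ring V) : (Fr.I →₀ 𝒟[O] U₀) →+ 𝒟[O] V :=
  Finsupp.liftAddHom fun γ => (AddMonoidHom.mulRight (Fr.e hV γ f)).comp
    (DSec.res hV : 𝒟[O] U₀ →+* 𝒟[O] V).toAddMonoidHom

theorem Frame.comb_apply (f : rsec S.ring V) (v : Fr.I →₀ 𝒟[O] U₀) :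
    Fr.comb hV f v = ∑ γ ∈ v.support, DSec.res hV (v γ) * Fr.e hV γ f := rfl

theorem Frame.comb_smul (f : rsec S.ring V) (d : 𝒟[O] U₀)
    (v : Fr.I →₀ 𝒟[O] U₀) :
    Fr.comb hV f (d • v) = DSec.res hV d * Fr.comb hV f v := by
  induction v using Finsupp.induction_linear with
  | zero => simp
  | add v w hv hw => rw [smul_add, map_add, map_add, hv, hw, mul_add]
  | single α x =>
    rw [Finsupp.smul_single, comb, Finsupp.liftAddHom_apply_single, Finsupp.liftAddHom_apply_single]
    exact (congrArg (· * _) (map_mul (DSec.res hV) d x)).trans (mul_assoc _ _ _)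

theorem Frame.q_eq (α : Fr.I) (f : rsec S.ring V) :
    Fr.q hV hι hF α f = Fr.comb hV f (Fr.M (single α 1)) := by
  refine Fr.div_eq hV ((isLmul_lmul hι hF f _).unique ?_).symm
  have := Fr.isLmul α hV f
  rw [comb_apply, rsm_sum]
  simpa only [rsm_mul, e] using this

theorem Frame.e_eq (γ : Fr.I) (f : rsec S.ring V) : Fr.e hV γ f =
    (Fr.M.symm (single γ 1)).sum fun α d => DSec.res hV d * Fr.q hV hι hF α f := by
  have := map_linearMap_eq_sum (DSec.res hV) (Fr.comb hV f) (Fr.comb_smul hV f) Fr.M.toLinearMap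
    (Fr.M.symm (single γ 1))
  simp only [LinearEquiv.coe_coe, ← Fr.q_eq hV hι hF] at this
  rw [← this, LinearEquiv.apply_symm_apply, comb, Finsupp.liftAddHom_apply_single]
  change _ = DSec.res hV 1 * _
  rw [map_one, one_mul]

variable {G : SheafOfModules.{u} (opSheaf O.D)}

/-- The maps `f ↦ f eB α` are linearly independent over every right `D`-module: first the dual basis
of `eA` isolates the coefficients of `eA γ (f)`, and then the matrix `M` is inverted. -/
theorem Frame.eq_zero_of_sum_q (F : Finset Fr.I) (t : Fr.I → msec G V)
    (h : ∀ f : rsec S.ring V, ∑ α ∈ F, t α ◂ Fr.q hV hι hF α f = 0) {β : Fr.I} (hβ : β ∈ F) :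
    t β = 0 := by
  -- The sections `o γ j` and `f γ j` pick the coefficient of `eA γ (f)`.
  have h₁ : ∀ γ : Fr.I, ∑ α ∈ F, t α ◂ DSec.res hV (Fr.M (single α 1) γ) = 0 := by
    intro γ
    have key : ∀ α, ∑ j, Fr.q hV hι hF α (rres S.ring hV (Fr.f γ j)) *
        mulOp O.ring O.selfLin V (rres O.ring hV (Fr.o γ j)) =
          DSec.res hV (Fr.M (single α 1) γ) := by
      intro α
      simp_rw [Fr.q_eq hV hι hF, Fr.comb_apply, sum_mul]
      rw [Finset.sum_comm]
      have : ∀ δ : Fr.I, ∑ j, Fr.e hV δ (rres S.ring hV (Fr.f γ j)) *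
          mulOp O.ring O.selfLin V (rres O.ring hV (Fr.o γ j)) = if δ = γ then 1 else 0 := by
        intro δ
        have hd := congrArg (fun o => mulOp O.ring O.selfLin V (rres O.ring hV o)) (Fr.dual γ δ)
        simp only [map_sum, map_mul, rres_lev le_rfl hV] at hd
        refine Eq.trans (sum_congr rfl fun j _ => ?_) (hd.trans ?_)
        · rw [e, ← map_mul, ← map_mul, mul_comm]
        · split_ifs <;> simp
      simp_rw [mul_assoc, ← mul_sum, this, mul_ite, mul_one, mul_zero,
        Finset.sum_ite_eq']
      split_ifs with hs
      · rfl
      · rw [Finsupp.notMem_support_iff.1 hs, map_zero]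
    have := congrArg (fun F : Fin (Fr.len γ) → msec G V => ∑ j, F j)
      (funext fun j => congrArg (· ◂ mulOp O.ring O.selfLin V (rres O.ring hV (Fr.o γ j)))
        (h (rres S.ring hV (Fr.f γ j))))
    simp only [sum_rsm, zero_rsm, Finset.sum_const_zero, ← rsm_mul] at this
    rw [Finset.sum_comm] at this
    simpa only [← rsm_sum, key] using this
  -- Multiplication by the inverse matrix separates the `t α`.
  let Γ := F.biUnion fun α => (Fr.M (single α 1)).support
  have h₂ : ∀ α ∈ F, ∑ γ ∈ Γ, DSec.res hV (Fr.M (single α 1) γ) *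
      DSec.res hV (Fr.M.symm (single γ 1) β) = if α = β then 1 else 0 := by
    intro α hα
    have := map_linearMap_eq_sum (DSec.res hV)
      ((DSec.res hV : 𝒟[O] U₀ →+* 𝒟[O] V).toAddMonoidHom.comp
        (Finsupp.applyAddHom β)) (fun d v => map_mul (DSec.res hV) d (v β)) Fr.M.symm.toLinearMap
      (Fr.M (single α 1))
    rw [Finsupp.sum_of_support_subset _
      (Finset.subset_biUnion_of_mem (fun α => (Fr.M (single α 1)).support) hα) _
      (fun _ _ => by rw [map_zero, zero_mul])] at this
    refine this.symm.trans ?_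
    change DSec.res hV (Fr.M.symm (Fr.M (single α 1)) β) = _
    rw [LinearEquiv.symm_apply_apply, Finsupp.single_apply]
    split_ifs <;> simp
  calc t β = ∑ α ∈ F, t α ◂ (if α = β then (1 : 𝒟[O] V) else 0) := by
        rw [Finset.sum_eq_single β]
        · rw [if_pos rfl, rsm_one]
        · intro α _ hα; rw [if_neg hα, rsm_zero]
        · exact fun h => absurd hβ h
    _ = ∑ γ ∈ Γ, (∑ α ∈ F, t α ◂ DSec.res hV (Fr.M (single α 1) γ)) ◂
          DSec.res hV (Fr.M.symm (single γ 1) β) := by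
        simp_rw [sum_rsm]
        rw [Finset.sum_comm]
        refine sum_congr rfl fun α hα => ?_
        rw [← h₂ α hα, rsm_sum]
        simp_rw [rsm_mul]
    _ = 0 := Finset.sum_eq_zero fun γ _ => by rw [h₁, zero_rsm]

/-- For an action of `S` by differential operators, `f ↦ f s` is locally a combination of the maps
`f ↦ f eB α`. -/
theorem Frame.exists_sum_q {act : ∀ U : Opens X, rsec S.ring U → msec G U →+ msec G U}
    (ha : IsDiffAction con act) (s : msec G U) {x : X} (hx : x ∈ U) (hx₀ : x ∈ U₀) :
    ∃ (V : Opens X) (hV : V ≤ U) (hV₀ : V ≤ U₀) (F : Finset Fr.I) (t : Fr.I → msec G V), x ∈ V ∧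
      ∀ W (hW : W ≤ V) (f : rsec S.ring W), act W f (mres G (hW.trans hV) s) =
        ∑ α ∈ F, mres G hW (t α) ◂ Fr.q (hW.trans hV₀) hι hF α f := by
  obtain ⟨V₁, hV₁, m, a, g, hxV₁, e⟩ := ha.exists_sum U s x hx
  choose W₁ hW₁ F₁ hxW₁ e₁ using fun i => Fr.basis (V₁ ⊓ U₀) inf_le_right
    (mres _ inf_le_left (a i)) x ⟨hxV₁, hx₀⟩
  obtain ⟨V', hxV', hV'⟩ := exists_common_nhd W₁ hxW₁
  let V := V' ⊓ (V₁ ⊓ U₀)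
  have hVW : ∀ i, V ≤ W₁ i := fun i => inf_le_left.trans (hV' i)
  have hVV₁ : V ≤ V₁ := inf_le_right.trans inf_le_left
  have hV₀ : V ≤ U₀ := inf_le_right.trans inf_le_right
  let F₂ := Finset.univ.biUnion F₁
  let c : Fin m → Fr.I → rsec O.ring V := fun i γ => rres O.ring (hVW i)
    (∑ j, rres O.ring ((hW₁ i).trans inf_le_right) (Fr.o γ j) *
        lev (hW₁ i) (mres _ inf_le_left (a i))
          (rres S.ring ((hW₁ i).trans inf_le_right) (Fr.f γ j)))
  have hc : ∀ i, mres _ hVV₁ (a i) = ∑ γ ∈ F₂, c i γ • mres _ hV₀ (Fr.eA γ) := by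
    intro i
    have := congrArg (mres _ (hVW i))
      (e₁ i F₂ (Finset.subset_biUnion_of_mem F₁ (Finset.mem_univ i)))
    rw [mres_mres, mres_mres] at this
    rw [this, map_sum]
    refine sum_congr rfl fun γ _ => ?_
    rw [mres_smul, mres_mres]
  let h : Fr.I → msec G V := fun γ => ∑ i, mres G hVV₁ (g i) ◂ mulOp O.ring O.selfLin V (c i γ)
  let n : Fr.I → Fr.I →₀ 𝒟[O] U₀ := fun γ => Fr.M.symm (single γ 1)
  let F := F₂.biUnion fun γ => (n γ).support
  refine ⟨V, hVV₁.trans hV₁, hV₀, F, fun α => ∑ γ ∈ F₂, h γ ◂ DSec.res hV₀ (n γ α),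
    ⟨hxV', hxV₁, hx₀⟩, fun W hW f => ?_⟩
  rw [e W (hW.trans hVV₁) f]
  have h₁ : ∀ i, mulOp O.ring O.selfLin W (lev (hW.trans hVV₁) (a i) f) =
      ∑ γ ∈ F₂, mulOp O.ring O.selfLin W (rres _ hW (c i γ)) * Fr.e (hW.trans hV₀) γ f := by
    intro i
    rw [← lev_mres hVV₁ hW, hc, lev_sum, map_sum]
    refine sum_congr rfl fun γ _ => ?_
    rw [lev_smul, map_mul, lev_mres]
    rfl
  have h₂ : ∀ γ ∈ F₂, Fr.e (hW.trans hV₀) γ f =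
      ∑ α ∈ F, DSec.res (hW.trans hV₀) (n γ α) * Fr.q (hW.trans hV₀) hι hF α f := by
    intro γ hγ
    rw [Fr.e_eq _ hι hF, Finsupp.sum_of_support_subset _
      (Finset.subset_biUnion_of_mem (fun γ => (n γ).support) hγ) _
      (fun _ _ => by rw [map_zero, zero_mul])]
  simp_rw [h₁, rsm_sum, rsm_mul]
  rw [Finset.sum_comm]
  calc _ = ∑ γ ∈ F₂, mres G hW (h γ) ◂ Fr.e (hW.trans hV₀) γ f := by
        refine sum_congr rfl fun γ _ => ?_
        rw [map_sum, sum_rsm]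
        refine sum_congr rfl fun i _ => ?_
        rw [mres_rsm, mres_mres, mulOp_res]
    _ = ∑ γ ∈ F₂, ∑ α ∈ F, mres G hW (h γ) ◂ DSec.res (hW.trans hV₀) (n γ α) ◂
          Fr.q (hW.trans hV₀) hι hF α f := by
        refine sum_congr rfl fun γ hγ => ?_
        rw [h₂ γ hγ, rsm_sum]
        simp_rw [rsm_mul]
    _ = _ := by
        rw [Finset.sum_comm]
        refine sum_congr rfl fun α _ => ?_
        rw [map_sum, sum_rsm]
        refine sum_congr rfl fun γ _ => ?_
        rw [mres_rsm]
        rfl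

end FrameCalc

/-! ### Coefficients in `R` -/

section Coef
variable [CommSheaf O.ring] {con : Corr S.ring O.ring} {con' : Corr O.ring T.ring}
  {inc : Corr S.ring T.ring} {R : RSh X} {B : RAct R (BMod O T con')}
  {ι : ∀ U : Opens X, rsec S.ring U →+* rsec T.ring U} (Fr : Frame con B ι U₀) (hV : V ≤ U₀)
  (hι : IsLeftMul inc B ι) (hF : HasFrames con B ι)

/-- The action of a section of `R` on a section of `B` as an additive map in the former. -/
def RAct.actHom (B : RAct R (BMod O T con')) (b : msec (BMod O T con') V) :
    rsec R V →+ msec (BMod O T con') V :=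
  AddMonoidHom.mk' (fun r => B.act V (.op r) b) fun r r' =>
    LinearMap.congr_fun (map_add (B.act V) (.op r) (.op r')) b

/-- The combination of the generators `eB α` with coefficients in `R`. -/
def Frame.gensum : (Fr.I →₀ rsec R V) →+ msec (BMod O T con') V :=
  Finsupp.liftAddHom fun α => B.actHom (mres _ hV (Fr.eB α))

theorem Frame.gensum_apply (ρ : Fr.I →₀ rsec R V) :
    Fr.gensum hV ρ = ∑ α ∈ ρ.support, B.act V (.op (ρ α)) (mres _ hV (Fr.eB α)) := rfl

theorem Frame.gensum_single (α : Fr.I) (r : rsec R V) :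
    Fr.gensum hV (single α r) = B.act V (.op r) (mres _ hV (Fr.eB α)) :=
  Finsupp.liftAddHom_apply_single _ _ _

theorem Frame.mres_gensum (hW : W ≤ V) (ρ : Fr.I →₀ rsec R V) :
    mres _ hW (Fr.gensum hV ρ) =
      Fr.gensum (hW.trans hV) (Finsupp.mapRange.addMonoidHom (rres R hW).toAddMonoidHom ρ) := by
  induction ρ using Finsupp.induction_linear with
  | zero => simp
  | add v w hv hw => simp only [map_add, hv, hw]
  | single α r =>
    rw [gensum_single, B.act_res, mres_mres, Finsupp.mapRange.addMonoidHom_apply,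
      Finsupp.mapRange_single, gensum_single]
    rfl

theorem Frame.act_gensum (r : rsec R V) (ρ : Fr.I →₀ rsec R V) :
    B.act V (.op r) (Fr.gensum hV ρ) =
      Fr.gensum hV (Finsupp.mapRange.addMonoidHom (AddMonoidHom.mulRight r) ρ) := by
  induction ρ using Finsupp.induction_linear with
  | zero => simp
  | add v w hv hw => simp only [map_add, hv, hw]
  | single α x =>
    rw [gensum_single, Finsupp.mapRange.addMonoidHom_apply, Finsupp.mapRange_single, gensum_single]
    exact (LinearMap.congr_fun (map_mul (B.act V) (.op r) (.op x)) _).symm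

include hι hF in
/-- The generators `eB α` are linearly independent over `R`. -/
theorem Frame.eq_zero_of_gensum {ρ : Fr.I →₀ rsec R V} (h : Fr.gensum hV ρ = 0) : ρ = 0 := by
  refine Finsupp.support_eq_empty.1 (Finset.eq_empty_of_forall_notMem fun β hβ => ?_)
  refine Finsupp.mem_support_iff.1 hβ (Fr.faithful V hV _ ?_)
  refine Fr.eq_zero_of_sum_q hV hι hF ρ.support
    (fun α => B.act V (.op (ρ α)) (mres _ hV (Fr.eB Fr.zero))) (fun f => ?_) hβ
  have := congrArg (lmul hι hF f) h
  rw [gensum_apply, map_sum, map_zero] at this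
  rw [← this]
  refine sum_congr rfl fun α _ => ?_
  rw [← B.act_rsm, q, rsm_div, lmul_act]

theorem Frame.exists_gensum (b : msec (BMod O T con') V) {y : X} (hy : y ∈ V) :
    ∃ (W : Opens X) (hW : W ≤ V) (ρ : Fr.I →₀ rsec R W), y ∈ W ∧
      mres _ hW b = Fr.gensum (hW.trans hV) ρ := by
  obtain ⟨W, hW, F, ρ, hy, e⟩ := Fr.gen V hV b y hy
  refine ⟨W, hW, ∑ α ∈ F, single α (ρ α), hy, ?_⟩
  rw [e, map_sum]
  exact sum_congr rfl fun α _ => (Fr.gensum_single _ α (ρ α)).symm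

/-- `r` is the coefficient of `eB zero` in `b`. -/
def Frame.IsCoef (b : msec (BMod O T con') V) (r : rsec R V) : Prop :=
  ∀ y ∈ V, ∃ (W : Opens X) (hW : W ≤ V) (ρ : Fr.I →₀ rsec R W), y ∈ W ∧
    mres _ hW b = Fr.gensum (hW.trans hV) ρ ∧ ρ Fr.zero = rres R hW r

variable {Fr hV}

theorem Frame.IsCoef.res (hW : W ≤ V) {b : msec (BMod O T con') V} {r : rsec R V}
    (h : Fr.IsCoef hV b r) : Fr.IsCoef (hW.trans hV) (mres _ hW b) (rres R hW r) := fun y hy => by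
  obtain ⟨W', hW', ρ, hyW, e, e'⟩ := h y (hW hy)
  refine ⟨W ⊓ W', inf_le_left, Finsupp.mapRange.addMonoidHom (rres R inf_le_right).toAddMonoidHom ρ,
    ⟨hy, hyW⟩, ?_, ?_⟩
  · rw [mres_mres, ← mres_mres _ hW' inf_le_right, e, mres_gensum]
  · rw [rres_rres, ← rres_rres R hW' inf_le_right, ← e']; rfl

include hι hF in
theorem Frame.IsCoef.unique {b : msec (BMod O T con') V} {r r' : rsec R V}
    (h : Fr.IsCoef hV b r) (h' : Fr.IsCoef hV b r') : r = r' := by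
  refine rres_ext fun y hy => ?_
  obtain ⟨W, hW, ρ, hyW, e₁, e₂⟩ := h y hy
  obtain ⟨W', hW', ρ', hyW', e₁', e₂'⟩ := h' y hy
  refine ⟨W ⊓ W', inf_le_left.trans hW, ⟨hyW, hyW'⟩, ?_⟩
  have h₁ := congrArg (mres _ (inf_le_left : W ⊓ W' ≤ W)) e₁
  have h₂ := congrArg (mres _ (inf_le_right : W ⊓ W' ≤ W')) e₁'
  rw [mres_gensum, mres_mres] at h₁ h₂
  have h₃ := Fr.eq_zero_of_gensum ((inf_le_left.trans hW).trans hV) hι hF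
    ((map_sub _ _ _).trans (sub_eq_zero.2 (h₁.symm.trans h₂)))
  have h₄ := DFunLike.congr_fun (sub_eq_zero.1 h₃) Fr.zero
  rw [← rres_rres R hW inf_le_left, ← rres_rres R hW' inf_le_right, ← e₂, ← e₂']
  exact h₄

theorem Frame.IsCoef.add {b b' : msec (BMod O T con') V} {r r' : rsec R V}
    (h : Fr.IsCoef hV b r) (h' : Fr.IsCoef hV b' r') : Fr.IsCoef hV (b + b') (r + r') :=
    fun y hy => by
  obtain ⟨W, hW, ρ, hyW, e₁, e₂⟩ := h y hy
  obtain ⟨W', hW', ρ', hyW', e₁', e₂'⟩ := h' y hy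
  refine ⟨W ⊓ W', inf_le_left.trans hW,
    Finsupp.mapRange.addMonoidHom (rres R inf_le_left).toAddMonoidHom ρ +
      Finsupp.mapRange.addMonoidHom (rres R inf_le_right).toAddMonoidHom ρ', ⟨hyW, hyW'⟩, ?_, ?_⟩
  · rw [map_add, map_add, ← mres_gensum (hV := hW.trans hV), ← mres_gensum (hV := hW'.trans hV),
      ← e₁, ← e₁', mres_mres, mres_mres]
  · rw [map_add, ← rres_rres R hW inf_le_left r, ← rres_rres R hW' inf_le_right r', ← e₂, ← e₂']
    rfl

theorem Frame.IsCoef.act {b : msec (BMod O T con') V} {r : rsec R V} (h : Fr.IsCoef hV b r)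
    (r' : rsec R V) : Fr.IsCoef hV (B.act V (.op r') b) (r * r') := fun y hy => by
  obtain ⟨W, hW, ρ, hyW, e₁, e₂⟩ := h y hy
  refine ⟨W, hW, Finsupp.mapRange.addMonoidHom (AddMonoidHom.mulRight (rres R hW r')) ρ,
    hyW, ?_, ?_⟩
  · rw [B.act_res, e₁, act_gensum]
  · rw [map_mul, ← e₂]; rfl

theorem Frame.isCoef_zero : Fr.IsCoef hV (mres _ hV (Fr.eB Fr.zero)) 1 := fun y hy =>
  ⟨V, le_rfl, single Fr.zero 1, hy, by
    rw [gensum_single, mres_self]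
    exact (LinearMap.congr_fun (map_one (B.act V)) _).symm, by
    rw [Finsupp.single_eq_same, map_one]⟩

include hι hF in
theorem Frame.exists_isCoef (b : msec (BMod O T con') V) : ∃ r, Fr.IsCoef hV b r := by
  have := msec_exists_of_local' (unitMod R) (U := V)
    (fun W hW r => Fr.IsCoef (hW.trans hV) (mres _ hW b) (show rsec R W from r))
    (fun W W' hW hW' r h => by
      have := h.res hW'
      rwa [mres_mres] at this)
    (fun W hW r h y hy => by
      obtain ⟨W', hW', hyW', h⟩ := h y hy
      obtain ⟨W'', hW'', ρ, hyW'', e₁, e₂⟩ := h y hyW'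
      refine ⟨W'', hW''.trans hW', ρ, hyW'', ?_, ?_⟩
      · rw [mres_mres] at e₁
        rw [mres_mres, e₁]
      · exact e₂.trans (rres_rres R hW' hW'' r))
    (fun W hW r r' h h' => h.unique hι hF h')
    (fun y hy => by
      obtain ⟨W, hW, ρ, hyW, e⟩ := Fr.exists_gensum hV b hy
      refine ⟨W, hW, ρ Fr.zero, hyW, fun z hz => ⟨W, le_rfl, ρ, hz, ?_, ?_⟩⟩
      · rw [mres_self, e]
      · exact (rres_self R _ _).symm)
  obtain ⟨r, hr⟩ := this
  rw [mres_self] at hr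
  exact ⟨r, hr⟩

variable (Fr hV)

/-- The coefficient of `eB zero`. -/
def Frame.coef : msec (BMod O T con') V →+ rsec R V :=
  AddMonoidHom.mk' (fun b => (Fr.exists_isCoef (hV := hV) hι hF b).choose) fun b b' =>
    (Fr.exists_isCoef (hV := hV) hι hF (b + b')).choose_spec.unique hι hF
      ((Fr.exists_isCoef hι hF b).choose_spec.add (Fr.exists_isCoef hι hF b').choose_spec)

theorem Frame.coef_spec (b : msec (BMod O T con') V) : Fr.IsCoef hV b (Fr.coef hV hι hF b) :=
  (Fr.exists_isCoef hι hF b).choose_spec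

variable {P P' : SheafOfModules.{u} R}

/-- The contraction `b ⊗ p ↦ c p`, where `c` is the coefficient of `eB zero` in `b`. -/
def Frame.coefBal (P : SheafOfModules.{u} R) : BalMap B P U₀ P where
  toFun W hW := AddMonoidHom.mk' (fun b => DistribSMul.toAddMonoidHom (msec P W)
      (Fr.coef hW hι hF b)) fun b b' => AddMonoidHom.ext fun p => by
    rw [map_add]; exact add_smul _ _ p
  natural V W hV hW b p := by
    change mres P hW (Fr.coef hV hι hF b • p) = Fr.coef _ hι hF (mres _ hW b) • mres P hW p
    rw [mres_smul, ((Fr.coef_spec hV hι hF b).res hW).unique hι hF (Fr.coef_spec _ hι hF _)]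
  bal W hW b r p := by
    change Fr.coef hW hι hF (B.act W (.op r) b) • p = Fr.coef hW hι hF b • r • p
    rw [(Fr.coef_spec hW hι hF _).unique hι hF ((Fr.coef_spec hW hι hF b).act r), mul_smul]

include hι hF in
/-- Contraction with the coefficient of `eB zero`, which is `1` on `eB zero`, recovers `p`. -/
theorem Frame.pure_zero_injective {p p' : msec P V} (h : B.pure (mres _ hV (Fr.eB Fr.zero)) p =
    B.pure (mres _ hV (Fr.eB Fr.zero)) p') : p = p' := by
  have := congrArg ((Fr.coefBal hι hF P).lift V hV) h
  rw [BalMap.lift_pure, BalMap.lift_pure] at this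
  change Fr.coef hV hι hF _ • p = Fr.coef hV hι hF _ • p' at this
  rwa [(Fr.coef_spec hV hι hF _).unique hι hF Fr.isCoef_zero, one_smul, one_smul] at this

include hι hF in
/-- A section `p` is determined by the tensors `b ⊗ p`. -/
theorem pure_injective {p p' : msec P U}
    (h : ∀ V (hV : V ≤ U) (b : msec (BMod O T con') V),
      B.pure b (mres P hV p) = B.pure b (mres P hV p')) : p = p' := by
  refine msec_ext P fun x hx => ?_
  obtain ⟨U₀, hxU₀, ⟨Fr⟩⟩ := hF x
  exact ⟨U ⊓ U₀, inf_le_left, ⟨hx, hxU₀⟩,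
    Fr.pure_zero_injective inf_le_right hι hF (h (U ⊓ U₀) inf_le_left _)⟩

/-- Every section of `B ⊗ P` is locally of the form `∑ eB α ⊗ p α`. -/
theorem Frame.exists_sum_pure (z : msec (B.tensor.obj P) U) {x : X} (hx : x ∈ U)
    (hx₀ : x ∈ U₀) : ∃ (V : Opens X) (hV : V ≤ U) (hV₀ : V ≤ U₀) (F : Finset Fr.I)
      (p : Fr.I → msec P V), x ∈ V ∧
      mres _ hV z = ∑ α ∈ F, B.pure (mres _ hV₀ (Fr.eB α)) (p α) := by
  obtain ⟨V₁, hV₁, m, b, p, hxV₁, e⟩ := B.exists_sum z hx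
  choose W hW ρ hxW e' using fun i => Fr.exists_gensum (V := V₁ ⊓ U₀) inf_le_right
    (mres _ inf_le_left (b i)) (y := x) ⟨hxV₁, hx₀⟩
  obtain ⟨V', hxV', hV'⟩ := exists_common_nhd W hxW
  let V := V' ⊓ (V₁ ⊓ U₀)
  have hVW : ∀ i, V ≤ W i := fun i => inf_le_left.trans (hV' i)
  have hVV₁ : V ≤ V₁ := inf_le_right.trans inf_le_left
  have hV₀ : V ≤ U₀ := inf_le_right.trans inf_le_right
  let F := Finset.univ.biUnion fun i => (ρ i).support
  refine ⟨V, hVV₁.trans hV₁, hV₀, F, fun α => ∑ i, rres R (hVW i) (ρ i α) • mres P hVV₁ (p i),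
    ⟨hxV', hxV₁, hx₀⟩, ?_⟩
  rw [← mres_mres _ hV₁ hVV₁, e, map_sum]
  have h₁ : ∀ i, mres _ hVV₁ (b i) =
      ∑ α ∈ F, B.act V (.op (rres R (hVW i) (ρ i α))) (mres _ hV₀ (Fr.eB α)) := by
    intro i
    have := congrArg (mres _ (hVW i)) (e' i)
    rw [mres_mres, mres_mres] at this
    rw [this, gensum_apply, map_sum]
    refine (sum_congr rfl fun α _ => ?_).trans (Finset.sum_subset
      (Finset.subset_biUnion_of_mem (fun i => (ρ i).support) (Finset.mem_univ i))
      fun α _ hα => ?_)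
    · rw [B.act_res, mres_mres]
    · rw [Finsupp.notMem_support_iff.1 hα, map_zero]
      exact LinearMap.congr_fun (map_zero (B.act V)) _
  have h₂ : ∀ i, B.pure (mres _ hVV₁ (b i)) (mres P hVV₁ (p i)) = ∑ α ∈ F,
      B.pure (mres _ hV₀ (Fr.eB α)) (rres R (hVW i) (ρ i α) • mres P hVV₁ (p i)) := by
    intro i
    rw [h₁]
    change B.pureHom (P := P) V _ _ = _
    rw [map_sum, AddMonoidHom.finsetSum_apply]
    exact sum_congr rfl fun α _ => B.pure_act _ _ _
  simp_rw [B.mres_pure, h₂]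
  rw [Finset.sum_comm]
  refine sum_congr rfl fun α _ => ?_
  exact (map_sum (B.pureHom (P := P) V (mres _ hV₀ (Fr.eB α))) _ _).symm

theorem Frame.tensorAct_pure_zero (α : Fr.I) (f : rsec S.ring V) (p : msec P V) :
    tensorAct hι hF P V f (B.pure (mres _ hV (Fr.eB α)) p) =
      (B.pure (mres _ hV (Fr.eB Fr.zero)) p : msec (B.tensor.obj P) V) ◂ Fr.q hV hι hF α f := by
  rw [tensorAct_pure, pure_rsm, q, rsm_div]

theorem app_tensor_map_pure (φ : P ⟶ P') (b : msec (BMod O T con') U)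
    (p : msec P U) : app (B.tensor.map φ) (B.pure b p) = B.pure b (app φ p) := by
  have := toSheafify_naturality (Opens.grothendieckTopology X)
    ((PresheafOfModules.toPresheaf _).map ((balPreFunctor B).map φ))
  exact (congrArg (fun f => (f.app (op U)).hom (balMk B P U b p)) this).symm

end Coef

/-! ### Morphisms `B → G` -/

section Inv
variable [CommSheaf O.ring] {con : Corr S.ring O.ring} {con' : Corr O.ring T.ring}
  {inc : Corr S.ring T.ring} {R : RSh X} {B : RAct R (BMod O T con')}
  {ι : ∀ U : Opens X, rsec S.ring U →+* rsec T.ring U} (hι : IsLeftMul inc B ι)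
  (hF : HasFrames con B ι) {G : SheafOfModules.{u} (opSheaf O.D)}
  (act : ∀ U : Opens X, rsec S.ring U → msec G U →+ msec G U)

/-- The `D`-linear and `S`-linear morphisms `B → G` over `U`. -/
def invSec (U : Opens X) :
    AddSubgroup (∀ W : {W : Opens X // W ≤ U}, msec (BMod O T con') W.1 →+ msec G W.1) where
  carrier := {ψ | (∀ V W (hV : V ≤ U) (hW : W ≤ V) (b : msec (BMod O T con') V),
      mres G hW (ψ ⟨V, hV⟩ b) = ψ ⟨W, hW.trans hV⟩ (mres _ hW b)) ∧
    (∀ V (hV : V ≤ U) (b : msec (BMod O T con') V) (d : 𝒟[O] V),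
      ψ ⟨V, hV⟩ (b ◂ d) = ψ ⟨V, hV⟩ b ◂ d) ∧
    ∀ V (hV : V ≤ U) (b : msec (BMod O T con') V) (f : rsec S.ring V),
      ψ ⟨V, hV⟩ (lmul hι hF f b) = act V f (ψ ⟨V, hV⟩ b)}
  zero_mem' := ⟨fun _ _ _ _ _ => map_zero _, fun _ _ _ d => (zero_rsm d).symm,
    fun _ _ _ _ => (map_zero _).symm⟩
  add_mem' {ψ χ} hψ hχ := ⟨fun V W hV hW b => by
      simp only [Pi.add_apply, AddMonoidHom.add_apply, map_add, hψ.1 V W hV hW, hχ.1 V W hV hW],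
    fun V hV b d => by
      simp only [Pi.add_apply, AddMonoidHom.add_apply, add_rsm, hψ.2.1, hχ.2.1],
    fun V hV b f => by
      simp only [Pi.add_apply, AddMonoidHom.add_apply, map_add, hψ.2.2, hχ.2.2]⟩
  neg_mem' {ψ} hψ := ⟨fun V W hV hW b => by
      simp only [Pi.neg_apply, AddMonoidHom.neg_apply, map_neg, hψ.1 V W hV hW],
    fun V hV b d => by
      simp only [Pi.neg_apply, AddMonoidHom.neg_apply, hψ.2.1]
      exact (smul_neg (opSec d : rsec (opSheaf O.D) V) (ψ ⟨V, hV⟩ b)).symm,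
    fun V hV b f => by
      simp only [Pi.neg_apply, AddMonoidHom.neg_apply, map_neg, hψ.2.2]⟩

/-- Restriction of morphisms `B → G`. -/
def invRes (h : W ≤ U) : invSec hι hF act U →+ invSec hι hF act W where
  toFun ψ := ⟨fun V => ψ.1 ⟨V.1, V.2.trans h⟩, fun V V' hV hW b => ψ.2.1 V V' (hV.trans h) hW b,
    fun V hV b d => ψ.2.2.1 V (hV.trans h) b d, fun V hV b f => ψ.2.2.2 V (hV.trans h) b f⟩
  map_zero' := rfl
  map_add' _ _ := rfl

/-- The presheaf of morphisms `B → G`. -/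
def invPre : (Opens X)ᵒᵖ ⥤ AddCommGrpCat.{u} where
  obj U := AddCommGrpCat.of (invSec hι hF act U.unop)
  map h := AddCommGrpCat.ofHom (invRes hι hF act h.unop.le)
  map_id _ := rfl
  map_comp _ _ := rfl

variable {act}

theorem invPre_isSheaf (ha : IsDiffAction con act) : Presheaf.IsSheaf
    (Opens.grothendieckTopology X) (invPre hι hF act) := by
  refine ab_isSheaf _ (fun U s t h => ?_) (fun {J} U V hV hc s hs => ?_)
  · have s' : invSec hι hF act U := s
    apply Subtype.ext
    funext V; ext b
    refine msec_ext G fun x hx => ?_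
    obtain ⟨W, hW, hxW, e⟩ := h x (V.2 hx)
    refine ⟨V.1 ⊓ W, inf_le_left, ⟨hx, hxW⟩, ?_⟩
    rw [(show invSec hι hF act U from s).2.1 V.1 (V.1 ⊓ W) V.2 inf_le_left,
      (show invSec hι hF act U from t).2.1 V.1 (V.1 ⊓ W) V.2 inf_le_left]
    have := congrArg (fun χ : invSec hι hF act W => χ.1 ⟨V.1 ⊓ W, inf_le_right⟩) e
    exact DFunLike.congr_fun this _
  · let φ : ∀ i, invSec hι hF act (V i) := s
    have key : ∀ (W : {W : Opens X // W ≤ U}) (b : msec (BMod O T con') W.1),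
        ∃ t : msec G W.1, ∀ i, mres G (inf_le_left : W.1 ⊓ V i ≤ W.1) t =
          (φ i).1 ⟨W.1 ⊓ V i, inf_le_right⟩ (mres _ inf_le_left b) := by
      intro W b
      refine msec_glue G (fun i => W.1 ⊓ V i) (fun i => inf_le_left)
        (fun x hx => (hc x (W.2 hx)).imp fun i hi => ⟨hx, hi⟩) _ fun i j => ?_
      rw [(φ i).2.1, (φ j).2.1, mres_mres, mres_mres]
      have := congrArg (fun χ : invSec hι hF act (V i ⊓ V j) =>
        χ.1 ⟨(W.1 ⊓ V i) ⊓ (W.1 ⊓ V j), inf_le_inf inf_le_right inf_le_right⟩) (hs i j)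
      exact DFunLike.congr_fun this _
    choose t ht using key
    have huniq : ∀ (W : {W : Opens X // W ≤ U}) (a b : msec G W.1),
        (∀ i, mres G (inf_le_left : W.1 ⊓ V i ≤ W.1) a = mres G inf_le_left b) → a = b := by
      intro W a b h
      refine msec_ext G fun x hx => ?_
      obtain ⟨i, hi⟩ := hc x (W.2 hx)
      exact ⟨W.1 ⊓ V i, inf_le_left, ⟨hx, hi⟩, h i⟩
    let ψ : ∀ W : {W : Opens X // W ≤ U}, msec (BMod O T con') W.1 →+ msec G W.1 := fun W =>
      AddMonoidHom.mk' (t W) fun a b => huniq W _ _ fun i => by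
        rw [ht, map_add, map_add, map_add, ht, ht]
    have hnat : ∀ W W' (hW : W ≤ U) (hW' : W' ≤ W) (b : msec (BMod O T con') W),
        mres G hW' (ψ ⟨W, hW⟩ b) = ψ ⟨W', hW'.trans hW⟩ (mres _ hW' b) := by
      intro W W' hW hW' b
      refine huniq ⟨W', hW'.trans hW⟩ _ _ fun i => ?_
      have h1 := ht ⟨W', hW'.trans hW⟩ (mres _ hW' b) i
      have h2 := congrArg (mres G (inf_le_inf_right (V i) hW' : W' ⊓ V i ≤ W ⊓ V i))
        (ht ⟨W, hW⟩ b i)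
      rw [mres_mres, (φ i).2.1, mres_mres] at h2
      rw [mres_mres] at h1
      rw [mres_mres]
      exact h2.trans h1.symm
    refine ⟨(⟨ψ, hnat, fun W hW b d => ?_, fun W hW b f => ?_⟩ : invSec hι hF act U), fun i => ?_⟩
    · refine huniq ⟨W, hW⟩ _ _ fun i => ?_
      have h1 := ht ⟨W, hW⟩ (b ◂ d) i
      rw [mres_rsm, (φ i).2.2.1, ← ht ⟨W, hW⟩ b i, ← mres_rsm] at h1
      exact h1
    · refine huniq ⟨W, hW⟩ _ _ fun i => ?_
      have h1 := ht ⟨W, hW⟩ (lmul hι hF f b) i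
      rw [mres_lmul, (φ i).2.2.2, ← ht ⟨W, hW⟩ b i, ← ha.natural] at h1
      exact h1
    · apply Subtype.ext
      funext W
      ext b
      refine msec_ext G fun x hx => ⟨W.1 ⊓ V i, inf_le_left, ⟨hx, W.2 hx⟩, ?_⟩
      exact (ht ⟨W.1, W.2.trans (hV i)⟩ b i).trans ((φ i).2.1 W.1 _ W.2 inf_le_left b).symm

/-- The action of `R` on morphisms `B → G`, by `(r ψ)(b) = ψ(b r)`. -/
instance invModule (U : Opens X) : Module (rsec R U) (invSec hι hF act U) where
  smul r ψ := ⟨fun V => (ψ.1 V).comp (B.act V.1 (.op (rres R V.2 r))).toAddMonoidHom,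
    fun V W hV hW b => by
      change mres G hW (ψ.1 ⟨V, hV⟩ (B.act V (.op (rres R hV r)) b)) =
        ψ.1 ⟨W, hW.trans hV⟩ (B.act W (.op (rres R (hW.trans hV) r)) (mres _ hW b))
      rw [ψ.2.1 V W hV hW, B.act_res, rres_rres],
    fun V hV b d => by
      change ψ.1 ⟨V, hV⟩ (B.act V (.op (rres R hV r)) (b ◂ d)) =
        ψ.1 ⟨V, hV⟩ (B.act V (.op (rres R hV r)) b) ◂ d
      rw [B.act_rsm, ψ.2.2.1],
    fun V hV b f => by
      change ψ.1 ⟨V, hV⟩ (B.act V (.op (rres R hV r)) (lmul hι hF f b)) =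
        act V f (ψ.1 ⟨V, hV⟩ (B.act V (.op (rres R hV r)) b))
      rw [← lmul_act, ψ.2.2.2]⟩
  one_smul ψ := Subtype.ext (by
    funext V; ext b
    change ψ.1 V (B.act V.1 (.op (rres R V.2 1)) b) = ψ.1 V b
    rw [map_one]
    exact congrArg (ψ.1 V) (LinearMap.congr_fun (map_one (B.act V.1)) b))
  mul_smul r r' ψ := Subtype.ext (by
    funext V; ext b
    change ψ.1 V (B.act V.1 (.op (rres R V.2 (r * r'))) b) =
      ψ.1 V (B.act V.1 (.op (rres R V.2 r')) (B.act V.1 (.op (rres R V.2 r)) b))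
    rw [map_mul]
    exact congrArg (ψ.1 V) (LinearMap.congr_fun (map_mul (B.act V.1) (.op _) (.op _)) b))
  smul_zero _ := rfl
  smul_add _ _ _ := rfl
  add_smul r r' ψ := Subtype.ext (by
    funext V; ext b
    change ψ.1 V (B.act V.1 (.op (rres R V.2 (r + r'))) b) =
      ψ.1 V (B.act V.1 (.op (rres R V.2 r)) b) + ψ.1 V (B.act V.1 (.op (rres R V.2 r')) b)
    rw [map_add, ← map_add (ψ.1 V)]
    exact congrArg (ψ.1 V) (LinearMap.congr_fun (map_add (B.act V.1) (.op _) (.op _)) b))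
  zero_smul ψ := Subtype.ext (by
    funext V; ext b
    change ψ.1 V (B.act V.1 (.op (rres R V.2 0)) b) = 0
    rw [map_zero, ← map_zero (ψ.1 V)]
    exact congrArg (ψ.1 V) (LinearMap.congr_fun (map_zero (B.act V.1)) b))

instance (U : (Opens X)ᵒᵖ) : Module (R.obj.obj U) ((invPre hι hF act).obj U) :=
  invModule hι hF U.unop

/-- The `R`-module of `D`-linear and `S`-linear morphisms `B → G`. -/
def invMod (ha : IsDiffAction con act) : SheafOfModules.{u} R where
  val := PresheafOfModules.ofPresheaf (invPre hι hF act) (fun U V h r ψ => Subtype.ext (by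
    funext W; ext b
    change (show invSec hι hF act U.unop from ψ).1 ⟨W.1, W.2.trans h.unop.le⟩
        (B.act W.1 (.op (rres R (W.2.trans h.unop.le) r)) b) =
      (show invSec hι hF act U.unop from ψ).1 ⟨W.1, W.2.trans h.unop.le⟩
        (B.act W.1 (.op (rres R W.2 (rres R h.unop.le r))) b)
    rw [rres_rres]))
  isSheaf := invPre_isSheaf hι hF ha

variable (ha : IsDiffAction con act)

/-- The value of a morphism `B → G`. -/
def invEv (h : V ≤ U) (ψ : msec (invMod hι hF ha) U) :
    msec (BMod O T con') V →+ msec G V := (show invSec hι hF act U from ψ).1 ⟨V, h⟩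

theorem invEv_mres (h : V ≤ U) (h' : W ≤ V) (ψ : msec (invMod hι hF ha) U) :
    invEv hι hF ha h' (mres _ h ψ) = invEv hι hF ha (h'.trans h) ψ := rfl

theorem mres_invEv (h : V ≤ U) (h' : W ≤ V) (ψ : msec (invMod hι hF ha) U)
    (b : msec (BMod O T con') V) :
    mres G h' (invEv hι hF ha h ψ b) = invEv hι hF ha (h'.trans h) ψ (mres _ h' b) :=
  (show invSec hι hF act U from ψ).2.1 V W h h' b

theorem invEv_rsm (h : V ≤ U) (ψ : msec (invMod hι hF ha) U)
    (b : msec (BMod O T con') V) (d : 𝒟[O] V) :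
    invEv hι hF ha h ψ (b ◂ d) = invEv hι hF ha h ψ b ◂ d :=
  (show invSec hι hF act U from ψ).2.2.1 V h b d

theorem invEv_lmul (h : V ≤ U) (ψ : msec (invMod hι hF ha) U)
    (b : msec (BMod O T con') V) (f : rsec S.ring V) :
    invEv hι hF ha h ψ (lmul hι hF f b) = act V f (invEv hι hF ha h ψ b) :=
  (show invSec hι hF act U from ψ).2.2.2 V h b f

theorem invEv_act (h : V ≤ U) (ψ : msec (invMod hι hF ha) U)
    (b : msec (BMod O T con') V) (r : rsec R U) :
    invEv hι hF ha h (r • ψ) b = invEv hι hF ha h ψ (B.act V (.op (rres R h r)) b) := rfl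

theorem invEv_ext {ψ χ : msec (invMod hι hF ha) U}
    (h : ∀ V (hV : V ≤ U) (b : msec (BMod O T con') V),
      invEv hι hF ha hV ψ b = invEv hι hF ha hV χ b) : ψ = χ := by
  apply Subtype.ext
  funext V; ext b
  exact h V.1 V.2 b

/-- The evaluation `b ⊗ ψ ↦ ψ(b)`. -/
def invBal (U : Opens X) : BalMap B (invMod hι hF ha) U G where
  toFun W _ := AddMonoidHom.mk' (fun b => AddMonoidHom.mk' (fun ψ => invEv hι hF ha le_rfl ψ b)
    fun _ _ => rfl) fun b b' => AddMonoidHom.ext fun ψ => map_add (invEv hι hF ha le_rfl ψ) b b'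
  natural V W hV hW b ψ := mres_invEv hι hF ha le_rfl hW ψ b
  bal W hW b r ψ := by
    change invEv hι hF ha le_rfl ψ (B.act W (.op r) b) = invEv hι hF ha le_rfl (r • ψ) b
    rw [invEv_act, rres_self]

/-- The evaluation on sections. -/
def invCounitSec (U : Opens X) : msec (B.tensor.obj (invMod hι hF ha)) U →+ msec G U :=
  (invBal hι hF ha U).lift U le_rfl

theorem invCounitSec_pure (b : msec (BMod O T con') U)
    (ψ : msec (invMod hι hF ha) U) :
    invCounitSec hι hF ha U (B.pure b ψ) = invEv hι hF ha le_rfl ψ b :=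
  (invBal hι hF ha U).lift_pure U le_rfl b ψ

theorem mres_invCounitSec (h : V ≤ U)
    (z : msec (B.tensor.obj (invMod hι hF ha)) U) :
    mres G h (invCounitSec hι hF ha U z) = invCounitSec hι hF ha V (mres _ h z) :=
  (invBal hι hF ha U).mres_lift U V le_rfl h z

/-- The morphism `B ⊗ H → G`, where `H` is the module of morphisms `B → G`. -/
def invCounit : B.tensor.obj (invMod hι hF ha) ⟶ G :=
  mkHom (invCounitSec hι hF ha) (fun U V h z => mres_invCounitSec hι hF ha h z) fun U d z => by
    refine msec_ext G fun x hx => ?_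
    obtain ⟨V, hV, m, b, ψ, hxV, e⟩ := B.exists_sum z hx
    refine ⟨V, hV, hxV, ?_⟩
    rw [mres_invCounitSec, mres_smul, mres_smul, mres_invCounitSec, e, smul_sum, map_sum,
      map_sum, smul_sum]
    refine sum_congr rfl fun i _ => ?_
    rw [B.smul_pure, invCounitSec_pure, invCounitSec_pure]
    exact invEv_rsm hι hF ha le_rfl (ψ i) (b i) (MulOpposite.unop (rres (opSheaf O.D) hV d))

variable (Fr : Frame con B ι U₀) (hV : V ≤ U₀)

include hι hF ha in
theorem Frame.invEv_eq (ψ : msec (invMod hι hF ha) V) (b : msec (BMod O T con') V) :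
    invEv hι hF ha le_rfl ψ b =
      invEv hι hF ha le_rfl ψ (mres _ hV (Fr.eB Fr.zero)) ◂ Fr.div hV b := by
  rw [← invEv_rsm, Fr.rsm_div]

/-- The values of `∑ eB α ⊗ ψ α` and of its multiples by `f` are combinations of the maps `f ↦ f eB
α`, with coefficients `ψ α (eB zero)`. -/
theorem invCounit_injective (z : msec (B.tensor.obj (invMod hι hF ha)) U)
    (hz : invCounitSec hι hF ha U z = 0) : z = 0 := by
  refine msec_ext _ fun x hx => ?_
  obtain ⟨U₀, hxU₀, ⟨Fr⟩⟩ := hF x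
  obtain ⟨V, hV, hV₀, F, ψ, hxV, e⟩ := Fr.exists_sum_pure z hx hxU₀
  refine ⟨V, hV, hxV, ?_⟩
  rw [e, map_zero]
  have h₁ := mres_invCounitSec hι hF ha hV z
  rw [hz, map_zero, e, map_sum] at h₁
  simp only [invCounitSec_pure] at h₁
  refine Finset.sum_eq_zero fun β hβ => ?_
  have : ψ β = 0 := by
    have h₂ := Fr.eq_zero_of_sum_q hV₀ hι hF F
      (fun α => invEv hι hF ha le_rfl (ψ α) (mres _ hV₀ (Fr.eB Fr.zero))) (fun f => by
        have h₃ := congrArg (act V f) h₁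
        rw [map_zero, map_sum] at h₃
        rw [h₃]
        refine sum_congr rfl fun α _ => ?_
        rw [← invEv_lmul, Fr.invEv_eq hι hF ha hV₀ (ψ α) (lmul hι hF f _)]
        rfl) hβ
    refine invEv_ext hι hF ha fun W hW b => ?_
    have h₄ := congrArg (mres G hW) h₂
    rw [mres_invEv, map_zero, mres_mres] at h₄
    have h₅ := Fr.invEv_eq hι hF ha (hW.trans hV₀) (mres _ hW (ψ β)) b
    rw [invEv_mres, h₄, zero_rsm] at h₅
    exact h₅
  rw [this]
  exact map_zero (B.pureHom V _)

/-- The morphism `b ↦ t b / eB zero`. -/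
def Frame.invOf (t : msec G V) (h : ∀ W (hW : W ≤ V) (f : rsec S.ring W),
    act W f (mres G hW t) = mres G hW t ◂ Fr.q (hW.trans hV) hι hF Fr.zero f) :
    msec (invMod hι hF ha) V :=
  (⟨fun W => AddMonoidHom.mk' (fun b => mres G W.2 t ◂ Fr.div (W.2.trans hV) b) fun b b' => by
      rw [map_add, rsm_add],
    fun W W' hW hW' b => by
      change mres G hW' (mres G hW t ◂ Fr.div (hW.trans hV) b) =
        mres G (hW'.trans hW) t ◂ Fr.div ((hW'.trans hW).trans hV) (mres _ hW' b)
      rw [mres_rsm, mres_mres, Fr.res_div],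
    fun W hW b d => by
      change mres G hW t ◂ Fr.div (hW.trans hV) (b ◂ d) = mres G hW t ◂ Fr.div (hW.trans hV) b ◂ d
      rw [Fr.div_rsm, rsm_mul],
    fun W hW b f => by
      change mres G hW t ◂ Fr.div (hW.trans hV) (lmul hι hF f b) =
        act W f (mres G hW t ◂ Fr.div (hW.trans hV) b)
      rw [ha.linear, h, ← rsm_mul, Frame.q, ← Fr.div_rsm, ← lmul_rsm, Fr.rsm_div]⟩ :
    invSec hι hF act V)

/-- A section `s` is locally the sum of the values at `eB α` of morphisms `b ↦ t α b / eB zero`. -/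
theorem invCounit_surjective (s : msec G U) :
    ∃ z, invCounitSec hι hF ha U z = s := by
  have := msec_exists_of_local' (B.tensor.obj (invMod hι hF ha)) (U := U)
    (fun V hV z => invCounitSec hι hF ha V z = mres G hV s)
    (fun V W hV hW z h => by rw [← mres_invCounitSec, h, mres_mres])
    (fun V hV z h => msec_ext G fun x hx => by
      obtain ⟨W, hW, hxW, e⟩ := h x hx
      exact ⟨W, hW, hxW, by rw [mres_invCounitSec, e, mres_mres]⟩)
    (fun V hV z z' h h' => sub_eq_zero.1 (invCounit_injective hι hF ha _ (by
      rw [map_sub, h, h', sub_self])))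
    (fun x hx => by
      obtain ⟨U₀, hxU₀, ⟨Fr⟩⟩ := hF x
      obtain ⟨V, hV, hV₀, F, t, hxV, e⟩ := Fr.exists_sum_q hι hF ha s hx hxU₀
      -- Both sides of `(g f) s = g (f s)` are combinations of the maps `f ↦ f eB α`.
      have ht : ∀ α ∈ F, ∀ W (hW : W ≤ V) (f : rsec S.ring W),
          act W f (mres G hW (t α)) =
            mres G hW (t α) ◂ Fr.q (hW.trans hV₀) hι hF Fr.zero f := by
        intro β hβ W hW g
        refine sub_eq_zero.1 (Fr.eq_zero_of_sum_q (hW.trans hV₀) hι hF F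
          (fun α => act W g (mres G hW (t α)) -
            mres G hW (t α) ◂ Fr.q (hW.trans hV₀) hι hF Fr.zero g) (fun f => ?_) hβ)
        have h₁ := ha.mul W g f (mres G (hW.trans hV) s)
        rw [e W hW, e W hW, map_sum, ← sub_eq_zero, ← Finset.sum_sub_distrib] at h₁
        rw [← neg_eq_zero, ← h₁, ← Finset.sum_neg_distrib]
        refine sum_congr rfl fun α _ => ?_
        rw [ha.linear, Fr.q_mul, rsm_mul, sub_eq_add_neg, add_rsm, neg_add, sub_eq_add_neg,
          add_comm]
        congr 1
        have : ∀ (y : msec G W) (d : 𝒟[O] W), -((-y) ◂ d) = y ◂ d := fun y d => by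
          rw [neg_eq_iff_add_eq_zero, ← add_rsm, neg_add_cancel, zero_rsm]
        exact this _ _
      classical
      refine ⟨V, hV, ∑ α ∈ F.attach, (B.pure (mres _ hV₀ (Fr.eB α.1))
        (Fr.invOf hι hF ha hV₀ (t α.1) (ht α.1 α.2)) :
          msec (B.tensor.obj (invMod hι hF ha)) V), hxV, ?_⟩
      rw [map_sum]
      simp only [invCounitSec_pure]
      have h₁ := e V le_rfl 1
      rw [ha.one] at h₁
      rw [h₁, ← Finset.sum_attach F]
      refine sum_congr (M := msec G V) rfl fun α _ => ?_
      change mres G le_rfl (t α.1) ◂ Fr.div _ (mres _ hV₀ (Fr.eB α.1)) = _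
      rw [Frame.q, lmul_one])
  obtain ⟨z, hz⟩ := this
  exact ⟨z, by rw [hz, mres_self]⟩

theorem isIso_invCounit : IsIso (invCounit hι hF ha) :=
  isIso_of_app_bijective _ fun _ =>
    ⟨(injective_iff_map_eq_zero (invCounitSec hι hF ha _)).2 (invCounit_injective hι hF ha),
      invCounit_surjective hι hF ha⟩

theorem invCounit_tensorAct (f : rsec S.ring U)
    (z : msec (B.tensor.obj (invMod hι hF ha)) U) :
    app (invCounit hι hF ha) (tensorAct hι hF _ U f z) = act U f (app (invCounit hι hF ha) z) := by
  change invCounitSec hι hF ha U _ = act U f (invCounitSec hι hF ha U z)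
  refine msec_ext G fun x hx => ?_
  obtain ⟨V, hV, m, b, ψ, hxV, e⟩ := B.exists_sum z hx
  refine ⟨V, hV, hxV, ?_⟩
  rw [mres_invCounitSec, mres_tensorAct, ha.natural, mres_invCounitSec, e, tensorAct_sum, map_sum,
    map_sum, map_sum]
  refine sum_congr rfl fun i _ => ?_
  rw [invCounitSec_pure, invCounitSec_pure, invEv_lmul]

end Inv

/-! ### The equivalence of categories -/

section Equivalence
variable [CommSheaf O.ring] {con : Corr S.ring O.ring} {con' : Corr O.ring T.ring}
  {inc : Corr S.ring T.ring} {R : RSh X} {B : RAct R (BMod O T con')}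
  {ι : ∀ U : Opens X, rsec S.ring U →+* rsec T.ring U} (hι : IsLeftMul inc B ι)
  (hF : HasFrames con B ι) {P P' : SheafOfModules.{u} R}

theorem app_tensor_map_tensorAct (φ : P ⟶ P') (f : rsec S.ring U)
    (z : msec (B.tensor.obj P) U) : app (B.tensor.map φ) (tensorAct hι hF P U f z) =
      tensorAct hι hF P' U f (app (B.tensor.map φ) z) := by
  refine msec_ext _ fun x hx => ?_
  obtain ⟨V, hV, m, b, p, hxV, e⟩ := B.exists_sum z hx
  refine ⟨V, hV, hxV, ?_⟩
  rw [mres_app, mres_tensorAct, mres_tensorAct, mres_app, e, tensorAct_sum, map_sum,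
    map_sum, map_sum]
  refine sum_congr rfl fun i _ => ?_
  rw [app_tensor_map_pure, app_tensor_map_pure, tensorAct_pure]

theorem tensor_obj_hom_ext {G : SheafOfModules.{u} (opSheaf O.D)} {φ ψ : B.tensor.obj P ⟶ G}
    (h : ∀ (U : Opens X) (b : msec (BMod O T con') U) (p : msec P U),
      app φ (B.pure b p) = app ψ (B.pure b p)) : φ = ψ := by
  refine hom_ext_app fun U z => msec_ext _ fun x hx => ?_
  obtain ⟨V, hV, m, b, p, hxV, e⟩ := B.exists_sum z hx
  refine ⟨V, hV, hxV, ?_⟩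
  rw [mres_app, mres_app, e, map_sum, map_sum]
  exact sum_congr rfl fun i _ => h _ _ _

/-- A morphism `B ⊗ P → B ⊗ P'` that commutes with the actions of `S` sends `b ⊗ p` to `b ⊗ p'` for
a section `p'` that does not depend on `b`. -/
theorem exists_pure_eq (φ : B.tensor.obj P ⟶ B.tensor.obj P')
    (hφ : ∀ (U : Opens X) (f : rsec S.ring U) (z : msec (B.tensor.obj P) U),
      app φ (tensorAct hι hF P U f z) = tensorAct hι hF P' U f (app φ z))
    (p : msec P U) : ∃ p' : msec P' U, ∀ V (hV : V ≤ U)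
      (b : msec (BMod O T con') V),
      B.pure b (mres P' hV p') = app φ (B.pure b (mres P hV p)) := by
  have := msec_exists_of_local' P' (U := U)
    (fun W hW p' => ∀ V (hV : V ≤ W) (b : msec (BMod O T con') V),
      B.pure b (mres P' hV p') = app φ (B.pure b (mres P (hV.trans hW) p)))
    (fun W W' hW hW' p' h V hV b => by rw [mres_mres, h])
    (fun W hW p' h V hV b => msec_ext _ fun x hx => by
      obtain ⟨W', hW', hxW', e⟩ := h x (hV hx)
      refine ⟨V ⊓ W', inf_le_left, ⟨hx, hxW'⟩, ?_⟩
      have := e (V ⊓ W') inf_le_right (mres _ inf_le_left b)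
      rw [mres_mres] at this
      rw [B.mres_pure, mres_mres, mres_app, B.mres_pure, mres_mres, this])
    (fun W hW p' p'' h h' => pure_injective hι hF fun V hV b => by rw [h, h'])
    (fun x hx => by
      obtain ⟨U₀, hxU₀, ⟨Fr⟩⟩ := hF x
      let V₁ := U ⊓ U₀
      let z := app φ (B.pure (mres _ (inf_le_right : V₁ ≤ U₀) (Fr.eB Fr.zero))
        (mres P (inf_le_left : V₁ ≤ U) p))
      obtain ⟨V, hV, hV₀, F, q, hxV, e⟩ := Fr.exists_sum_pure z (x := x) ⟨hx, hxU₀⟩ hxU₀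
      let q' : Fr.I → msec P' V := fun α => if α ∈ F then q α else 0
      let F' := insert Fr.zero F
      have e' : mres _ hV z = ∑ α ∈ F', B.pure (mres _ hV₀ (Fr.eB α)) (q' α) := by
        rw [e]
        refine (sum_congr rfl fun α hα => ?_).trans
          (Finset.sum_subset (Finset.subset_insert _ _) fun α _ hα => ?_)
        · simp only [q', if_pos hα]
        · simp only [q', if_neg hα]
          exact map_zero (B.pureHom V _)
      -- Since `φ` is linear over `D` and `S`, the map `f ↦ f z` is a multiple of `f ↦ f eB zero`;
      -- for `z = ∑ eB α ⊗ q' α` this determines the coefficients.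
      have h₁ : ∀ f : rsec S.ring V, tensorAct hι hF P' V f (mres _ hV z) =
          mres _ hV z ◂ Fr.q hV₀ hι hF Fr.zero f := by
        intro f
        rw [mres_app, ← hφ, B.mres_pure, mres_mres, Fr.tensorAct_pure_zero, app_rsm]
      have h₂ := Fr.eq_zero_of_sum_q hV₀ hι hF F'
        (fun α => (if α = Fr.zero then mres _ hV z else 0) -
          B.pure (mres _ hV₀ (Fr.eB Fr.zero)) (q' α)) (fun f => by
        have h₃ := h₁ f
        nth_rw 1 [e'] at h₃
        rw [map_sum] at h₃
        simp only [Fr.tensorAct_pure_zero] at h₃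
        simp only [sub_eq_add_neg, add_rsm, rsm_neg_left, Finset.sum_add_distrib,
          Finset.sum_neg_distrib]
        rw [h₃, Finset.sum_eq_single Fr.zero, if_pos rfl, add_neg_cancel]
        · intro α _ hα
          rw [if_neg hα, zero_rsm]
        · exact fun h => absurd (Finset.mem_insert_self _ _) h)
        (Finset.mem_insert_self _ _)
      rw [if_pos rfl, sub_eq_zero] at h₂
      refine ⟨V, hV.trans inf_le_left, q' Fr.zero, hxV, fun W hW b => ?_⟩
      have h₄ := congrArg (fun z => mres _ hW z ◂ Fr.div (hW.trans hV₀) b) h₂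
      simp only [B.mres_pure, mres_mres] at h₄
      rw [pure_rsm, Fr.rsm_div, mres_app, B.mres_pure, mres_mres, mres_mres, ← app_rsm, pure_rsm,
        Fr.rsm_div] at h₄
      exact h₄.symm)
  exact this

/-- If frames exist locally, `P ↦ B ⊗ P` is an equivalence from `R`-modules to comodules. -/
theorem inducesEquivalence (hι : IsLeftMul inc B ι) (hF : HasFrames con B ι)
    (hc : HasCoproduct con) (hO : IsGenByDer O) {side : Side}
    (hside : side = .right ∨ ∀ (U : Opens X) (f g : rsec S.ring U), f * g = g * f) :
    InducesEquivalence con con' inc B side := by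
  refine ⟨existsUnique_stdCoalg hF.hasEvalBasis hc, fun C hC =>
    ⟨fun P => existsUnique_stdCoaction hι hF hC hside, fun δ hδ => ?_⟩⟩
  have hA := hF.hasEvalBasis
  have hδ' := fun P => (isStdCoaction_iff hι hF).1 (hδ P)
  have h : ∀ {P P' : SheafOfModules.{u} R} (f : P ⟶ P'),
      IsComodHom (δ P) (δ P') (B.tensor.map f) := fun {P P'} φ =>
    (isComodHom_iff hA).2 fun U f s => by
      rw [hδ', hδ', app_tensor_map_tensorAct]
  refine ⟨h, ?_⟩
  have hfaithful : (Comod.lift B.tensor δ h).Faithful :=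
    { map_injective := fun {P P'} φ ψ e => hom_ext_app fun U p => by
        have e' : B.tensor.map φ = B.tensor.map ψ := congrArg Comod.Hom.hom e
        refine pure_injective hι hF fun V hV b => ?_
        rw [mres_app, mres_app, ← app_tensor_map_pure, e', app_tensor_map_pure] }
  have hfull : (Comod.lift B.tensor δ h).Full :=
    { map_surjective := fun {P P'} φ => by
        have hφ : ∀ (U : Opens X) (f : rsec S.ring U) (z : msec (B.tensor.obj P) U),
            app φ.hom (tensorAct hι hF P U f z) = tensorAct hι hF P' U f (app φ.hom z) := by
          intro U f z
          have := (isComodHom_iff hA).1 φ.isComodHom U f z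
          refine ((congrArg (app φ.hom) (hδ' P U f z)).symm.trans this).trans ?_
          exact hδ' P' U f _
        have ex := fun U (p : msec P U) => exists_pure_eq hι hF φ.hom hφ p
        choose g hg using ex
        refine ⟨mkHom (fun U => AddMonoidHom.mk' (g U) fun p p' =>
          pure_injective hι hF fun V hV b => ?_) (fun U V hV p => ?_) (fun U r p => ?_), ?_⟩
        · rw [hg, map_add, map_add, B.pure_add_right, B.pure_add_right, map_add, hg, hg]
        · refine pure_injective hι hF fun W hW b => ?_
          change _ = B.pure b (mres P' hW (g V (mres P hV p)))
          rw [hg, mres_mres, mres_mres]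
          exact hg U p _ _ _
        · refine pure_injective hι hF fun V hV b => ?_
          change B.pure b (mres P' hV (g U (r • p))) = B.pure b (mres P' hV (r • g U p))
          rw [hg, mres_smul, mres_smul, ← B.pure_act, ← B.pure_act, hg]
        · refine Comod.Hom.ext (tensor_obj_hom_ext fun U b p => ?_)
          refine (app_tensor_map_pure _ b p).trans ?_
          have := hg U p U le_rfl b
          rwa [mres_self, mres_self] at this }
  have hess : (Comod.lift B.tensor δ h).EssSurj :=
    { mem_essImage := fun G => by
        have ha : IsDiffAction con (coactAct G.coaction.coact) :=
          isDiffAction_coactAct hO hC hside G.coaction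
        obtain ⟨i, hi₁, hi₂⟩ := (isIso_invCounit hι hF ha).out
        have h₁ : IsComodHom (δ (invMod hι hF ha)) G.coaction (invCounit hι hF ha) :=
          (isComodHom_iff hA).2 fun U f s => by
            rw [hδ', invCounit_tensorAct]
        have h₂ : IsComodHom G.coaction (δ (invMod hι hF ha)) i :=
          (isComodHom_iff hA).2 fun U f s => by
            have h₃ : ∀ z : msec (B.tensor.obj (invMod hι hF ha)) U,
                app i (app (invCounit hι hF ha) z) = z := fun z => by
              rw [← app_comp, hi₁, app_id]
            have h₄ : ∀ s : msec G.mod U, app (invCounit hι hF ha) (app i s) = s := fun s => by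
              rw [← app_comp, hi₂, app_id]
            have h₅ := (isComodHom_iff hA).1 h₁ U f (app i s)
            rw [h₄] at h₅
            rw [← h₅, h₃]
        exact ⟨invMod hι hF ha, ⟨⟨⟨invCounit hι hF ha, h₁⟩, ⟨i, h₂⟩, Comod.Hom.ext hi₁,
          Comod.Hom.ext hi₂⟩⟩⟩ }
  exact { }

end Equivalence

/-! ### Multi-indices -/

section MultiIndex
variable {J : Type} [DecidableEq J]

theorem multiIndex_induction {Q : (J →₀ ℕ) → Prop} (α : J →₀ ℕ) (zero : Q 0)
    (add : ∀ α i, Q α → Q (α + single i 1)) : Q α := by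
  induction α using Finsupp.induction with
  | zero => exact zero
  | single_add i n f _ _ ih =>
    induction n with
    | zero => simpa using ih
    | succ n ih' =>
      by_cases hn : n = 0
      · subst hn
        rw [zero_add, add_comm]
        exact add _ _ ih
      · have := add _ i (ih' hn)
        rwa [add_right_comm, ← Finsupp.single_add] at this

/-- The decompositions of a multi-index as a sum of two multi-indices. -/
abbrev decomp (α : J →₀ ℕ) : Finset ((J →₀ ℕ) × (J →₀ ℕ)) := Finset.HasAntidiagonal.antidiagonal α

theorem mem_decomp {α : J →₀ ℕ} {p : (J →₀ ℕ) × (J →₀ ℕ)} : p ∈ decomp α ↔ p.1 + p.2 = α :=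
  Finset.HasAntidiagonal.mem_antidiagonal

variable {N : Type*} [AddCommMonoid N]

theorem sum_decomp_swap (α : J →₀ ℕ) (h : (J →₀ ℕ) → (J →₀ ℕ) → N) :
    ∑ p ∈ decomp α, h p.2 p.1 = ∑ p ∈ decomp α, h p.1 p.2 :=
  Finset.sum_nbij' Prod.swap Prod.swap
    (fun _ hp => mem_decomp.2 ((add_comm _ _).trans (mem_decomp.1 hp)))
    (fun _ hp => mem_decomp.2 ((add_comm _ _).trans (mem_decomp.1 hp)))
    (fun _ _ => rfl) (fun _ _ => rfl) (fun _ _ => rfl)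

/-- A sum over the decompositions of `α + eᵢ`, weighted by the `i`-th entry of the first part, is a
sum over the decompositions of `α`. -/
theorem sum_decomp_add_single_fst (α : J →₀ ℕ) (i : J) (h : (J →₀ ℕ) → (J →₀ ℕ) → N) :
    ∑ p ∈ decomp (α + single i 1), p.1 i • h p.1 p.2 =
      ∑ p ∈ decomp α, (p.1 i + 1) • h (p.1 + single i 1) p.2 := by
  symm
  refine Finset.sum_of_injOn (fun p => (p.1 + single i 1, p.2)) ?_ ?_ ?_ ?_
  · rintro ⟨a, b⟩ - ⟨a', b'⟩ - e
    simpa using e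
  · rintro ⟨a, b⟩ h
    rw [Finset.mem_coe, mem_decomp] at h ⊢
    rw [← h, add_right_comm]
  · rintro ⟨a, b⟩ hab hn
    rw [mem_decomp] at hab
    have : a i = 0 := by
      by_contra h0
      refine hn ⟨(a - single i 1, b), ?_, ?_⟩
      · have hle : single i 1 ≤ a := by
          rw [Finsupp.single_le_iff]; omega
        rw [Finset.mem_coe, mem_decomp]
        change a - single i 1 + b = α
        have h2 : a - single i 1 + single i 1 = a := tsub_add_cancel_of_le hle
        refine add_right_cancel (b := single i 1) ?_
        rw [add_right_comm, h2]
        exact hab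
      · have hle : single i 1 ≤ a := by
          rw [Finsupp.single_le_iff]; omega
        exact Prod.ext (tsub_add_cancel_of_le hle) rfl
    change a i • h a b = 0
    rw [this, zero_smul]
  · rintro ⟨a, b⟩ -
    simp

theorem sum_decomp_add_single_snd (α : J →₀ ℕ) (i : J) (h : (J →₀ ℕ) → (J →₀ ℕ) → N) :
    ∑ p ∈ decomp (α + single i 1), p.2 i • h p.1 p.2 =
      ∑ p ∈ decomp α, (p.2 i + 1) • h p.1 (p.2 + single i 1) := by
  rw [← sum_decomp_swap _ fun a b => b i • h a b,
    ← sum_decomp_swap _ fun a b => (b i + 1) • h a (b + single i 1)]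
  exact sum_decomp_add_single_fst α i fun a b => h b a

theorem smul_sum_decomp_add_single (α : J →₀ ℕ) (i : J) (h : (J →₀ ℕ) → (J →₀ ℕ) → N) :
    (α i + 1) • ∑ p ∈ decomp (α + single i 1), h p.1 p.2 =
      ∑ p ∈ decomp α, ((p.1 i + 1) • h (p.1 + single i 1) p.2 +
        (p.2 i + 1) • h p.1 (p.2 + single i 1)) := by
  rw [Finset.sum_add_distrib, ← sum_decomp_add_single_fst, ← sum_decomp_add_single_snd,
    ← Finset.sum_add_distrib, smul_sum]
  refine sum_congr rfl fun p hp => ?_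
  rw [← add_smul]
  congr 1
  have := DFunLike.congr_fun (mem_decomp.1 hp) i
  simpa using this.symm

theorem sum_decomp_assoc (α : J →₀ ℕ) (h : (J →₀ ℕ) → (J →₀ ℕ) → (J →₀ ℕ) → N) :
    ∑ p ∈ decomp α, ∑ q ∈ decomp p.1, h q.1 q.2 p.2 =
      ∑ p ∈ decomp α, ∑ q ∈ decomp p.2, h p.1 q.1 q.2 := by
  rw [Finset.sum_sigma', Finset.sum_sigma']
  refine Finset.sum_nbij' (fun x => ⟨(x.2.1, x.2.2 + x.1.2), (x.2.2, x.1.2)⟩)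
    (fun x => ⟨(x.1.1 + x.2.1, x.2.2), (x.1.1, x.2.1)⟩) ?_ ?_ ?_ ?_ ?_
  · rintro ⟨⟨a, b⟩, ⟨c, d⟩⟩ h
    simp only [Finset.mem_sigma, mem_decomp] at h ⊢
    obtain ⟨rfl, rfl⟩ := h
    exact ⟨(add_assoc _ _ _).symm, trivial⟩
  · rintro ⟨⟨a, b⟩, ⟨c, d⟩⟩ h
    simp only [Finset.mem_sigma, mem_decomp] at h ⊢
    obtain ⟨rfl, rfl⟩ := h
    exact ⟨add_assoc _ _ _, trivial⟩
  · rintro ⟨⟨a, b⟩, ⟨c, d⟩⟩ h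
    simp only [Finset.mem_sigma, mem_decomp] at h
    obtain ⟨rfl, rfl⟩ := h
    rfl
  · rintro ⟨⟨a, b⟩, ⟨c, d⟩⟩ h
    simp only [Finset.mem_sigma, mem_decomp] at h
    obtain ⟨rfl, rfl⟩ := h
    rfl
  · intros; rfl

end MultiIndex

/-! ### Divided powers -/

section DivPow
variable {J : Type} [DecidableEq J] {D : Type*} [Ring D]

/-- The divided powers `p α = d ^ α / α!` of a family of commuting elements `d i`. -/
structure DivPow (d : J → D) where
  p : (J →₀ ℕ) → D
  p_zero : p 0 = 1
  mul_p : ∀ i α, d i * p α = (α i + 1) • p (α + single i 1)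
  comm : ∀ i α, Commute (d i) (p α)

/-- The sign `(-1) ^ |α|`. -/
def sgn (α : J →₀ ℕ) : ℤˣ := (-1) ^ α.degree

theorem sgn_zero : sgn (0 : J →₀ ℕ) = 1 := by simp [sgn]

theorem sgn_add_single (α : J →₀ ℕ) (i : J) : sgn (α + single i 1) = -sgn α := by
  simp [sgn, Finsupp.degree_single, pow_succ]

theorem sgn_mul_self (α : J →₀ ℕ) : sgn α * sgn α = 1 := Int.units_mul_self _

variable {d : J → D} (π : DivPow d)

/-- The subfamily of the divided powers that belongs to a subfamily of the `d i`. -/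
def DivPow.restrict {J' : Type} [DecidableEq J'] (f : J' ↪ J) : DivPow (fun i => d (f i)) where
  p α := π.p (α.embDomain f)
  p_zero := by rw [Finsupp.embDomain_zero, π.p_zero]
  mul_p i α := by
    rw [π.mul_p, Finsupp.embDomain_apply_self, Finsupp.embDomain_add, Finsupp.embDomain_single]
  comm i α := π.comm _ _

variable [IsAddTorsionFree D]

theorem DivPow.commute (α β : J →₀ ℕ) : Commute (π.p α) (π.p β) := by
  induction α using multiIndex_induction with
  | zero => rw [π.p_zero]; exact Commute.one_left _
  | add α i ih =>
    have h : Commute (d i * π.p α) (π.p β) := (π.comm i β).mul_left ih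
    rw [π.mul_p] at h
    have h' : (α i + 1) • (π.p (α + single i 1) * π.p β) =
        (α i + 1) • (π.p β * π.p (α + single i 1)) := by
      rw [← smul_mul_assoc, ← mul_smul_comm]; exact h
    exact IsAddTorsionFree.nsmul_right_injective (Nat.succ_ne_zero _) h'

/-- The power series `∑ p α t ^ α` and `∑ (-1) ^ |α| p α t ^ α` are inverse to each other. -/
theorem DivPow.sum_sgn (ε : J →₀ ℕ) : ∑ q ∈ decomp ε, sgn q.2 • (π.p q.1 * π.p q.2) =
    if ε = 0 then 1 else 0 := by
  rcases eq_or_ne ε 0 with rfl | hε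
  · simp [π.p_zero, sgn_zero]
  rw [if_neg hε]
  obtain ⟨i, hi⟩ := Finsupp.ne_iff.1 hε
  obtain ⟨α, rfl⟩ : ∃ α, ε = α + single i 1 := by
    refine ⟨ε - single i 1, (tsub_add_cancel_of_le ?_).symm⟩
    rw [Finsupp.single_le_iff]
    exact Nat.one_le_iff_ne_zero.2 hi
  refine (IsAddTorsionFree.nsmul_right_injective (Nat.succ_ne_zero (α i)) : Function.Injective
    fun a : D => (α i + 1) • a) ?_
  change (α i + 1) • _ = (α i + 1) • (0 : D)
  rw [smul_sum_decomp_add_single α i fun a b => sgn b • (π.p a * π.p b), smul_zero]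
  refine Finset.sum_eq_zero fun q _ => ?_
  have h₁ : (q.1 i + 1) • (sgn q.2 • (π.p (q.1 + single i 1) * π.p q.2)) =
      sgn q.2 • (d i * π.p q.1 * π.p q.2) := by
    rw [smul_comm, π.mul_p, smul_mul_assoc]
  have h₂ : (q.2 i + 1) • (sgn (q.2 + single i 1) •
      (π.p q.1 * π.p (q.2 + single i 1))) = -(sgn q.2 • (d i * π.p q.1 * π.p q.2)) := by
    rw [smul_comm, sgn_add_single, ← mul_smul_comm, ← π.mul_p, (π.comm i q.1).eq, mul_assoc]
    simp [Units.smul_def]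
  rw [h₁, h₂, add_neg_cancel]

theorem DivPow.sum_sgn' (ε : J →₀ ℕ) :
    ∑ q ∈ decomp ε, sgn q.1 • (π.p q.1 * π.p q.2) = if ε = 0 then 1 else 0 := by
  rw [← π.sum_sgn, ← sum_decomp_swap _ fun a b => sgn b • (π.p a * π.p b)]
  refine sum_congr rfl fun q _ => ?_
  rw [(π.commute _ _).eq]

/-- Contraction with a power series `s` with coefficients in `D`. -/
def contract (s : (J →₀ ℕ) → D) : ((J →₀ ℕ) →₀ D) →ₗ[D] ((J →₀ ℕ) →₀ D) :=
  Finsupp.linearCombination D fun α =>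
    ∑ q ∈ decomp α, single q.1 (s q.2)

theorem contract_single (s : (J →₀ ℕ) → D) (α : J →₀ ℕ) (x : D) :
    contract s (single α x) =
      ∑ q ∈ decomp α, single q.1 (x * s q.2) := by
  rw [contract, Finsupp.linearCombination_single, smul_sum]
  simp_rw [Finsupp.smul_single, smul_eq_mul]

theorem contract_contract (s s' : (J →₀ ℕ) → D) (h : ∀ ε, ∑ q ∈ decomp ε,
    s q.2 * s' q.1 = if ε = 0 then 1 else 0) (v : (J →₀ ℕ) →₀ D) :
    contract s' (contract s v) = v := by
  induction v using Finsupp.induction_linear with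
  | zero => simp
  | add v w hv hw => rw [map_add, map_add, hv, hw]
  | single α x =>
    rw [contract_single, map_sum]
    simp_rw [contract_single]
    rw [sum_decomp_assoc α fun a b c => single a (x * s c * s' b)]
    have : ∀ p : (J →₀ ℕ) × (J →₀ ℕ), ∑ q ∈ decomp p.2,
        single p.1 (x * s q.2 * s' q.1) =
          single p.1 (x * if p.2 = 0 then 1 else 0) := by
      intro p
      rw [← h, mul_sum, ← Finsupp.singleAddHom_apply, map_sum]
      simp_rw [mul_assoc]
      rfl
    simp_rw [this]
    rw [Finset.sum_eq_single (α, 0)]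
    · simp
    · rintro ⟨a, b⟩ hab hne
      rw [mem_decomp] at hab
      have : b ≠ 0 := by
        rintro rfl
        exact hne (Prod.ext (by simpa using hab) rfl)
      simp [this]
    · intro h; simp at h

/-- The triangular matrix with entries `(-1) ^ |α - γ| p (α - γ)`, and its inverse with entries
`p (α - γ)`. -/
def DivPow.matrix : ((J →₀ ℕ) →₀ D) ≃ₗ[D] ((J →₀ ℕ) →₀ D) :=
  LinearEquiv.ofLinearMap (contract fun β => sgn β • π.p β) (contract π.p)
    (LinearMap.ext fun v => contract_contract π.p (fun β => sgn β • π.p β) (fun ε => by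
      rw [← π.sum_sgn']
      refine sum_congr rfl fun q _ => ?_
      rw [mul_smul_comm, (π.commute _ _).eq]) v)
    (LinearMap.ext fun v => contract_contract (fun β => sgn β • π.p β) π.p (fun ε => by
      rw [← π.sum_sgn]
      refine sum_congr rfl fun q _ => ?_
      rw [smul_mul_assoc, (π.commute _ _).eq]) v)

theorem DivPow.matrix_single (α : J →₀ ℕ) : π.matrix (single α 1) =
    ∑ q ∈ decomp α, single q.1 (sgn q.2 • π.p q.2) := by
  have h : π.matrix (single α 1) =
    contract (fun β => sgn β • π.p β) (single α 1) := rfl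
  rw [h, contract_single]
  simp_rw [one_mul]

end DivPow

/-! ### Existence of divided powers -/

section Exists
variable {J : Type} [DecidableEq J] {D : Type*} [Ring D] [Algebra ℚ D]

/-- Divided powers of commuting elements exist in algebras over the rational numbers. -/
theorem exists_divPow (d : J → D) (hd : ∀ i k, d i * d k = d k * d i) : Nonempty (DivPow d) := by
  have hc : ∀ a ∈ Set.range d, ∀ b ∈ Set.range d, a * b = b * a := by
    rintro _ ⟨i, rfl⟩ _ ⟨k, rfl⟩; exact hd i k
  have := Algebra.isMulCommutative_adjoin ℚ hc
  let _ : CommRing (Algebra.adjoin ℚ (Set.range d)) :=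
    { (Subalgebra.toRing _ : Ring (Algebra.adjoin ℚ (Set.range d))) with
      mul_comm := fun a b => Subtype.ext (setLike_mul_comm a.2 b.2) }
  let d' : J → Algebra.adjoin ℚ (Set.range d) := fun i => ⟨d i, Algebra.subset_adjoin ⟨i, rfl⟩⟩
  let φ : MvPolynomial J ℚ →ₐ[ℚ] Algebra.adjoin ℚ (Set.range d) := MvPolynomial.aeval d'
  let c : (J →₀ ℕ) → ℚ := fun α => (α.prod fun _ n => (n.factorial : ℚ))⁻¹
  have hφ : ∀ i, φ (MvPolynomial.X i) = d' i := fun i => MvPolynomial.aeval_X _ _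
  have hcα : ∀ i α, c α = (α i + 1 : ℕ) * c (α + single i 1) := by
    intro i α
    have h₁ : (α + single i 1).prod (fun _ n => (n.factorial : ℚ)) =
        (α i + 1 : ℕ) * α.prod fun _ n => (n.factorial : ℚ) := by
      have e₁ := Finsupp.mul_prod_erase' (α + single i 1) i
        (fun _ n => (n.factorial : ℚ)) (fun _ => by simp)
      have e₂ := Finsupp.mul_prod_erase' α i (fun _ n => (n.factorial : ℚ)) (fun _ => by simp)
      rw [← e₁, ← e₂, Finsupp.erase_add, Finsupp.erase_single, add_zero]
      simp [Nat.factorial_succ, mul_assoc]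
    have h₂ : ((α i + 1 : ℕ) : ℚ) ≠ 0 := Nat.cast_ne_zero.2 (Nat.succ_ne_zero _)
    simp only [c]
    rw [h₁, mul_inv, mul_inv_cancel_left₀ h₂]
  refine ⟨⟨fun α => (φ (MvPolynomial.monomial α (c α)) : D), ?_, fun i α => ?_, fun i α => ?_⟩⟩
  · have : MvPolynomial.monomial (0 : J →₀ ℕ) (c 0) = 1 := by simp [c]
    rw [this, map_one]; rfl
  · have h : MvPolynomial.X i * MvPolynomial.monomial α (c α) =
        (α i + 1) • MvPolynomial.monomial (α + single i 1)
          (c (α + single i 1)) := by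
      rw [MvPolynomial.X, MvPolynomial.monomial_mul, one_mul, ← map_nsmul, add_comm, hcα i α,
        nsmul_eq_mul]
    have h' := congrArg (fun P => (φ P : D)) h
    simp only [map_mul, hφ, map_nsmul] at h'
    exact h'
  · have h := congrArg (fun P => (φ P : D))
      (mul_comm (MvPolynomial.X i) (MvPolynomial.monomial α (c α)))
    simp only [map_mul, hφ] at h
    exact h

end Exists

/-! ### Values of functions -/

section Values

/-- The value of a function at a point. -/
def valAt (z : U) : 𝒪[𝒢] U →+* K :=
  (Pi.evalRingHom (fun _ => K) z).comp (germSub 𝒢 U).val.toRingHom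

theorem valAt_rres (h : V ≤ U) (z : V) (f : 𝒪[𝒢] U) :
    valAt z (rres _ h f) = valAt ⟨z.1, h z.2⟩ f := rfl

theorem valAt_scalar (z : U) (k : K) :
    valAt z ((germSheaf 𝒢).scalar U k) = k := rfl

theorem valAt_ext {f g : 𝒪[𝒢] U}
    (h : ∀ z : U, valAt z f = valAt z g) : f = g := Subtype.ext (funext h)

instance [IsAddTorsionFree K] (U : Opens X) : IsAddTorsionFree (𝒪[𝒢] U) where
  nsmul_right_injective n hn f g h := valAt_ext fun z => by
    have := congrArg (valAt z) h
    simp only [map_nsmul] at this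
    exact IsAddTorsionFree.nsmul_right_injective hn this

/-- The inclusion of one sheaf of functions in another one. -/
def germIncl (hle : ∀ x, 𝒢' x ≤ 𝒢 x) (U : Opens X) :
    𝒪[𝒢'] U →+* 𝒪[𝒢] U where
  toFun f := (⟨fn 𝒢' f, fun x => by
    obtain ⟨g, hg, V, hV, e⟩ := (show germSub 𝒢' U from f).2 x
    exact ⟨g, hle _ hg, V, hV, e⟩⟩ : germSub 𝒢 U)
  map_one' := rfl
  map_mul' _ _ := rfl
  map_zero' := rfl
  map_add' _ _ := rfl

variable (hle : ∀ x, 𝒢' x ≤ 𝒢 x)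

theorem valAt_germIncl (z : U) (f : 𝒪[𝒢'] U) :
    valAt z (germIncl hle U f) = valAt z f := rfl

theorem rres_germIncl (h : V ≤ U) (f : 𝒪[𝒢'] U) :
    rres _ h (germIncl hle U f) = germIncl hle V (rres _ h f) := rfl

theorem germIncl_scalar (k : K) :
    germIncl hle U ((germSheaf 𝒢').scalar U k) = (germSheaf 𝒢).scalar U k := rfl

theorem germIncl_self (h : ∀ x, 𝒢 x ≤ 𝒢 x) (f : 𝒪[𝒢] U) :
    germIncl h U f = f := rfl

end Values

/-! ### The algebra of differential operators -/

section ScalarD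
variable [CommSheaf O.ring]

theorem DSec.ev_scalar_mul (d : 𝒟[O] U) (h : V ≤ U) (k : K)
    (f : rsec O.ring V) : d.ev h (O.scalar V k * f) = O.scalar V k * d.ev h f :=
  d.2.linear V h _ _ f ⟨k, rfl, rfl⟩

theorem mulOp_ev (h : V ≤ U) (o : rsec O.ring U) (f : rsec O.ring V) :
    (mulOp O.ring O.selfLin U o).ev h f = rres O.ring h o * f := rfl

/-- The operators on an open subset are an algebra over the scalars. -/
instance (U : Opens X) : Algebra K (𝒟[O] U) :=
  ((mulOp O.ring O.selfLin U).comp (O.scalar U)).toAlgebra' fun k d => DSec.ext fun V h f => by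
    rw [DSec.mul_ev, DSec.mul_ev]
    change rres O.ring h (O.scalar U k) * d.ev h f = d.ev h (rres O.ring h (O.scalar U k) * f)
    rw [O.scalar_res, DSec.ev_scalar_mul]

/-- The value of an operator on a section, as an additive map in the operator. -/
def DSec.evHom (h : V ≤ U) (f : rsec O.ring V) :
    𝒟[O] U →+ rsec O.ring V :=
  AddMonoidHom.mk' (fun d => d.ev h f) fun _ _ => rfl

theorem DSec.evHom_apply (h : V ≤ U) (f : rsec O.ring V)
    (d : 𝒟[O] U) : DSec.evHom h f d = d.ev h f := rfl

theorem DSec.ev_add (d : 𝒟[O] U) (h : V ≤ U)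
    (f g : rsec O.ring V) : d.ev h (f + g) = d.ev h f + d.ev h g := map_add (d.1 ⟨V, h⟩) f g

/-- The value of an operator on a section, as an additive map in the section. -/
def DSec.homEv (d : 𝒟[O] U) (h : V ≤ U) :
    rsec O.ring V →+ rsec O.ring V :=
  AddMonoidHom.mk' (fun f => d.ev h f) (d.ev_add h)

theorem DSec.homEv_apply (d : 𝒟[O] U) (h : V ≤ U)
    (f : rsec O.ring V) : d.homEv h f = d.ev h f := rfl

theorem DSec.rres_ev (d : 𝒟[O] U) (h : V ≤ U) (hW : W ≤ V)
    (f : rsec O.ring V) : rres O.ring hW (d.ev h f) = d.ev (hW.trans h) (rres O.ring hW f) :=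
  d.2.natural V W h hW f

theorem DSec.IsDer.ev_one {d : 𝒟[O] U} (hd : d.IsDer) (h : V ≤ U) :
    d.ev h 1 = 0 := by
  have := hd V h 1 1
  rw [mul_one, mul_one, one_mul] at this
  exact left_eq_add.1 this

theorem DSec.IsDer.ev_scalar {d : 𝒟[O] U} (hd : d.IsDer)
    (h : V ≤ U) (k : K) : d.ev h (O.scalar V k) = 0 := by
  rw [← mul_one (O.scalar V k), DSec.ev_scalar_mul, hd.ev_one, mul_zero]

theorem DSec.IsDer.commutator {d d' : 𝒟[O] U} (hd : d.IsDer)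
    (hd' : d'.IsDer) : (d * d' - d' * d).IsDer := fun V h f g => by
  have key : ∀ f, (d * d' - d' * d).ev h f = d.ev h (d'.ev h f) - d'.ev h (d.ev h f) :=
    fun f => map_sub (DSec.evHom h f) _ _
  rw [key, key, key, hd' V h f g, hd V h f g, DSec.ev_add, DSec.ev_add, hd V h, hd V h, hd' V h,
    hd' V h]
  ring

instance [IsAddTorsionFree K] {𝒢 : X → Subalgebra K (X → K)} (U : Opens X) :
    IsAddTorsionFree (𝒟[germSheaf 𝒢] U) where
  nsmul_right_injective n hn d d' h := DSec.ext fun V hV f => by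
    have := congrArg (DSec.evHom hV f) h
    simp only [map_nsmul] at this
    exact IsAddTorsionFree.nsmul_right_injective hn this

end ScalarD

/-! ### The Leibniz rule -/

section Leibniz
variable [CommSheaf O.ring] {J : Type} [DecidableEq J] {d : J → 𝒟[O] U}

theorem sgn_add (α β : J →₀ ℕ) : sgn (α + β) = sgn α * sgn β := by
  simp [sgn, pow_add]

variable [∀ V : Opens X, IsAddTorsionFree (rsec O.ring V)]

/-- The Leibniz rule for the divided powers of commuting derivations. -/
theorem DivPow.leibniz (π : DivPow d) (hd : ∀ i, (d i).IsDer) (α : J →₀ ℕ)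
    (h : V ≤ U) (f g : rsec O.ring V) : (π.p α).ev h (f * g) =
      ∑ q ∈ decomp α, (π.p q.1).ev h f * (π.p q.2).ev h g := by
  induction α using multiIndex_induction with
  | zero =>
    have : decomp (0 : J →₀ ℕ) = {(0, 0)} := by
      ext ⟨a, b⟩; simp
    rw [this, Finset.sum_singleton, π.p_zero]; rfl
  | add α i ih =>
    have hs : ∀ β (f : rsec O.ring V), (d i).ev h ((π.p β).ev h f) =
        (β i + 1) • (π.p (β + single i 1)).ev h f := fun β f => by
      have := congrArg (DSec.evHom h f) (π.mul_p i β)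
      rwa [map_nsmul] at this
    refine IsAddTorsionFree.nsmul_right_injective (Nat.succ_ne_zero (α i)) ?_
    change (α i + 1) • _ = (α i + 1) • _
    rw [smul_sum_decomp_add_single α i fun a b => (π.p a).ev h f * (π.p b).ev h g, ← hs, ih,
      ← DSec.homEv_apply, map_sum]
    refine sum_congr rfl fun q _ => ?_
    rw [DSec.homEv_apply, hd i V h, hs, hs, smul_mul_assoc, mul_smul_comm]

theorem DSec.unit_smul_ev (h : V ≤ U) (s : ℤˣ) (a : 𝒟[O] U)
    (f : rsec O.ring V) : (s • a).ev h f = s • a.ev h f := by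
  rcases Int.units_eq_one_or s with rfl | rfl
  · rw [one_smul, one_smul]
  · rw [Units.neg_smul, Units.neg_smul, one_smul, one_smul]; rfl

/-- The formula for the product of a function `f` with the operator `(-1) ^ |α| p α`, as a sum of
compositions of operators with the multiplication by derivatives of `f`. -/
theorem DivPow.mul_sgn_ev [IsAddTorsionFree (𝒟[O] U)] (π : DivPow d)
    (hd : ∀ i, (d i).IsDer) (α : J →₀ ℕ) (h : V ≤ U) (f g : rsec O.ring V) :
    f * (sgn α • π.p α).ev h g =
      ∑ q ∈ decomp α, (sgn q.2 • π.p q.2).ev h ((π.p q.1).ev h f * g) := by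
  symm
  calc _ = ∑ p ∈ decomp α, ∑ q ∈ decomp p.2,
        sgn (q.1 + q.2) • ((π.p q.1).ev h ((π.p p.1).ev h f) * (π.p q.2).ev h g) := by
        refine sum_congr rfl fun p _ => ?_
        rw [DSec.unit_smul_ev, π.leibniz hd _ h, smul_sum]
        refine sum_congr rfl fun q hq => ?_
        rw [mem_decomp.1 hq]
    _ = ∑ p ∈ decomp α, (∑ q ∈ decomp p.1, sgn q.2 • (π.p q.1 * π.p q.2)).ev h f *
        (sgn p.2 • π.p p.2).ev h g := by
        rw [← sum_decomp_assoc α fun a b c =>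
          sgn (b + c) • ((π.p b).ev h ((π.p a).ev h f) * (π.p c).ev h g)]
        refine sum_congr rfl fun p _ => ?_
        rw [← DSec.evHom_apply h f, map_sum, sum_mul]
        refine sum_congr rfl fun q _ => ?_
        rw [DSec.evHom_apply, DSec.unit_smul_ev, DSec.unit_smul_ev, smul_mul_smul_comm, sgn_add,
          (π.commute _ _).eq]
        rfl
    _ = _ := by
        simp_rw [π.sum_sgn]
        rw [Finset.sum_eq_single (0, α)]
        · rw [if_pos rfl]; rfl
        · rintro ⟨a, b⟩ hab hne
          rw [mem_decomp] at hab
          have : a ≠ 0 := by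
            rintro rfl
            exact hne (Prod.ext rfl (by simpa using hab))
          rw [if_neg this]
          exact zero_mul ((sgn b • π.p b).ev h g)
        · intro h; simp at h

end Leibniz

/-! ### Coordinates and the Taylor formula -/

section Chart

theorem multiIndex_cases {J : Type} [DecidableEq J] (α : J →₀ ℕ) :
    α = 0 ∨ ∃ β i, α = β + single i 1 := by
  induction α using multiIndex_induction with
  | zero => exact .inl rfl
  | add α i _ => exact .inr ⟨α, i, rfl⟩

theorem multiIndex_add_single_ne_zero {J : Type} [DecidableEq J] (α : J →₀ ℕ) (i : J) :
    α + single i 1 ≠ 0 := fun h => by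
  have := DFunLike.congr_fun h i
  simp at this

/-- Hadamard's lemma: a function in the sheaf given by `𝒢'` is, near `z`, the sum of a constant and
of the products of the functions `xᵢ - xᵢ(z)` with functions in that sheaf. -/
def IsHadamard (𝒢' : X → Subalgebra K (X → K)) {J : Type} [Fintype J]
    (x : J → 𝒪[𝒢'] U₀) : Prop :=
  ∀ V (hV : V ≤ U₀) (f : 𝒪[𝒢'] V) (z : V),
    ∃ (W : Opens X) (hW : W ≤ V) (g : J → 𝒪[𝒢'] W), z.1 ∈ W ∧
      rres _ hW f = (germSheaf 𝒢').scalar W (valAt z f) +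
        ∑ i, (rres _ (hW.trans hV) (x i) -
          (germSheaf 𝒢').scalar W (valAt z (rres _ hV (x i)))) * g i

/-- A system of coordinates over `U₀` for the sheaf of functions given by `𝒢'`: functions `x i`
satisfying Hadamard's lemma and the divided powers of commuting derivations `d i` dual to them. The
derivations act on a possibly larger sheaf of functions, given by `𝒢`. -/
structure Chart (hle : ∀ x, 𝒢' x ≤ 𝒢 x) (U₀ : Opens X) where
  J : Type
  [fintype : Fintype J]
  [dec : DecidableEq J]
  x : J → 𝒪[𝒢'] U₀
  d : J → 𝒟[germSheaf 𝒢] U₀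
  der : ∀ i, (d i).IsDer
  d_x : ∀ i k, (d i).ev le_rfl (germIncl hle U₀ (x k)) = if i = k then 1 else 0
  π : DivPow d
  hadamard : IsHadamard 𝒢' x

attribute [instance] Chart.fintype Chart.dec

variable (c : Chart hle U₀)

/-- The function `xᵢ - xᵢ(z)`. -/
def Chart.u (hV : V ≤ U₀) (z : V) (i : c.J) : 𝒪[𝒢'] V :=
  rres _ hV (c.x i) - (germSheaf 𝒢').scalar V (valAt z (rres _ hV (c.x i)))

/-- The substitution of the functions `xᵢ - xᵢ(z)` in polynomials. -/
def Chart.poly (hV : V ≤ U₀) (z : V) :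
    MvPolynomial c.J K →+* 𝒪[𝒢'] V :=
  MvPolynomial.eval₂Hom ((germSheaf 𝒢').scalar V) (c.u hV z)

/-- The monomial `∏ (xᵢ - xᵢ(z)) ^ γᵢ`. -/
def Chart.mono (hV : V ≤ U₀) (z : V) (γ : c.J →₀ ℕ) : 𝒪[𝒢'] V :=
  c.poly hV z (MvPolynomial.monomial γ 1)

theorem Chart.poly_monomial (hV : V ≤ U₀) (z : V) (γ : c.J →₀ ℕ) (k : K) :
    c.poly hV z (MvPolynomial.monomial γ k) = (germSheaf 𝒢').scalar V k * c.mono hV z γ := by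
  rw [Chart.mono, ← mul_one k, ← MvPolynomial.C_mul_monomial, map_mul, mul_one]
  congr 1
  exact MvPolynomial.eval₂Hom_C _ _ _

theorem Chart.mono_zero (hV : V ≤ U₀) (z : V) : c.mono hV z 0 = 1 :=
  (c.poly hV z).map_one

theorem Chart.mono_add_single (hV : V ≤ U₀) (z : V) (γ : c.J →₀ ℕ) (i : c.J) :
    c.mono hV z (γ + single i 1) = c.mono hV z γ * c.u hV z i := by
  rw [Chart.mono, MvPolynomial.monomial_add_single, pow_one, map_mul]
  congr 1
  exact MvPolynomial.eval₂Hom_X' _ _ _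

theorem Chart.rres_poly (hV : V ≤ U₀) (hW : W ≤ V) (z : W)
    (P : MvPolynomial c.J K) :
    rres _ hW (c.poly hV ⟨z.1, hW z.2⟩ P) = c.poly (hW.trans hV) z P := by
  refine DFunLike.congr_fun (f := (rres _ hW).comp (c.poly hV ⟨z.1, hW z.2⟩))
    (MvPolynomial.ringHom_ext (fun k => ?_) fun i => ?_) P
  · rw [RingHom.comp_apply, Chart.poly, Chart.poly, MvPolynomial.eval₂Hom_C,
      MvPolynomial.eval₂Hom_C]
    rfl
  · rw [RingHom.comp_apply, Chart.poly, Chart.poly, MvPolynomial.eval₂Hom_X',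
      MvPolynomial.eval₂Hom_X']
    rfl

theorem Chart.rres_mono (hV : V ≤ U₀) (hW : W ≤ V) (z : W) (γ : c.J →₀ ℕ) :
    rres _ hW (c.mono hV ⟨z.1, hW z.2⟩ γ) = c.mono (hW.trans hV) z γ := c.rres_poly hV hW z _

/-- The ideal of functions that vanish at `z`. -/
def vanIdeal (𝒢' : X → Subalgebra K (X → K)) (z : V) :
    Ideal (𝒪[𝒢'] V) := RingHom.ker (valAt z)

theorem map_vanIdeal_pow_le (hW : W ≤ V) (z : W) (N : ℕ) :
    (vanIdeal 𝒢' (⟨z.1, hW z.2⟩ : V) ^ N).map (rres (germSheaf 𝒢').ring hW) ≤ vanIdeal 𝒢'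
      z ^ N := by
  rw [Ideal.map_pow]
  refine Ideal.pow_right_mono (Ideal.map_le_iff_le_comap.2 fun f hf => ?_) N
  exact hf

theorem Chart.u_mem (hV : V ≤ U₀) (z : V) (i : c.J) :
    c.u hV z i ∈ vanIdeal 𝒢' z := by
  change valAt z (c.u hV z i) = 0
  rw [Chart.u, map_sub, valAt_scalar, sub_self]

theorem Chart.mono_mem (hV : V ≤ U₀) (z : V) (γ : c.J →₀ ℕ) :
    c.mono hV z γ ∈ vanIdeal 𝒢' z ^ γ.degree := by
  induction γ using multiIndex_induction with
  | zero => simp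
  | add γ i ih =>
    rw [c.mono_add_single, map_add, Finsupp.degree_single, pow_add, pow_one]
    exact Ideal.mul_mem_mul ih (c.u_mem hV z i)

/-- The Taylor formula: modulo a power of the ideal of functions vanishing at `z`, functions are
polynomials near `z`. -/
theorem Chart.exists_taylor (N : ℕ) (hV : V ≤ U₀) (f : 𝒪[𝒢'] V)
    (z : V) : ∃ (W : Opens X) (hW : W ≤ V) (hz : z.1 ∈ W) (P : MvPolynomial c.J K),
      rres _ hW f - c.poly (hW.trans hV) ⟨z.1, hz⟩ P ∈ vanIdeal 𝒢' (⟨z.1, hz⟩ : W) ^ N := by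
  induction N generalizing V with
  | zero => exact ⟨V, le_rfl, z.2, 0, by simp⟩
  | succ N ih =>
    obtain ⟨W, hW, g, hz, e⟩ := c.hadamard V hV f z
    choose W' hW' hz' P hP using fun i => ih (hW.trans hV) (g i) ⟨z.1, hz⟩
    let W₁ : Opens X := Finset.univ.inf W' ⊓ W
    have h₁ : ∀ i, W₁ ≤ W' i := fun i => inf_le_left.trans (Finset.inf_le (Finset.mem_univ i))
    have hz₁ : z.1 ∈ W₁ := by
      refine ⟨?_, hz⟩
      change z.1 ∈ Finset.univ.inf W'
      rw [← SetLike.mem_coe, Opens.coe_finset_inf]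
      simpa using hz'
    have h₂ : W₁ ≤ W := inf_le_right
    refine ⟨W₁, h₂.trans hW, hz₁, MvPolynomial.C (valAt z f) + ∑ i, MvPolynomial.X i * P i, ?_⟩
    have e₁ : rres _ (h₂.trans hW) f - c.poly ((h₂.trans hW).trans hV) ⟨z.1, hz₁⟩
        (MvPolynomial.C (valAt z f) + ∑ i, MvPolynomial.X i * P i) =
        ∑ i, c.u ((h₂.trans hW).trans hV) ⟨z.1, hz₁⟩ i *
          rres _ (h₁ i) (rres _ (hW' i) (g i) -
            c.poly (((hW' i).trans hW).trans hV) ⟨z.1, hz' i⟩ (P i)) := by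
      have e₂ := congrArg (rres (germSheaf 𝒢').ring h₂) e
      rw [rres_rres, map_add, map_sum] at e₂
      have e₃ : c.poly ((h₂.trans hW).trans hV) ⟨z.1, hz₁⟩
          (MvPolynomial.C (valAt z f) + ∑ i, MvPolynomial.X i * P i) =
          (germSheaf 𝒢').scalar W₁ (valAt z f) +
          ∑ i, c.u ((h₂.trans hW).trans hV) ⟨z.1, hz₁⟩ i *
            c.poly ((h₂.trans hW).trans hV) ⟨z.1, hz₁⟩ (P i) := by
        rw [map_add, map_sum]
        congr 1
        · exact MvPolynomial.eval₂Hom_C _ _ _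
        · refine sum_congr rfl fun i _ => ?_
          rw [map_mul]
          congr 1
          exact MvPolynomial.eval₂Hom_X' _ _ _
      rw [e₂, e₃]
      have e₄ : rres (germSheaf 𝒢').ring h₂ ((germSheaf 𝒢').scalar W (valAt z f)) =
        (germSheaf 𝒢').scalar W₁ (valAt z f) := rfl
      rw [e₄, add_sub_add_left_eq_sub, ← Finset.sum_sub_distrib]
      refine sum_congr rfl fun i _ => ?_
      rw [map_sub, rres_rres, c.rres_poly _ (h₁ i) ⟨z.1, hz₁⟩, map_mul, mul_sub]
      rfl
    rw [e₁, pow_succ']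
    refine Ideal.sum_mem _ fun i _ => Ideal.mul_mem_mul (c.u_mem _ _ i) ?_
    exact map_vanIdeal_pow_le (h₁ i) ⟨z.1, hz₁⟩ N (Ideal.mem_map_of_mem _ (hP i))

section TaylorSeries
variable [IsAddTorsionFree K]

theorem Chart.p_ev_d (γ : c.J →₀ ℕ) (i : c.J) (hV : V ≤ U₀)
    (f : 𝒪[𝒢] V) : (c.π.p γ).ev hV ((c.d i).ev hV f) =
      (γ i + 1) • (c.π.p (γ + single i 1)).ev hV f := by
  have := congrArg (DSec.evHom hV f) ((c.π.comm i γ).symm.eq.trans (c.π.mul_p i γ))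
  rwa [map_nsmul] at this

/-- The Taylor series at `z`. -/
def Chart.taylor (hV : V ≤ U₀) (z : V) :
    𝒪[𝒢'] V →+* MvPowerSeries c.J K where
  toFun f γ := valAt z ((c.π.p γ).ev hV (germIncl hle V f))
  map_one' := by
    funext γ
    change valAt z ((c.π.p γ).ev hV (germIncl hle V 1)) = MvPowerSeries.coeff γ 1
    rw [MvPowerSeries.coeff_one, map_one]
    rcases multiIndex_cases γ with rfl | ⟨β, i, rfl⟩
    · rw [if_pos rfl, c.π.p_zero]; rfl
    · rw [if_neg (multiIndex_add_single_ne_zero β i)]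
      have := c.p_ev_d β i hV 1
      rw [(c.der i).ev_one, ← DSec.homEv_apply, map_zero] at this
      have h := (smul_eq_zero_iff_right (Nat.succ_ne_zero (β i))).1 this.symm
      rw [h, map_zero]
  map_mul' f g := by
    funext γ
    refine Eq.trans ?_ (MvPowerSeries.coeff_mul (R := K) γ _ _).symm
    rw [map_mul, c.π.leibniz c.der, map_sum]
    exact sum_congr rfl fun q _ => map_mul _ _ _
  map_zero' := by
    funext γ
    change valAt z ((c.π.p γ).homEv hV (germIncl hle V 0)) = 0
    rw [map_zero, map_zero, map_zero]
  map_add' f g := by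
    funext γ
    change valAt z ((c.π.p γ).homEv hV (germIncl hle V (f + g))) = _
    rw [map_add, map_add, map_add]
    rfl

theorem Chart.coeff_taylor (hV : V ≤ U₀) (z : V) (γ : c.J →₀ ℕ)
    (f : 𝒪[𝒢'] V) : MvPowerSeries.coeff γ (c.taylor hV z f) =
      valAt z ((c.π.p γ).ev hV (germIncl hle V f)) := rfl

theorem Chart.taylor_scalar (hV : V ≤ U₀) (z : V) (k : K) :
    c.taylor hV z ((germSheaf 𝒢').scalar V k) = MvPowerSeries.C k := by
  ext γ
  rw [c.coeff_taylor, germIncl_scalar, ← mul_one ((germSheaf 𝒢).scalar V k), DSec.ev_scalar_mul,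
    map_mul, valAt_scalar, ← map_one (germIncl hle V), ← c.coeff_taylor, map_one,
    MvPowerSeries.coeff_one, MvPowerSeries.coeff_C]
  split <;> simp

theorem Chart.taylor_u (hV : V ≤ U₀) (z : V) (i : c.J) :
    c.taylor hV z (c.u hV z i) = MvPowerSeries.X i := by
  ext γ
  rcases multiIndex_cases γ with rfl | ⟨β, k, rfl⟩
  · rw [c.coeff_taylor, c.π.p_zero, MvPowerSeries.coeff_zero_X]
    exact c.u_mem hV z i
  · have h₁ : (c.d k).ev hV (germIncl hle V (c.u hV z i)) = if k = i then 1 else 0 := by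
      have h₂ := congrArg (rres (germSheaf 𝒢).ring hV) (c.d_x k i)
      rw [DSec.rres_ev] at h₂
      rw [← DSec.homEv_apply, Chart.u, map_sub, map_sub, germIncl_scalar, DSec.homEv_apply,
        DSec.homEv_apply, (c.der k).ev_scalar, sub_zero]
      refine h₂.trans ?_
      split
      · exact map_one _
      · exact map_zero _
    have h₂ := c.p_ev_d β k hV (germIncl hle V (c.u hV z i))
    have h₃ : valAt z ((c.π.p β).ev hV ((c.d k).ev hV (germIncl hle V (c.u hV z i)))) =
        if k = i ∧ β = 0 then 1 else 0 := by
      rw [h₁]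
      by_cases hk : k = i
      · rw [if_pos hk, ← map_one (germIncl hle V), ← c.coeff_taylor, map_one,
          MvPowerSeries.coeff_one]
        simp [hk]
      · rw [if_neg hk, ← DSec.homEv_apply, map_zero, map_zero, if_neg fun h => hk h.1]
    rw [h₂, map_nsmul, ← c.coeff_taylor] at h₃
    refine IsAddTorsionFree.nsmul_right_injective (Nat.succ_ne_zero (β k)) ?_
    change (β k + 1) • _ = (β k + 1) • _
    rw [h₃, MvPowerSeries.coeff_X]
    by_cases hk : k = i ∧ β = 0
    · obtain ⟨rfl, rfl⟩ := hk
      simp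
    · rw [if_neg hk, if_neg, smul_zero]
      intro h
      refine hk ?_
      have h₄ := congrArg Finsupp.degree h
      rw [map_add, Finsupp.degree_single, Finsupp.degree_single] at h₄
      have h₅ : β = 0 := by
        rw [← Finsupp.degree_eq_zero_iff]; omega
      subst h₅
      rw [zero_add] at h
      exact ⟨Finsupp.single_left_injective one_ne_zero h, rfl⟩

theorem Chart.taylor_poly (hV : V ≤ U₀) (z : V) (P : MvPolynomial c.J K) :
    c.taylor hV z (c.poly hV z P) = (P : MvPowerSeries c.J K) := by
  refine DFunLike.congr_fun (f := (c.taylor hV z).comp (c.poly hV z))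
    (g := MvPolynomial.coeToMvPowerSeries.ringHom)
    (MvPolynomial.ringHom_ext (fun k => ?_) fun i => ?_) P
  · rw [RingHom.comp_apply, Chart.poly, MvPolynomial.eval₂Hom_C, c.taylor_scalar]
    exact (MvPolynomial.coe_C k).symm
  · rw [RingHom.comp_apply, Chart.poly, MvPolynomial.eval₂Hom_X', c.taylor_u]
    exact (MvPolynomial.coe_X i).symm

/-- Derivatives of order less than `N` of the elements of the `N`-th power of the ideal of functions
vanishing at `z` vanish at `z`. -/
theorem Chart.coeff_taylor_eq_zero (hV : V ≤ U₀) (z : V) {N : ℕ}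
    {f : 𝒪[𝒢'] V} (hf : f ∈ vanIdeal 𝒢' z ^ N) {γ : c.J →₀ ℕ}
    (hγ : γ.degree < N) : MvPowerSeries.coeff γ (c.taylor hV z f) = 0 := by
  induction N generalizing f γ with
  | zero => exact absurd hγ (Nat.not_lt_zero _)
  | succ N ih =>
    rw [pow_succ'] at hf
    refine Submodule.mul_induction_on hf (fun a ha b hb => ?_) (fun a b ha hb => ?_)
    · rw [map_mul, MvPowerSeries.coeff_mul]
      refine Finset.sum_eq_zero fun q hq => ?_
      rw [mem_decomp] at hq
      by_cases h0 : q.1 = 0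
      · have : MvPowerSeries.coeff q.1 (c.taylor hV z a) = 0 := by
          rw [h0, c.coeff_taylor, c.π.p_zero]
          exact ha
        rw [this, zero_mul]
      · rw [ih hb, mul_zero]
        have h₁ := congrArg Finsupp.degree hq
        rw [map_add] at h₁
        have h₂ : q.1.degree ≠ 0 := fun h => h0 ((Finsupp.degree_eq_zero_iff _).1 h)
        omega
    · rw [map_add, map_add, ha, hb, add_zero]

/-- The functions `(x - x(z)) ^ γ` and the operators `p δ` are dual to each other at `z`. -/
theorem Chart.p_mono (hV : V ≤ U₀) (z : V) (γ δ : c.J →₀ ℕ) :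
    valAt z ((c.π.p δ).ev hV (germIncl hle V (c.mono hV z γ))) = if δ = γ then 1 else 0 := by
  rw [← c.coeff_taylor, Chart.mono, c.taylor_poly, MvPolynomial.coeff_coe,
    MvPolynomial.coeff_monomial]
  simp [eq_comm]

end TaylorSeries

/-- The values of the functions `(x - x(z)) ^ γ`, as functions also of `z`, are finite sums of
products of a function of `z` and a function. -/
theorem Chart.exists_coef (γ : c.J →₀ ℕ) : ∃ (m : ℕ) (o : Fin m → 𝒪[𝒢] U₀)
    (f : Fin m → 𝒪[𝒢'] U₀), ∀ V (hV : V ≤ U₀) (z : V),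
      c.mono hV z γ = ∑ j, (germSheaf 𝒢').scalar V (valAt z (rres _ hV (o j))) *
        rres _ hV (f j) := by
  induction γ using multiIndex_induction with
  | zero =>
    refine ⟨1, fun _ => 1, fun _ => 1, fun V hV z => ?_⟩
    simp only [map_one, mul_one, Finset.sum_const, Finset.card_univ, Fintype.card_fin, one_smul]
    exact c.mono_zero hV z
  | add γ i ih =>
    obtain ⟨m, o, f, h⟩ := ih
    refine ⟨m + m, Fin.append o fun j => -(o j * germIncl hle U₀ (c.x i)),
      Fin.append (fun j => f j * c.x i) f, fun V hV z => ?_⟩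
    rw [c.mono_add_single, h, Chart.u, mul_sub, Fin.sum_univ_add]
    simp only [Fin.append_left, Fin.append_right]
    rw [sum_mul, sum_mul, sub_eq_add_neg, ← Finset.sum_neg_distrib]
    congr 1
    · refine sum_congr rfl fun j _ => ?_
      rw [map_mul, mul_assoc]
    · refine sum_congr rfl fun j _ => ?_
      rw [map_neg, map_neg, map_neg, map_mul, map_mul, map_mul]
      change _ = -((germSheaf 𝒢').scalar V (valAt z (rres _ hV (o j))) *
        (germSheaf 𝒢').scalar V (valAt z (rres _ hV (c.x i)))) * _
      ring

end Chart

/-! ### Expansion of operators in coordinates -/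

section Expand
variable {con : Corr (germSheaf 𝒢').ring (germSheaf 𝒢).ring}

/-- An operator of order less than `N` sends the `N`-th power of the ideal of functions vanishing at
`z` to functions vanishing at `z`. -/
theorem valAt_eq_zero_of_orderLT (hcon : ∀ U f, con.rel U f (germIncl hle U f)) {N : ℕ}
    {φ : Fam (germSheaf 𝒢').ring (unitMod (germSheaf 𝒢).ring) V}
    (hφ : Fam.OrderLT con N V φ) (z : V) {f : 𝒪[𝒢'] V}
    (hf : f ∈ vanIdeal 𝒢' z ^ N) : valAt z (toUnit _ V (φ ⟨V, le_rfl⟩ f)) = 0 := by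
  induction N generalizing φ f with
  | zero =>
    rw [show φ = 0 from hφ]
    exact map_zero (valAt z)
  | succ N ih =>
    rw [pow_succ'] at hf
    refine Submodule.mul_induction_on hf (fun a ha b hb => ?_) (fun a b ha hb => ?_)
    · have h := ih (hφ V le_rfl a _ (hcon V a)) hb
      have h₁ : valAt z (germIncl hle V a * toUnit _ V (φ ⟨V, le_rfl⟩ b) -
        toUnit _ V (φ ⟨V, le_rfl⟩ (a * b))) = 0 := h
      rw [map_sub, map_mul, valAt_germIncl, show valAt z a = 0 from ha, zero_mul, zero_sub,
        neg_eq_zero] at h₁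
      exact h₁
    · rw [map_add, map_add, map_add, ha, hb, add_zero]

theorem lev_scalar_mul {O S : AlgSheaf K X} [CommSheaf O.ring] {con : Corr S.ring O.ring}
    (h : V ≤ U) (a : msec (AMod O S con) U) (k : K) (f : rsec S.ring V) :
    lev h a (S.scalar V k * f) = O.scalar V k * lev h a f :=
  (show diffOps (unitMod O.ring) (S.lin O) con U from a).2.linear V h _ _ f ⟨k, rfl, rfl⟩

/-- The value of an operator as an additive map in the section. -/
def homLev {O S : AlgSheaf K X} [CommSheaf O.ring] {con : Corr S.ring O.ring}
    (h : V ≤ U) (a : msec (AMod O S con) U) : rsec S.ring V →+ rsec O.ring V :=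
  AddMonoidHom.mk' (fun f => lev h a f) (lev_add_right h a)

theorem homLev_apply {O S : AlgSheaf K X} [CommSheaf O.ring] {con : Corr S.ring O.ring}
    (h : V ≤ U) (a : msec (AMod O S con) U) (f : rsec S.ring V) :
    homLev h a f = lev h a f := rfl

variable [IsAddTorsionFree K] (c : Chart hle U₀)

/-- The value at `z` of an operator of order less than `N`, in terms of the derivatives of order
less than `N` and of the values of the operator on the functions `(x - x(z)) ^ γ`. -/
theorem Chart.valAt_lev (hcon : ∀ U f, con.rel U f (germIncl hle U f)) {N : ℕ}
    (hV : V ≤ U₀) (a : msec (AMod (germSheaf 𝒢) (germSheaf 𝒢') con) V)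
    (ha : Fam.OrderLT con N V (show diffOps _ _ con V from a).1) (F : Finset (c.J →₀ ℕ))
    (hF : ∀ γ, γ.degree < N → γ ∈ F) (hW : W ≤ V)
    (f : 𝒪[𝒢'] W) (z : W) : valAt z (lev hW a f) =
      ∑ γ ∈ F, valAt z (lev hW a (c.mono (hW.trans hV) z γ)) *
        valAt z ((c.π.p γ).ev (hW.trans hV) (germIncl hle W f)) := by
  obtain ⟨W', hW', hz, P, hP⟩ := c.exists_taylor N (hW.trans hV) f z
  have h₁ : ∀ g ∈ vanIdeal 𝒢' (⟨z.1, hz⟩ : W') ^ N,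
      valAt (⟨z.1, hz⟩ : W') (lev (hW'.trans hW) a g) = 0 := fun g hg =>
    valAt_eq_zero_of_orderLT hcon (Fam.OrderLT.res (hW'.trans hW) ha) ⟨z.1, hz⟩ hg
  have hm : ∀ γ, c.mono ((hW'.trans hW).trans hV) ⟨z.1, hz⟩ γ =
      rres _ hW' (c.mono (hW.trans hV) z γ) := fun γ =>
    (c.rres_mono (hW.trans hV) hW' ⟨z.1, hz⟩ γ).symm
  have h₂ : valAt z (lev hW a f) = valAt (⟨z.1, hz⟩ : W') (lev (hW'.trans hW) a
      (c.poly ((hW'.trans hW).trans hV) ⟨z.1, hz⟩ P)) := by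
    have := h₁ _ hP
    rw [← homLev_apply, map_sub, map_sub, sub_eq_zero, homLev_apply, homLev_apply,
      ← rres_lev hW hW']
      at this
    exact this
  have h₃ : ∀ γ, γ.degree < N → valAt z ((c.π.p γ).ev (hW.trans hV) (germIncl hle W f)) =
      MvPolynomial.coeff γ P := fun γ hγ => by
    have := c.coeff_taylor_eq_zero ((hW'.trans hW).trans hV) ⟨z.1, hz⟩ hP hγ
    rw [map_sub, map_sub, c.taylor_poly, MvPolynomial.coeff_coe, sub_eq_zero, c.coeff_taylor,
      ← rres_germIncl, ← DSec.rres_ev _ (hW.trans hV) hW'] at this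
    exact this
  have h₄ : ∀ γ, valAt (⟨z.1, hz⟩ : W') (lev (hW'.trans hW) a
      (c.mono ((hW'.trans hW).trans hV) ⟨z.1, hz⟩ γ)) =
      valAt z (lev hW a (c.mono (hW.trans hV) z γ)) := fun γ => by
    rw [hm, ← rres_lev hW hW']; rfl
  have h₅ : ∀ γ, ¬ γ.degree < N → valAt z (lev hW a (c.mono (hW.trans hV) z γ)) = 0 :=
    fun γ hγ => by
    rw [← h₄]
    exact h₁ _ (Ideal.pow_le_pow_right (not_lt.1 hγ) (c.mono_mem _ _ _))
  rw [h₂]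
  conv_lhs => rw [P.as_sum]
  rw [map_sum, ← homLev_apply, map_sum, map_sum]
  have h₆ : ∀ γ, valAt (⟨z.1, hz⟩ : W') (homLev (hW'.trans hW) a
      (c.poly ((hW'.trans hW).trans hV) ⟨z.1, hz⟩ (MvPolynomial.monomial γ (P.coeff γ)))) =
      valAt z (lev hW a (c.mono (hW.trans hV) z γ)) * P.coeff γ := fun γ => by
    rw [c.poly_monomial, homLev_apply, lev_scalar_mul, map_mul, h₄, valAt_scalar, mul_comm]
  simp_rw [h₆]
  have h₇ : ∀ γ, valAt z (lev hW a (c.mono (hW.trans hV) z γ)) *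
      valAt z ((c.π.p γ).ev (hW.trans hV) (germIncl hle W f)) =
      valAt z (lev hW a (c.mono (hW.trans hV) z γ)) * P.coeff γ := fun γ => by
    by_cases hγ : γ.degree < N
    · rw [h₃ γ hγ]
    · rw [h₅ γ hγ, zero_mul, zero_mul]
  simp_rw [h₇]
  have e₁ : ∑ γ ∈ P.support, valAt z (lev hW a (c.mono (hW.trans hV) z γ)) * P.coeff γ =
      ∑ γ ∈ F ∪ P.support, valAt z (lev hW a (c.mono (hW.trans hV) z γ)) * P.coeff γ :=
    Finset.sum_subset Finset.subset_union_right fun γ _ hγ => by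
      rw [MvPolynomial.notMem_support_iff.1 hγ, mul_zero]
  have e₂ : ∑ γ ∈ F, valAt z (lev hW a (c.mono (hW.trans hV) z γ)) * P.coeff γ =
      ∑ γ ∈ F ∪ P.support, valAt z (lev hW a (c.mono (hW.trans hV) z γ)) * P.coeff γ :=
    Finset.sum_subset Finset.subset_union_left fun γ _ hγ => by
      rw [h₅ γ fun h => hγ (hF γ h), zero_mul]
  rw [e₁, e₂]

/-- The number of terms in the formula for the coefficients of an operator. -/
def Chart.len (γ : c.J →₀ ℕ) : ℕ := (c.exists_coef γ).choose

/-- The functions of the point in the formula for the coefficients of an operator. -/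
def Chart.o (γ : c.J →₀ ℕ) : Fin (c.len γ) → 𝒪[𝒢] U₀ :=
  (c.exists_coef γ).choose_spec.choose

/-- The arguments of the operator in the formula for its coefficients. -/
def Chart.f (γ : c.J →₀ ℕ) : Fin (c.len γ) → 𝒪[𝒢'] U₀ :=
  (c.exists_coef γ).choose_spec.choose_spec.choose

theorem Chart.mono_eq (γ : c.J →₀ ℕ) (hV : V ≤ U₀) (z : V) : c.mono hV z γ =
    ∑ j, (germSheaf 𝒢').scalar V (valAt z (rres _ hV (c.o γ j))) * rres _ hV (c.f γ j) :=
  (c.exists_coef γ).choose_spec.choose_spec.choose_spec V hV z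

/-- The coefficient of an operator at the derivative with multi-index `γ`. -/
def Chart.coef (hV : V ≤ U₀) (a : msec (AMod (germSheaf 𝒢) (germSheaf 𝒢') con) V)
    (γ : c.J →₀ ℕ) : 𝒪[𝒢] V :=
  ∑ j, rres _ hV (c.o γ j) * lev le_rfl a (rres _ hV (c.f γ j))

theorem Chart.valAt_coef (hV : V ≤ U₀)
    (a : msec (AMod (germSheaf 𝒢) (germSheaf 𝒢') con) V) (γ : c.J →₀ ℕ) (z : V) :
    valAt z (c.coef hV a γ) = valAt z (lev le_rfl a (c.mono hV z γ)) := by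
  rw [Chart.coef, c.mono_eq, ← homLev_apply, map_sum, map_sum, map_sum]
  refine sum_congr rfl fun j _ => ?_
  rw [homLev_apply, lev_scalar_mul, map_mul, map_mul, valAt_scalar]

theorem Chart.rres_coef (hV : V ≤ U₀) (hW : W ≤ V)
    (a : msec (AMod (germSheaf 𝒢) (germSheaf 𝒢') con) V) (γ : c.J →₀ ℕ) :
    rres _ hW (c.coef hV a γ) = c.coef (hW.trans hV) (mres _ hW a) γ := by
  rw [Chart.coef, Chart.coef, map_sum]
  refine sum_congr rfl fun j _ => ?_
  rw [map_mul, rres_rres, rres_lev, rres_rres, lev_mres]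

variable (con) in
/-- The operators from a sheaf of functions to another one given by the inclusion. -/
def inclOp (hle : ∀ x, 𝒢' x ≤ 𝒢 x) (hcon : ∀ U f t, con.rel U f t ↔ t = germIncl hle U f)
    (U : Opens X) : diffOps (unitMod (germSheaf 𝒢).ring) ((germSheaf 𝒢').lin (germSheaf 𝒢)) con U :=
  ⟨fun V => (toUnit _ V.1).symm.toAddMonoidHom.comp (germIncl hle V.1).toAddMonoidHom,
    { natural := fun _ _ _ _ _ => rfl
      linear := by
        rintro V hV _ _ a ⟨k, rfl, rfl⟩
        exact map_mul (germIncl hle V) _ _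
      order := fun x hx => ⟨U, le_rfl, 1, hx, fun V hV s t r => by
        rw [(hcon V s t).1 r]
        funext W; ext a
        exact sub_eq_zero.2 (map_mul (germIncl hle W.1) (rres (germSheaf 𝒢').ring W.2 s) a).symm⟩ }⟩

variable (hcon : ∀ U f t, con.rel U f t ↔ t = germIncl hle U f)

/-- The derivative with multi-index `γ` as an operator on the smaller sheaf of functions. -/
def Chart.eA (γ : c.J →₀ ℕ) : msec (AMod (germSheaf 𝒢) (germSheaf 𝒢') con) U₀ :=
  toL (leftDiff _ _ con) (c.π.p γ • inclOp con hle hcon U₀ : diffOps _ _ con U₀)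

theorem Chart.lev_eA (γ : c.J →₀ ℕ) (hV : V ≤ U₀) (f : 𝒪[𝒢'] V) :
    lev hV (c.eA hcon γ) f = (c.π.p γ).ev hV (germIncl hle V f) := rfl

theorem Chart.finite_degree_lt (N : ℕ) : {γ : c.J →₀ ℕ | γ.degree < N}.Finite :=
  Finsupp.finite_of_degree_lt N

/-- Operators are locally finite sums of derivatives with coefficients. -/
theorem Chart.basis (V : Opens X) (hV : V ≤ U₀)
    (a : msec (AMod (germSheaf 𝒢) (germSheaf 𝒢') con) V) (y : X) (hy : y ∈ V) :
    ∃ (W : Opens X) (hW : W ≤ V) (F₀ : Finset (c.J →₀ ℕ)), y ∈ W ∧ ∀ F, F₀ ⊆ F → mres _ hW a =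
      ∑ γ ∈ F, c.coef (hW.trans hV) (mres _ hW a) γ • mres _ (hW.trans hV) (c.eA hcon γ) := by
  obtain ⟨W, hW, N, hyW, hN⟩ := (show diffOps _ _ con V from a).2.order y hy
  refine ⟨W, hW, (c.finite_degree_lt N).toFinset, hyW, fun F hF => lev_ext fun W' hW' f =>
    valAt_ext fun z => ?_⟩
  rw [lev_sum, map_sum, c.valAt_lev (fun U f => (hcon U f _).2 rfl) (hW.trans hV) (mres _ hW a) hN F
    (fun γ hγ => hF ((Set.Finite.mem_toFinset _).2 hγ)) hW' f z]
  refine sum_congr rfl fun γ _ => ?_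
  rw [lev_smul, map_mul, lev_mres _ _ (c.eA hcon γ), c.lev_eA, c.rres_coef, c.valAt_coef]
  rfl

theorem Chart.dual (γ δ : c.J →₀ ℕ) :
    c.coef le_rfl (c.eA hcon δ) γ = if δ = γ then 1 else 0 := valAt_ext fun z => by
  rw [c.valAt_coef, c.lev_eA, c.p_mono]
  split <;> simp

end Expand

/-! ### The frame given by coordinates -/

section Coordinates

/-- A derivation that vanishes on the coordinates vanishes on all functions in the sheaf that they
belong to. -/
theorem DSec.IsDer.ev_eq_zero {J : Type} [Fintype J] {x : J → 𝒪[𝒢'] U₀}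
    (hx : IsHadamard 𝒢' x) {d : 𝒟[germSheaf 𝒢] U₀} (hd : d.IsDer)
    (h : ∀ i, d.ev le_rfl (germIncl hle U₀ (x i)) = 0) (hV : V ≤ U₀)
    (f : 𝒪[𝒢'] V) : d.ev hV (germIncl hle V f) = 0 := valAt_ext fun z => by
  obtain ⟨W, hW, g, hz, e⟩ := hx V hV f z
  have h₁ : valAt z (d.ev hV (germIncl hle V f)) =
      valAt (⟨z.1, hz⟩ : W) (d.homEv (hW.trans hV) (germIncl hle W (rres _ hW f))) := by
    rw [DSec.homEv_apply, ← rres_germIncl, ← DSec.rres_ev d hV hW]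
    rfl
  have h₂ : ∀ i, d.homEv (hW.trans hV) (germIncl hle W (rres _ (hW.trans hV) (x i))) = 0 :=
    fun i => by
    rw [DSec.homEv_apply, ← rres_germIncl, ← DSec.rres_ev d le_rfl (hW.trans hV), h, map_zero]
  rw [h₁, e, map_add, map_add, map_add, germIncl_scalar, DSec.homEv_apply, hd.ev_scalar, map_zero,
    zero_add, map_sum, map_sum, map_sum, map_zero]
  refine Finset.sum_eq_zero fun i _ => ?_
  rw [map_mul, DSec.homEv_apply, hd W, ← DSec.homEv_apply, map_sub, map_sub, germIncl_scalar,
    h₂, DSec.homEv_apply, hd.ev_scalar, sub_zero, zero_mul, zero_add, map_mul, map_sub,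
    valAt_germIncl, valAt_scalar, valAt_rres, valAt_rres, sub_self, zero_mul]

/-- Coordinates for the whole sheaf of functions: derivations dual to functions that satisfy
Hadamard's lemma commute with each other. -/
theorem exists_chart [Algebra ℚ K] {J : Type} [Fintype J] [DecidableEq J]
    (x : J → 𝒪[𝒢] U₀)
    (d : J → 𝒟[germSheaf 𝒢] U₀) (der : ∀ i, (d i).IsDer)
    (d_x : ∀ i k, (d i).ev le_rfl (x k) = if i = k then 1 else 0) (hx : IsHadamard 𝒢 x) :
    Nonempty (DivPow d) := by
  let _ : Algebra ℚ (𝒟[germSheaf 𝒢] U₀) :=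
    ((algebraMap K (𝒟[germSheaf 𝒢] U₀)).comp
      (algebraMap ℚ K)).toAlgebra' fun q d =>
        Algebra.commutes (algebraMap ℚ K q) d
  refine exists_divPow d fun i k => sub_eq_zero.1 (DSec.ext fun V hV f => ?_)
  refine DSec.IsDer.ev_eq_zero (hle := fun _ => le_rfl) hx ((der i).commutator (der k))
    (fun j => ?_) hV f
  have key : ∀ f, (d i * d k - d k * d i).ev le_rfl f =
      (d i).ev le_rfl ((d k).ev le_rfl f) - (d k).ev le_rfl ((d i).ev le_rfl f) :=
    fun f => map_sub (DSec.evHom le_rfl f) _ _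
  have h0 : ∀ (i : J) (P : Prop) [Decidable P],
      (d i).ev le_rfl (if P then (1 : 𝒪[𝒢] U₀) else 0) = 0 := by
    intro i P _
    split
    · exact (der i).ev_one _
    · exact map_zero ((d i).homEv le_rfl)
  rw [key, germIncl_self, d_x, d_x, h0, h0, sub_zero]

theorem DSec.mulOp_mul_ev {O : AlgSheaf K X} [CommSheaf O.ring] (h : V ≤ U)
    (o : rsec O.ring U) (d : 𝒟[O] U) (f : rsec O.ring V) :
    (mulOp O.ring O.selfLin U o * d).ev h f = rres O.ring h o * d.ev h f := rfl

variable [IsAddTorsionFree K]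

/-- The expansion of a differential operator of the sheaf of functions in coordinates. -/
theorem Chart.exists_expansion (c : Chart (fun x => le_refl (𝒢 x)) U₀) (V : Opens X) (hV : V ≤ U₀)
    (b : 𝒟[germSheaf 𝒢] V) (y : X) (hy : y ∈ V) :
    ∃ (W : Opens X) (hW : W ≤ V) (F : Finset (c.J →₀ ℕ))
      (o : (c.J →₀ ℕ) → 𝒪[𝒢] W), y ∈ W ∧ DSec.res hW b =
        ∑ γ ∈ F, mulOp _ _ W (o γ) * DSec.res (hW.trans hV) (c.π.p γ) := by
  obtain ⟨W, hW, F, hyW, e⟩ := c.basis (con := Corr.eq _) (fun U f t => eq_comm) V hV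
    (show diffOps _ _ (Corr.eq _) V from b) y hy
  exact ⟨W, hW, F, _, hyW, e F subset_rfl⟩

/-- Divided powers of the derivations `d i` are products of derivations and rational constants. -/
theorem isGenByDer_of_chart [Algebra ℚ K]
    (h : ∀ x, ∃ U₀ : Opens X, x ∈ U₀ ∧ Nonempty (Chart (fun x => le_refl (𝒢 x)) U₀)) :
    IsGenByDer (germSheaf 𝒢) := fun U d x hx => by
  obtain ⟨U₀, hxU₀, ⟨c⟩⟩ := h x
  obtain ⟨W, hW, F, o, hxW, e⟩ := c.exists_expansion (U ⊓ U₀) inf_le_right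
    (DSec.res inf_le_left d) x ⟨hx, hxU₀⟩
  have key : ∀ γ, DSec.res (hW.trans inf_le_right) (c.π.p γ) ∈ Subring.closure
      (Set.range (mulOp _ _ W) ∪ {τ : DSec _ (germSheaf 𝒢).selfLin W | τ.IsDer}) := by
    intro γ
    induction γ using multiIndex_induction with
    | zero => rw [c.π.p_zero, map_one]; exact one_mem _
    | add γ i ih =>
      have h₁ : DSec.res (hW.trans inf_le_right) (c.π.p (γ + single i 1)) =
          mulOp _ _ W ((germSheaf 𝒢).scalar W (algebraMap ℚ K (γ i + 1 : ℕ)⁻¹)) *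
            (DSec.res (hW.trans inf_le_right) (c.d i) *
              DSec.res (hW.trans inf_le_right) (c.π.p γ)) := by
        rw [← map_mul, c.π.mul_p, map_nsmul, mul_smul_comm, ← smul_mul_assoc, ← map_nsmul,
          ← map_nsmul,
          ← map_nsmul, nsmul_eq_mul,
            mul_inv_cancel₀ (Nat.cast_ne_zero.2 (Nat.succ_ne_zero _)), map_one,
          map_one, map_one, one_mul]
      rw [h₁]
      refine mul_mem (Subring.subset_closure (.inl ⟨_, rfl⟩)) (mul_mem ?_ ih)
      exact Subring.subset_closure (.inr fun V hV f g =>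
        c.der i V (hV.trans (hW.trans inf_le_right)) f g)
  refine ⟨W, hW.trans inf_le_left, hxW, ?_⟩
  change DSec.res hW (DSec.res inf_le_left d) ∈ _
  rw [e]
  refine sum_mem fun γ _ => mul_mem (Subring.subset_closure (.inl ⟨_, rfl⟩)) (key γ)

variable {con : Corr (germSheaf 𝒢').ring (germSheaf 𝒢).ring}

/-- The coproduct of `∂^γ / γ!` is given by the Leibniz rule. -/
theorem hasCoproduct_of_chart (hcon : ∀ U f t, con.rel U f t ↔ t = germIncl hle U f)
    (h : ∀ x, ∃ U₀ : Opens X, x ∈ U₀ ∧ Nonempty (Chart hle U₀)) : HasCoproduct con := by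
  intro U a x hx
  obtain ⟨U₀, hxU₀, ⟨c⟩⟩ := h x
  obtain ⟨W, hW, F, hxW, e⟩ := c.basis hcon (U ⊓ U₀) inf_le_right (mres _ inf_le_left a) x
    ⟨hx, hxU₀⟩
  have e := e F subset_rfl
  let G : Finset ((_ : c.J →₀ ℕ) × (c.J →₀ ℕ) × (c.J →₀ ℕ)) := F.sigma fun γ => decomp γ
  obtain ⟨o, ho⟩ : ∃ o : (c.J →₀ ℕ) → 𝒪[𝒢] W, mres _ (hW.trans inf_le_left) a =
    ∑ γ ∈ F, o γ • mres _ (hW.trans inf_le_right) (c.eA hcon γ) := ⟨_, e⟩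
  have key : ∀ V (hV : V ≤ W) (f₁ f₂ : 𝒪[𝒢'] V),
      lev (hV.trans (hW.trans inf_le_left)) a (f₁ * f₂) = ∑ i ∈ G,
        lev hV (o i.1 • mres _ (hW.trans inf_le_right) (c.eA hcon i.2.1)) f₁ *
          lev hV (mres _ (hW.trans inf_le_right) (c.eA hcon i.2.2)) f₂ := by
    intro V hV f₁ f₂
    rw [← lev_mres (hW.trans inf_le_left) hV a, ho, lev_sum, Finset.sum_sigma]
    refine sum_congr rfl fun γ _ => ?_
    rw [lev_smul, lev_mres, c.lev_eA, map_mul, c.π.leibniz c.der, mul_sum]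
    exact sum_congr rfl fun q _ => (mul_assoc _ _ _).symm
  refine ⟨W, hW.trans inf_le_left, G.card,
    fun j => o (G.equivFin.symm j).1.1 • mres _ (hW.trans inf_le_right) (c.eA hcon
      (G.equivFin.symm j).1.2.1),
    fun j => mres _ (hW.trans inf_le_right) (c.eA hcon (G.equivFin.symm j).1.2.2), hxW,
    fun V hV f₁ f₂ => ?_⟩
  rw [key]
  refine (Finset.sum_coe_sort G _).symm.trans ?_
  exact (Equiv.sum_comp G.equivFin.symm fun i =>
    lev hV (o i.1.1 • mres _ (hW.trans inf_le_right) (c.eA hcon i.1.2.1)) f₁ *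
          lev hV (mres _ (hW.trans inf_le_right) (c.eA hcon i.1.2.2)) f₂).symm

theorem Chart.eB_zero (c : Chart hle U₀) : sgn (0 : c.J →₀ ℕ) • c.π.p 0 = 1 := by
  rw [sgn_zero, one_smul, c.π.p_zero]

/-- The frame defined by a chart, for the operators of the sheaf of functions to itself. -/
def Chart.frame (c : Chart hle U₀)
    (hcon : ∀ U f t, con.rel U f t ↔ t = germIncl hle U f) {R : RSh X}
    (B : RAct R (BMod (germSheaf 𝒢) (germSheaf 𝒢) (Corr.eq _)))
    (faithful : ∀ (V : Opens X) (r : rsec R V),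
      B.act V (.op r) (1 : 𝒟[germSheaf 𝒢] V) = 0 → r = 0)
    (gen : ∀ V (hV : V ≤ U₀) (b : 𝒟[germSheaf 𝒢] V),
      ∀ y ∈ V, ∃ (W : Opens X) (hW : W ≤ V) (F : Finset (c.J →₀ ℕ))
        (ρ : (c.J →₀ ℕ) → rsec R W), y ∈ W ∧ DSec.res hW b =
          ∑ α ∈ F, B.act W (.op (ρ α)) (DSec.res (hW.trans hV) (sgn α • c.π.p α))) :
    Frame con B (germIncl hle) U₀ where
  I := c.J →₀ ℕ
  dec := inferInstance
  zero := 0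
  eA := c.eA hcon
  len := c.len
  o := c.o
  f := c.f
  basis V hV a y hy := by
    obtain ⟨W, hW, F₀, hyW, e⟩ := c.basis hcon V hV a y hy
    refine ⟨W, hW, F₀, hyW, fun F hF => (e F hF).trans ?_⟩
    rfl
  dual γ δ := by
    rw [← c.dual hcon γ δ, Chart.coef]
    refine sum_congr rfl fun j _ => ?_
    rw [rres_self, rres_self]
  eB α := (sgn α • c.π.p α : 𝒟[germSheaf 𝒢] U₀)
  bijective V hV := by
    rw [c.eB_zero]
    exact Function.bijective_id
  faithful V hV r hr := by
    rw [c.eB_zero] at hr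
    exact faithful V r hr
  gen := gen
  M := c.π.matrix
  mul α V hV f g := by
    rw [c.eB_zero]
    refine (c.π.mul_sgn_ev c.der α hV (germIncl hle V f) g).trans ?_
    change _ = ∑ γ ∈ (c.π.matrix (single α 1)).support,
      (c.π.matrix (single α 1) γ).ev hV ((c.π.p γ).ev hV (germIncl hle V f) * g)
    let Ψ : ((c.J →₀ ℕ) →₀ 𝒟[germSheaf 𝒢] U₀) →+
        𝒪[𝒢] V :=
      Finsupp.liftAddHom fun γ => DSec.evHom hV ((c.π.p γ).ev hV (germIncl hle V f) * g)
    change _ = Ψ (c.π.matrix (single α 1))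
    rw [c.π.matrix_single, map_sum]
    refine sum_congr rfl fun q _ => ?_
    exact (Finsupp.liftAddHom_apply_single (fun γ => DSec.evHom (O := germSheaf 𝒢) hV
      ((c.π.p γ).ev hV (germIncl hle V f) * g)) q.1 _).symm

end Coordinates

/-! ### Left multiplication of operators by functions -/

section LeftMul

theorem rev_postAct {con' : Corr O.ring T.ring} (h : V ≤ U) (t : rsec T.ring U)
    (b : msec (BMod O T con') U) (g : rsec O.ring V) :
    rev h ((postAct O T con').act U (.op t) b) g = rev h b g * rres T.ring h t := rfl

theorem isLeftMul_postAct {con' : Corr O.ring T.ring} {inc : Corr S.ring T.ring}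
    (ι : ∀ U : Opens X, rsec S.ring U →+* rsec T.ring U)
    (rel_iff : ∀ (U : Opens X) (f : rsec S.ring U) (t : rsec T.ring U), inc.rel U f t ↔ t = ι U f)
    (res : ∀ U V (h : V ≤ U) (f : rsec S.ring U),
      rres T.ring h (ι U f) = ι V (rres S.ring h f)) :
    IsLeftMul inc (postAct O T con') ι where
  rel_iff := rel_iff
  res := res
  act U f b b' r hb V h g := by rw [rev_postAct, rev_postAct, hb, mul_assoc]

theorem rev_preAct [CommSheaf O.ring] {L : Lin O.ring}
    {hL : ∀ U s t, O.selfLin.rel U s t → L.rel U s t}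
    (h : V ≤ U) (r : rsec (opSheaf (DSheaf O.ring L)) U)
    (b : msec (BMod O O (Corr.eq _)) U) (g : rsec O.ring V) :
    rev h ((preAct O L hL).act U (.op r) b) g =
      (show (DSec O.ring L U)ᵐᵒᵖ from r).unop.ev h (rev h b g) := rfl

theorem isLeftMul_preAct [CommSheaf O.ring] {L : Lin O.ring}
    {hL : ∀ U s t, O.selfLin.rel U s t → L.rel U s t} {inc : Corr S.ring O.ring}
      (ι : ∀ U : Opens X, rsec S.ring U →+* rsec O.ring U)
    (rel_iff : ∀ (U : Opens X) (f : rsec S.ring U) (t : rsec O.ring U), inc.rel U f t ↔ t = ι U f)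
    (res : ∀ U V (h : V ≤ U) (f : rsec S.ring U),
      rres O.ring h (ι U f) = ι V (rres S.ring h f))
    (lin : ∀ (U : Opens X) (f : rsec S.ring U), L.rel U (ι U f) (ι U f)) :
    IsLeftMul inc (preAct O L hL) ι where
  rel_iff := rel_iff
  res := res
  act U f b b' r hb V h g := by
    rw [rev_preAct, rev_preAct, hb]
    exact (show (DSec O.ring L U)ᵐᵒᵖ from r).unop.2.linear V h _ _ _ (lin V _)

end LeftMul

/-! ### Sheaves of functions with coordinates -/

section Absolute
variable [Algebra ℚ K] [IsAddTorsionFree K]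

/-- The equivalence of categories for a sheaf of functions that has coordinates near every point. -/
theorem inducesEquivalence_of_chart
    (h : ∀ x, ∃ U₀ : Opens X, x ∈ U₀ ∧ Nonempty (Chart (fun x => le_refl (𝒢 x)) U₀)) :
    InducesEquivalence (O := germSheaf 𝒢) (S := germSheaf 𝒢) (T := germSheaf 𝒢)
      (Corr.eq _) (Corr.eq _) (Corr.eq _) (postAct (germSheaf 𝒢) (germSheaf 𝒢) (Corr.eq _))
      .left := by
  have hcon : ∀ U (f t : 𝒪[𝒢] U),
      (Corr.eq (germSheaf 𝒢).ring).rel U f t ↔ t = germIncl (fun x => le_refl (𝒢 x)) U f :=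
    fun U f t => eq_comm
  refine inducesEquivalence (isLeftMul_postAct (germIncl fun x => le_refl (𝒢 x)) hcon
    fun _ _ _ _ => rfl) (fun x => ?_) (hasCoproduct_of_chart hcon h) (isGenByDer_of_chart h)
    (.inr fun U f g => mul_comm f g)
  obtain ⟨U₀, hx, ⟨c⟩⟩ := h x
  refine ⟨U₀, hx, ⟨c.frame hcon _ (fun V r hr => ?_) fun V hV b y hy => ?_⟩⟩
  · have h₁ := congrArg (fun b : msec (BMod (germSheaf 𝒢) (germSheaf 𝒢) (Corr.eq _)) V =>
      rev le_rfl b 1) hr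
    have h₂ : (1 : 𝒪[𝒢] V) * rres _ le_rfl r = 0 := h₁
    rwa [one_mul, rres_self] at h₂
  · obtain ⟨W, hW, F, o, hyW, e⟩ := c.exists_expansion V hV b y hy
    refine ⟨W, hW, F, fun α => sgn α • o α, hyW, ?_⟩
    rw [e]
    refine sum_congr rfl fun α _ => DSec.ext fun W' hW' f => ?_
    have h₁ : rev hW' ((postAct (germSheaf 𝒢) (germSheaf 𝒢) (Corr.eq _)).act W (.op (sgn α • o α))
        (DSec.res (hW.trans hV) (sgn α • c.π.p α) :
          𝒟[germSheaf 𝒢] W)) f =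
      (sgn α • c.π.p α).ev (hW'.trans (hW.trans hV)) f * rres _ hW' (sgn α • o α) := rfl
    refine Eq.trans ?_ h₁.symm
    rw [DSec.unit_smul_ev, DSec.mulOp_mul_ev]
    have h₂ : rres (germSheaf 𝒢).ring hW' (sgn α • o α) = sgn α • rres _ hW' (o α) := by
      rcases Int.units_eq_one_or (sgn α) with h | h <;> rw [h]
      · rw [one_smul, one_smul]
      · rw [Units.neg_smul, Units.neg_smul, one_smul, one_smul, map_neg]
    rw [h₂, smul_mul_smul_comm, sgn_mul_self, one_smul, mul_comm]
    rfl

end Absolute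

/-! ### Coordinates relative to a subsheaf -/

section Relative
variable {J J' : Type} [DecidableEq J] [DecidableEq J'] {D : Type*} [Ring D] [IsAddTorsionFree D]

theorem DivPow.p_add {d : J → D} (π : DivPow d) (α β : J →₀ ℕ) (h : ∀ i, α i = 0 ∨ β i = 0) :
    π.p (α + β) = π.p α * π.p β := by
  induction β using multiIndex_induction with
  | zero => rw [add_zero, π.p_zero, mul_one]
  | add β i ih =>
    have h₁ : ∀ k, α k = 0 ∨ β k = 0 := fun k => (h k).imp_right fun h => by
      rw [Finsupp.add_apply] at h; omega
    have h₂ : α i = 0 := (h i).resolve_right fun h => by simp at h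
    refine IsAddTorsionFree.nsmul_right_injective (Nat.succ_ne_zero (β i)) ?_
    change (β i + 1) • _ = (β i + 1) • _
    have h₃ := π.mul_p i (α + β)
    rw [Finsupp.add_apply, h₂, zero_add, ih h₁] at h₃
    rw [← add_assoc, ← h₃, ← mul_smul_comm, ← π.mul_p, ← mul_assoc, ← mul_assoc, (π.comm i α).eq]

/-- The part of a multi-index for the left summand of the set of indices. -/
def fstIndex (γ : J ⊕ J' →₀ ℕ) : J →₀ ℕ := γ.comapDomain Sum.inl Sum.inl_injective.injOn

/-- The part of a multi-index for the right summand of the set of indices. -/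
def sndIndex (γ : J ⊕ J' →₀ ℕ) : J' →₀ ℕ := γ.comapDomain Sum.inr Sum.inr_injective.injOn

theorem fstIndex_add_sndIndex (γ : J ⊕ J' →₀ ℕ) : γ =
    (fstIndex γ).embDomain Function.Embedding.inl +
      (sndIndex γ).embDomain Function.Embedding.inr := by
  ext i
  rcases i with i | i
  · rw [Finsupp.add_apply]
    have h₁ := Finsupp.embDomain_apply_self (Function.Embedding.inl : J ↪ J ⊕ J') (fstIndex γ) i
    have h₂ := Finsupp.embDomain_of_notMem_range (Function.Embedding.inr : J' ↪ J ⊕ J') (sndIndex γ)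
      (.inl i) (by simp)
    refine Eq.trans ?_ (congrArg₂ (· + ·) h₁ h₂).symm
    rfl
  · rw [Finsupp.add_apply]
    have h₁ := Finsupp.embDomain_apply_self (Function.Embedding.inr : J' ↪ J ⊕ J') (sndIndex γ) i
    have h₂ := Finsupp.embDomain_of_notMem_range (Function.Embedding.inl : J ↪ J ⊕ J') (fstIndex γ)
      (.inr i) (by simp)
    refine Eq.trans ?_ (congrArg₂ (· + ·) h₂ h₁).symm
    exact (zero_add _).symm

theorem DivPow.p_eq_mul {d : J ⊕ J' → D} (π : DivPow d) (γ : J ⊕ J' →₀ ℕ) :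
    π.p γ = (π.restrict Function.Embedding.inr).p (sndIndex γ) *
      (π.restrict Function.Embedding.inl).p (fstIndex γ) := by
  conv_lhs => rw [fstIndex_add_sndIndex γ]
  rw [π.p_add, (π.commute _ _).eq]
  · rfl
  · rintro (i | i)
    · exact .inr (Finsupp.embDomain_of_notMem_range _ _ _ (by simp))
    · exact .inl (Finsupp.embDomain_of_notMem_range _ _ _ (by simp))

end Relative

section RelativeChart
variable [Algebra ℚ K] [IsAddTorsionFree K]

/-- Coordinates for a sheaf of functions, part of which are coordinates for a subsheaf. -/
structure RelChart (hle : ∀ x, 𝒢' x ≤ 𝒢 x) (U₀ : Opens X) where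
  J : Type
  J' : Type
  [fintype : Fintype J]
  [dec : DecidableEq J]
  [fintype' : Fintype J']
  [dec' : DecidableEq J']
  x : J → 𝒪[𝒢'] U₀
  x' : J' → 𝒪[𝒢] U₀
  d : J ⊕ J' → 𝒟[germSheaf 𝒢] U₀
  der : ∀ i, (d i).IsDer
  d_x : ∀ i k, (d i).ev le_rfl (Sum.elim (fun k => germIncl hle U₀ (x k)) x' k) =
    if i = k then 1 else 0
  hadamard : IsHadamard 𝒢' x
  hadamard' : IsHadamard 𝒢 (Sum.elim (fun k => germIncl hle U₀ (x k)) x')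

attribute [instance] RelChart.fintype RelChart.dec RelChart.fintype' RelChart.dec'

variable (c : RelChart hle U₀)

/-- The divided powers of all derivations. -/
def RelChart.π : DivPow c.d := (exists_chart _ c.d c.der c.d_x c.hadamard').some

/-- The chart given by all coordinates. -/
def RelChart.full : Chart (fun x => le_refl (𝒢 x)) U₀ where
  J := c.J ⊕ c.J'
  x := Sum.elim (fun k => germIncl hle U₀ (c.x k)) c.x'
  d := c.d
  der := c.der
  d_x := c.d_x
  π := c.π
  hadamard := c.hadamard'

/-- The chart given by the coordinates for the subsheaf. -/
def RelChart.sub : Chart hle U₀ where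
  J := c.J
  x := c.x
  d i := c.d (Function.Embedding.inl i)
  der i := c.der _
  d_x i k := (c.d_x (.inl i) (.inl k)).trans (by simp)
  π := c.π.restrict Function.Embedding.inl
  hadamard := c.hadamard

/-- Derivatives in the direction of the remaining coordinates are linear over the subsheaf. -/
theorem RelChart.ev_mul (β : c.J' →₀ ℕ) (hV : V ≤ U₀) (f : 𝒪[𝒢'] V)
    (g : 𝒪[𝒢] V) :
    ((c.π.restrict Function.Embedding.inr).p β).ev hV (germIncl hle V f * g) =
      germIncl hle V f * ((c.π.restrict Function.Embedding.inr).p β).ev hV g := by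
  let π := c.π.restrict Function.Embedding.inr
  have h0 : ∀ (β : c.J' →₀ ℕ) (i : c.J'), (π.p (β + single i 1)).ev hV (germIncl hle V f) =
    0 := by
    intro β i
    have h₁ : (c.d (.inr i)).ev hV (germIncl hle V f) = 0 :=
      (c.der _).ev_eq_zero c.hadamard (fun k => (c.d_x (.inr i) (.inl k)).trans (by simp)) hV f
    have h₂ := congrArg (DSec.evHom hV (germIncl hle V f))
      ((π.comm i β).symm.eq.trans (π.mul_p i β))
    rw [map_nsmul] at h₂
    have h₃ : DSec.evHom hV (germIncl hle V f) (π.p β * c.d (Function.Embedding.inr i)) =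
        (π.p β).homEv hV ((c.d (.inr i)).ev hV (germIncl hle V f)) := rfl
    rw [h₃, h₁, map_zero] at h₂
    exact (smul_eq_zero_iff_right (Nat.succ_ne_zero (β i))).1 h₂.symm
  change (π.p β).ev hV _ = _ * (π.p β).ev hV g
  rw [π.leibniz (fun i => c.der _) β hV, Finset.sum_eq_single (0, β)]
  · rw [π.p_zero]; rfl
  · rintro ⟨a, b⟩ hab hne
    rw [mem_decomp] at hab
    rcases multiIndex_cases a with rfl | ⟨a, i, rfl⟩
    · exact absurd (congrArg (Prod.mk 0) ((zero_add b).symm.trans hab)) hne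
    · rw [h0, zero_mul]
  · intro h; simp at h

/-- An operator with a larger class of scalars for which it is linear. -/
def DSec.ofLinear {O : AlgSheaf K X} (L : Lin O.ring)
    (d : 𝒟[O] U) (h : ∀ V (hV : V ≤ U) (s t a : rsec O.ring V),
      L.rel V s t → d.ev hV (s * a) = t * d.ev hV a) : DSec O.ring L U :=
  ⟨d.1, ⟨d.2.natural, h, d.2.order⟩⟩

/-- The equivalence of categories for a sheaf of functions and a subsheaf that have compatible
coordinates near every point. -/
theorem inducesEquivalence_of_relChart (hle : ∀ x, 𝒢' x ≤ 𝒢 x)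
    (h : ∀ x, ∃ U₀ : Opens X, x ∈ U₀ ∧ Nonempty (RelChart hle U₀)) :
    InducesEquivalence (O := germSheaf 𝒢) (S := germSheaf 𝒢') (T := germSheaf 𝒢)
      (sameFn 𝒢' 𝒢) (Corr.eq _) (sameFn 𝒢' 𝒢)
      (preAct (germSheaf 𝒢) (overLin 𝒢 𝒢') (overLin_scalar 𝒢 𝒢')) .left := by
  have hcon : ∀ U (f : 𝒪[𝒢'] U) (t : 𝒪[𝒢] U),
      (sameFn 𝒢' 𝒢).rel U f t ↔ t = germIncl hle U f := fun U f t =>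
    ⟨fun h => Subtype.ext (Eq.symm h), by rintro rfl; rfl⟩
  refine inducesEquivalence (isLeftMul_preAct (L := overLin 𝒢 𝒢') (germIncl hle) hcon
    (fun _ _ _ _ => rfl) fun U f => ⟨rfl, (show germSub 𝒢' U from f).2⟩) (fun x => ?_)
    (hasCoproduct_of_chart hcon fun x => (h x).imp fun U hU => ⟨hU.1, hU.2.map RelChart.sub⟩)
    (isGenByDer_of_chart fun x => (h x).imp fun U hU => ⟨hU.1, hU.2.map RelChart.full⟩)
    (.inr fun U f g => mul_comm f g)
  obtain ⟨U₀, hx, ⟨c⟩⟩ := h x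
  refine ⟨U₀, hx, ⟨c.sub.frame hcon _ (fun V r hr => ?_) fun V hV b y hy => ?_⟩⟩
  · refine MulOpposite.unop_injective (Subtype.ext ?_)
    exact congrArg (fun b : 𝒟[germSheaf 𝒢] V => b.1) hr
  · obtain ⟨W, hW, F, o, hyW, e⟩ := c.full.exists_expansion V hV b y hy
    let ρ₀ : (c.J →₀ ℕ) → 𝒟[germSheaf 𝒢] W := fun α =>
      ∑ γ ∈ F with fstIndex γ = α, mulOp _ _ W (sgn α • o γ) *
        DSec.res (hW.trans hV) ((c.π.restrict Function.Embedding.inr).p (sndIndex γ))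
    have hρ : ∀ α (V' : Opens X) (hV' : V' ≤ W) (s t a : 𝒪[𝒢] V'),
        (overLin 𝒢 𝒢').rel V' s t → (ρ₀ α).ev hV' (s * a) = t * (ρ₀ α).ev hV' a := by
      rintro α V' hV' s _ a ⟨rfl, hs⟩
      obtain ⟨f, rfl⟩ : ∃ f : 𝒪[𝒢'] V', s = germIncl hle V' f := ⟨⟨_, hs⟩, rfl⟩
      rw [← DSec.evHom_apply, ← DSec.evHom_apply, map_sum, map_sum, mul_sum]
      refine sum_congr rfl fun γ _ => ?_
      rw [DSec.evHom_apply, DSec.evHom_apply, DSec.mulOp_mul_ev, DSec.mulOp_mul_ev, mul_left_comm]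
      exact congrArg (_ * ·) (c.ev_mul (sndIndex γ) (hV'.trans (hW.trans hV)) f a)
    refine ⟨W, hW, F.image fstIndex, fun α => .op (DSec.ofLinear _ (ρ₀ α) (hρ α)), hyW, ?_⟩
    have h₂ : ∀ (s : ℤˣ) (o : 𝒪[𝒢] W)
        (A : 𝒟[germSheaf 𝒢] W)
        (A' : 𝒟[germSheaf 𝒢] U₀),
        mulOp _ _ W (s • o) * A * DSec.res (hW.trans hV) (s • A') =
          mulOp _ _ W o * (A * DSec.res (hW.trans hV) A') := fun s o A A' => by
      rcases Int.units_eq_one_or s with rfl | rfl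
      · rw [one_smul, one_smul, mul_assoc]
      · rw [Units.neg_smul, Units.neg_smul, one_smul, one_smul, map_neg, map_neg, neg_mul,
          neg_mul_neg, mul_assoc]
    have h₁ : ∀ α, (preAct (germSheaf 𝒢) (overLin 𝒢 𝒢') (overLin_scalar 𝒢 𝒢')).act W
        (.op (.op (DSec.ofLinear _ (ρ₀ α) (hρ α)))) (DSec.res (hW.trans hV)
          (sgn α • c.sub.π.p α) : 𝒟[germSheaf 𝒢] W) =
        (ρ₀ α * DSec.res (hW.trans hV) (sgn α • c.sub.π.p α) :
          𝒟[germSheaf 𝒢] W) := fun α => rfl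
    refine Eq.trans ?_ (sum_congr rfl fun α _ => (h₁ α).symm)
    rw [e]
    refine (Finset.sum_fiberwise_of_maps_to (g := fstIndex) (t := F.image fstIndex)
      (fun γ hγ => Finset.mem_image_of_mem _ hγ) (fun γ => mulOp _ _ W (o γ) *
        DSec.res (hW.trans hV) (c.full.π.p γ))).symm.trans ?_
    refine sum_congr rfl fun α _ => ?_
    refine Eq.trans ?_ (sum_mul _ _ _).symm
    refine sum_congr rfl fun γ hγ => ?_
    rw [h₂, ← map_mul]
    have h₃ := c.π.p_eq_mul γ
    rw [(Finset.mem_filter.1 hγ).2] at h₃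
    exact congrArg (fun A => mulOp _ _ W (o γ) * DSec.res (hW.trans hV) A) h₃

end RelativeChart

/-! ### Hadamard's lemma for holomorphic functions -/

section Analysis
open Filter Topology

section Vector
variable {E : Type v} [NormedAddCommGroup E] [NormedSpace ℂ E] {K : Type} [NormedAddCommGroup K]
  [NormedSpace ℂ K]

/-- Hadamard's lemma for analytic functions on a vector space. -/
theorem exists_hadamard_vector [CompleteSpace K] {f : E → K} {a : E} (hf : AnalyticAt ℂ f a) :
    ∃ G : E → (E →L[ℂ] K), AnalyticAt ℂ G a ∧ ∀ᶠ u in 𝓝 a, f u = f a + G u (u - a) := by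
  obtain ⟨p, r, hp⟩ := hf
  have hr : 0 < p.shift.radius := by
    rw [p.radius_shift]; exact hp.r_pos.trans_le hp.r_le
  have h₁ := p.shift.hasFPowerSeriesOnBall hr
  have h₂ : HasFPowerSeriesAt (fun u => p.shift.sum (u - a)) p.shift a := by
    have := h₁.comp_sub a
    rw [zero_add] at this
    exact this.hasFPowerSeriesAt
  refine ⟨fun u => p.shift.sum (u - a), ⟨_, h₂⟩, ?_⟩
  filter_upwards [hp.eventually_hasSum_sub, h₂.eventually_hasSum_sub] with u h₃ h₄
  refine h₃.unique ?_
  have h₅ : (p 0 fun _ => u - a) = f a := hp.coeff_zero _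
  have h₆ := (ContinuousLinearMap.apply ℂ K (u - a)).hasSum h₄
  rw [← h₅]
  refine HasSum.zero_add ?_
  have h₇ : (fun n => p (n + 1) fun _ => u - a) = fun n =>
      ContinuousLinearMap.apply ℂ K (u - a) (p.shift n fun _ => u - a) := funext fun n => by
    change _ = p (n + 1) (Fin.snoc (α := fun _ => E) (fun _ => u - a) (u - a))
    congr 1
    funext i
    refine Fin.lastCases ?_ (fun i => ?_) i
    · rw [Fin.snoc_last]
    · rw [Fin.snoc_castSucc]
  rw [h₇]
  exact h₆

end Vector
section Manifold
variable {E : Type v} [NormedAddCommGroup E] [NormedSpace ℂ E] [FiniteDimensional ℂ E] {M : Type u}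
  [TopologicalSpace M] [ChartedSpace E M] [IsManifold 𝓘(ℂ, E) ω M] {K : Type} [NormedCommRing K]
  [NormedAlgebra ℂ K] [FiniteDimensional ℂ K]

theorem mem_holGerms {x : M} {g : M → K} :
    g ∈ holGerms E M K x ↔ ContMDiffAt 𝓘(ℂ, E) 𝓘(ℂ, K) ω g x := by
  constructor
  · intro hg
    refine Algebra.adjoin_induction (p := fun g _ => ContMDiffAt 𝓘(ℂ, E) 𝓘(ℂ, K) ω g x)
      ?_ (fun r => contMDiffAt_const) (fun a b _ _ ha hb => ha.add hb) (fun a b _ _ ha hb => ?_) hg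
    · rintro _ ⟨h, hh, rfl⟩
      exact ((algebraMapCLM ℂ K).contDiff.contMDiff.contMDiffAt (x := h x)).comp x hh
    · exact ContMDiffAt.comp (I' := 𝓘(ℂ, K × K)) (g := fun p : K × K => p.1 * p.2) x
        (contDiff_mul (𝕜 := ℂ) (𝔸 := K)).contMDiff.contMDiffAt (ha.prodMk_space hb)
  · intro hg
    let κ := Module.finBasis ℂ K
    have : g = ∑ j, κ j • fun y => algebraMap ℂ K (κ.coord j (g y)) := by
      funext y
      rw [Finset.sum_apply]
      refine (κ.sum_repr (g y)).symm.trans (sum_congr rfl fun j _ => ?_)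
      rw [Algebra.smul_def, mul_comm]
      rfl
    rw [this]
    have hj : ∀ j, (fun y => algebraMap ℂ K (κ.coord j (g y))) ∈ holGerms E M K x := fun j =>
      Algebra.subset_adjoin ⟨fun y => κ.coord j (g y),
        ((LinearMap.toContinuousLinearMap (κ.coord j)).contDiff.contMDiff.contMDiffAt
          (x := g x)).comp x hg, rfl⟩
    exact sum_mem fun j _ => Subalgebra.smul_mem _ (hj j) _

theorem eventually_mem_holGerms {x : M} {g : M → K} (hg : g ∈ holGerms E M K x) :
    ∀ᶠ y in 𝓝 x, g ∈ holGerms E M K y := by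
  filter_upwards [(contMDiffAt_iff_contMDiffAt_nhds (by simp)).1 (mem_holGerms.1 hg)] with y hy
    using mem_holGerms.2 hy

variable {φ : OpenPartialHomeomorph M E} {J : Type} [Fintype J] (b : Module.Basis J ℂ E)

theorem analyticAt_of_mem_holGerms
    (hφ : φ ∈ IsManifold.maximalAtlas 𝓘(ℂ, E) ω M) {z : M} (hz : z ∈ φ.source) {f : M → K}
    (hf : f ∈ holGerms E M K z) : AnalyticAt ℂ (f ∘ φ.symm) (φ z) := by
  rw [mem_holGerms] at hf
  have h := contMDiffAt_symm_of_mem_maximalAtlas hφ (φ.map_source hz)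
  rw [← φ.left_inv hz] at hf
  exact (contMDiffAt_iff_contDiffAt.1 (hf.comp (φ z) h)).analyticAt

theorem comp_mem_holGerms_of_analyticAt
    (hφ : φ ∈ IsManifold.maximalAtlas 𝓘(ℂ, E) ω M) {z : M} (hz : z ∈ φ.source) {f : E → K}
    (hf : AnalyticAt ℂ f (φ z)) : f ∘ φ ∈ holGerms E M K z :=
  mem_holGerms.2 ((contMDiffAt_iff_contDiffAt.2 hf.contDiffAt).comp z
    (contMDiffAt_of_mem_maximalAtlas hφ hz))

/-- Hadamard's lemma for holomorphic functions near a point of a manifold. -/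
theorem exists_hadamard
    (hφ : φ ∈ IsManifold.maximalAtlas 𝓘(ℂ, E) ω M) {z : M} (hz : z ∈ φ.source) {f : M →
      K} (hf : f ∈ holGerms E M K z) :
    ∃ G : J → M → K, (∀ i, G i ∈ holGerms E M K z) ∧ ∀ᶠ y in 𝓝 z, f y = f z +
      ∑ i, (algebraMap ℂ K (b.coord i (φ y)) - algebraMap ℂ K (b.coord i (φ z))) * G i y := by
  obtain ⟨G, hG, h⟩ := exists_hadamard_vector (analyticAt_of_mem_holGerms hφ hz hf)
  refine ⟨fun i y => G (φ y) (b i), fun i => comp_mem_holGerms_of_analyticAt hφ hz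
    (f := fun u => G u (b i))
    (((ContinuousLinearMap.apply ℂ K (b i)).analyticAt _).comp hG), ?_⟩
  filter_upwards [(φ.continuousAt hz).eventually h, φ.open_source.mem_nhds hz] with y hy hys
  rw [Function.comp_apply, Function.comp_apply, φ.left_inv hz, φ.left_inv hys] at hy
  rw [hy]
  congr 1
  conv_lhs => rw [← b.sum_repr (φ y - φ z)]
  rw [map_sum]
  refine sum_congr rfl fun i _ => ?_
  rw [map_smul, Algebra.smul_def, map_sub, Finsupp.sub_apply, map_sub]
  rfl

end Manifold
end Analysis

/-! ### Derivations as operators -/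

section MkDer
variable [CommSheaf O.ring]

/-- A derivation of sheaves as a differential operator. -/
def DSec.mkDer (D : ∀ V : {V : Opens X // V ≤ U}, rsec O.ring V.1 →+ rsec O.ring V.1)
    (natural : ∀ V W (hV : V ≤ U) (hW : W ≤ V) (f : rsec O.ring V),
      rres O.ring hW (D ⟨V, hV⟩ f) = D ⟨W, hW.trans hV⟩ (rres O.ring hW f))
    (linear : ∀ (V : {V : Opens X // V ≤ U}) (k : K), D V (O.scalar V.1 k) = 0)
    (leibniz : ∀ (V : {V : Opens X // V ≤ U}) (f g : rsec O.ring V.1),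
      D V (f * g) = D V f * g + f * D V g) : 𝒟[O] U :=
  ⟨fun V => (toUnit _ V.1).symm.toAddMonoidHom.comp (D V),
    { natural := natural
      linear := by
        rintro V hV _ _ a ⟨k, rfl, rfl⟩
        refine (leibniz ⟨V, hV⟩ _ _).trans ?_
        rw [linear, zero_mul, zero_add]
        rfl
      order := fun x hx => ⟨U, le_rfl, 2, hx, fun V hV f t h V' hV' f' t' h' => by
        obtain rfl : f = t := h
        obtain rfl : f' = t' := h'
        have key : ∀ W (hW : W ≤ U) (f a : rsec O.ring W),
            f * D ⟨W, hW⟩ a - D ⟨W, hW⟩ (f * a) = -(D ⟨W, hW⟩ f * a) := fun W hW f a => by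
          rw [leibniz]; ring
        funext W
        ext a
        have h₁ := key W.1 (W.2.trans (hV'.trans hV)) (rres _ (W.2.trans hV') f) a
        have h₂ := key W.1 (W.2.trans (hV'.trans hV)) (rres _ (W.2.trans hV') f)
          (rres _ W.2 f' * a)
        have h₃ : rres _ W.2 f' * (rres _ (W.2.trans hV') f *
            D ⟨W.1, W.2.trans (hV'.trans hV)⟩ a -
              D ⟨W.1, W.2.trans (hV'.trans hV)⟩ (rres _ (W.2.trans hV') f * a)) -
            (rres _ (W.2.trans hV') f * D ⟨W.1, W.2.trans (hV'.trans hV)⟩ (rres _ W.2 f' * a) -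
              D ⟨W.1, W.2.trans (hV'.trans hV)⟩
                (rres _ (W.2.trans hV') f * (rres _ W.2 f' * a))) = 0 := by
          rw [h₁, h₂]; ring
        exact h₃⟩ }⟩

theorem DSec.isDer_mkDer
    {D : ∀ V : {V : Opens X // V ≤ U}, rsec O.ring V.1 →+ rsec O.ring V.1}
    {natural linear leibniz} : (DSec.mkDer D natural linear leibniz).IsDer :=
  fun V hV f g => leibniz ⟨V, hV⟩ f g

end MkDer

/-! ### Extension of sections by zero -/

section Extension

/-- A function as a section of a sheaf of functions. -/
def germSec (V : Opens X) (g : X → K) (h : ∀ z ∈ V, g ∈ 𝒢 z) : 𝒪[𝒢] V :=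
  (⟨fun y => g y.1, fun x => ⟨g, h x.1 x.2, ⊤, trivial, fun _ _ => rfl⟩⟩ : germSub 𝒢 V)

theorem valAt_germSec (g : X → K) (h : ∀ z ∈ V, g ∈ 𝒢 z) (z : V) :
    valAt z (germSec V g h) = g z.1 := rfl

open Classical in
/-- The extension of a section by zero. -/
def secExt (f : 𝒪[𝒢] V) : X → K :=
  fun y => if h : y ∈ V then valAt ⟨y, h⟩ f else 0

theorem secExt_apply (f : 𝒪[𝒢] V) (z : V) :
    secExt f z.1 = valAt z f := dif_pos z.2

theorem secExt_add (f g : 𝒪[𝒢] V) :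
    secExt (f + g) = secExt f + secExt g := by
  funext y
  by_cases h : y ∈ V
  · rw [Pi.add_apply, secExt_apply _ ⟨y, h⟩, secExt_apply _ ⟨y, h⟩, secExt_apply _ ⟨y, h⟩, map_add]
  · simp [secExt, h]

theorem secExt_mul (f g : 𝒪[𝒢] V) :
    secExt (f * g) = secExt f * secExt g := by
  funext y
  by_cases h : y ∈ V
  · rw [Pi.mul_apply, secExt_apply _ ⟨y, h⟩, secExt_apply _ ⟨y, h⟩, secExt_apply _ ⟨y, h⟩, map_mul]
  · simp [secExt, h]

theorem secExt_rres_eventuallyEq (hW : W ≤ V) (f : 𝒪[𝒢] V) (z : W) :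
    secExt (rres _ hW f) =ᶠ[nhds z.1] secExt f := by
  filter_upwards [W.isOpen.mem_nhds z.2] with y hy
  rw [secExt_apply _ ⟨y, hy⟩, secExt_apply f ⟨y, hW hy⟩]
  rfl

theorem exists_secExt_eventuallyEq (f : 𝒪[𝒢] V) (z : V) :
    ∃ g ∈ 𝒢 z.1, secExt f =ᶠ[nhds z.1] g := by
  obtain ⟨g, hg, W, hW, e⟩ := (show germSub 𝒢 V from f).2 z
  refine ⟨g, hg, ?_⟩
  filter_upwards [W.isOpen.mem_nhds hW, V.isOpen.mem_nhds z.2] with y hy hyV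
  rw [secExt_apply _ ⟨y, hyV⟩]
  exact e ⟨y, hyV⟩ hy

end Extension

/-! ### Partial derivatives in a chart -/

section Derivative
open Filter Topology
variable {E : Type v} [NormedAddCommGroup E] [NormedSpace ℂ E] [FiniteDimensional ℂ E] {M : Type u}
  [TopologicalSpace M] [ChartedSpace E M] [IsManifold 𝓘(ℂ, E) ω M] {K : Type} [NormedCommRing K]
  [NormedAlgebra ℂ K] [FiniteDimensional ℂ K] {φ : OpenPartialHomeomorph M E}

/-- The domain of a chart. -/
def chartDomain (φ : OpenPartialHomeomorph M E) : Opens (TopCat.of M) := ⟨φ.source, φ.open_source⟩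

theorem secExt_mem_holGerms {V : Opens (TopCat.of M)} (f : rsec (holSheaf E M K).ring V) (z : V) :
    secExt f ∈ holGerms E M K z.1 := by
  obtain ⟨g, hg, e⟩ := exists_secExt_eventuallyEq f z
  exact mem_holGerms.2 ((mem_holGerms.1 hg).congr_of_eventuallyEq e)

/-- A section in the coordinates given by a chart. -/
def inChart (φ : OpenPartialHomeomorph M E) {V : Opens (TopCat.of M)}
    (f : rsec (holSheaf E M K).ring V) : E → K := secExt f ∘ φ.symm

theorem analyticAt_inChart (hφ : φ ∈ IsManifold.maximalAtlas 𝓘(ℂ, E) ω M)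
    {V : Opens (TopCat.of M)} (hV : V ≤ chartDomain φ) (f : rsec (holSheaf E M K).ring V) (z : V) :
    AnalyticAt ℂ (inChart φ f) (φ z.1) :=
  analyticAt_of_mem_holGerms hφ (hV z.2) (secExt_mem_holGerms f z)

theorem eventually_symm {z : M} (hz : z ∈ φ.source) {Q : M → Prop} (h : ∀ᶠ y in 𝓝 z, Q y) :
    ∀ᶠ u in 𝓝 (φ z), Q (φ.symm u) := by
  have := φ.continuousAt_symm (φ.map_source hz)
  rw [ContinuousAt, φ.left_inv hz] at this
  exact this.eventually h

/-- The partial derivative of a section in the direction of a vector, in the coordinates given by a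
chart. -/
def chartDeriv (hφ : φ ∈ IsManifold.maximalAtlas 𝓘(ℂ, E) ω M) (v : E) {V : Opens (TopCat.of M)}
    (hV : V ≤ chartDomain φ) (f : rsec (holSheaf E M K).ring V) : rsec (holSheaf E M K).ring V :=
  germSec V (fun y => fderiv ℂ (inChart φ f) (φ y) v) fun z hz =>
    comp_mem_holGerms_of_analyticAt hφ (hV hz) (f := fun u => fderiv ℂ (inChart φ f) u v)
      (((ContinuousLinearMap.apply ℂ K v).analyticAt _).comp
        (analyticAt_inChart hφ hV f ⟨z, hz⟩).fderiv)

theorem valAt_chartDeriv (hφ : φ ∈ IsManifold.maximalAtlas 𝓘(ℂ, E) ω M) (v : E)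
    {V : Opens (TopCat.of M)} (hV : V ≤ chartDomain φ) (f : rsec (holSheaf E M K).ring V) (z : V) :
    valAt z (chartDeriv hφ v hV f) = fderiv ℂ (inChart φ f) (φ z.1) v := rfl

theorem fderiv_inChart_of_eventuallyEq {V : Opens (TopCat.of M)} (hV : V ≤ chartDomain φ)
    (f : rsec (holSheaf E M K).ring V) (z : V) {g : E → K}
    (h : ∀ᶠ y in 𝓝 z.1, secExt f y = g (φ y)) :
    fderiv ℂ (inChart φ f) (φ z.1) = fderiv ℂ g (φ z.1) := by
  refine Filter.EventuallyEq.fderiv_eq ?_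
  filter_upwards [eventually_symm (hV z.2) h, φ.open_target.mem_nhds (φ.map_source (hV z.2))]
    with u hu ht
  rw [φ.right_inv ht] at hu
  exact hu

/-- The partial derivative as a differential operator. -/
def chartDer (K : Type) [NormedCommRing K] [NormedAlgebra ℂ K] [FiniteDimensional ℂ K]
    (hφ : φ ∈ IsManifold.maximalAtlas 𝓘(ℂ, E) ω M) (v : E) :
    DSec (holSheaf E M K).ring (holSheaf E M K).selfLin (chartDomain φ) :=
  DSec.mkDer (fun V => AddMonoidHom.mk' (chartDeriv hφ v V.2) fun f g => valAt_ext fun z => by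
      rw [map_add, valAt_chartDeriv, valAt_chartDeriv, valAt_chartDeriv, inChart, secExt_add]
      have h := fderiv_add (analyticAt_inChart hφ V.2 f z).differentiableAt
        (analyticAt_inChart hφ V.2 g z).differentiableAt
      exact congrArg (fun L : E →L[ℂ] K => L v) h)
    (fun V W hV hW f => valAt_ext fun z => by
      refine Eq.trans ?_ (congrArg (fun L : E →L[ℂ] K => L v)
        (fderiv_inChart_of_eventuallyEq (hW.trans hV) (rres _ hW f) z (g := inChart φ f) ?_).symm)
      · rfl
      · filter_upwards [secExt_rres_eventuallyEq hW f z, φ.open_source.mem_nhds (hV (hW z.2))]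
          with y hy hys
        rw [hy, inChart, Function.comp_apply, φ.left_inv hys])
    (fun V k => valAt_ext fun z => by
      refine (congrArg (fun L : E →L[ℂ] K => L v)
        (fderiv_inChart_of_eventuallyEq V.2 ((holSheaf E M K).scalar V.1 k) z
          (g := fun _ => k) ?_)).trans ?_
      · filter_upwards [V.1.isOpen.mem_nhds z.2] with y hy
        exact (secExt_apply ((holSheaf E M K).scalar V.1 k) ⟨y, hy⟩).trans rfl
      · rw [fderiv_const_apply, map_zero]; rfl)
    (fun V f g => valAt_ext fun z => by
      change fderiv ℂ (inChart φ (f * g)) (φ z.1) v = _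
      have h := fderiv_mul (analyticAt_inChart hφ V.2 f z).differentiableAt
        (analyticAt_inChart hφ V.2 g z).differentiableAt
      rw [inChart, secExt_mul]
      refine (congrArg (fun L : E →L[ℂ] K => L v) h).trans ?_
      have h₁ : ∀ f : rsec (holSheaf E M K).ring V.1, inChart φ f (φ z.1) = valAt z f := fun f => by
        rw [inChart, Function.comp_apply, φ.left_inv (V.2 z.2), secExt_apply]
      rw [add_apply, smul_apply,
        smul_apply, h₁, h₁, smul_eq_mul, smul_eq_mul, map_add, map_mul, map_mul]
      change valAt z f * valAt z (chartDeriv hφ v V.2 g) +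
        valAt z g * valAt z (chartDeriv hφ v V.2 f) =
        valAt z (chartDeriv hφ v V.2 f) * valAt z g + valAt z f * valAt z (chartDeriv hφ v V.2 g)
      ring)

theorem isDer_chartDer (hφ : φ ∈ IsManifold.maximalAtlas 𝓘(ℂ, E) ω M) (v : E) :
    (chartDer K hφ v).IsDer := DSec.isDer_mkDer

variable {J : Type} [Fintype J] [DecidableEq J] (b : Module.Basis J ℂ E)

/-- The coordinate functions of a chart. -/
def chartCoord (K : Type) [NormedCommRing K] [NormedAlgebra ℂ K] [FiniteDimensional ℂ K]
    (hφ : φ ∈ IsManifold.maximalAtlas 𝓘(ℂ, E) ω M) (i : J) :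
    rsec (holSheaf E M K).ring (chartDomain φ) :=
  germSec _ (fun y => algebraMap ℂ K (b.coord i (φ y))) fun _ hz =>
    comp_mem_holGerms_of_analyticAt hφ hz (f := fun u => algebraMap ℂ K (b.coord i u))
      (((algebraMapCLM ℂ K).comp (LinearMap.toContinuousLinearMap (b.coord i))).analyticAt _)

theorem chartDer_chartCoord (hφ : φ ∈ IsManifold.maximalAtlas 𝓘(ℂ, E) ω M) (i k : J) :
    (chartDer K hφ (b i)).ev le_rfl (chartCoord b K hφ k) = if i = k then 1 else 0 :=
  valAt_ext fun z => by
    let L : E →L[ℂ] K := (algebraMapCLM ℂ K).comp (LinearMap.toContinuousLinearMap (b.coord k))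
    refine (congrArg (fun L : E →L[ℂ] K => L (b i)) (fderiv_inChart_of_eventuallyEq le_rfl
      (chartCoord b K hφ k) z (g := L) ?_)).trans ?_
    · filter_upwards [φ.open_source.mem_nhds z.2] with y hy
      exact secExt_apply (chartCoord b K hφ k) ⟨y, hy⟩
    · rw [L.fderiv]
      change algebraMap ℂ K (b.coord k (b i)) = _
      rw [Module.Basis.coord_apply, b.repr_self, Finsupp.single_apply]
      split
      · rw [map_one, map_one]
      · rw [map_zero, map_zero]

theorem isHadamard_chartCoord (hφ : φ ∈ IsManifold.maximalAtlas 𝓘(ℂ, E) ω M) :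
    IsHadamard (X := TopCat.of M) (holGerms E M K) (chartCoord b K hφ) := fun V hV f z => by
  obtain ⟨G, hG, h⟩ := exists_hadamard b hφ (hV z.2) (secExt_mem_holGerms f z)
  have hG' : ∀ᶠ y in 𝓝 z.1, ∀ i, G i ∈ holGerms E M K y :=
    eventually_all.2 fun i => eventually_mem_holGerms (hG i)
  obtain ⟨t, ht, hto, hzt⟩ := eventually_nhds_iff.1 (h.and hG')
  refine ⟨⟨t, hto⟩ ⊓ V, inf_le_right, fun i => germSec _ (G i) fun y hy => (ht y hy.1).2 i,
    ⟨hzt, z.2⟩, valAt_ext fun y => ?_⟩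
  have e := (ht y.1 y.2.1).1
  rw [secExt_apply f ⟨y.1, y.2.2⟩, secExt_apply f z] at e
  rw [valAt_rres, e, map_add, map_sum, valAt_scalar]
  rfl

end Derivative

/-! ### Coordinates on manifolds and for submersions -/

section Submersion
open Filter Topology

theorem nsmul_germSheaf_injective {X : TopCat.{u}} {K : Type} [CommRing K] [IsAddTorsionFree K]
    {𝒢 : X → Subalgebra K (X → K)} (U : Opens X) {n : ℕ} (hn : n ≠ 0) :
    Function.Injective fun f : 𝒪[𝒢] U => n • f :=
  IsAddTorsionFree.nsmul_right_injective hn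

section HolChart
variable {E : Type v} [NormedAddCommGroup E] [NormedSpace ℂ E] [FiniteDimensional ℂ E] {M : Type u}
  [TopologicalSpace M] [ChartedSpace E M] [IsManifold 𝓘(ℂ, E) ω M] {φ : OpenPartialHomeomorph M E}

/-- The system of coordinates given by a chart of a complex manifold and a basis of the model
space. -/
def holChart (K : Type) [NormedCommRing K] [NormedAlgebra ℂ K] [FiniteDimensional ℂ K]
    [IsAddTorsionFree K] [Algebra ℚ K] {J : Type} [Fintype J] [DecidableEq J]
    (b : Module.Basis J ℂ E) (hφ : φ ∈ IsManifold.maximalAtlas 𝓘(ℂ, E) ω M) :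
    Chart (X := TopCat.of M) (fun x => le_refl (holGerms E M K x)) (chartDomain φ) where
  J := J
  x := chartCoord b K hφ
  d i := chartDer K hφ (b i)
  der _ := isDer_chartDer hφ _
  d_x := chartDer_chartCoord b hφ
  π := (exists_chart (X := TopCat.of M) (chartCoord b K hφ) (fun i => chartDer K hφ (b i))
    (fun _ => isDer_chartDer hφ _) (chartDer_chartCoord b hφ) (isHadamard_chartCoord b hφ)).some
  hadamard := isHadamard_chartCoord b hφ

theorem exists_chart_holSheaf (K : Type) [NormedCommRing K] [NormedAlgebra ℂ K]
    [FiniteDimensional ℂ K] [IsAddTorsionFree K] [Algebra ℚ K] (x : M) :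
    ∃ U₀ : Opens (TopCat.of M), x ∈ U₀ ∧
      Nonempty (Chart (X := TopCat.of M) (fun x => le_refl (holGerms E M K x)) U₀) :=
  ⟨chartDomain (chartAt E x), mem_chart_source E x,
    ⟨holChart K (Module.finBasis ℂ E) (IsManifold.chart_mem_maximalAtlas x)⟩⟩

end HolChart

variable {E : Type v} {F : Type w} {Z X : Type u} [NormedAddCommGroup E] [NormedSpace ℂ E]
  [FiniteDimensional ℂ E] [TopologicalSpace Z] [ChartedSpace E Z] [IsManifold 𝓘(ℂ, E) ω Z]
  [NormedAddCommGroup F] [NormedSpace ℂ F] [FiniteDimensional ℂ F] [TopologicalSpace X]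
  [ChartedSpace F X] [IsManifold 𝓘(ℂ, F) ω X] {p : Z → X}

theorem pullGerms_le (hp : ContMDiff 𝓘(ℂ, E) 𝓘(ℂ, F) ω p) (z : Z) :
    pullGerms F ℂ p z ≤ holGerms E Z ℂ z := by
  rintro _ ⟨g, hg, rfl⟩
  exact comp_mem_holGerms hp z g hg

/-- A section of `p⁻¹ O_X` is locally the pullback of a holomorphic function. -/
theorem exists_eq_pullInv (hp : ContMDiff 𝓘(ℂ, E) 𝓘(ℂ, F) ω p) {V : Opens (TopCat.of Z)}
    (f : rsec (germSheaf (X := TopCat.of Z) (pullGerms F ℂ p)).ring V) (z : V) :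
    ∃ (Ω : Opens (TopCat.of X)) (f' : rsec (holSheaf F X ℂ).ring Ω) (W : Opens (TopCat.of Z))
      (hW : W ≤ V) (hW' : W ≤ (Opens.map (topHom hp)).obj Ω), z.1 ∈ W ∧
      rres _ hW f = rres _ hW' (pullInv hp f') := by
  obtain ⟨_, ⟨g, hg, rfl⟩, W, hzW, e⟩ :=
    (show germSub (X := TopCat.of Z) (pullGerms F ℂ p) V from f).2 z
  obtain ⟨t, ht, hto, hzt⟩ := eventually_nhds_iff.1 (eventually_mem_holGerms hg)
  let Ω : Opens (TopCat.of X) := ⟨t, hto⟩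
  refine ⟨Ω, germSec Ω g ht, (W ⊓ V) ⊓ (Opens.map (topHom hp)).obj Ω,
    inf_le_left.trans inf_le_right, inf_le_right, ⟨⟨hzW, z.2⟩, hzt⟩, valAt_ext fun y => ?_⟩
  exact e ⟨y.1, y.2.1.2⟩ y.2.1.1

variable (hp : ContMDiff 𝓘(ℂ, E) 𝓘(ℂ, F) ω p) {z : Z}
  (h : Manifold.IsSubmersionAt 𝓘(ℂ, E) 𝓘(ℂ, F) ω p z)

theorem finiteDimensional_complement :
    FiniteDimensional ℂ h.complement :=
  Module.Finite.of_surjective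
    ((LinearMap.snd ℂ F h.complement).comp h.equiv.toLinearEquiv.toLinearMap)
    (Prod.snd_surjective.comp h.equiv.surjective)

/-- A basis of the model space adapted to a submersion. -/
def submersionBasis :
    Module.Basis (Fin (Module.finrank ℂ F) ⊕ Fin (Module.finrank ℂ h.complement)) ℂ E :=
  have := finiteDimensional_complement h
  ((Module.finBasis ℂ F).prod (Module.finBasis ℂ h.complement)).map h.equiv.symm.toLinearEquiv

theorem submersionBasis_inl (i : Fin (Module.finrank ℂ F)) :
    h.equiv (submersionBasis h (.inl i)) = (Module.finBasis ℂ F i, 0) := by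
  have := finiteDimensional_complement h
  refine (congrArg h.equiv (Module.Basis.map_apply ..)).trans
    ((h.equiv.apply_symm_apply _).trans ?_)
  exact Prod.ext (Module.Basis.prod_apply_inl_fst ..) (Module.Basis.prod_apply_inl_snd ..)

theorem coord_submersionBasis_inl (i : Fin (Module.finrank ℂ F)) (u : E) :
    (submersionBasis h).coord (.inl i) u = (Module.finBasis ℂ F).coord i (h.equiv u).1 := by
  have := finiteDimensional_complement h
  rw [Module.Basis.coord_apply, Module.Basis.coord_apply]
  exact Module.Basis.prod_repr_inl ..

theorem codChart_apply {y : Z}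
    (hy : y ∈ h.domChart.source) : h.codChart (p y) = (h.equiv (h.domChart y)).1 := by
  have hy' : h.domChart y ∈ (h.domChart.extend 𝓘(ℂ, E)).target := by
    simpa using h.domChart.map_source hy
  have := h.writtenInCharts hy'
  simpa [h.domChart.left_inv hy] using this

theorem chartDomain_domChart_le :
    (chartDomain h.domChart : Opens (TopCat.of Z)) ≤
      (Opens.map (topHom hp)).obj (chartDomain h.codChart) :=
  fun _ hy => h.source_subset_preimage_source hy

/-- The coordinates on the base of a submersion, pulled back. -/
def baseCoord (i : Fin (Module.finrank ℂ F)) :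
    rsec (germSheaf (X := TopCat.of Z) (pullGerms F ℂ p)).ring (chartDomain h.domChart) :=
  rres _ (chartDomain_domChart_le hp h)
    (pullInv hp (chartCoord (Module.finBasis ℂ F) ℂ h.codChart_mem_maximalAtlas i))

theorem germIncl_baseCoord (i : Fin (Module.finrank ℂ F)) :
    germIncl (X := TopCat.of Z) (pullGerms_le hp) _ (baseCoord hp h i) =
      chartCoord (submersionBasis h) ℂ h.domChart_mem_maximalAtlas (.inl i) :=
  valAt_ext fun y => by
    change algebraMap ℂ ℂ ((Module.finBasis ℂ F).coord i (h.codChart (p y.1))) =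
      algebraMap ℂ ℂ ((submersionBasis h).coord (.inl i) (h.domChart y.1))
    rw [codChart_apply h y.2, coord_submersionBasis_inl]

theorem elim_baseCoord :
    Sum.elim (fun k => germIncl (X := TopCat.of Z) (pullGerms_le hp) _ (baseCoord hp h k))
      (fun k => chartCoord (submersionBasis h) ℂ h.domChart_mem_maximalAtlas (.inr k)) =
    chartCoord (submersionBasis h) ℂ h.domChart_mem_maximalAtlas := by
  funext k
  rcases k with k | k
  · exact germIncl_baseCoord hp h k
  · rfl

theorem isHadamard_baseCoord :
    IsHadamard (X := TopCat.of Z) (pullGerms F ℂ p) (baseCoord hp h) := fun V hV f y => by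
  obtain ⟨Ω, f', W, hW, hW', hy, e⟩ := exists_eq_pullInv hp f y
  let y' : (chartDomain h.codChart ⊓ Ω : Opens (TopCat.of X)) :=
    ⟨p y.1, chartDomain_domChart_le hp h (hV y.2), hW' hy⟩
  obtain ⟨Ω', hΩ', g, hy', e'⟩ := isHadamard_chartCoord (Module.finBasis ℂ F)
    h.codChart_mem_maximalAtlas _ inf_le_left (rres _ inf_le_right f') y'
  refine ⟨W ⊓ (Opens.map (topHom hp)).obj Ω', inf_le_left.trans hW,
    fun i => rres _ inf_le_right (pullInv hp (g i)), ⟨hy, hy'⟩, valAt_ext fun v => ?_⟩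
  have e₁ := congrArg (valAt ⟨v.1, v.2.1⟩) e
  have e₂ := congrArg (valAt ⟨y.1, hy⟩) e
  have e₃ := congrArg (valAt (⟨p v.1, v.2.2⟩ : Ω')) e'
  rw [map_add, map_sum] at e₃ ⊢
  refine e₁.trans (e₃.trans ?_)
  refine congrArg₂ (· + ·) e₂.symm ?_
  rfl

/-- The system of coordinates given by a submersion in the charts in which it is a linear
projection. -/
def submersionChart :
    RelChart (X := TopCat.of Z) (pullGerms_le hp) (chartDomain h.domChart) where
  J := Fin (Module.finrank ℂ F)
  J' := Fin (Module.finrank ℂ h.complement)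
  x := baseCoord hp h
  x' k := chartCoord (submersionBasis h) ℂ h.domChart_mem_maximalAtlas (.inr k)
  d i := chartDer ℂ h.domChart_mem_maximalAtlas (submersionBasis h i)
  der _ := isDer_chartDer _ _
  d_x i k := by
    rw [elim_baseCoord hp h]
    exact chartDer_chartCoord (submersionBasis h) _ i k
  hadamard := isHadamard_baseCoord hp h
  hadamard' := by
    rw [elim_baseCoord hp h]
    exact isHadamard_chartCoord (submersionBasis h) _

/-- The derivations along the base coordinates are compatible with pullback. -/
theorem chartDer_pullHol (i : Fin (Module.finrank ℂ F))
    {Ω : Opens (TopCat.of X)} (hΩ : Ω ≤ chartDomain h.codChart)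
    (f : rsec (holSheaf F X ℂ).ring Ω) {W : Opens (TopCat.of Z)} (hW : W ≤ chartDomain h.domChart)
    (hW' : W ≤ (Opens.map (topHom hp)).obj Ω) :
    (chartDer ℂ h.domChart_mem_maximalAtlas (submersionBasis h (.inl i))).ev hW
      (rres _ hW' (pullHol hp f)) = rres _ hW' (pullHol hp
        ((chartDer ℂ h.codChart_mem_maximalAtlas (Module.finBasis ℂ F i)).ev hΩ f)) :=
  valAt_ext fun y => by
    let y' : Ω := ⟨p y.1, hW' y.2⟩
    let L : E →L[ℂ] F :=
      (ContinuousLinearMap.fst ℂ F h.complement).comp h.equiv.toContinuousLinearMap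
    have hL : L (h.domChart y.1) = h.codChart y'.1 := (codChart_apply h (hW y.2)).symm
    have h₁ : fderiv ℂ (inChart h.domChart (rres _ hW' (pullHol hp f))) (h.domChart y.1) =
        fderiv ℂ (inChart h.codChart f ∘ L) (h.domChart y.1) := by
      refine fderiv_inChart_of_eventuallyEq hW (rres _ hW' (pullHol hp f)) y
        (g := inChart h.codChart f ∘ L) ?_
      filter_upwards [W.isOpen.mem_nhds y.2] with v hv
      have hLv : L (h.domChart v) = h.codChart (p v) := (codChart_apply h (hW hv)).symm
      rw [secExt_apply (rres _ hW' (pullHol hp f)) (⟨v, hv⟩ : W), Function.comp_apply, hLv,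
        inChart, Function.comp_apply,
        show h.codChart.symm (h.codChart (p v)) = p v from h.codChart.left_inv (hΩ (hW' hv)),
        secExt_apply f (⟨p v, hW' hv⟩ : Ω)]
      rfl
    have h₂ := (analyticAt_inChart h.codChart_mem_maximalAtlas hΩ f y').differentiableAt
    rw [← hL] at h₂
    refine (congrArg (fun A : E →L[ℂ] ℂ => A (submersionBasis h (.inl i)))
      (h₁.trans (fderiv_comp _ h₂ L.differentiableAt))).trans ?_
    rw [L.fderiv, hL]
    change fderiv ℂ (inChart h.codChart f) (h.codChart y'.1)
      (h.equiv (submersionBasis h (.inl i))).1 = _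
    rw [submersionBasis_inl]
    rfl

/-- Iterated derivatives along the base coordinates are compatible with pullback. -/
theorem divPow_pullHol (γ : Fin (Module.finrank ℂ F) →₀ ℕ)
    {Ω : Opens (TopCat.of X)} (hΩ : Ω ≤ chartDomain h.codChart)
    (f : rsec (holSheaf F X ℂ).ring Ω) {W : Opens (TopCat.of Z)} (hW : W ≤ chartDomain h.domChart)
    (hW' : W ≤ (Opens.map (topHom hp)).obj Ω) :
    ((submersionChart hp h).sub.π.p γ).ev hW (rres _ hW' (pullHol hp f)) =
      rres _ hW' (pullHol hp (((holChart ℂ (Module.finBasis ℂ F)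
        h.codChart_mem_maximalAtlas).π.p γ).ev hΩ f)) := by
  let c := (submersionChart hp h).sub
  let c' := holChart ℂ (Module.finBasis ℂ F) h.codChart_mem_maximalAtlas
  change (c.π.p γ).ev hW (rres _ hW' (pullHol hp f)) =
      rres _ hW' (pullHol hp ((c'.π.p γ).ev hΩ f))
  induction γ using multiIndex_induction generalizing Ω f W with
  | zero =>
    refine (congrArg (fun A => DSec.ev A hW (rres _ hW' (pullHol hp f))) c.π.p_zero).trans ?_
    exact (congrArg (fun A => rres _ hW' (pullHol hp (DSec.ev A hΩ f))) c'.π.p_zero).symm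
  | add γ i ih =>
    refine nsmul_germSheaf_injective (X := TopCat.of Z) (𝒢 := holGerms E Z ℂ) W
      (Nat.succ_ne_zero (γ i)) ?_
    have h₁ := c.p_ev_d γ i hW (rres _ hW' (pullHol hp f))
    have h₂ := congrArg (fun g => rres _ hW' (pullHol hp g)) (c'.p_ev_d γ i hΩ f)
    have h₃ : (c.d i).ev hW (rres _ hW' (pullHol hp f)) =
        rres _ hW' (pullHol hp ((c'.d i).ev hΩ f)) := chartDer_pullHol hp h i hΩ f hW hW'
    rw [h₃, ih hΩ _ hW hW'] at h₁
    refine h₁.symm.trans (h₂.trans ?_)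
    exact map_nsmul ((rres _ hW').comp (germPull (topHom hp) (comp_mem_holGerms hp) Ω)) _ _

end Submersion

/-! ### Inverse images of modules -/

section InverseImage
variable {Z : TopCat.{u}} {𝒢' : Z → Subalgebra K (Z → K)} {p : Z ⟶ X}
  {h : ∀ (z : Z), ∀ g ∈ 𝒢 (p z), (fun y => g (p y)) ∈ 𝒢' z}
  {N : SheafOfModules.{u} (germSheaf 𝒢).ring} {A A' : SheafOfModules.{u} (germSheaf 𝒢').ring}

variable (p h) in
/-- The direct image of a module. -/
def directImage (A : SheafOfModules.{u} (germSheaf 𝒢').ring) :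
    SheafOfModules.{u} (germSheaf 𝒢).ring :=
  (SheafOfModules.pushforward.{u} (germPullHom p h)).obj A

variable (p h) in
/-- The direct image of a morphism. -/
def directImageMap (g : A ⟶ A') : directImage p h A ⟶ directImage p h A' :=
  (SheafOfModules.pushforward.{u} (germPullHom p h)).map g

/-- A morphism to a direct image given by its values. -/
def pullMk (f : ∀ U : Opens X, msec N U →+ msec A ((Opens.map p).obj U))
    (hn : ∀ U V (hV : V ≤ U) (s : msec N U),
      mres A ((Opens.map p).monotone hV) (f U s) = f V (mres N hV s))
    (hs : ∀ (U : Opens X) (r : 𝒪[𝒢] U) (s : msec N U),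
      f U (r • s) = germPull p h U r • f U s) : N ⟶ directImage p h A :=
  mkHom (N := directImage p h A) f hn hs

/-- The value of a morphism to a direct image, as a section over the inverse image. -/
def pullSec (t : N ⟶ directImage p h A) {Ω : Opens X}
    (s : msec N Ω) : msec A ((Opens.map p).obj Ω) := app t s

variable (t : N ⟶ directImage p h A)

theorem pullSec_add {Ω : Opens X} (s s' : msec N Ω) :
    pullSec t (s + s') = pullSec t s + pullSec t s' := map_add (app t) s s'

theorem pullSec_smul {Ω : Opens X} (r : 𝒪[𝒢] Ω) (s : msec N Ω) :
    pullSec t (r • s) = germPull p h Ω r • pullSec t s := map_smul (app t) r s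

theorem mres_pullSec {Ω Ω' : Opens X} (hΩ : Ω' ≤ Ω) (s : msec N Ω) :
    mres A ((Opens.map p).monotone hΩ) (pullSec t s) = pullSec t (mres N hΩ s) :=
  mres_app t hΩ s

theorem pullSec_comp (g : A ⟶ A') {Ω : Opens X} (s : msec N Ω) :
    pullSec (t ≫ directImageMap p h g) s = app g (pullSec t s) :=
  rfl

/-- The values of two morphisms to direct images, as a pair. -/
def pullPair (t : N ⟶ directImage p h A)
    (t' : N ⟶ directImage p h A') {Ω : Opens X}
    {W : Opens Z} (hW : W ≤ (Opens.map p).obj Ω) (s : msec N Ω) : msec A W × msec A' W :=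
  (mres A hW (pullSec t s), mres A' hW (pullSec t' s))

variable (t' : N ⟶ directImage p h A')

theorem pullPair_add {Ω : Opens X} {W : Opens Z} (hW : W ≤ (Opens.map p).obj Ω) (s s' : msec N Ω) :
    pullPair t t' hW (s + s') = pullPair t t' hW s + pullPair t t' hW s' := by
  simp only [pullPair, pullSec_add, map_add, Prod.mk_add_mk]

theorem pullPair_smul {Ω : Opens X} {W : Opens Z} (hW : W ≤ (Opens.map p).obj Ω)
    (r : 𝒪[𝒢] Ω) (s : msec N Ω) :
    pullPair t t' hW (r • s) = rres _ hW (germPull p h Ω r) • pullPair t t' hW s := by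
  simp only [pullPair, pullSec_smul, mres_smul, Prod.smul_mk]

theorem pullPair_mres {Ω Ω' : Opens X} (hΩ : Ω' ≤ Ω) {W : Opens Z} (hW : W ≤ (Opens.map p).obj Ω')
    (s : msec N Ω) : pullPair t t' hW (mres N hΩ s) =
      pullPair t t' (hW.trans ((Opens.map p).monotone hΩ)) s := by
  simp only [pullPair, ← mres_pullSec, mres_mres]

/-- Restriction of pairs of sections. -/
def pairRes (A A' : SheafOfModules.{u} (germSheaf 𝒢').ring) {V W : Opens Z} (hW : W ≤ V) :
    msec A V × msec A' V →+ msec A W × msec A' W := (mres A hW).prodMap (mres A' hW)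

theorem pairRes_pairRes {V W W' : Opens Z} (hW : W ≤ V) (hW' : W' ≤ W)
    (x : msec A V × msec A' V) :
    pairRes A A' hW' (pairRes A A' hW x) = pairRes A A' (hW'.trans hW) x :=
  Prod.ext (mres_mres ..) (mres_mres ..)

theorem pairRes_smul {V W : Opens Z} (hW : W ≤ V) (r : 𝒪[𝒢'] V)
    (x : msec A V × msec A' V) :
    pairRes A A' hW (r • x) = rres _ hW r • pairRes A A' hW x :=
  Prod.ext (mres_smul ..) (mres_smul ..)

theorem pairRes_pullPair {Ω : Opens X} {V W : Opens Z} (hV : V ≤ (Opens.map p).obj Ω) (hW : W ≤ V)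
    (s : msec N Ω) : pairRes A A' hW (pullPair t t' hV s) = pullPair t t' (hW.trans hV) s :=
  Prod.ext (mres_mres ..) (mres_mres ..)

/-- The submodule spanned by the pairs of values of two morphisms to direct images. -/
def pullSpan (t : N ⟶ directImage p h A)
    (t' : N ⟶ directImage p h A') (W : Opens Z) :
    Submodule (𝒪[𝒢'] W) (msec A W × msec A' W) :=
  Submodule.span _ {x | ∃ (Ω : Opens X) (hW : W ≤ (Opens.map p).obj Ω) (s : msec N Ω),
    x = pullPair t t' hW s}

theorem pairRes_mem_span {V W : Opens Z} (hW : W ≤ V) {S : Set (msec A V × msec A' V)}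
    {S' : Set (msec A W × msec A' W)} (hS : ∀ x ∈ S, pairRes A A' hW x ∈ S')
    {x : msec A V × msec A' V} (hx : x ∈ Submodule.span (𝒪[𝒢'] V) S) :
    pairRes A A' hW x ∈ Submodule.span (𝒪[𝒢'] W) S' := by
  induction hx using Submodule.span_induction with
  | mem x hx => exact Submodule.subset_span (hS x hx)
  | zero => rw [map_zero]; exact zero_mem _
  | add x y _ _ hx hy => rw [map_add]; exact add_mem hx hy
  | smul r x _ hx => rw [pairRes_smul]; exact Submodule.smul_mem _ _ hx

theorem pairRes_mem_pullSpan {V W : Opens Z} (hW : W ≤ V) {x : msec A V × msec A' V}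
    (hx : x ∈ pullSpan t t' V) : pairRes A A' hW x ∈ pullSpan t t' W :=
  pairRes_mem_span hW (by
    rintro _ ⟨Ω, hV, s, rfl⟩
    exact ⟨Ω, hW.trans hV, s, pairRes_pullPair ..⟩) hx

/-- Sections of a module over `V₀` that generate it over the subsets of `V₀` and whose images under
a morphism to a direct image form a basis over the subsets of `U₀`. -/
structure PullFrame (t : N ⟶ directImage p h A)
    (V₀ : Opens X) (U₀ : Opens Z) where
  le : U₀ ≤ (Opens.map p).obj V₀
  I : Type
  e : I → msec N V₀
  gen : ∀ Ω (hΩ : Ω ≤ V₀) (s : msec N Ω), ∀ y ∈ Ω, ∃ (Ω' : Opens X) (hΩ' : Ω' ≤ Ω),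
    y ∈ Ω' ∧ mres N hΩ' s ∈ Submodule.span (𝒪[𝒢] Ω')
      (Set.range fun i => mres N (hΩ'.trans hΩ) (e i))
  gen' : ∀ (V : Opens Z) (hV : V ≤ U₀) (a : msec A V), ∀ y ∈ V, ∃ (W : Opens Z) (hW : W ≤ V),
    y ∈ W ∧ mres A hW a ∈ Submodule.span (𝒪[𝒢'] W)
      (Set.range fun i => mres A ((hW.trans hV).trans le) (pullSec t (e i)))
  indep : ∀ (W : Opens Z) (hW : W ≤ U₀), LinearIndependent (𝒪[𝒢'] W)
    fun i => mres A (hW.trans le) (pullSec t (e i))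

variable {t} {V₀ : Opens X} {U₀ : Opens Z}

/-- Near a point of the domain of a frame, only the values on the frame are needed. -/
theorem PullFrame.pairRes_mem (c : PullFrame t V₀ U₀) {W : Opens Z}
    {x : msec A W × msec A' W} (hx : x ∈ pullSpan t t' W) (z : Z) (hz : z ∈ W) (hz' : z ∈ U₀) :
    ∃ (W' : Opens Z) (hW' : W' ≤ W) (hW₀ : W' ≤ U₀), z ∈ W' ∧ pairRes A A' hW' x ∈
      Submodule.span (𝒪[𝒢'] W')
        (Set.range fun i => pullPair t t' (hW₀.trans c.le) (c.e i)) := by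
  have hres : ∀ {W₁ W₂ : Opens Z} (h₁ : W₁ ≤ W) (h₂ : W₂ ≤ W₁) (h₀ : W₁ ≤ U₀)
      {x : msec A W × msec A' W}, pairRes A A' h₁ x ∈ Submodule.span (𝒪[𝒢'] W₁)
        (Set.range fun i => pullPair t t' (h₀.trans c.le) (c.e i)) →
      pairRes A A' (h₂.trans h₁) x ∈ Submodule.span (𝒪[𝒢'] W₂)
        (Set.range fun i => pullPair t t' ((h₂.trans h₀).trans c.le) (c.e i)) := by
    intro W₁ W₂ h₁ h₂ h₀ x hx
    rw [← pairRes_pairRes h₁ h₂]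
    refine pairRes_mem_span h₂ ?_ hx
    rintro _ ⟨i, rfl⟩
    exact ⟨i, (pairRes_pullPair ..).symm⟩
  induction hx using Submodule.span_induction with
  | mem x hx =>
    obtain ⟨Ω, hW, s, rfl⟩ := hx
    obtain ⟨Ω', hΩ', hy, hs⟩ := c.gen (Ω ⊓ V₀) inf_le_right (mres N inf_le_left s) (p z)
      ⟨hW hz, c.le hz'⟩
    refine ⟨(W ⊓ (Opens.map p).obj Ω') ⊓ U₀, inf_le_left.trans inf_le_left, inf_le_right,
      ⟨⟨hz, hy⟩, hz'⟩, ?_⟩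
    have hW' : (W ⊓ (Opens.map p).obj Ω') ⊓ U₀ ≤ (Opens.map p).obj Ω' :=
      inf_le_left.trans inf_le_right
    have key : ∀ s : msec N Ω', s ∈ Submodule.span (𝒪[𝒢] Ω')
        (Set.range fun i => mres N (hΩ'.trans inf_le_right) (c.e i)) →
        pullPair t t' hW' s ∈ Submodule.span
          (𝒪[𝒢'] ((W ⊓ (Opens.map p).obj Ω') ⊓ U₀))
          (Set.range fun i => pullPair t t'
            ((inf_le_right : (W ⊓ (Opens.map p).obj Ω') ⊓ U₀ ≤ U₀).trans c.le) (c.e i)) := by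
      intro s hs
      induction hs using Submodule.span_induction with
      | mem s hs =>
        obtain ⟨i, rfl⟩ := hs
        exact Submodule.subset_span ⟨i, (pullPair_mres ..).symm⟩
      | zero =>
        have : pullPair t t' hW' 0 = 0 := by
          have := pullPair_add t t' hW' 0 0
          rwa [add_zero, eq_comm, add_eq_left] at this
        rw [this]; exact zero_mem _
      | add x y _ _ hx hy => rw [pullPair_add]; exact add_mem hx hy
      | smul r x _ hx => rw [pullPair_smul]; exact Submodule.smul_mem _ _ hx
    have := key _ hs
    rw [pullPair_mres, pullPair_mres] at this
    rw [pairRes_pullPair]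
    exact this
  | zero =>
    refine ⟨W ⊓ U₀, inf_le_left, inf_le_right, ⟨hz, hz'⟩, ?_⟩
    rw [map_zero]; exact zero_mem _
  | add x y _ _ hx hy =>
    obtain ⟨W₁, h₁, h₁', hz₁, hx⟩ := hx
    obtain ⟨W₂, h₂, h₂', hz₂, hy⟩ := hy
    refine ⟨W₁ ⊓ W₂, inf_le_left.trans h₁, inf_le_left.trans h₁', ⟨hz₁, hz₂⟩, ?_⟩
    rw [map_add]
    exact add_mem (hres h₁ inf_le_left h₁' hx) (hres h₂ inf_le_right h₂' hy)
  | smul r x _ hx =>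
    obtain ⟨W₁, h₁, h₁', hz₁, hx⟩ := hx
    refine ⟨W₁, h₁, h₁', hz₁, ?_⟩
    rw [pairRes_smul]
    exact Submodule.smul_mem _ _ hx

theorem snd_eq_zero_of_mem_pullSpan (ht : ∀ z, ∃ (V₀ : Opens X) (U₀ : Opens Z),
    z ∈ U₀ ∧ Nonempty (PullFrame t V₀ U₀)) {W : Opens Z} {n : msec A' W}
    (hn : (0, n) ∈ pullSpan t t' W) : n = 0 := by
  refine msec_ext A' fun z hz => ?_
  obtain ⟨V₀, U₀, hz', ⟨c⟩⟩ := ht z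
  obtain ⟨W', hW', hW₀, hz₁, h'⟩ := c.pairRes_mem t' hn z hz hz'
  refine ⟨W', hW', hz₁, ?_⟩
  rw [← Set.image_univ, Finsupp.mem_span_image_iff_linearCombination] at h'
  obtain ⟨b, -, hb⟩ := h'
  have h₁ := congrArg Prod.fst hb
  have h₂ := congrArg Prod.snd hb
  rw [Finsupp.linearCombination_apply, Finsupp.sum, Prod.fst_sum] at h₁
  rw [Finsupp.linearCombination_apply, Finsupp.sum, Prod.snd_sum] at h₂
  have hb0 : b = 0 := by
    refine linearIndependent_iff.1 (c.indep W' hW₀) b ?_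
    rw [Finsupp.linearCombination_apply, Finsupp.sum]
    exact h₁.trans (map_zero (mres A hW'))
  rw [hb0] at h₂
  exact h₂.symm.trans (by simp)

theorem exists_mem_pullSpan (ht : ∀ z, ∃ (V₀ : Opens X) (U₀ : Opens Z),
    z ∈ U₀ ∧ Nonempty (PullFrame t V₀ U₀)) {V : Opens Z} (a : msec A V) (z : Z) (hz : z ∈ V) :
    ∃ (W : Opens Z) (hW : W ≤ V) (n : msec A' W), z ∈ W ∧ (mres A hW a, n) ∈ pullSpan t t' W := by
  obtain ⟨V₀, U₀, hz', ⟨c⟩⟩ := ht z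
  obtain ⟨W, hW, hzW, hs⟩ := c.gen' (V ⊓ U₀) inf_le_right (mres A inf_le_left a) z ⟨hz, hz'⟩
  rw [mres_mres] at hs
  have key : ∀ x : msec A W, x ∈ Submodule.span (𝒪[𝒢'] W)
      (Set.range fun i => mres A ((hW.trans inf_le_right).trans c.le) (pullSec t (c.e i))) →
      ∃ n, (x, n) ∈ pullSpan t t' W := by
    intro x hx
    induction hx using Submodule.span_induction with
    | mem x hx =>
      obtain ⟨i, rfl⟩ := hx
      exact ⟨_, Submodule.subset_span ⟨_, (hW.trans inf_le_right).trans c.le, c.e i, rfl⟩⟩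
    | zero => exact ⟨0, zero_mem _⟩
    | add x y _ _ hx hy =>
      obtain ⟨n, hn⟩ := hx
      obtain ⟨m, hm⟩ := hy
      exact ⟨n + m, add_mem hn hm⟩
    | smul r x _ hx =>
      obtain ⟨n, hn⟩ := hx
      exact ⟨r • n, Submodule.smul_mem _ r hn⟩
  obtain ⟨n, hn⟩ := key _ hs
  exact ⟨W, hW.trans inf_le_left, n, hzW, hn⟩

/-- A pair of sections that locally are the same linear combination of the values of two morphisms
to direct images. -/
def InPullSpan (t : N ⟶ directImage p h A)
    (t' : N ⟶ directImage p h A') (V : Opens Z)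
    (x : msec A V × msec A' V) : Prop :=
  ∀ z ∈ V, ∃ (W : Opens Z) (hW : W ≤ V), z ∈ W ∧ pairRes A A' hW x ∈ pullSpan t t' W

variable {t'}

theorem InPullSpan.add {V : Opens Z} {x y : msec A V × msec A' V} (hx : InPullSpan t t' V x)
    (hy : InPullSpan t t' V y) : InPullSpan t t' V (x + y) := fun z hz => by
  obtain ⟨W₁, h₁, hz₁, hx⟩ := hx z hz
  obtain ⟨W₂, h₂, hz₂, hy⟩ := hy z hz
  refine ⟨W₁ ⊓ W₂, inf_le_left.trans h₁, ⟨hz₁, hz₂⟩, ?_⟩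
  rw [map_add, ← pairRes_pairRes h₁ inf_le_left, ← pairRes_pairRes h₂ inf_le_right]
  exact add_mem (pairRes_mem_pullSpan t t' _ hx) (pairRes_mem_pullSpan t t' _ hy)

theorem InPullSpan.smul {V : Opens Z} {x : msec A V × msec A' V} (hx : InPullSpan t t' V x)
    (r : 𝒪[𝒢'] V) : InPullSpan t t' V (r • x) := fun z hz => by
  obtain ⟨W₁, h₁, hz₁, hx⟩ := hx z hz
  refine ⟨W₁, h₁, hz₁, ?_⟩
  rw [pairRes_smul]
  exact Submodule.smul_mem _ _ hx

theorem InPullSpan.res {V W : Opens Z} (hW : W ≤ V) {x : msec A V × msec A' V}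
    (hx : InPullSpan t t' V x) : InPullSpan t t' W (pairRes A A' hW x) := fun z hz => by
  obtain ⟨W₁, h₁, hz₁, hx⟩ := hx z (hW hz)
  refine ⟨W₁ ⊓ W, inf_le_right, ⟨hz₁, hz⟩, ?_⟩
  have := pairRes_mem_pullSpan t t' (inf_le_left : W₁ ⊓ W ≤ W₁) hx
  rw [pairRes_pairRes] at this ⊢
  exact this

theorem InPullSpan.ext (ht : ∀ z, ∃ (V₀ : Opens X) (U₀ : Opens Z),
    z ∈ U₀ ∧ Nonempty (PullFrame t V₀ U₀)) {V : Opens Z} {a : msec A V} {n n' : msec A' V}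
    (hn : InPullSpan t t' V (a, n)) (hn' : InPullSpan t t' V (a, n')) : n = n' := by
  rw [← sub_eq_zero]
  refine msec_ext A' fun z hz => ?_
  have h₁ : InPullSpan t t' V (0, n - n') := by
    have := hn.add (hn'.smul (-1))
    rwa [neg_one_smul, Prod.neg_mk, Prod.mk_add_mk, add_neg_cancel, ← sub_eq_add_neg] at this
  obtain ⟨W, hW, hzW, hx⟩ := h₁ z hz
  refine ⟨W, hW, hzW, ?_⟩
  rw [map_zero]
  refine snd_eq_zero_of_mem_pullSpan t' ht (t := t) ?_
  have : pairRes A A' hW (0, n - n') = (0, mres A' hW (n - n')) :=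
    Prod.ext (map_zero (mres A hW)) rfl
  rwa [this] at hx

theorem InPullSpan.exists (ht : ∀ z, ∃ (V₀ : Opens X) (U₀ : Opens Z),
    z ∈ U₀ ∧ Nonempty (PullFrame t V₀ U₀)) {V : Opens Z} (a : msec A V) :
    ∃ n : msec A' V, InPullSpan t t' V (a, n) := by
  have := msec_exists_of_local' A' (U := V) (fun W hW n => InPullSpan t t' W (mres A hW a, n))
    (fun W W' hW hW' n hn => by
      have := hn.res hW'
      rwa [show pairRes A A' hW' (mres A hW a, n) = (mres A (hW'.trans hW) a, mres A' hW' n) from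
        Prod.ext (mres_mres ..) rfl] at this)
    (fun W hW n hn z hz => by
      obtain ⟨W₁, h₁, hz₁, hx⟩ := hn z hz
      obtain ⟨W₂, h₂, hz₂, hx⟩ := hx z hz₁
      refine ⟨W₂, h₂.trans h₁, hz₂, ?_⟩
      rw [← pairRes_pairRes h₁ h₂,
        show pairRes A A' h₁ (mres A hW a, n) = (mres A (h₁.trans hW) a, mres A' h₁ n) from
          Prod.ext (mres_mres ..) rfl]
      exact hx)
    (fun W hW n n' hn hn' => hn.ext ht hn')
    (fun z hz => by
      obtain ⟨W, hW, n, hzW, hx⟩ := exists_mem_pullSpan t' ht a z hz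
      refine ⟨W, hW, n, hzW, fun y hy => ⟨W, le_rfl, hy, pairRes_mem_pullSpan t t' _ hx⟩⟩)
  rwa [mres_self] at this

/-- Every morphism to a direct image extends along a morphism that locally has frames. -/
theorem exists_hom_of_pullFrame (ht : ∀ z, ∃ (V₀ : Opens X) (U₀ : Opens Z),
    z ∈ U₀ ∧ Nonempty (PullFrame t V₀ U₀)) :
    ∃ k : A ⟶ A', (∀ V (a : msec A V), InPullSpan t t' V (a, app k a)) ∧
      ∀ Ω (s : msec N Ω), app k (pullSec t s) = pullSec t' s := by
  choose k hk using fun V (a : msec A V) => InPullSpan.exists (t' := t') ht a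
  let k' : A ⟶ A' := mkHom (fun V => AddMonoidHom.mk' (k V) fun a b =>
      (hk V (a + b)).ext ht ((hk V a).add (hk V b)))
    (fun U V hV a => ((hk U a).res hV).ext ht (hk V _))
    (fun U r a => (hk U (r • a)).ext ht ((hk U a).smul r))
  have hk' : ∀ V (a : msec A V), app k' a = k V a := fun V a => app_mkHom ..
  refine ⟨k', fun V a => by rw [hk']; exact hk V a, fun Ω s => ?_⟩
  rw [hk']
  refine (hk _ _).ext ht fun z hz => ⟨_, le_rfl, hz, Submodule.subset_span ⟨Ω, le_rfl, s, rfl⟩⟩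

theorem isIso_of_pullFrame (ht : ∀ z, ∃ (V₀ : Opens X) (U₀ : Opens Z),
    z ∈ U₀ ∧ Nonempty (PullFrame t V₀ U₀)) (j : A' ⟶ A)
    (hj : t' ≫ directImageMap p h j = t)
    (hext : ∀ k k' : A' ⟶ A', t' ≫ directImageMap p h k =
      t' ≫ directImageMap p h k' → k = k') : IsIso j := by
  have hj' : ∀ (Ω : Opens X) (s : msec N Ω), app j (pullSec t' s) = pullSec t s := by
    intro Ω s
    rw [← pullSec_comp, hj]
  obtain ⟨k, hk, hk'⟩ := exists_hom_of_pullFrame (t' := t') ht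
  refine ⟨k, hext _ _ (hom_ext_app fun Ω s => ?_),
    hom_ext_app fun V a => msec_ext A fun z hz => ?_⟩
  · change app k (app j (pullSec t' s)) = pullSec t' s
    rw [hj', hk']
  · obtain ⟨W, hW, hzW, hx⟩ := hk V a z hz
    refine ⟨W, hW, hzW, ?_⟩
    have key : ∀ x ∈ pullSpan t t' W, app j x.2 = x.1 := by
      intro x hx
      induction hx using Submodule.span_induction with
      | mem x hx =>
        obtain ⟨Ω, hW, s, rfl⟩ := hx
        exact (mres_app j hW _).symm.trans (congrArg (mres A hW) (hj' Ω s))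
      | zero => exact map_zero (app j)
      | add x y _ _ hx hy => rw [Prod.snd_add, map_add, hx, hy, Prod.fst_add]
      | smul r x _ hx => rw [Prod.smul_snd, map_smul, hx, Prod.smul_fst]
    exact (mres_app j hW _).trans (key _ hx)

/-- A morphism to a direct image that locally has frames exhibits the inverse image. -/
theorem exists_inverseImage_iso (t : N ⟶ directImage p h A)
    (ht : ∀ z, ∃ (V₀ : Opens X) (U₀ : Opens Z), z ∈ U₀ ∧ Nonempty (PullFrame t V₀ U₀)) :
    ∃ j : (germInverseImage p h).obj N ≅ A, ∀ (Ω : Opens X) (s : msec N Ω),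
      app j.hom (germInverseImageSec p h N s) = pullSec t s := by
  let adj := SheafOfModules.pullbackPushforwardAdjunction.{u} (germPullHom p h)
  let η : N ⟶ directImage p h ((germInverseImage p h).obj N) :=
    adj.unit.app N
  let j : (germInverseImage p h).obj N ⟶ A := (adj.homEquiv N A).symm t
  have hj : η ≫ directImageMap p h j = t :=
    (adj.homEquiv_unit N A j).symm.trans (Equiv.apply_symm_apply _ t)
  have := isIso_of_pullFrame ht j hj fun k k' e => (adj.homEquiv N _).injective
    ((adj.homEquiv_unit N _ k).trans (e.trans (adj.homEquiv_unit N _ k').symm))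
  refine ⟨asIso j, fun Ω s => ?_⟩
  change app j (pullSec η s) = pullSec t s
  rw [← pullSec_comp, hj]

end InverseImage

/-! ### Derivatives as a basis -/

section BaseDerivatives
variable {con : Corr (germSheaf 𝒢').ring (germSheaf 𝒢).ring} [IsAddTorsionFree K] (c : Chart hle U₀)
  (hcon : ∀ U f t, con.rel U f t ↔ t = germIncl hle U f)

theorem Chart.linearIndependent_eA (hV : V ≤ U₀) :
    LinearIndependent (𝒪[𝒢] V)
      fun γ => mres (AMod (germSheaf 𝒢) (germSheaf 𝒢') con) hV (c.eA hcon γ) := by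
  rw [linearIndependent_iff']
  intro F b hb γ hγ
  refine valAt_ext fun z => ?_
  have h := congrArg (fun a => valAt z (lev le_rfl a (c.mono hV z γ))) hb
  simp only [lev_sum, map_sum] at h
  rw [Finset.sum_eq_single γ] at h
  · rw [lev_smul, map_mul, lev_mres _ _ (c.eA hcon γ), c.lev_eA, c.p_mono, if_pos rfl, mul_one,
      rres_self] at h
    exact h
  · intro δ _ hδ
    rw [lev_smul, map_mul, lev_mres _ _ (c.eA hcon δ), c.lev_eA, c.p_mono, if_neg hδ, mul_zero]
  · exact fun h => absurd hγ h

theorem Chart.mem_span_eA (V : Opens X) (hV : V ≤ U₀)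
    (a : msec (AMod (germSheaf 𝒢) (germSheaf 𝒢') con) V) (y : X) (hy : y ∈ V) :
    ∃ (W : Opens X) (hW : W ≤ V), y ∈ W ∧ mres _ hW a ∈
      Submodule.span (𝒪[𝒢] W) (Set.range fun γ =>
        mres (AMod (germSheaf 𝒢) (germSheaf 𝒢') con) (hW.trans hV) (c.eA hcon γ)) := by
  obtain ⟨W, hW, F, hyW, e⟩ := c.basis hcon V hV a y hy
  refine ⟨W, hW, hyW, ?_⟩
  rw [e F subset_rfl]
  exact sum_mem fun γ _ => Submodule.smul_mem _ _ (Submodule.subset_span ⟨γ, rfl⟩)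

end BaseDerivatives

/-! ### The inverse image of the operators on the base -/

section SubmersionInverseImage
variable {E : Type v} {F : Type w} {Z X : Type u} [NormedAddCommGroup E] [NormedSpace ℂ E]
  [FiniteDimensional ℂ E] [TopologicalSpace Z] [ChartedSpace E Z] [IsManifold 𝓘(ℂ, E) ω Z]
  [NormedAddCommGroup F] [NormedSpace ℂ F] [FiniteDimensional ℂ F] [TopologicalSpace X]
  [ChartedSpace F X] [IsManifold 𝓘(ℂ, F) ω X] {p : Z → X}

theorem eq_rel_iff (U : Opens (TopCat.of X)) (f t : rsec (holSheaf F X ℂ).ring U) :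
    (Corr.eq (holSheaf F X ℂ).ring).rel U f t ↔
      t = germIncl (X := TopCat.of X) (fun x => le_refl (holGerms F X ℂ x)) U f := eq_comm

theorem sameFn_rel_iff (hp : ContMDiff 𝓘(ℂ, E) 𝓘(ℂ, F) ω p) (U : Opens (TopCat.of Z))
    (f : rsec (germSheaf (X := TopCat.of Z) (pullGerms F ℂ p)).ring U)
    (t : rsec (holSheaf E Z ℂ).ring U) :
    (sameFn (X := TopCat.of Z) (pullGerms F ℂ p) (holGerms E Z ℂ)).rel U f t ↔
      t = germIncl (X := TopCat.of Z) (pullGerms_le hp) U f :=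
  ⟨fun h => Subtype.ext (Eq.symm h), by rintro rfl; rfl⟩

/-- The operator `n : p⁻¹ O_X → O_Z` is `f ∘ p ↦ P(f) ∘ p`. -/
def IsPulledOp (hp : ContMDiff 𝓘(ℂ, E) 𝓘(ℂ, F) ω p) {U : Opens (TopCat.of X)}
    (P : msec (AMod (holSheaf F X ℂ) (holSheaf F X ℂ) (Corr.eq _)) U)
    (V : Opens (TopCat.of Z)) (n : msec (leftO (relDiff (E := E) (F := F) p)) V) : Prop :=
  ∀ (Ω : Opens (TopCat.of X)) (hΩ : Ω ≤ U) (f : rsec (holSheaf F X ℂ).ring Ω)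
    (W : Opens (TopCat.of Z)) (hW : W ≤ V) (hW' : W ≤ (Opens.map (topHom hp)).obj Ω),
    lev (O := holSheaf E Z ℂ) hW n (rres _ hW' (pullInv hp f)) =
      rres _ hW' (pullHol hp (lev hΩ P f))

section PulledOperator
variable {hp : ContMDiff 𝓘(ℂ, E) 𝓘(ℂ, F) ω p} {U : Opens (TopCat.of X)}
  {P : msec (AMod (holSheaf F X ℂ) (holSheaf F X ℂ) (Corr.eq _)) U}
  {V : Opens (TopCat.of Z)} {n : msec (leftO (relDiff (E := E) (F := F) p)) V}

theorem IsPulledOp.mres {U' : Opens (TopCat.of X)}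
    (h : IsPulledOp hp P V n) (hU : U' ≤ U) {V' : Opens (TopCat.of Z)} (hV : V' ≤ V) :
    IsPulledOp hp (mres _ hU P) V' (mres _ hV n) := fun Ω hΩ f W hW hW' => by
  rw [lev_mres hV hW n, h Ω (hΩ.trans hU) f W _ hW', lev_mres hU hΩ P]

theorem IsPulledOp.ext
    (hV : V ≤ (Opens.map (topHom hp)).obj U)
    {n' : msec (leftO (relDiff (E := E) (F := F) p)) V}
    (h : IsPulledOp hp P V n) (h' : IsPulledOp hp P V n') : n = n' := by
  refine lev_ext (O := holSheaf E Z ℂ) fun W hW f => rres_ext fun z hz => ?_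
  obtain ⟨Ω, f', W', hW', hW'', hz', e⟩ := exists_eq_pullInv hp f ⟨z, hz⟩
  refine ⟨W', hW', hz', ?_⟩
  have hΩ : W' ≤ (Opens.map (topHom hp)).obj (Ω ⊓ U) := fun y hy => ⟨hW'' hy, hV (hW (hW' hy))⟩
  have e' : rres _ hW'' (pullInv hp f') =
    rres _ hΩ (pullInv hp (rres _ (inf_le_left : Ω ⊓ U ≤ Ω) f')) := rfl
  rw [rres_lev hW hW' n, rres_lev hW hW' n', e, e', h _ inf_le_right, h' _ inf_le_right]

theorem IsPulledOp.add
    {P' : msec (AMod (holSheaf F X ℂ) (holSheaf F X ℂ) (Corr.eq _)) U}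
    {n' : msec (leftO (relDiff (E := E) (F := F) p)) V}
    (h : IsPulledOp hp P V n) (h' : IsPulledOp hp P' V n') :
    IsPulledOp hp (P + P') V (n + n') := fun Ω hΩ f W hW hW' => by
  rw [lev_add hW n n', lev_add hΩ P P', h Ω hΩ f W hW hW', h' Ω hΩ f W hW hW']
  rfl

theorem IsPulledOp.smul
    (hV : V ≤ (Opens.map (topHom hp)).obj U)
    (h : IsPulledOp hp P V n) (r : rsec (holSheaf F X ℂ).ring U) :
    IsPulledOp hp (r • P) V (rres (holSheaf E Z ℂ).ring hV (pullHol hp r) • n) :=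
  fun Ω hΩ f W hW hW' => by
  rw [lev_smul hW _ n, lev_smul hΩ r P, h Ω hΩ f W hW hW']
  rfl

theorem IsPulledOp.zero : IsPulledOp hp
      (0 : msec (AMod (holSheaf F X ℂ) (holSheaf F X ℂ) (Corr.eq _)) U) V
      (0 : msec (leftO (relDiff (E := E) (F := F) p)) V) := fun _ _ _ _ _ _ => rfl

theorem IsPulledOp.of_locally
    (h : ∀ z ∈ V, ∃ (W : Opens (TopCat.of Z)) (hW : W ≤ V), z ∈ W ∧
      IsPulledOp hp P W (DCom.mres _ hW n)) : IsPulledOp hp P V n := fun Ω hΩ f W hW hW' => by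
  refine rres_ext fun z hz => ?_
  obtain ⟨W', hV', hz', h'⟩ := h z (hW hz)
  refine ⟨W' ⊓ W, inf_le_right, ⟨hz', hz⟩, ?_⟩
  have := h' Ω hΩ f (W' ⊓ W) inf_le_left (inf_le_right.trans hW')
  rw [lev_mres hV' inf_le_left n] at this
  rw [rres_lev hW inf_le_right n, rres_rres, this, rres_rres]

end PulledOperator

variable (hp : Manifold.IsSubmersion 𝓘(ℂ, E) 𝓘(ℂ, F) ω p)

/-- The derivatives along base coordinates are the pullbacks of the derivatives on the base. -/
theorem isPulledOp_eA (hp : ContMDiff 𝓘(ℂ, E) 𝓘(ℂ, F) ω p) {z : Z}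
    (h : Manifold.IsSubmersionAt 𝓘(ℂ, E) 𝓘(ℂ, F) ω p z) (γ : Fin (Module.finrank ℂ F) →₀ ℕ) :
    IsPulledOp hp ((holChart ℂ (Module.finBasis ℂ F) h.codChart_mem_maximalAtlas).eA
      eq_rel_iff γ) (chartDomain h.domChart)
      ((submersionChart hp h).sub.eA (sameFn_rel_iff hp) γ) := fun _ hΩ f _ hW hW' =>
  ((submersionChart hp h).sub.lev_eA (sameFn_rel_iff hp) γ hW _).trans
    (divPow_pullHol hp h γ hΩ f hW hW')

theorem exists_isPulledOp {U : Opens (TopCat.of X)}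
    (P : msec (AMod (holSheaf F X ℂ) (holSheaf F X ℂ) (Corr.eq _)) U) :
    ∃ n, IsPulledOp hp.contMDiff P ((Opens.map (topHom hp.contMDiff)).obj U) n := by
  refine msec_exists_of_local' _ (fun V _ n => IsPulledOp hp.contMDiff P V n)
    (fun V W hV hW n hn => ?_) (fun V hV n hn => .of_locally hn)
    (fun V hV n n' hn hn' => hn.ext hV hn') fun z hz => ?_
  · have := hn.mres le_rfl hW
    rwa [mres_self] at this
  let h := hp.isSubmersionAt z
  let c := (submersionChart hp.contMDiff h).sub
  let c' := holChart ℂ (Module.finBasis ℂ F) h.codChart_mem_maximalAtlas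
  obtain ⟨Ω, hΩ, F₀, hz', e⟩ := c'.basis eq_rel_iff (U ⊓ chartDomain h.codChart) inf_le_right
    (mres _ inf_le_left P) (p z) ⟨hz, h.mem_codChart_source⟩
  let V : Opens (TopCat.of Z) := chartDomain h.domChart ⊓ (Opens.map (topHom hp.contMDiff)).obj Ω
  have key : ∀ P' ∈ Submodule.span (rsec (holSheaf F X ℂ).ring Ω) (Set.range fun γ =>
      mres (AMod (holSheaf F X ℂ) (holSheaf F X ℂ) (Corr.eq _)) (hΩ.trans inf_le_right)
        (c'.eA eq_rel_iff γ)), ∃ n, IsPulledOp hp.contMDiff P' V n := by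
    intro P' hP'
    induction hP' using Submodule.span_induction with
    | mem P' hP' =>
      obtain ⟨γ, rfl⟩ := hP'
      exact ⟨_, (isPulledOp_eA hp.contMDiff h γ).mres _ inf_le_left⟩
    | zero => exact ⟨0, .zero⟩
    | add P₁ P₂ _ _ h₁ h₂ =>
      obtain ⟨n₁, h₁⟩ := h₁
      obtain ⟨n₂, h₂⟩ := h₂
      exact ⟨_, h₁.add h₂⟩
    | smul r P₁ _ h₁ =>
      obtain ⟨n₁, h₁⟩ := h₁
      exact ⟨_, h₁.smul inf_le_right r⟩
  obtain ⟨n, hn⟩ := key (mres _ hΩ (mres _ inf_le_left P)) (by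
    rw [e F₀ subset_rfl]
    exact sum_mem fun γ _ => Submodule.smul_mem _ _ (Submodule.subset_span ⟨γ, rfl⟩))
  refine ⟨V, fun y hy => (hΩ hy.2).1, n, ⟨h.mem_domChart_source, hz'⟩, fun Ω' hΩ' f W hW hW' => ?_⟩
  have hW'' : W ≤ (Opens.map (topHom hp.contMDiff)).obj (Ω' ⊓ Ω) := fun y hy => ⟨hW' hy, (hW hy).2⟩
  have := hn (Ω' ⊓ Ω) inf_le_right (rres _ inf_le_left f) W hW hW''
  rw [mres_mres, lev_mres _ _ P, ← rres_lev hΩ' inf_le_left P] at this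
  exact this

/-- The morphism of `O_X`-modules from `D_X` to the direct image of the differential operators
`p⁻¹ O_X → O_Z`. -/
def pulledOp : leftO (leftDiff (holSheaf F X ℂ) (holSheaf F X ℂ) (Corr.eq _)) ⟶
    directImage (topHom hp.contMDiff) (comp_mem_holGerms hp.contMDiff)
      (leftO (relDiff (E := E) (F := F) p)) :=
  pullMk (fun _ => AddMonoidHom.mk' (fun P => (exists_isPulledOp hp P).choose)
      fun P P' => (exists_isPulledOp hp (P + P')).choose_spec.ext le_rfl
        ((exists_isPulledOp hp P).choose_spec.add (exists_isPulledOp hp P').choose_spec))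
    (fun _ _ hV P => ((exists_isPulledOp hp P).choose_spec.mres hV _).ext le_rfl
      (exists_isPulledOp hp _).choose_spec)
    (fun _ r P => (exists_isPulledOp hp (r • P)).choose_spec.ext le_rfl
      ((exists_isPulledOp hp P).choose_spec.smul le_rfl r))

theorem isPulledOp_pulledOp {U : Opens (TopCat.of X)}
    (P : msec (AMod (holSheaf F X ℂ) (holSheaf F X ℂ) (Corr.eq _)) U) :
    IsPulledOp hp.contMDiff P ((Opens.map (topHom hp.contMDiff)).obj U)
      (pullSec (pulledOp hp) P) :=
  (exists_isPulledOp hp P).choose_spec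

/-- In the coordinates given by a submersion, the derivatives on the base are a frame. -/
def pullFrame {z : Z} (h : Manifold.IsSubmersionAt 𝓘(ℂ, E) 𝓘(ℂ, F) ω p z) :
    PullFrame (pulledOp hp) (chartDomain h.codChart) (chartDomain h.domChart) :=
  have e : ∀ (W : Opens (TopCat.of Z)) (hW : W ≤ chartDomain h.domChart)
      (γ : Fin (Module.finrank ℂ F) →₀ ℕ),
      mres (leftO (relDiff (E := E) (F := F) p))
        (hW.trans (chartDomain_domChart_le hp.contMDiff h)) (pullSec (pulledOp hp)
          ((holChart ℂ (Module.finBasis ℂ F) h.codChart_mem_maximalAtlas).eA eq_rel_iff γ)) =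
      mres (leftO (relDiff (E := E) (F := F) p)) hW
        ((submersionChart hp.contMDiff h).sub.eA (sameFn_rel_iff hp.contMDiff) γ) := fun W hW γ =>
    ((isPulledOp_pulledOp hp _).mres le_rfl _).ext
      (hW.trans (chartDomain_domChart_le hp.contMDiff h))
      ((isPulledOp_eA hp.contMDiff h γ).mres le_rfl hW)
  { le := chartDomain_domChart_le hp.contMDiff h
    I := Fin (Module.finrank ℂ F) →₀ ℕ
    e γ := (holChart ℂ (Module.finBasis ℂ F) h.codChart_mem_maximalAtlas).eA eq_rel_iff γ
    gen Ω hΩ s y hy := (holChart ℂ (Module.finBasis ℂ F) h.codChart_mem_maximalAtlas).mem_span_eA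
      eq_rel_iff Ω hΩ s y hy
    gen' V hV a y hy := by
      obtain ⟨W, hW, hy, ha⟩ := (submersionChart hp.contMDiff h).sub.mem_span_eA
        (sameFn_rel_iff hp.contMDiff) V hV a y hy
      refine ⟨W, hW, hy, ?_⟩
      rw [funext (e W (hW.trans hV))]
      exact ha
    indep W hW := by
      rw [funext (e W hW)]
      exact (submersionChart hp.contMDiff h).sub.linearIndependent_eA
        (sameFn_rel_iff hp.contMDiff) hW }

/-- The derivatives on the base form a basis of `D_X`, and their images form a basis of the
operators `p⁻¹ O_X → O_Z`. -/
theorem isInverseImageOfD_of_isSubmersion : IsInverseImageOfD hp.contMDiff := by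
  obtain ⟨j, hj⟩ := exists_inverseImage_iso (pulledOp hp) fun z =>
    ⟨_, _, (hp.isSubmersionAt z).mem_domChart_source, ⟨pullFrame hp (hp.isSubmersionAt z)⟩⟩
  refine ⟨j, fun U V h P f => ?_⟩
  have e := hj U P
  have := isPulledOp_pulledOp hp P V h f _ ((Opens.map (topHom hp.contMDiff)).monotone h) le_rfl
  rw [rres_self, rres_self, ← e] at this
  exact this

theorem inducesEquivalence_of_isSubmersion (hp : Manifold.IsSubmersion 𝓘(ℂ, E) 𝓘(ℂ, F) ω p) :
    InducesEquivalence (O := holSheaf E Z ℂ)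
      (S := germSheaf (X := TopCat.of Z) (pullGerms F ℂ p)) (T := holSheaf E Z ℂ)
      (sameFn (X := TopCat.of Z) (pullGerms F ℂ p) (holGerms E Z ℂ)) (Corr.eq _)
      (sameFn (X := TopCat.of Z) (pullGerms F ℂ p) (holGerms E Z ℂ))
      (preAct (holSheaf E Z ℂ) (overLin (X := TopCat.of Z) (holGerms E Z ℂ) (pullGerms F ℂ p))
        (overLin_scalar (X := TopCat.of Z) (holGerms E Z ℂ) (pullGerms F ℂ p))) .left :=
  inducesEquivalence_of_relChart (X := TopCat.of Z) (pullGerms_le hp.contMDiff) fun z =>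
    ⟨_, (hp.isSubmersionAt z).mem_domChart_source,
      ⟨submersionChart hp.contMDiff (hp.isSubmersionAt z)⟩⟩

end SubmersionInverseImage

theorem inducesEquivalence_holSheaf (E : Type v) (M : Type u) [NormedAddCommGroup E]
    [NormedSpace ℂ E] [FiniteDimensional ℂ E] [TopologicalSpace M] [ChartedSpace E M]
    [IsManifold 𝓘(ℂ, E) ω M] :
    InducesEquivalence (O := holSheaf E M ℂ) (S := holSheaf E M ℂ) (T := holSheaf E M ℂ)
      (Corr.eq _) (Corr.eq _) (Corr.eq _)
      (postAct (holSheaf E M ℂ) (holSheaf E M ℂ) (Corr.eq _)) .left :=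
  inducesEquivalence_of_chart (X := TopCat.of M) (exists_chart_holSheaf ℂ)

/-! ### Iterated twisted commutators -/

section TwistedOrder

/-- Families of additive endomorphisms of the groups of sections over the subsets of `V`. -/
abbrev EndF (O : RSh X) (V : Opens X) : Type u :=
  ∀ W : {W : Opens X // W ≤ V}, AddMonoid.End (rsec O W.1)

variable {O : RSh X}

/-- Restriction of families of endomorphisms. -/
def EndF.res (h : W ≤ V) : EndF O V →+* EndF O W where
  toFun φ W' := φ ⟨W'.1, W'.2.trans h⟩
  map_one' := rfl
  map_mul' _ _ := rfl
  map_zero' := rfl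
  map_add' _ _ := rfl

/-- Multiplication by a section. -/
def EndF.mulL (s : rsec O V) : EndF O V := fun W => AddMonoidHom.mulLeft (rres O W.2 s)

theorem EndF.res_mulL (h : W ≤ V) (s : rsec O V) :
    EndF.res h (EndF.mulL s) = EndF.mulL (rres O h s) := by
  funext W'
  ext f
  change rres O _ s * f = rres O _ (rres O h s) * f
  rw [rres_rres]

/-- All `N`-fold iterated twisted commutators `x φ - φ y` of `φ` vanish, for the pairs `(x, y)`
satisfying `𝒬`. -/
def TwOrd (𝒬 : ∀ V, EndF O V → EndF O V → Prop) : ℕ → ∀ V, EndF O V → Prop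
  | 0, _, φ => φ = 0
  | N + 1, V, φ => ∀ W (h : W ≤ V) (x y : EndF O W), 𝒬 W x y →
      TwOrd 𝒬 N W (x * EndF.res h φ - EndF.res h φ * y)

variable {𝒬 : ∀ V, EndF O V → EndF O V → Prop}

theorem TwOrd.res {N : ℕ} (h : W ≤ V) {φ : EndF O V} (hφ : TwOrd 𝒬 N V φ) :
    TwOrd 𝒬 N W (EndF.res h φ) := by
  cases N with
  | zero => rw [show φ = 0 from hφ]; rfl
  | succ N => exact fun W' h' x y hxy => hφ W' (h'.trans h) x y hxy

theorem TwOrd.zero (𝒬 : ∀ V, EndF O V → EndF O V → Prop) (N : ℕ) (V : Opens X) :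
    TwOrd 𝒬 N V 0 := by
  induction N generalizing V with
  | zero => rfl
  | succ N ih =>
    intro W h x y _
    rw [map_zero, mul_zero, zero_mul, sub_zero]
    exact ih W

theorem TwOrd.mono {N N' : ℕ} (h : N ≤ N') {φ : EndF O V} (hφ : TwOrd 𝒬 N V φ) :
    TwOrd 𝒬 N' V φ := by
  induction N generalizing N' V φ with
  | zero => rw [show φ = 0 from hφ]; exact TwOrd.zero ..
  | succ N ih =>
    obtain ⟨N'', rfl⟩ : ∃ k, N' = k + 1 := ⟨N' - 1, by omega⟩
    exact fun W hW x y hxy => ih (by omega) (hφ W hW x y hxy)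

theorem TwOrd.add {N : ℕ} {φ ψ : EndF O V} (hφ : TwOrd 𝒬 N V φ)
    (hψ : TwOrd 𝒬 N V ψ) : TwOrd 𝒬 N V (φ + ψ) := by
  induction N generalizing V with
  | zero => rw [show φ = 0 from hφ, show ψ = 0 from hψ, add_zero]; rfl
  | succ N ih =>
    intro W h x y hxy
    have := ih (hφ W h x y hxy) (hψ W h x y hxy)
    rwa [sub_add_sub_comm, ← mul_add, ← add_mul, ← map_add] at this

theorem TwOrd.neg {N : ℕ} {φ : EndF O V} (hφ : TwOrd 𝒬 N V φ) :
    TwOrd 𝒬 N V (-φ) := by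
  induction N generalizing V with
  | zero => rw [show φ = 0 from hφ, neg_zero]; rfl
  | succ N ih =>
    intro W h x y hxy
    have := ih (hφ W h x y hxy)
    convert this using 1
    funext W'
    ext f
    change x W' (-φ ⟨W'.1, W'.2.trans h⟩ f) - -φ ⟨W'.1, W'.2.trans h⟩ (y W' f) =
      -(x W' (φ ⟨W'.1, W'.2.trans h⟩ f) - φ ⟨W'.1, W'.2.trans h⟩ (y W' f))
    rw [map_neg]
    abel

theorem TwOrd.sub {N N' : ℕ} {φ ψ : EndF O V} (hφ : TwOrd 𝒬 N V φ)
    (hψ : TwOrd 𝒬 N' V ψ) : TwOrd 𝒬 (max N N') V (φ - ψ) := by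
  rw [sub_eq_add_neg]
  exact (hφ.mono (le_max_left _ _)).add (hψ.mono (le_max_right _ _)).neg

variable (O) in
/-- The pairs of equal multiplication operators. -/
def EqPair (V : Opens X) (x y : EndF O V) : Prop := ∃ s, x = EndF.mulL s ∧ y = EndF.mulL s

/-- Orders add up under composition, because commutators satisfy the Leibniz rule. -/
theorem TwOrd.mul {N N' : ℕ} {φ ψ : EndF O V} (hφ : TwOrd (EqPair O) N V φ)
    (hψ : TwOrd (EqPair O) N' V ψ) : TwOrd (EqPair O) (N + N') V (φ * ψ) := by
  induction h : N + N' generalizing N N' V φ ψ with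
  | zero =>
    obtain ⟨rfl, rfl⟩ := Nat.add_eq_zero_iff.1 h
    rw [show φ = 0 from hφ, zero_mul]
    rfl
  | succ k ih =>
    cases N with
    | zero => rw [show φ = 0 from hφ, zero_mul]; exact TwOrd.zero ..
    | succ N =>
    cases N' with
    | zero => rw [show ψ = 0 from hψ, mul_zero]; exact TwOrd.zero ..
    | succ N' =>
    rintro W hW _ _ ⟨s, rfl, rfl⟩
    have h₁ := ih (hφ W hW _ _ ⟨s, rfl, rfl⟩) (hψ.res hW) (by omega)
    have h₂ := ih (hφ.res hW) (hψ W hW _ _ ⟨s, rfl, rfl⟩) (by omega)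
    have := h₁.add h₂
    rw [map_mul]
    convert this using 1
    simp only [mul_sub, sub_mul, mul_assoc]
    abel

/-! ### Perturbed multiplication operators -/

section Perturbation
variable {z : ∀ V, EndF O V} {m N₁ : ℕ}

/-- Pairs of operators that are equal to a multiplication operator up to multiples of `z` by
operators of order less than `N₁` commuting with `z`. -/
def IsPerturbed (z : ∀ V, EndF O V) (N₁ : ℕ) (V : Opens X) (s : rsec O V) (x y : EndF O V) : Prop :=
  ∃ x' y', Commute (z V) x' ∧ Commute (z V) y' ∧ TwOrd (EqPair O) N₁ V x' ∧
    TwOrd (EqPair O) N₁ V y' ∧ x = EndF.mulL s + z V * x' ∧ y = EndF.mulL s + z V * y'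

/-- Differential operators have finite order with respect to perturbed multiplication operators. The
nilpotent element `z` makes the induction end. -/
theorem TwOrd.perturbed (hz : ∀ V W (h : W ≤ V), EndF.res h (z V) = z W)
    (hzm : ∀ V, z V ^ m = 0) (hzs : ∀ V s, Commute (z V) (EndF.mulL s))
    (h𝒬 : ∀ V x y, 𝒬 V x y → ∃ s, IsPerturbed z N₁ V s x y) (N : ℕ) :
    ∃ N', ∀ V φ, Commute (z V) φ → TwOrd (EqPair O) N V φ → TwOrd 𝒬 N' V φ := by
  -- Induction on `k = m - j`, where `z ^ j` vanishes for `k = 0`, and then on the order `N` of `φ`.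
  have key : ∀ k j, j + k = m → ∀ N, ∃ N', ∀ V φ, Commute (z V) φ → TwOrd (EqPair O) N V φ →
      TwOrd 𝒬 N' V (z V ^ j * φ) := by
    intro k
    induction k with
    | zero =>
      rintro j rfl N
      exact ⟨0, fun V φ _ _ => by rw [← add_zero j, hzm, zero_mul]; rfl⟩
    | succ k ihk =>
      intro j hj N
      induction N with
      | zero => exact ⟨0, fun V φ _ hφ => by rw [show φ = 0 from hφ, mul_zero]; rfl⟩
      | succ N ih =>
        obtain ⟨N₂, h₂⟩ := ih
        obtain ⟨N₃, h₃⟩ := ihk (j + 1) (by omega) (N + 1 + N₁)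
        refine ⟨max N₂ N₃ + 1, fun V φ hc hφ W hW x y hxy => ?_⟩
        obtain ⟨s, x', y', hx, hy, hx', hy', rfl, rfl⟩ := h𝒬 W x y hxy
        have hc' : Commute (z W) (EndF.res hW φ) := by
          have := hc.map (EndF.res hW)
          rwa [hz] at this
        have e₁ := h₂ W _ (((hzs W s).mul_right hc').sub_right (hc'.mul_right (hzs W s)))
          (hφ W hW _ _ ⟨s, rfl, rfl⟩)
        have e₂ := h₃ W _ ((hx.mul_right hc').sub_right (hc'.mul_right hy))
          (((hx'.mul (hφ.res hW)).sub ((hφ.res hW).mul hy')).mono (by omega))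
        have := (e₁.mono (le_max_left N₂ N₃)).add (e₂.mono (le_max_right N₂ N₃))
        convert this using 1
        rw [map_mul, map_pow, hz]
        have c₁ := ((hzs W s).pow_left j).eq
        have c₂ := (hx.pow_left j).eq
        have c₃ := hc'.eq
        have d₁ : EndF.mulL s * (z W ^ j * EndF.res hW φ) =
            z W ^ j * (EndF.mulL s * EndF.res hW φ) := by
          rw [← mul_assoc, ← c₁, mul_assoc]
        have d₂ : z W * x' * (z W ^ j * EndF.res hW φ) = z W ^ (j + 1) * (x' * EndF.res hW φ) := by
          rw [mul_assoc, ← mul_assoc x', ← c₂, pow_succ', mul_assoc, mul_assoc]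
        have d₃ : z W ^ j * EndF.res hW φ * (z W * y') = z W ^ (j + 1) * (EndF.res hW φ * y') := by
          rw [mul_assoc, ← mul_assoc (EndF.res hW φ), ← c₃, pow_succ, mul_assoc, mul_assoc]
        rw [add_mul, mul_add, d₁, d₂, d₃, mul_sub, mul_sub, mul_assoc]
        abel
  obtain ⟨N', h⟩ := key m 0 (zero_add m) N
  exact ⟨N', fun V φ hc hφ => by simpa using h V φ hc hφ⟩

/-- Conversely, operators of finite order with respect to perturbed multiplication operators are
differential operators. -/
theorem TwOrd.of_perturbed (hz : ∀ V W (h : W ≤ V), EndF.res h (z V) = z W)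
    (hzm : ∀ V, z V ^ m = 0) (hzs : ∀ V s, Commute (z V) (EndF.mulL s))
    (h𝒬 : ∀ V ≤ U₀, ∀ s, ∃ x y, 𝒬 V x y ∧ IsPerturbed z N₁ V s x y) (N : ℕ) :
    ∃ N', ∀ V ≤ U₀, ∀ φ, Commute (z V) φ → TwOrd 𝒬 N V φ → TwOrd (EqPair O) N' V φ := by
  -- The same induction; an unperturbed commutator is a perturbed one up to a multiple of `z`.
  have key : ∀ k j, j + k = m → ∀ N, ∃ N', ∀ V ≤ U₀, ∀ φ, Commute (z V) φ → TwOrd 𝒬 N V φ →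
      TwOrd (EqPair O) N' V (z V ^ j * φ) := by
    intro k
    induction k with
    | zero =>
      rintro j rfl N
      exact ⟨0, fun V _ φ _ _ => by rw [← add_zero j, hzm, zero_mul]; rfl⟩
    | succ k ihk =>
      intro j hj N
      induction N with
      | zero => exact ⟨0, fun V _ φ _ hφ => by rw [show φ = 0 from hφ, mul_zero]; rfl⟩
      | succ N ih =>
        obtain ⟨N₂, h₂⟩ := ih
        obtain ⟨N₃, h₃⟩ := ihk (j + 1) (by omega) (N + 1)
        refine ⟨max N₂ (N₁ + N₃) + 1, ?_⟩
        rintro V hV φ hc hφ W hW _ _ ⟨s, rfl, rfl⟩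
        obtain ⟨_, _, hxy, x', y', hx, hy, hx', hy', rfl, rfl⟩ := h𝒬 W (hW.trans hV) s
        have hc' : Commute (z W) (EndF.res hW φ) := by
          have := hc.map (EndF.res hW)
          rwa [hz] at this
        have e₁ := h₂ W (hW.trans hV) _
          ((((hzs W s).add_right ((Commute.refl _).mul_right hx)).mul_right hc').sub_right
          (hc'.mul_right ((hzs W s).add_right ((Commute.refl _).mul_right hy)))) (hφ W hW _ _ hxy)
        have e₂ := h₃ W (hW.trans hV) _ hc' (hφ.res hW)
        have e₃ := (hx'.mul e₂).sub (e₂.mul hy')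
        have := (e₁.mono (le_max_left N₂ (N₁ + N₃))).add (e₃.mono (by omega)).neg
        convert this using 1
        rw [map_mul, map_pow, hz]
        have c₁ := ((hzs W s).pow_left j).eq
        have c₂ := (hx.pow_left (j + 1)).eq
        have c₃ := hc'.eq
        have d₁ : EndF.mulL s * (z W ^ j * EndF.res hW φ) =
            z W ^ j * (EndF.mulL s * EndF.res hW φ) := by
          rw [← mul_assoc, ← c₁, mul_assoc]
        have d₂ : x' * (z W ^ (j + 1) * EndF.res hW φ) =
            z W ^ j * (z W * x' * EndF.res hW φ) := by
          rw [← mul_assoc, ← c₂, pow_succ]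
          simp only [mul_assoc]
        have d₃ : z W ^ (j + 1) * EndF.res hW φ * y' =
            z W ^ j * (EndF.res hW φ * (z W * y')) := by
          rw [← mul_assoc (EndF.res hW φ), ← c₃, pow_succ]
          simp only [mul_assoc]
        rw [d₁, d₂, d₃, add_mul, mul_add, mul_assoc (z W ^ j)]
        simp only [mul_sub, mul_add, mul_assoc]
        abel
  obtain ⟨N', h⟩ := key m 0 (zero_add m) N
  exact ⟨N', fun V hV φ hc hφ => by simpa using h V hV φ hc hφ⟩

end Perturbation

/-! ### Transport along isomorphisms of sheaves -/

section Transport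

/-- An isomorphism over `U₀` of the sheaves of groups underlying two sheaves of rings. -/
structure AddIso (O S : RSh X) (U₀ : Opens X) where
  iso : ∀ V : Opens X, V ≤ U₀ → (rsec O V ≃+ rsec S V)
  natural : ∀ V W (hV : V ≤ U₀) (hW : W ≤ V) (f : rsec O V),
    rres S hW (iso V hV f) = iso W (hW.trans hV) (rres O hW f)

/-- The identity isomorphism. -/
def AddIso.refl (O : RSh X) (U₀ : Opens X) : AddIso O O U₀ :=
    ⟨fun _ _ => AddEquiv.refl _, fun _ _ _ _ _ => rfl⟩

variable {S T : RSh X}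

theorem AddIso.natural_symm (θ : AddIso O S U₀) (hV : V ≤ U₀) (hW : W ≤ V)
    (s : rsec S V) :
    rres O hW ((θ.iso V hV).symm s) = (θ.iso W (hW.trans hV)).symm (rres S hW s) := by
  rw [AddEquiv.eq_symm_apply, ← θ.natural V W hV hW, AddEquiv.apply_symm_apply]

/-- A family of maps, transported by isomorphisms. -/
def AddIso.conj (θ₁ : AddIso O S U₀) (θ₂ : AddIso O T U₀) (hV : V ≤ U₀)
    (φ : Fam S (unitMod T) V) : EndF O V := fun W =>
  (((θ₂.iso W.1 (W.2.trans hV)).symm : rsec T W.1 →+ rsec O W.1).comp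
    (toUnit T W.1 : msec (unitMod T) W.1 →+ rsec T W.1)).comp
    ((φ W).comp (θ₁.iso W.1 (W.2.trans hV) : rsec O W.1 →+ rsec S W.1))

/-- Multiplication operators, transported by an isomorphism. -/
def AddIso.conjMul (θ : AddIso O S U₀) (hV : V ≤ U₀) (s : rsec S V) : EndF O V :=
  fun W => ((θ.iso W.1 (W.2.trans hV)).symm : rsec S W.1 →+ rsec O W.1).comp
    ((AddMonoidHom.mulLeft (rres S W.2 s)).comp
      (θ.iso W.1 (W.2.trans hV) : rsec O W.1 →+ rsec S W.1))

/-- The pairs of multiplication operators by corresponding sections. -/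
def CorrPair (con : Corr S T) (θ₁ : AddIso O S U₀) (θ₂ : AddIso O T U₀) (V : Opens X)
    (x y : EndF O V) : Prop :=
  ∃ (hV : V ≤ U₀) (s : rsec S V) (t : rsec T V), con.rel V s t ∧ x = θ₂.conjMul hV t ∧
    y = θ₁.conjMul hV s

/-- The order of a differential operator `S → T` can be computed after transport to `O`. -/
theorem orderLT_iff_twOrd (con : Corr S T) (θ₁ : AddIso O S U₀) (θ₂ : AddIso O T U₀) {N : ℕ}
    (hV : V ≤ U₀) (φ : Fam S (unitMod T) V) :
    Fam.OrderLT con N V φ ↔ TwOrd (CorrPair con θ₁ θ₂) N V (θ₁.conj θ₂ hV φ) := by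
  induction N generalizing V φ with
  | zero =>
    refine ⟨fun h => ?_, fun h => ?_⟩
    · rw [show φ = 0 from h]
      funext W
      ext f
      exact map_zero (θ₂.iso W.1 (W.2.trans hV)).symm
    · change φ = 0
      funext W
      ext f
      have h₁ := DFunLike.congr_fun (congrFun (show θ₁.conj θ₂ hV φ = 0 from h) W)
        ((θ₁.iso W.1 (W.2.trans hV)).symm f)
      have h₂ : (θ₂.iso W.1 (W.2.trans hV)).symm (toUnit T W.1 (φ W
        (θ₁.iso W.1 (W.2.trans hV) ((θ₁.iso W.1 (W.2.trans hV)).symm f)))) = 0 := h₁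
      rw [AddEquiv.apply_symm_apply, EmbeddingLike.map_eq_zero_iff] at h₂
      exact h₂
  | succ N ih =>
    have key : ∀ W (hW : W ≤ V) (s : rsec S W) (t : rsec T W),
        θ₁.conj θ₂ (hW.trans hV) (Fam.commutator s t (Fam.restrict hW φ)) =
          θ₂.conjMul (hW.trans hV) t * EndF.res hW (θ₁.conj θ₂ hV φ) -
            EndF.res hW (θ₁.conj θ₂ hV φ) * θ₁.conjMul (hW.trans hV) s := by
      intro W hW s t
      funext W'
      ext f
      let e₂ := θ₂.iso W'.1 (W'.2.trans (hW.trans hV))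
      let e₁ := θ₁.iso W'.1 (W'.2.trans (hW.trans hV))
      let ψ : rsec S W'.1 →+ rsec T W'.1 := φ ⟨W'.1, W'.2.trans hW⟩
      change e₂.symm (rres T W'.2 t * ψ (e₁ f) - ψ (rres S W'.2 s * e₁ f)) =
        e₂.symm (rres T W'.2 t * e₂ (e₂.symm (ψ (e₁ f)))) -
          e₂.symm (ψ (e₁ (e₁.symm (rres S W'.2 s * e₁ f))))
      rw [AddEquiv.apply_symm_apply, AddEquiv.apply_symm_apply, map_sub]
    constructor
    · rintro h W hW _ _ ⟨hW₀, s, t, hst, rfl, rfl⟩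
      have := (ih (hW.trans hV) _).1 (h W hW s t hst)
      rwa [key] at this
    · intro h W hW s t hst
      rw [ih (hW.trans hV), key]
      exact h W hW _ _ ⟨hW.trans hV, s, t, hst, rfl, rfl⟩

theorem orderLT_eq_iff_twOrd {N : ℕ} (φ : Fam O (unitMod O) V) :
    Fam.OrderLT (Corr.eq O) N V φ ↔
      TwOrd (EqPair O) N V ((AddIso.refl O V).conj (AddIso.refl O V) le_rfl φ) := by
  rw [orderLT_iff_twOrd (Corr.eq O) (AddIso.refl O V) (AddIso.refl O V) le_rfl]
  have h : ∀ W ≤ V, ∀ x y : EndF O W, EqPair O W x y ↔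
      CorrPair (Corr.eq O) (AddIso.refl O V) (AddIso.refl O V) W x y := fun W hW x y =>
    ⟨fun ⟨s, hx, hy⟩ => ⟨hW, s, s, rfl, hx, hy⟩, by rintro ⟨_, s, _, rfl, hx, hy⟩; exact
      ⟨s, hx, hy⟩⟩
  have key : ∀ (N : ℕ) (W : Opens X) (_ : W ≤ V) (ψ : EndF O W),
      TwOrd (CorrPair (Corr.eq O) (AddIso.refl O V) (AddIso.refl O V)) N W ψ ↔
        TwOrd (EqPair O) N W ψ := by
    intro N
    induction N with
    | zero => exact fun W _ ψ => Iff.rfl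
    | succ N ih =>
      exact fun W hW ψ => forall_congr' fun W' => forall_congr' fun hW' => forall_congr' fun x =>
        forall_congr' fun y => by rw [h W' (hW'.trans hW) x y, ih W' (hW'.trans hW)]
  exact key N V le_rfl _

end Transport
end TwistedOrder

/-! ### Orders of products of derivations -/

section ToEnd
variable [CommSheaf O.ring]

/-- Differential operators as families of endomorphisms. -/
def DSec.toEnd : 𝒟[O] V →+* EndF O.ring V where
  toFun d W := d.homEv W.2
  map_one' := rfl
  map_mul' _ _ := rfl
  map_zero' := rfl
  map_add' _ _ := rfl

theorem DSec.toEnd_mulOp (s : rsec O.ring V) :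
    DSec.toEnd (mulOp O.ring O.selfLin V s) = EndF.mulL s := rfl

theorem DSec.algebraMap_eq (k : K) :
    algebraMap K (𝒟[O] V) k = mulOp O.ring O.selfLin V (O.scalar V k) := rfl

theorem DSec.smul_ev (h : V ≤ U) (k : K) (d : 𝒟[O] U)
    (f : rsec O.ring V) : (k • d).ev h f = O.scalar V k * d.ev h f := by
  rw [Algebra.smul_def, DSec.algebraMap_eq, DSec.mulOp_mul_ev, O.scalar_res]

theorem DSec.commute_toEnd (k : K) (d : 𝒟[O] V) :
    Commute (EndF.mulL (O.scalar V k)) d.toEnd := by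
  have : Commute (algebraMap K (𝒟[O] V) k) d := Algebra.commutes k d
  exact this.map DSec.toEnd

theorem twOrd_mulL (s : rsec O.ring V) : TwOrd (EqPair O.ring) 1 V (EndF.mulL s) := by
  rintro W hW _ _ ⟨t, rfl, rfl⟩
  rw [EndF.res_mulL, ← DSec.toEnd_mulOp, ← DSec.toEnd_mulOp, ← map_mul, ← map_mul, ← map_mul,
    ← map_mul, mul_comm t, sub_self]
  rfl

theorem twOrd_of_isDer {d : 𝒟[O] V} (hd : d.IsDer) :
    TwOrd (EqPair O.ring) 2 V d.toEnd := by
  rintro W hW _ _ ⟨s, rfl, rfl⟩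
  have : EndF.mulL s * EndF.res hW d.toEnd - EndF.res hW d.toEnd * EndF.mulL s =
      -EndF.mulL (d.ev hW s) := by
    funext W'
    ext f
    change rres O.ring W'.2 s * d.ev (W'.2.trans hW) f -
      d.ev (W'.2.trans hW) (rres O.ring W'.2 s * f)
      = -(rres O.ring W'.2 (d.ev hW s) * f)
    rw [hd, DSec.rres_ev]
    ring
  rw [this]
  exact (twOrd_mulL _).neg

theorem TwOrd.of_nsmul [∀ V : Opens X, IsAddTorsionFree (rsec O.ring V)]
    {𝒬 : ∀ V, EndF O.ring V → EndF O.ring V → Prop} {N k : ℕ} (hk : k ≠ 0)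
    {φ : EndF O.ring V} (h : TwOrd 𝒬 N V (k • φ)) : TwOrd 𝒬 N V φ := by
  induction N generalizing V with
  | zero =>
    funext W
    ext f
    have : k • φ W f = 0 := DFunLike.congr_fun (congrFun (show k • φ = 0 from h) W) f
    exact (smul_eq_zero_iff_right hk).1 this
  | succ N ih =>
    intro W hW x y hxy
    refine ih ?_
    have := h W hW x y hxy
    rw [map_nsmul, mul_smul_comm, smul_mul_assoc] at this
    convert this using 1
    funext W'
    ext f
    exact smul_sub k (x W' (EndF.res hW φ W' f)) (EndF.res hW φ W' (y W' f))

theorem DivPow.exists_twOrd [∀ V : Opens X, IsAddTorsionFree (rsec O.ring V)] {J : Type}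
    [DecidableEq J] {d : J → 𝒟[O] U} (π : DivPow d)
    (hd : ∀ i, (d i).IsDer) (α : J →₀ ℕ) : ∃ N, TwOrd (EqPair O.ring) N U (π.p α).toEnd := by
  induction α using multiIndex_induction with
  | zero =>
    refine ⟨1, ?_⟩
    rw [π.p_zero, ← map_one (mulOp O.ring O.selfLin U), DSec.toEnd_mulOp]
    exact twOrd_mulL 1
  | add α i ih =>
    obtain ⟨N, hN⟩ := ih
    refine ⟨2 + N, TwOrd.of_nsmul (Nat.succ_ne_zero (α i)) ?_⟩
    rw [← map_nsmul, Nat.succ_eq_add_one, ← π.mul_p, map_mul]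
    exact (twOrd_of_isDer (hd i)).mul hN

end ToEnd

/-! ### Operators of a perturbed algebra -/

section Transport
variable [CommSheaf O.ring]

/-- The isomorphisms `θ₁ : O → S` and `θ₂ : O → T` are linear, and they transport multiplication by
corresponding sections of `S` and `T` to multiplication operators up to multiples of the nilpotent
scalar `ħ` by operators of order less than `N₁`. -/
structure IsPerturbedCorr (con : Corr S.ring T.ring) (θ₁ : AddIso O.ring S.ring U₀)
    (θ₂ : AddIso O.ring T.ring U₀) (ħ : K) (N₁ : ℕ) : Prop where
  nilpotent : IsNilpotent ħ
  linear₁ : ∀ V (hV : V ≤ U₀) (k : K) (f : rsec O.ring V),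
    θ₁.iso V hV (O.scalar V k * f) = S.scalar V k * θ₁.iso V hV f
  linear₂ : ∀ V (hV : V ≤ U₀) (k : K) (f : rsec O.ring V),
    θ₂.iso V hV (O.scalar V k * f) = T.scalar V k * θ₂.iso V hV f
  perturbed : ∀ V x y, CorrPair con θ₁ θ₂ V x y →
    ∃ s, IsPerturbed (fun V => EndF.mulL (O.scalar V ħ)) N₁ V s x y
  exists_pair : ∀ V ≤ U₀, ∀ s, ∃ x y, CorrPair con θ₁ θ₂ V x y ∧
    IsPerturbed (fun V => EndF.mulL (O.scalar V ħ)) N₁ V s x y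

variable {con : Corr S.ring T.ring} {θ₁ : AddIso O.ring S.ring U₀} {θ₂ : AddIso O.ring T.ring U₀}
  {ħ : K} {N₁ : ℕ} (H : IsPerturbedCorr con θ₁ θ₂ ħ N₁)

include H

theorem IsPerturbedCorr.symm_linear₁ (hV : V ≤ U₀) (k : K) (f : rsec S.ring V) :
    (θ₁.iso V hV).symm (S.scalar V k * f) = O.scalar V k * (θ₁.iso V hV).symm f := by
  rw [AddEquiv.symm_apply_eq, H.linear₁, AddEquiv.apply_symm_apply]

theorem IsPerturbedCorr.symm_linear₂ (hV : V ≤ U₀) (k : K) (f : rsec T.ring V) :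
    (θ₂.iso V hV).symm (T.scalar V k * f) = O.scalar V k * (θ₂.iso V hV).symm f := by
  rw [AddEquiv.symm_apply_eq, H.linear₂, AddEquiv.apply_symm_apply]

/-- The operator `θ₂ d θ₁⁻¹`, where `d` is a differential operator of `O`. -/
def IsPerturbedCorr.ofD (hV : V ≤ U₀) (d : 𝒟[O] V) :
    diffOps (unitMod T.ring) (S.lin T) con V :=
  ⟨fun W => ((toUnit T.ring W.1).symm : rsec T.ring W.1 →+ msec (unitMod T.ring) W.1).comp
      ((θ₂.iso W.1 (W.2.trans hV) : rsec O.ring W.1 →+ rsec T.ring W.1).comp ((d.homEv W.2).comp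
        ((θ₁.iso W.1 (W.2.trans hV)).symm : rsec S.ring W.1 →+ rsec O.ring W.1))),
    { natural := fun W W' hW hW' s => by
        change rres T.ring hW'
          (θ₂.iso W (hW.trans hV) (d.ev hW ((θ₁.iso W (hW.trans hV)).symm s))) =
          θ₂.iso W' _ (d.ev (hW'.trans hW) ((θ₁.iso W' _).symm (rres S.ring hW' s)))
        rw [θ₂.natural, DSec.rres_ev, θ₁.natural_symm]
      linear := by
        rintro W hW _ _ a ⟨k, rfl, rfl⟩
        change θ₂.iso W (hW.trans hV) (d.ev hW ((θ₁.iso W (hW.trans hV)).symm (S.scalar W k * a))) =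
          T.scalar W k * θ₂.iso W (hW.trans hV) (d.ev hW ((θ₁.iso W (hW.trans hV)).symm a))
        rw [H.symm_linear₁, DSec.ev_scalar_mul, H.linear₂]
      order := fun x hx => by
        obtain ⟨W, hW, N, hxW, h⟩ := d.2.order x hx
        rw [orderLT_eq_iff_twOrd] at h
        obtain ⟨m, hm⟩ := H.nilpotent
        obtain ⟨N', hN'⟩ := TwOrd.perturbed (O := O.ring) (m := m) (fun V W h => by
            rw [EndF.res_mulL, O.scalar_res]) (fun V => by
            rw [← DSec.toEnd_mulOp, ← map_pow, ← map_pow, ← map_pow, hm, map_zero, map_zero,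
              map_zero])
          (fun V s => DSec.commute_toEnd ħ (mulOp O.ring O.selfLin V s)) H.perturbed N
        refine ⟨W, hW, N', hxW, (orderLT_iff_twOrd con θ₁ θ₂ (hW.trans hV) _).2 ?_⟩
        convert hN' W _ (DSec.commute_toEnd ħ (DSec.res hW d)) h using 1
        funext W'
        ext f
        change (θ₂.iso W'.1 _).symm (θ₂.iso W'.1 _ (d.ev (W'.2.trans hW)
          ((θ₁.iso W'.1 _).symm (θ₁.iso W'.1 _ f)))) = d.ev (W'.2.trans hW) f
        rw [AddEquiv.symm_apply_apply, AddEquiv.symm_apply_apply] }⟩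

/-- The operator `θ₂⁻¹ a θ₁`, where `a` is a differential operator `S → T`. -/
def IsPerturbedCorr.toD (hV : V ≤ U₀)
    (a : diffOps (unitMod T.ring) (S.lin T) con V) : 𝒟[O] V :=
  ⟨fun W => ((toUnit O.ring W.1).symm : rsec O.ring W.1 →+ msec (unitMod O.ring) W.1).comp
      (θ₁.conj θ₂ hV a.1 W),
    { natural := fun W W' hW hW' s => by
        change rres O.ring hW'
          ((θ₂.iso W _).symm (toUnit T.ring W (a.1 ⟨W, hW⟩ (θ₁.iso W (hW.trans hV) s)))) =
          (θ₂.iso W' _).symm (toUnit T.ring W'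
            (a.1 ⟨W', hW'.trans hW⟩ (θ₁.iso W' _ (rres O.ring hW' s))))
        rw [θ₂.natural_symm, ← θ₁.natural W W' (hW.trans hV) hW', ← a.2.natural W W' hW hW']
        rfl
      linear := by
        rintro W hW _ _ f ⟨k, rfl, rfl⟩
        change (θ₂.iso W _).symm
          (toUnit T.ring W (a.1 ⟨W, hW⟩ (θ₁.iso W (hW.trans hV) (O.scalar W k * f)))) =
          O.scalar W k * (θ₂.iso W _).symm
            (toUnit T.ring W (a.1 ⟨W, hW⟩ (θ₁.iso W (hW.trans hV) f)))
        rw [← H.symm_linear₂, H.linear₁, a.2.linear W hW _ _ _ ⟨k, rfl, rfl⟩]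
        rfl
      order := fun x hx => by
        obtain ⟨W, hW, N, hxW, h⟩ := a.2.order x hx
        rw [orderLT_iff_twOrd con θ₁ θ₂ (hW.trans hV)] at h
        obtain ⟨m, hm⟩ := H.nilpotent
        obtain ⟨N', hN'⟩ := TwOrd.of_perturbed (O := O.ring) (m := m) (fun V W h => by
            rw [EndF.res_mulL, O.scalar_res]) (fun V => by
            rw [← DSec.toEnd_mulOp, ← map_pow, ← map_pow, ← map_pow, hm, map_zero, map_zero,
              map_zero])
          (fun V s => DSec.commute_toEnd ħ (mulOp O.ring O.selfLin V s)) H.exists_pair N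
        refine ⟨W, hW, N', hxW, (orderLT_eq_iff_twOrd _).2 (hN' W (hW.trans hV) _ ?_ h)⟩
        funext W'
        ext f
        change rres O.ring W'.2 (O.scalar W ħ) * (θ₂.iso W'.1 _).symm
            (toUnit T.ring W'.1 (a.1 ⟨W'.1, W'.2.trans hW⟩
              (θ₁.iso W'.1 (W'.2.trans (hW.trans hV)) f))) =
          (θ₂.iso W'.1 _).symm (toUnit T.ring W'.1 (a.1 ⟨W'.1, W'.2.trans hW⟩
            (θ₁.iso W'.1 (W'.2.trans (hW.trans hV)) (rres O.ring W'.2 (O.scalar W ħ) * f))))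
        rw [O.scalar_res, ← H.symm_linear₂, H.linear₁, a.2.linear _ _ _ _ _ ⟨ħ, rfl, rfl⟩]
        rfl }⟩

end Transport

/-! ### Integration by parts -/

section Bilinear
variable [IsAddTorsionFree K] [Algebra ℚ K] (c : Chart (fun x => le_refl (𝒢 x)) U₀)

theorem Chart.exists_p_mul_p (ε γ : c.J →₀ ℕ) :
    ∃ k : K, c.π.p ε * c.π.p γ = k • c.π.p (ε + γ) := by
  induction ε using multiIndex_induction with
  | zero => exact ⟨1, by rw [c.π.p_zero, one_mul, zero_add, one_smul]⟩
  | add ε i ih =>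
    obtain ⟨k, hk⟩ := ih
    refine ⟨algebraMap ℚ K ((ε i + 1 : ℕ) : ℚ)⁻¹ * (k * ((ε i + γ i + 1 : ℕ) : K)), ?_⟩
    refine IsAddTorsionFree.nsmul_right_injective (Nat.succ_ne_zero (ε i)) ?_
    change (ε i + 1) • _ = (ε i + 1) • _
    have h₁ : ((ε i + 1 : ℕ) : K) * algebraMap ℚ K ((ε i + 1 : ℕ) : ℚ)⁻¹ = 1 := by
      rw [← map_natCast (algebraMap ℚ K), ← map_mul, mul_inv_cancel₀, map_one]
      exact Nat.cast_ne_zero.2 (Nat.succ_ne_zero _)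
    rw [← smul_mul_assoc, ← c.π.mul_p, mul_assoc, hk, mul_smul_comm, c.π.mul_p,
      ← Nat.cast_smul_eq_nsmul K (ε i + 1), smul_smul, ← mul_assoc, h₁, one_mul,
      ← Nat.cast_smul_eq_nsmul K, smul_smul, add_right_comm]
    rfl

theorem Chart.exists_p_mul_sgn (ε γ : c.J →₀ ℕ) :
    ∃ k : K, c.π.p ε * (sgn γ • c.π.p γ) = k • c.π.p (ε + γ) := by
  obtain ⟨k, hk⟩ := c.exists_p_mul_p ε γ
  rcases Int.units_eq_one_or (sgn γ) with h | h <;> rw [h]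
  · exact ⟨k, by rw [one_smul, hk]⟩
  · exact ⟨-k, by rw [Units.neg_smul, one_smul, mul_neg, hk, neg_smul]⟩

/-- The bidifferential operator `(f, g) ↦ ∑ T γ (∂^γ f · g)` with coefficients `T`. -/
def Chart.bidiff (hV : V ≤ U₀) (f g : 𝒪[𝒢] V) :
    ((c.J →₀ ℕ) →₀ 𝒟[germSheaf 𝒢] U₀) →+ 𝒪[𝒢] V :=
  Finsupp.liftAddHom fun γ => DSec.evHom hV ((c.π.p γ).ev hV f * g)

theorem Chart.bidiff_single (hV : V ≤ U₀) (f g : 𝒪[𝒢] V)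
    (γ : c.J →₀ ℕ) (t : 𝒟[germSheaf 𝒢] U₀) :
    c.bidiff hV f g (single γ t) = t.ev hV ((c.π.p γ).ev hV f * g) :=
  Finsupp.liftAddHom_apply_single _ _ _

theorem Chart.bidiff_smul (hV : V ≤ U₀) (f g : 𝒪[𝒢] V)
    (d : 𝒟[germSheaf 𝒢] U₀)
    (t : (c.J →₀ ℕ) →₀ 𝒟[germSheaf 𝒢] U₀) :
    c.bidiff hV f g (d • t) = d.ev hV (c.bidiff hV f g t) := by
  induction t using Finsupp.induction_linear with
  | zero => rw [smul_zero, map_zero, ← DSec.homEv_apply, map_zero]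
  | add v w hv hw => rw [smul_add, map_add, map_add, hv, hw, DSec.ev_add]
  | single γ t => rw [Finsupp.smul_single, bidiff_single, bidiff_single, smul_eq_mul, DSec.mul_ev]

theorem Chart.bidiff_smul_scalar (hV : V ≤ U₀) (f g : 𝒪[𝒢] V) (k : K)
    (t : (c.J →₀ ℕ) →₀ 𝒟[germSheaf 𝒢] U₀) :
    c.bidiff hV f g (k • t) = (germSheaf 𝒢).scalar V k * c.bidiff hV f g t := by
  induction t using Finsupp.induction_linear with
  | zero => rw [smul_zero, map_zero, mul_zero]
  | add v w hv hw => rw [smul_add, map_add, map_add, hv, hw, mul_add]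
  | single γ t => rw [Finsupp.smul_single, bidiff_single, bidiff_single, DSec.smul_ev]

theorem Chart.bidiff_matrix (hV : V ≤ U₀) (f g : 𝒪[𝒢] V)
    (α : c.J →₀ ℕ) : c.bidiff hV f g (c.π.matrix (single α 1)) =
      f * (sgn α • c.π.p α).ev hV g := by
  rw [c.π.matrix_single, map_sum, c.π.mul_sgn_ev c.der]
  exact sum_congr rfl fun q _ => c.bidiff_single hV f g _ _

/-- Integration by parts: the operators `(f, g) ↦ ∂^ε f · ∂^δ g` are of the form
`∑ T γ (∂^γ f · g)`. -/
theorem Chart.exists_bidiff (ε δ : c.J →₀ ℕ) :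
    ∃ t, ∀ V (hV : V ≤ U₀) (f g : 𝒪[𝒢] V),
      c.bidiff hV f g t = (c.π.p ε).ev hV f * (sgn δ • c.π.p δ).ev hV g := by
  choose k hk using fun γ => c.exists_p_mul_p γ ε
  refine ⟨∑ q ∈ decomp δ, k q.1 • single (q.1 + ε) (sgn q.2 • c.π.p q.2),
    fun V hV f g => ?_⟩
  rw [map_sum, c.π.mul_sgn_ev c.der]
  refine sum_congr rfl fun q _ => ?_
  rw [c.bidiff_smul_scalar, c.bidiff_single, ← DSec.mul_ev (c.π.p q.1), hk, DSec.smul_ev, mul_assoc,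
    DSec.ev_scalar_mul]

end Bilinear

/-! ### Star products in coordinates -/

section Star
variable [IsAddTorsionFree K] [Algebra ℚ K]

/-- An isomorphism `θ` over the domain `U₀` of a chart from a sheaf of functions to a sheaf of
algebras `Q`, such that the product of `Q` is `θ f * θ g = θ (f g + ħ ∑ C_q ∂^(q.1) f ∂^(q.2) g)`
with a nilpotent scalar `ħ`, and such that sections of the two sheaves correspond to each other if
`θ` identifies them modulo `ħ`. -/
structure StarData {Q : AlgSheaf K X} (con' : Corr (germSheaf 𝒢).ring Q.ring)
    (c : Chart (fun x => le_refl (𝒢 x)) U₀) (ħ : K) where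
  nilpotent : IsNilpotent ħ
  θ : AddIso (germSheaf 𝒢).ring Q.ring U₀
  linear : ∀ V (hV : V ≤ U₀) (k : K) (f : 𝒪[𝒢] V),
    θ.iso V hV ((germSheaf 𝒢).scalar V k * f) = Q.scalar V k * θ.iso V hV f
  Λ : Finset ((c.J →₀ ℕ) × (c.J →₀ ℕ))
  C : (c.J →₀ ℕ) × (c.J →₀ ℕ) → 𝒪[𝒢] U₀
  mul : ∀ V (hV : V ≤ U₀) (f g : 𝒪[𝒢] V),
    θ.iso V hV f * θ.iso V hV g = θ.iso V hV (f * g + (germSheaf 𝒢).scalar V ħ *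
      ∑ q ∈ Λ, rres _ hV (C q) * ((c.π.p q.1).ev hV f * (c.π.p q.2).ev hV g))
  rel_iff : ∀ V (hV : V ≤ U₀) (s : 𝒪[𝒢] V) (t : rsec Q.ring V),
    con'.rel V s t ↔ ∃ u, (θ.iso V hV).symm t = s + (germSheaf 𝒢).scalar V ħ * u

variable {Q : AlgSheaf K X} {con' : Corr (germSheaf 𝒢).ring Q.ring}
  {c : Chart (fun x => le_refl (𝒢 x)) U₀} {ħ : K} (S : StarData con' c ħ) (hV : V ≤ U₀)

/-- The first order part of the operator of left multiplication by `f`. -/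
def StarData.lmul' (f : 𝒪[𝒢] V) : 𝒟[germSheaf 𝒢] V :=
  ∑ q ∈ S.Λ, mulOp _ _ V (rres _ hV (S.C q) * (c.π.p q.1).ev hV f) * DSec.res hV (c.π.p q.2)

theorem StarData.lmul'_ev (hW : W ≤ V) (f : 𝒪[𝒢] V) (g : 𝒪[𝒢] W) :
    (S.lmul' hV f).ev hW g = ∑ q ∈ S.Λ, rres _ (hW.trans hV) (S.C q) *
      ((c.π.p q.1).ev (hW.trans hV) (rres _ hW f) * (c.π.p q.2).ev (hW.trans hV) g) := by
  rw [← DSec.evHom_apply, StarData.lmul', map_sum]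
  refine sum_congr rfl fun q _ => ?_
  rw [DSec.evHom_apply, DSec.mulOp_mul_ev, map_mul, rres_rres, DSec.rres_ev, mul_assoc]
  rfl

theorem StarData.conjMul_eq (s : rsec Q.ring V) : S.θ.conjMul hV s =
    EndF.mulL ((S.θ.iso V hV).symm s) + EndF.mulL ((germSheaf 𝒢).scalar V ħ) *
      (S.lmul' hV ((S.θ.iso V hV).symm s)).toEnd := by
  funext W
  ext g
  change (S.θ.iso W.1 (W.2.trans hV)).symm (rres Q.ring W.2 s * S.θ.iso W.1 (W.2.trans hV) g) =
    rres _ W.2 ((S.θ.iso V hV).symm s) * g + rres _ W.2 ((germSheaf 𝒢).scalar V ħ) *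
      (S.lmul' hV ((S.θ.iso V hV).symm s)).ev W.2 g
  have h : rres Q.ring W.2 s = S.θ.iso W.1 (W.2.trans hV) (rres _ W.2 ((S.θ.iso V hV).symm s)) := by
    rw [← S.θ.natural V W.1 hV W.2, AddEquiv.apply_symm_apply]
  rw [h, S.mul, AddEquiv.symm_apply_apply, S.lmul'_ev, AlgSheaf.scalar_res]

/-- The first order parts of the multiplication operators have bounded order: by `StarData.mul` they
involve only finitely many derivatives. -/
theorem StarData.exists_twOrd : ∃ N, ∀ V (hV : V ≤ U₀) (u f : 𝒪[𝒢] V),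
    TwOrd (EqPair (germSheaf 𝒢).ring) N V (mulOp _ (germSheaf 𝒢).selfLin V u +
      S.lmul' hV f).toEnd := by
  choose N hN using fun γ => c.π.exists_twOrd c.der γ
  have key : ∀ Λ : Finset ((c.J →₀ ℕ) × (c.J →₀ ℕ)), ∃ N, ∀ V (hV : V ≤ U₀)
      (f : 𝒪[𝒢] V), TwOrd (EqPair (germSheaf 𝒢).ring) N V (∑ q ∈ Λ,
        mulOp _ (germSheaf 𝒢).selfLin V (rres _ hV (S.C q) * (c.π.p q.1).ev hV f) *
          DSec.res hV (c.π.p q.2)).toEnd := by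
    intro Λ
    induction Λ using Finset.cons_induction with
    | empty => exact ⟨0, fun V hV f => by rw [Finset.sum_empty, map_zero]; rfl⟩
    | cons q Λ _ ih =>
      obtain ⟨N₁, h₁⟩ := ih
      refine ⟨max (1 + N q.2) N₁, fun V hV f => ?_⟩
      rw [Finset.sum_cons, map_add, map_mul]
      exact (((twOrd_mulL _).mul ((hN q.2).res hV)).mono (le_max_left _ _)).add
        ((h₁ V hV f).mono (le_max_right _ _))
  obtain ⟨N₁, h₁⟩ := key S.Λ
  refine ⟨max 1 N₁, fun V hV u f => ?_⟩
  rw [map_add]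
  exact ((twOrd_mulL _).mono (le_max_left _ _)).add ((h₁ V hV f).mono (le_max_right _ _))

theorem StarData.mulL_add_mul (t u : 𝒪[𝒢] V) :
    EndF.mulL (t + (germSheaf 𝒢).scalar V ħ * u) =
      EndF.mulL t + EndF.mulL ((germSheaf 𝒢).scalar V ħ) * EndF.mulL u := by
  rw [← DSec.toEnd_mulOp, map_add, map_mul, map_add, map_mul]
  rfl

theorem StarData.isPerturbed {N₁ : ℕ}
    (hN : ∀ V (hV : V ≤ U₀) (u f : 𝒪[𝒢] V),
      TwOrd (EqPair (germSheaf 𝒢).ring) N₁ V (mulOp _ (germSheaf 𝒢).selfLin V u +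
        S.lmul' hV f).toEnd)
    {s : 𝒪[𝒢] V} {t : rsec Q.ring V} (h : con'.rel V s t) :
    ∃ y', Commute (EndF.mulL ((germSheaf 𝒢).scalar V ħ)) y' ∧
      TwOrd (EqPair (germSheaf 𝒢).ring) N₁ V y' ∧
      S.θ.conjMul hV t = EndF.mulL s + EndF.mulL ((germSheaf 𝒢).scalar V ħ) * y' := by
  obtain ⟨u, hu⟩ := (S.rel_iff V hV s t).1 h
  refine ⟨_, DSec.commute_toEnd ħ _, hN V hV u ((S.θ.iso V hV).symm t), ?_⟩
  rw [S.conjMul_eq, map_add, mul_add, ← add_assoc, DSec.toEnd_mulOp, ← StarData.mulL_add_mul, ← hu]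

theorem StarData.rel_self (s : 𝒪[𝒢] V) : con'.rel V s (S.θ.iso V hV s) :=
  (S.rel_iff V hV _ _).2 ⟨0, by rw [AddEquiv.symm_apply_apply, mul_zero, add_zero]⟩

/-- Multiplication by sections that correspond to each other agrees modulo `ħ`, in the source as
well as in the target. -/
theorem StarData.exists_isPerturbedCorr : ∃ N₁,
    IsPerturbedCorr con'.flip S.θ (AddIso.refl _ U₀) ħ N₁ ∧
      IsPerturbedCorr con' (AddIso.refl _ U₀) S.θ ħ N₁ := by
  obtain ⟨N₁, hN⟩ := S.exists_twOrd
  have h₀ : ∀ V, ∀ s : 𝒪[𝒢] V,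
      EndF.mulL s = EndF.mulL s + EndF.mulL ((germSheaf 𝒢).scalar V ħ) * 0 := fun V s => by
    rw [mul_zero, add_zero]
  refine ⟨N₁, ⟨S.nilpotent, S.linear, fun _ _ _ _ => rfl, ?_, fun V hV s => ?_⟩,
    ⟨S.nilpotent, fun _ _ _ _ => rfl, S.linear, ?_, fun V hV s => ?_⟩⟩
  · rintro V _ _ ⟨hV, t, s, h, rfl, rfl⟩
    obtain ⟨y', h₁, h₂, h₃⟩ := S.isPerturbed hV hN h
    exact ⟨s, 0, y', Commute.zero_right _, h₁, TwOrd.zero _ _ _, h₂, h₀ V s, h₃⟩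
  · obtain ⟨y', h₁, h₂, h₃⟩ := S.isPerturbed hV hN (S.rel_self hV s)
    exact ⟨_, _, ⟨hV, S.θ.iso V hV s, s, S.rel_self hV s, rfl, rfl⟩,
      0, y', Commute.zero_right _, h₁, TwOrd.zero _ _ _, h₂, h₀ V s, h₃⟩
  · rintro V _ _ ⟨hV, s, t, h, rfl, rfl⟩
    obtain ⟨y', h₁, h₂, h₃⟩ := S.isPerturbed hV hN h
    exact ⟨s, y', 0, h₁, Commute.zero_right _, h₂, TwOrd.zero _ _ _, h₃, h₀ V s⟩
  · obtain ⟨y', h₁, h₂, h₃⟩ := S.isPerturbed hV hN (S.rel_self hV s)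
    exact ⟨_, _, ⟨hV, s, S.θ.iso V hV s, S.rel_self hV s, rfl, rfl⟩,
      y', 0, h₁, Commute.zero_right _, h₂, TwOrd.zero _ _ _, h₃, h₀ V s⟩

/-- The operator of right multiplication by `g`. -/
def StarData.rmul : 𝒪[𝒢] V →+ 𝒟[germSheaf 𝒢] V :=
  AddMonoidHom.mk' (fun g => mulOp _ _ V g + ħ • ∑ q ∈ S.Λ,
    mulOp _ _ V (rres _ hV (S.C q) * (c.π.p q.2).ev hV g) * DSec.res hV (c.π.p q.1)) fun f g => by
  simp only [DSec.ev_add, map_add, mul_add, add_mul, Finset.sum_add_distrib, smul_add]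
  abel

theorem StarData.rmul_apply (g : 𝒪[𝒢] V) :
    S.rmul hV g = mulOp _ _ V g + ħ • ∑ q ∈ S.Λ,
    mulOp _ _ V (rres _ hV (S.C q) * (c.π.p q.2).ev hV g) * DSec.res hV (c.π.p q.1) := rfl

theorem StarData.mul_eq_rmul (f g : 𝒪[𝒢] V) :
    S.θ.iso V hV f * S.θ.iso V hV g = S.θ.iso V hV ((S.rmul hV g).ev le_rfl f) := by
  rw [S.mul]
  congr 1
  have h : (S.rmul hV g).ev le_rfl f = (mulOp _ (germSheaf 𝒢).selfLin V g).ev le_rfl f +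
      (ħ • ∑ q ∈ S.Λ, mulOp _ (germSheaf 𝒢).selfLin V (rres _ hV (S.C q) * (c.π.p q.2).ev hV g) *
        DSec.res hV (c.π.p q.1)).ev le_rfl f := rfl
  rw [h, DSec.smul_ev]
  congr 1
  · rw [mulOp_ev, rres_self, mul_comm]
  · congr 1
    refine Eq.trans ?_ (map_sum (DSec.evHom le_rfl f) _ _).symm
    refine sum_congr rfl fun q _ => ?_
    rw [DSec.evHom_apply, DSec.mulOp_mul_ev, rres_self, mul_assoc, mul_comm ((c.π.p q.1).ev hV f)]
    rfl

theorem StarData.rmul_scalar_mul (k : K) (g : 𝒪[𝒢] V) :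
    S.rmul hV ((germSheaf 𝒢).scalar V k * g) = k • S.rmul hV g := by
  simp only [S.rmul_apply, smul_add, DSec.ev_scalar_mul, smul_comm k ħ, smul_sum]
  congr 1
  · rw [map_mul, ← DSec.algebraMap_eq, Algebra.smul_def]
  · refine sum_congr rfl fun q _ => ?_
    rw [mul_left_comm, map_mul, ← DSec.algebraMap_eq, mul_assoc, ← Algebra.smul_def]

theorem StarData.res_rmul (hW : W ≤ V) (g : 𝒪[𝒢] V) :
    DSec.res hW (S.rmul hV g) = S.rmul (hW.trans hV) (rres _ hW g) := by
  rw [S.rmul_apply, S.rmul_apply, map_add, Algebra.smul_def, Algebra.smul_def, map_mul, map_sum,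
    DSec.algebraMap_eq, DSec.algebraMap_eq, ← mulOp_res, ← mulOp_res, AlgSheaf.scalar_res]
  congr 2
  refine sum_congr rfl fun q _ => ?_
  rw [map_mul, ← mulOp_res, map_mul, rres_rres, DSec.rres_ev]
  rfl

end Star

/-! ### The frame given by a star product -/

section StarFrame
variable [IsAddTorsionFree K] [Algebra ℚ K] {Q : AlgSheaf K X}
  {con' : Corr (germSheaf 𝒢).ring Q.ring} {c : Chart (fun x => le_refl (𝒢 x)) U₀} {ħ : K}
  (S : StarData con' c ħ) (hV : V ≤ U₀)

/-- A perturbation of an automorphism by a multiple of a nilpotent scalar is an automorphism. -/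
theorem isUnit_add_smul_of_isNilpotent {A : Type*} [Ring A] [Algebra K A] (hħ : IsNilpotent ħ)
    {a : A} (ha : IsUnit a) (x : A) : IsUnit (a + ħ • x) := by
  obtain ⟨a, rfl⟩ := ha
  have h : IsNilpotent (ħ • ((↑a⁻¹ : A) * x)) := by
    obtain ⟨m, hm⟩ := hħ
    exact ⟨m, by rw [smul_pow, hm, zero_smul]⟩
  have := a.isUnit.mul h.isUnit_one_add
  rwa [mul_add, mul_one, mul_smul_comm, Units.mul_inv_cancel_left] at this

/-- The matrix that expresses `f * (eB α)` by the functions `∂^γ f` is invertible, as it is the one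
for the commutative product modulo `ħ`. -/
theorem StarData.exists_matrix :
    ∃ M : ((c.J →₀ ℕ) →₀ 𝒟[germSheaf 𝒢] U₀)
        ≃ₗ[𝒟[germSheaf 𝒢] U₀]
        ((c.J →₀ ℕ) →₀ 𝒟[germSheaf 𝒢] U₀),
      ∀ (α : c.J →₀ ℕ) (V : Opens X) (hV : V ≤ U₀) (f g : 𝒪[𝒢] V),
        S.θ.iso V hV f * S.θ.iso V hV ((sgn α • c.π.p α).ev hV g) =
          S.θ.iso V hV (c.bidiff hV f g (M (single α 1))) := by
  have h₁ : ∀ ε δ α : c.J →₀ ℕ, ∃ t, ∀ V (hV : V ≤ U₀) (f g : 𝒪[𝒢] V),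
      c.bidiff hV f g t = (c.π.p ε).ev hV f * (c.π.p δ).ev hV ((sgn α • c.π.p α).ev hV g) := by
    intro ε δ α
    obtain ⟨k, hk⟩ := c.exists_p_mul_sgn δ α
    obtain ⟨t, ht⟩ := c.exists_bidiff ε (δ + α)
    refine ⟨(sgn (δ + α) : ℤ) • k • t, fun V hV f g => ?_⟩
    rw [map_zsmul, c.bidiff_smul_scalar, ht, DSec.unit_smul_ev, ← DSec.mul_ev, hk, DSec.smul_ev,
      ← Units.smul_def]
    rcases Int.units_eq_one_or (sgn (δ + α)) with h | h <;> rw [h]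
    · simp only [one_smul, mul_left_comm]
    · simp only [Units.neg_smul, one_smul, mul_left_comm, mul_neg, neg_neg]
  choose t ht using h₁
  let D := 𝒟[germSheaf 𝒢] U₀
  -- The rows of `Y` express the terms of the star product of order `ħ` by integration by parts.
  let Y : Module.End D ((c.J →₀ ℕ) →₀ D) := Finsupp.linearCombination D fun α =>
    ∑ q ∈ S.Λ, (mulOp _ (germSheaf 𝒢).selfLin U₀ (S.C q) : D) • t q.1 q.2 α
  have hM : IsUnit (c.π.matrix.toLinearMap + ħ • Y : Module.End D ((c.J →₀ ℕ) →₀ D)) :=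
    isUnit_add_smul_of_isNilpotent S.nilpotent
      ((Module.End.isUnit_iff _).2 c.π.matrix.bijective) Y
  refine ⟨LinearEquiv.ofBijective _ ((Module.End.isUnit_iff _).1 hM), fun α V hV f g => ?_⟩
  rw [S.mul]
  congr 1
  change _ = c.bidiff hV f g (c.π.matrix (single α 1) + ħ • Y (single α 1))
  rw [map_add, c.bidiff_matrix, c.bidiff_smul_scalar]
  congr 2
  rw [Finsupp.linearCombination_single, one_smul, map_sum]
  refine sum_congr rfl fun q _ => ?_
  rw [c.bidiff_smul, mulOp_ev, ht]

/-- The combination of the operators `(-1) ^ |α| p α` with coefficients acting by right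
multiplication. -/
def StarData.gensum : ((c.J →₀ ℕ) →₀ 𝒪[𝒢] V) →+
    𝒟[germSheaf 𝒢] V :=
  Finsupp.liftAddHom fun α =>
    (AddMonoidHom.mulRight (DSec.res hV (sgn α • c.π.p α))).comp (S.rmul hV)

theorem StarData.gensum_single (α : c.J →₀ ℕ) (g : 𝒪[𝒢] V) :
    S.gensum hV (single α g) = S.rmul hV g * DSec.res hV (sgn α • c.π.p α) :=
  Finsupp.liftAddHom_apply_single _ _ _

theorem StarData.gensum_apply (ρ : (c.J →₀ ℕ) →₀ 𝒪[𝒢] V) :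
    S.gensum hV ρ = ∑ α ∈ ρ.support, S.rmul hV (ρ α) * DSec.res hV (sgn α • c.π.p α) := rfl

theorem StarData.res_gensum (hW : W ≤ V) (ρ : (c.J →₀ ℕ) →₀ 𝒪[𝒢] V) :
    DSec.res hW (S.gensum hV ρ) = S.gensum (hW.trans hV)
      (Finsupp.mapRange.addMonoidHom (rres (germSheaf 𝒢).ring hW).toAddMonoidHom ρ) := by
  induction ρ using Finsupp.induction_linear with
  | zero => simp
  | add v w hv hw => simp only [map_add, hv, hw]
  | single α r =>
    rw [gensum_single, Finsupp.mapRange.addMonoidHom_apply, Finsupp.mapRange_single, gensum_single,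
      map_mul, S.res_rmul]
    rfl

/-- Right multiplications and derivatives generate the differential operators: they do so modulo
`ħ`, and `ħ` is nilpotent. -/
theorem StarData.exists_gensum (d : 𝒟[germSheaf 𝒢] V) {y : X}
    (hy : y ∈ V) : ∃ (W : Opens X) (hW : W ≤ V) (ρ : (c.J →₀ ℕ) →₀ 𝒪[𝒢] W),
      y ∈ W ∧ DSec.res hW d = S.gensum (hW.trans hV) ρ := by
  obtain ⟨m, hm⟩ := S.nilpotent
  -- Induction on `k = m - j`: the expansion of `d` in coordinates is correct up to `ħ • d'`.
  have key : ∀ k j, j + k = m → ∀ V (hV : V ≤ U₀) (_ : y ∈ V)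
      (d : 𝒟[germSheaf 𝒢] V),
      ∃ (W : Opens X) (hW : W ≤ V) (ρ : (c.J →₀ ℕ) →₀ 𝒪[𝒢] W),
        y ∈ W ∧ ħ ^ j • DSec.res hW d = S.gensum (hW.trans hV) ρ := by
    intro k
    induction k with
    | zero =>
      rintro j rfl V hV hy d
      exact ⟨V, le_rfl, 0, hy, by rw [← add_zero j, hm, zero_smul, map_zero]⟩
    | succ k ih =>
      intro j hj V hV hy d
      obtain ⟨W₁, hW₁, F, o, hy₁, e₁⟩ := c.exists_expansion V hV d y hy
      let d' : 𝒟[germSheaf 𝒢] W₁ := ∑ α ∈ F, (∑ q ∈ S.Λ,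
        mulOp _ _ W₁ (rres _ (hW₁.trans hV) (S.C q) * (c.π.p q.2).ev (hW₁.trans hV) (sgn α • o α)) *
          DSec.res (hW₁.trans hV) (c.π.p q.1)) * DSec.res (hW₁.trans hV) (sgn α • c.π.p α)
      have e₂ : S.gensum (hW₁.trans hV) (∑ α ∈ F, single α (sgn α • o α)) =
          DSec.res hW₁ d + ħ • d' := by
        rw [map_sum, e₁, smul_sum, ← Finset.sum_add_distrib]
        refine sum_congr rfl fun α _ => ?_
        rw [S.gensum_single, S.rmul_apply, add_mul, smul_mul_assoc]
        congr 1
        rcases Int.units_eq_one_or (sgn α) with h | h <;> rw [h]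
        · simp only [one_smul]
        · simp only [Units.neg_smul, one_smul, map_neg, neg_mul_neg]
      obtain ⟨W, hW, ρ, hyW, e₃⟩ := ih (j + 1) (by omega) W₁ (hW₁.trans hV) hy₁ d'
      refine ⟨W, hW.trans hW₁, Finsupp.mapRange.addMonoidHom
        (rres (germSheaf 𝒢).ring hW).toAddMonoidHom (∑ α ∈ F,
          single α ((germSheaf 𝒢).scalar W₁ (ħ ^ j) * sgn α • o α)) - ρ, hyW, ?_⟩
      have e₄ : S.gensum (hW₁.trans hV) (∑ α ∈ F,
          single α ((germSheaf 𝒢).scalar W₁ (ħ ^ j) * sgn α • o α)) =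
          ħ ^ j • (DSec.res hW₁ d + ħ • d') := by
        rw [← e₂, map_sum, map_sum, smul_sum]
        refine sum_congr rfl fun α _ => ?_
        rw [S.gensum_single, S.gensum_single, S.rmul_scalar_mul, smul_mul_assoc]
      have e₅ : ∀ (k : K) (a : 𝒟[germSheaf 𝒢] W₁),
          DSec.res hW (k • a) = k • DSec.res hW a := fun k a => by
        rw [Algebra.smul_def, Algebra.smul_def, map_mul, DSec.algebraMap_eq, DSec.algebraMap_eq,
          ← mulOp_res, AlgSheaf.scalar_res]
      rw [map_sub, ← e₃, ← S.res_gensum (hW₁.trans hV), e₄, e₅, map_add, e₅, smul_add, smul_smul,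
        ← pow_succ,
        add_sub_cancel_right]
      rfl
  obtain ⟨W, hW, ρ, hyW, e⟩ := key m 0 (zero_add m) V hV hy d
  exact ⟨W, hW, ρ, hyW, by rwa [pow_zero, one_smul] at e⟩

variable {N₁ : ℕ} (HA : IsPerturbedCorr con'.flip S.θ (AddIso.refl _ U₀) ħ N₁)
  (HB : IsPerturbedCorr con' (AddIso.refl _ U₀) S.θ ħ N₁)

/-- The operator `d θ⁻¹`. -/
def StarData.aOf (d : 𝒟[germSheaf 𝒢] V) :
    msec (AMod (germSheaf 𝒢) Q con'.flip) V := toL (leftDiff _ _ con'.flip) (HA.ofD hV d)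

theorem StarData.lev_aOf (d : 𝒟[germSheaf 𝒢] V) (hW : W ≤ V)
    (f : rsec Q.ring W) :
    lev hW (S.aOf hV HA d) f = d.ev hW ((S.θ.iso W (hW.trans hV)).symm f) := rfl

/-- The operator `a θ`. -/
def StarData.dOfA (a : msec (AMod (germSheaf 𝒢) Q con'.flip) V) :
    𝒟[germSheaf 𝒢] V := HA.toD hV a

theorem StarData.dOfA_ev (a : msec (AMod (germSheaf 𝒢) Q con'.flip) V) (hW : W ≤ V)
    (f : 𝒪[𝒢] W) :
    (S.dOfA hV HA a).ev hW f = lev hW a (S.θ.iso W (hW.trans hV) f) := rfl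

/-- The operator `θ d`. -/
def StarData.bOf (d : 𝒟[germSheaf 𝒢] V) :
    msec (BMod (germSheaf 𝒢) Q con') V := HB.ofD hV d

theorem StarData.rev_bOf (d : 𝒟[germSheaf 𝒢] V) (hW : W ≤ V)
    (g : 𝒪[𝒢] W) :
    rev hW (S.bOf hV HB d) g = S.θ.iso W (hW.trans hV) (d.ev hW g) := rfl

/-- The operator `θ⁻¹ b`. -/
def StarData.dOfB (b : msec (BMod (germSheaf 𝒢) Q con') V) :
    𝒟[germSheaf 𝒢] V := HB.toD hV b

theorem StarData.dOfB_ev (b : msec (BMod (germSheaf 𝒢) Q con') V) (hW : W ≤ V)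
    (g : 𝒪[𝒢] W) :
    (S.dOfB hV HB b).ev hW g = (S.θ.iso W (hW.trans hV)).symm (rev hW b g) := rfl

theorem StarData.bOf_zero_rsm (d : 𝒟[germSheaf 𝒢] V) (hW : W ≤ V)
    (g : 𝒪[𝒢] W) :
    rev hW (mres (BMod (germSheaf 𝒢) Q con') hV
      (S.bOf le_rfl HB (sgn (0 : c.J →₀ ℕ) • c.π.p 0)) ◂ d) g =
      S.θ.iso W (hW.trans hV) (d.ev hW g) := by
  rw [rev_rsm, rev_mres, S.rev_bOf, c.eB_zero]
  rfl

/-- The frame for the operators `a : Q → O` and `b : O → Q`. -/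
theorem StarData.nonempty_frame (S : StarData con' c ħ) : Nonempty
    (Frame con'.flip (postAct (germSheaf 𝒢) Q con')
    (fun U => RingHom.id (rsec Q.ring U)) U₀) := by
  obtain ⟨N₁, HA, HB⟩ := S.exists_isPerturbedCorr
  obtain ⟨M, hM⟩ := S.exists_matrix
  have hf : ∀ V (hV : V ≤ U₀) (f : 𝒪[𝒢] U₀),
      rres Q.ring hV (S.θ.iso U₀ le_rfl f) = S.θ.iso V hV (rres _ hV f) := fun V hV f =>
    S.θ.natural U₀ V le_rfl hV f
  refine ⟨{
    I := c.J →₀ ℕ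
    dec := inferInstance
    zero := 0
    eA := fun γ => S.aOf le_rfl HA (c.π.p γ)
    len := c.len
    o := c.o
    f := fun γ j => S.θ.iso U₀ le_rfl (c.f γ j)
    basis := fun V hV a y hy => ?_
    dual := fun γ δ => ?_
    eB := fun α => S.bOf le_rfl HB (sgn α • c.π.p α)
    bijective := fun V hV => ⟨fun d d' h => ?_, fun b => ?_⟩
    faithful := fun V hV r hr => ?_
    gen := fun V hV b y hy => ?_
    M := M
    mul := fun α V hV f g => ?_ }⟩
  · obtain ⟨W, hW, F₀, hyW, e⟩ := c.basis (con := Corr.eq _) (fun U f t => eq_comm) V hV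
      (show diffOps _ _ (Corr.eq _) V from S.dOfA hV HA a) y hy
    refine ⟨W, hW, F₀, hyW, fun F hF => lev_ext fun W' hW' f => ?_⟩
    have h := congrArg (fun x : msec (AMod (germSheaf 𝒢) (germSheaf 𝒢) (Corr.eq _)) W =>
      lev hW' x ((S.θ.iso W' (hW'.trans (hW.trans hV))).symm f)) (e F hF)
    dsimp only at h
    rw [lev_sum] at h ⊢
    have h₁ : lev hW' (mres (AMod (germSheaf 𝒢) (germSheaf 𝒢) (Corr.eq _)) hW
        (show diffOps _ _ (Corr.eq _) V from S.dOfA hV HA a))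
        ((S.θ.iso W' (hW'.trans (hW.trans hV))).symm f) = lev hW' (mres _ hW a) f := by
      refine (S.dOfA_ev hV HA a (hW'.trans hW) _).trans ?_
      rw [AddEquiv.apply_symm_apply, lev_mres]
    rw [← h₁, h]
    refine sum_congr rfl fun γ _ => ?_
    rw [lev_smul, lev_smul]
    refine congrArg₂ (· * ·) (congrArg (rres _ hW') (sum_congr rfl fun j _ => ?_)) rfl
    rw [hf]
    rfl
  · rw [← c.dual (con := Corr.eq _) (fun U f t => eq_comm) γ δ]
    refine sum_congr rfl fun j _ => ?_
    rw [S.lev_aOf, AddEquiv.symm_apply_apply, rres_self, rres_self]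
    rfl
  · refine DSec.ext fun W hW g => (S.θ.iso W (hW.trans hV)).injective ?_
    have := congrArg (fun b : msec (BMod (germSheaf 𝒢) Q con') V => rev hW b g) h
    dsimp only at this
    rwa [S.bOf_zero_rsm, S.bOf_zero_rsm] at this
  · refine ⟨S.dOfB hV HB b, rev_ext fun W hW g => ?_⟩
    rw [S.bOf_zero_rsm, S.dOfB_ev, AddEquiv.apply_symm_apply]
  · have := congrArg (fun b : msec (BMod (germSheaf 𝒢) Q con') V =>
      rev le_rfl b ((S.θ.iso V hV).symm 1)) hr
    rw [rev_postAct, rev_mres, S.rev_bOf, c.eB_zero, rres_self] at this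
    have h₁ : S.θ.iso V hV ((S.θ.iso V hV).symm 1) * r = 0 := this
    rwa [AddEquiv.apply_symm_apply, one_mul] at h₁
  · obtain ⟨W, hW, ρ, hyW, e⟩ := S.exists_gensum hV (S.dOfB hV HB b) hy
    refine ⟨W, hW, ρ.support, fun α => S.θ.iso W (hW.trans hV) (ρ α), hyW,
      rev_ext fun W' hW' g => ?_⟩
    have h := congrArg (DSec.evHom hW' g) e
    rw [S.gensum_apply, map_sum] at h
    have h₁ : (S.dOfB hV HB b).ev (hW'.trans hW) g = _ := h
    rw [S.dOfB_ev, AddEquiv.symm_apply_eq, map_sum] at h₁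
    rw [rev_mres, h₁, rev_sum]
    refine sum_congr rfl fun α _ => ?_
    rw [rev_postAct, rev_mres, S.rev_bOf, S.θ.natural, S.mul_eq_rmul,
      ← S.res_rmul (hW.trans hV) hW']
    rfl
  · obtain ⟨f, rfl⟩ := (S.θ.iso V hV).surjective f
    rw [S.rev_bOf, RingHom.id_apply, hM, Chart.bidiff, Finsupp.liftAddHom_apply,
      Finsupp.sum, map_sum]
    refine sum_congr rfl fun γ _ => ?_
    rw [S.rev_bOf, S.lev_aOf, AddEquiv.symm_apply_apply, c.eB_zero]
    rfl

theorem exists_common_nhd_of_finite {ι : Type*} [Finite ι] {x : X} (V : ι → Opens X)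
    (h : ∀ i, x ∈ V i) : ∃ W : Opens X, x ∈ W ∧ ∀ i, W ≤ V i := by
  obtain ⟨n, ⟨e⟩⟩ := Finite.exists_equiv_fin ι
  obtain ⟨W, hx, hW⟩ := exists_common_nhd (fun k => V (e.symm k)) fun k => h _
  exact ⟨W, hx, fun i => by simpa using hW (e i)⟩

/-- The product of `Q` is a finite sum of products of derivatives, to which the coproduct of
operators on functions applies. -/
theorem StarData.exists_coproduct (S : StarData con' c ħ)
    (hc : HasCoproduct (Corr.eq (germSheaf 𝒢).ring))
    (a : msec (AMod (germSheaf 𝒢) Q con'.flip) U) {x : X} (hx : x ∈ U) (hx₀ : x ∈ U₀) :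
    ∃ (V : Opens X) (hV : V ≤ U) (m : ℕ) (b b' : Fin m → msec (AMod (germSheaf 𝒢) Q con'.flip) V),
      x ∈ V ∧ ∀ W (hW : W ≤ V) (f₁ f₂ : rsec Q.ring W),
        lev (hW.trans hV) a (f₁ * f₂) = ∑ i, lev hW (b i) f₁ * lev hW (b' i) f₂ := by
  obtain ⟨N₁, HA, -⟩ := S.exists_isPerturbedCorr
  let V₁ : Opens X := U ⊓ U₀
  have hU : V₁ ≤ U := inf_le_left
  have h₀ : V₁ ≤ U₀ := inf_le_right
  let d := S.dOfA h₀ HA (mres _ hU a)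
  -- The index `none` stands for the term `f g` of the star product.
  let ι := Option {q // q ∈ S.Λ}
  let e : ι → 𝒟[germSheaf 𝒢] V₁ := fun i =>
    i.elim d fun q => d * mulOp _ _ V₁ ((germSheaf 𝒢).scalar V₁ ħ * rres _ h₀ (S.C q))
  let p : ι → (c.J →₀ ℕ) × (c.J →₀ ℕ) := fun i => i.elim (0, 0) Subtype.val
  have key : ∀ W (hW : W ≤ V₁) (h₁ h₂ : 𝒪[𝒢] W),
      lev (hW.trans hU) a (S.θ.iso W (hW.trans h₀) h₁ * S.θ.iso W (hW.trans h₀) h₂) =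
        ∑ i, (e i).ev hW ((c.π.p (p i).1).ev (hW.trans h₀) h₁ *
          (c.π.p (p i).2).ev (hW.trans h₀) h₂) := by
    intro W hW h₁ h₂
    rw [S.mul, ← lev_mres hU hW, ← S.dOfA_ev h₀ HA, DSec.ev_add, Fintype.sum_option]
    congr 1
    · change _ = d.ev hW ((c.π.p 0).ev _ h₁ * (c.π.p 0).ev _ h₂)
      rw [c.π.p_zero]
      rfl
    · rw [mul_sum, ← DSec.homEv_apply, map_sum]
      refine (Finset.sum_coe_sort S.Λ _).symm.trans (sum_congr rfl fun q _ => ?_)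
      change d.ev hW _ = d.ev hW (rres _ hW ((germSheaf 𝒢).scalar V₁ ħ * rres _ h₀ (S.C q)) * _)
      rw [map_mul, AlgSheaf.scalar_res, rres_rres, mul_assoc]
      rfl
  choose V hV m b b' hxV hb using fun i => hc V₁
    (show diffOps _ _ (Corr.eq _) V₁ from e i) x ⟨hx, hx₀⟩
  obtain ⟨V₂, hx₂, hV₂⟩ := exists_common_nhd_of_finite V hxV
  have hV₁ : V₂ ≤ V₁ := (hV₂ none).trans (hV none)
  let β : (i : ι) → Fin (m i) → 𝒟[germSheaf 𝒢] V₂ := fun i j =>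
    DSec.res (hV₂ i) (show diffOps _ _ (Corr.eq _) (V i) from b i j)
  let β' : (i : ι) → Fin (m i) → 𝒟[germSheaf 𝒢] V₂ := fun i j =>
    DSec.res (hV₂ i) (show diffOps _ _ (Corr.eq _) (V i) from b' i j)
  let en := Fintype.equivFin (Σ i, Fin (m i))
  refine ⟨V₂, hV₁.trans hU, _,
    fun k => S.aOf (hV₁.trans h₀) HA
      (β _ (en.symm k).2 * DSec.res (hV₁.trans h₀) (c.π.p (p (en.symm k).1).1)),
    fun k => S.aOf (hV₁.trans h₀) HA
      (β' _ (en.symm k).2 * DSec.res (hV₁.trans h₀) (c.π.p (p (en.symm k).1).2)),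
    hx₂, fun W hW f₁ f₂ => ?_⟩
  obtain ⟨h₁, rfl⟩ := (S.θ.iso W (hW.trans (hV₁.trans h₀))).surjective f₁
  obtain ⟨h₂, rfl⟩ := (S.θ.iso W (hW.trans (hV₁.trans h₀))).surjective f₂
  refine (key W (hW.trans hV₁) h₁ h₂).trans ?_
  simp only [S.lev_aOf, AddEquiv.symm_apply_apply]
  rw [Equiv.sum_comp en.symm (fun k : Σ i, Fin (m i) =>
    (β _ k.2 * DSec.res (hV₁.trans h₀) (c.π.p (p k.1).1)).ev hW h₁ *
      (β' _ k.2 * DSec.res (hV₁.trans h₀) (c.π.p (p k.1).2)).ev hW h₂), Fintype.sum_sigma]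
  exact sum_congr rfl fun i _ => hb i W (hW.trans (hV₂ i)) _ _

/-- Sheaves of algebras that are locally given by star products induce equivalences. -/
theorem inducesEquivalence_of_starData
    (hchart : ∀ x, ∃ U₀ : Opens X, x ∈ U₀ ∧ Nonempty (Chart (fun x => le_refl (𝒢 x)) U₀))
    (h : ∀ x, ∃ (U₀ : Opens X) (c : Chart (fun x => le_refl (𝒢 x)) U₀) (ħ : K), x ∈ U₀ ∧
      Nonempty (StarData con' c ħ)) :
    InducesEquivalence con'.flip con' (Corr.eq _) (postAct (germSheaf 𝒢) Q con') .right := by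
  have hc : HasCoproduct (Corr.eq (germSheaf 𝒢).ring) :=
    hasCoproduct_of_chart (hle := fun x => le_refl (𝒢 x)) (fun U f t => eq_comm) hchart
  refine inducesEquivalence (isLeftMul_postAct (fun U => RingHom.id _) (fun U f t => eq_comm)
    fun _ _ _ _ => rfl) (fun x => ?_) (fun U a x hx => ?_) (isGenByDer_of_chart hchart) (.inl rfl)
  · obtain ⟨U₀, c, ħ, hx, ⟨S⟩⟩ := h x
    exact ⟨U₀, hx, S.nonempty_frame⟩
  · obtain ⟨U₀, c, ħ, hx₀, ⟨S⟩⟩ := h x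
    exact S.exists_coproduct hc a hx hx₀

end StarFrame

/-! ### Bidifferential operators in coordinates -/

section Restrict

/-- The restriction of a system of coordinates to an open subset. -/
def Chart.restrict (c : Chart hle U₀) (hV : V ≤ U₀) : Chart hle V where
  J := c.J
  x i := rres _ hV (c.x i)
  d i := DSec.res hV (c.d i)
  der i W hW f g := c.der i W (hW.trans hV) f g
  d_x i k := by
    have h := congrArg (rres (germSheaf 𝒢).ring hV) (c.d_x i k)
    rw [DSec.rres_ev] at h
    refine h.trans ?_
    split
    · exact map_one _
    · exact map_zero _
  π :=
    { p := fun γ => DSec.res hV (c.π.p γ)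
      p_zero := by rw [c.π.p_zero, map_one]
      mul_p := fun i γ => by rw [← map_mul, c.π.mul_p, map_nsmul]
      comm := fun i γ => (c.π.comm i γ).map (DSec.res hV) }
  hadamard W hW f z := c.hadamard W (hW.trans hV) f z

end Restrict

section Bidiff
variable {𝒢 : X → Subalgebra ℂ (X → ℂ)}

/-- For a fixed first argument, a bidifferential operator is a differential operator. -/
theorem BidiffOp.isDiffOp_left (B : BidiffOp (germSheaf 𝒢) U) {N : ℕ} (hV : V ≤ U)
    (f : 𝒪[𝒢] V)
    (h : Fam.OrderLT (Corr.eq (germSheaf 𝒢).ring) N V (fun W =>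
        (toUnit (germSheaf 𝒢).ring W.1).symm.toAddMonoidHom.comp
          (B.toFun ⟨W.1, W.2.trans hV⟩ (rres (germSheaf 𝒢).ring W.2 f)) :
            Fam (germSheaf 𝒢).ring (unitMod (germSheaf 𝒢).ring) V)) :
    IsDiffOp ((germSheaf 𝒢).lin (germSheaf 𝒢)) (Corr.eq (germSheaf 𝒢).ring) (fun W =>
        (toUnit (germSheaf 𝒢).ring W.1).symm.toAddMonoidHom.comp
          (B.toFun ⟨W.1, W.2.trans hV⟩ (rres (germSheaf 𝒢).ring W.2 f)) :
            Fam (germSheaf 𝒢).ring (unitMod (germSheaf 𝒢).ring) V) where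
  natural W W' hW hW' g := (B.natural W W' (hW.trans hV) hW' (rres _ hW f) g).trans (by
    rw [rres_rres]; rfl)
  linear := by
    rintro W hW _ _ g ⟨k, rfl, rfl⟩
    exact B.linear_right ⟨W, hW.trans hV⟩ k _ g
  order _ hx := ⟨V, le_rfl, N, hx, h⟩

/-- For a fixed second argument, a bidifferential operator is a differential operator. -/
theorem BidiffOp.isDiffOp_right (B : BidiffOp (germSheaf 𝒢) U) {N : ℕ} (hV : V ≤ U)
    (f : 𝒪[𝒢] V)
    (h : Fam.OrderLT (Corr.eq (germSheaf 𝒢).ring) N V (fun W =>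
        (toUnit (germSheaf 𝒢).ring W.1).symm.toAddMonoidHom.comp
          ((B.toFun ⟨W.1, W.2.trans hV⟩).flip (rres (germSheaf 𝒢).ring W.2 f)) :
            Fam (germSheaf 𝒢).ring (unitMod (germSheaf 𝒢).ring) V)) :
    IsDiffOp ((germSheaf 𝒢).lin (germSheaf 𝒢)) (Corr.eq (germSheaf 𝒢).ring) (fun W =>
        (toUnit (germSheaf 𝒢).ring W.1).symm.toAddMonoidHom.comp
          ((B.toFun ⟨W.1, W.2.trans hV⟩).flip (rres (germSheaf 𝒢).ring W.2 f)) :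
            Fam (germSheaf 𝒢).ring (unitMod (germSheaf 𝒢).ring) V) where
  natural W W' hW hW' g := (B.natural W W' (hW.trans hV) hW' g (rres _ hW f)).trans (by
    rw [rres_rres]; rfl)
  linear := by
    rintro W hW _ _ g ⟨k, rfl, rfl⟩
    exact B.linear_left ⟨W, hW.trans hV⟩ k g _
  order _ hx := ⟨V, le_rfl, N, hx, h⟩

/-- The expansion of a bidifferential operator in coordinates. -/
theorem BidiffOp.exists_expansion (B : BidiffOp (germSheaf 𝒢) U)
    (c : Chart (fun x => le_refl (𝒢 x)) U₀) {x : X} (hx : x ∈ U) (hx₀ : x ∈ U₀) :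
    ∃ (V : Opens X) (hV : V ≤ U) (hV₀ : V ≤ U₀) (F₀ : Finset (c.J →₀ ℕ))
      (C : (c.J →₀ ℕ) × (c.J →₀ ℕ) → 𝒪[𝒢] V), x ∈ V ∧ ∀ F, F₀ ⊆ F →
      ∀ W (hW : W ≤ V) (f g : 𝒪[𝒢] W),
        B.toFun ⟨W, hW.trans hV⟩ f g = ∑ q ∈ F ×ˢ F, rres _ hW (C q) *
          ((c.π.p q.1).ev (hW.trans hV₀) f * (c.π.p q.2).ev (hW.trans hV₀) g) := by
  obtain ⟨V₁, hV₁, N, hx₁, hN⟩ := B.order x hx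
  let V : Opens X := V₁ ⊓ U₀
  have hV : V ≤ U := inf_le_left.trans hV₁
  have hV₀ : V ≤ U₀ := inf_le_right
  refine ⟨V, hV, hV₀, (c.finite_degree_lt N).toFinset, fun q => ∑ j, ∑ k,
    rres _ hV₀ (c.o q.1 j) * (rres _ hV₀ (c.o q.2 k) *
      B.toFun ⟨V, hV⟩ (rres _ hV₀ (c.f q.1 j)) (rres _ hV₀ (c.f q.2 k))), ⟨hx₁, hx₀⟩,
    fun F hF W hW f g => valAt_ext fun z => ?_⟩
  have hF' : ∀ γ : c.J →₀ ℕ, γ.degree < N → γ ∈ F := fun γ hγ =>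
    hF ((Set.Finite.mem_toFinset _).2 hγ)
  have hW₀ := hW.trans hV₀
  have h₁ : ∀ f g : 𝒪[𝒢] W, valAt z (B.toFun ⟨W, hW.trans hV⟩ f g) =
      ∑ δ ∈ F, valAt z (B.toFun ⟨W, hW.trans hV⟩ f (c.mono hW₀ z δ)) *
        valAt z ((c.π.p δ).ev hW₀ g) := fun f g => by
    have h := (hN W (hW.trans inf_le_left) f).1
    have := c.valAt_lev (con := Corr.eq _) (fun _ _ => rfl) hW₀
      (⟨_, B.isDiffOp_left (hW.trans hV) f h⟩ :
        diffOps (unitMod (germSheaf 𝒢).ring) ((germSheaf 𝒢).lin (germSheaf 𝒢)) (Corr.eq _) W)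
      h F hF' le_rfl g z
    have e : ∀ g : 𝒪[𝒢] W, B.toFun ⟨W, hW.trans hV⟩ f g =
      B.toFun ⟨W, hW.trans hV⟩ (rres _ le_rfl f) g := fun g => by rw [rres_self]
    simp only [e]
    exact this
  have h₂ : ∀ f g : 𝒪[𝒢] W, valAt z (B.toFun ⟨W, hW.trans hV⟩ f g) =
      ∑ γ ∈ F, valAt z (B.toFun ⟨W, hW.trans hV⟩ (c.mono hW₀ z γ) g) *
        valAt z ((c.π.p γ).ev hW₀ f) := fun f g => by
    have h := (hN W (hW.trans inf_le_left) g).2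
    have := c.valAt_lev (con := Corr.eq _) (fun _ _ => rfl) hW₀
      (⟨_, B.isDiffOp_right (hW.trans hV) g h⟩ :
        diffOps (unitMod (germSheaf 𝒢).ring) ((germSheaf 𝒢).lin (germSheaf 𝒢)) (Corr.eq _) W)
      h F hF' le_rfl f z
    have e : ∀ f : 𝒪[𝒢] W, B.toFun ⟨W, hW.trans hV⟩ f g =
      B.toFun ⟨W, hW.trans hV⟩ f (rres _ le_rfl g) := fun f => by rw [rres_self]
    simp only [e]
    exact this
  have h₃ : ∀ γ δ, valAt z (rres (germSheaf 𝒢).ring hW (∑ j, ∑ k,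
      rres _ hV₀ (c.o γ j) * (rres _ hV₀ (c.o δ k) *
        B.toFun ⟨V, hV⟩ (rres _ hV₀ (c.f γ j)) (rres _ hV₀ (c.f δ k))))) =
      valAt z (B.toFun ⟨W, hW.trans hV⟩ (c.mono hW₀ z γ) (c.mono hW₀ z δ)) := fun γ δ => by
    have key : B.toFun ⟨W, hW.trans hV⟩ (c.mono hW₀ z γ) (c.mono hW₀ z δ) = ∑ j, ∑ k,
        (germSheaf 𝒢).scalar W (valAt z (rres _ hW₀ (c.o γ j))) *
          ((germSheaf 𝒢).scalar W (valAt z (rres _ hW₀ (c.o δ k))) *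
            B.toFun ⟨W, hW.trans hV⟩ (rres _ hW₀ (c.f γ j)) (rres _ hW₀ (c.f δ k))) := by
      rw [c.mono_eq, c.mono_eq, map_sum (B.toFun ⟨W, hW.trans hV⟩), AddMonoidHom.finsetSum_apply]
      refine sum_congr rfl fun j _ => ?_
      rw [map_sum]
      refine sum_congr rfl fun k _ => ?_
      rw [B.linear_left ⟨W, hW.trans hV⟩, B.linear_right ⟨W, hW.trans hV⟩]
    rw [key, map_sum, map_sum, map_sum]
    refine sum_congr rfl fun j _ => ?_
    rw [map_sum, map_sum, map_sum]
    refine sum_congr rfl fun k _ => ?_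
    rw [map_mul, map_mul, map_mul, B.natural V W hV hW, map_mul, map_mul, map_mul, valAt_scalar,
      valAt_scalar, rres_rres, rres_rres, rres_rres, rres_rres]
  rw [h₁, map_sum, Finset.sum_product_right]
  refine sum_congr rfl fun δ _ => ?_
  rw [h₂, sum_mul]
  refine sum_congr rfl fun γ _ => ?_
  rw [map_mul, map_mul, h₃, mul_assoc]

end Bidiff

/-! ### Change of scalars -/

section Linear
open Filter Topology
variable {E : Type v} [NormedAddCommGroup E] [NormedSpace ℂ E] [FiniteDimensional ℂ E] {M : Type u}
  [TopologicalSpace M] [ChartedSpace E M] [IsManifold 𝓘(ℂ, E) ω M] {K : Type} [NormedCommRing K]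
  [NormedAlgebra ℂ K] [FiniteDimensional ℂ K] {K' : Type} [NormedCommRing K'] [NormedAlgebra ℂ K']
  [FiniteDimensional ℂ K'] {φ : OpenPartialHomeomorph M E}

/-- The composition of functions with a linear map. -/
def secMap (L : K →ₗ[ℂ] K') (V : Opens (TopCat.of M)) :
    rsec (holSheaf E M K).ring V →+ rsec (holSheaf E M K').ring V :=
  AddMonoidHom.mk' (fun f => germSec V (fun y => L (secExt f y)) fun z hz => mem_holGerms.2
    ((LinearMap.toContinuousLinearMap L).contDiff.contMDiff.contMDiffAt.comp z
      (mem_holGerms.1 (secExt_mem_holGerms f ⟨z, hz⟩)))) fun f g => valAt_ext fun z => by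
    rw [map_add, valAt_germSec, valAt_germSec, valAt_germSec, secExt_add, Pi.add_apply, map_add]

theorem valAt_secMap (L : K →ₗ[ℂ] K') {V : Opens (TopCat.of M)} (f : rsec (holSheaf E M K).ring V)
    (z : V) : valAt z (secMap L V f) = L (valAt z f) :=
  congrArg L (secExt_apply f z)

theorem chartDer_secMap (hφ : φ ∈ IsManifold.maximalAtlas 𝓘(ℂ, E) ω M) (v : E) (L : K →ₗ[ℂ] K')
    {V : Opens (TopCat.of M)} (hV : V ≤ chartDomain φ) (f : rsec (holSheaf E M K).ring V) :
    (chartDer K' hφ v).ev hV (secMap L V f) = secMap L V ((chartDer K hφ v).ev hV f) :=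
  valAt_ext fun z => by
    let L' := LinearMap.toContinuousLinearMap L
    have h₁ : fderiv ℂ (inChart φ (secMap L V f)) (φ z.1) =
        fderiv ℂ (L' ∘ inChart φ f) (φ z.1) := by
      refine fderiv_inChart_of_eventuallyEq hV (secMap L V f) z (g := L' ∘ inChart φ f) ?_
      filter_upwards [V.isOpen.mem_nhds z.2] with y hy
      rw [secExt_apply (secMap L V f) (⟨y, hy⟩ : V), valAt_secMap, Function.comp_apply, inChart,
        Function.comp_apply, φ.left_inv (hV hy), secExt_apply f (⟨y, hy⟩ : V)]
      rfl
    have h₂ := (analyticAt_inChart hφ hV f z).differentiableAt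
    have h₃ := (L'.hasFDerivAt.comp _ h₂.hasFDerivAt).fderiv
    rw [valAt_secMap]
    exact congrArg (fun A : E →L[ℂ] K' => A v) (h₁.trans h₃)

variable [IsAddTorsionFree K] [Algebra ℚ K] [IsAddTorsionFree K'] [Algebra ℚ K'] {J : Type}
  [Fintype J] [DecidableEq J]

theorem divPow_secMap (b : Module.Basis J ℂ E) (hφ : φ ∈ IsManifold.maximalAtlas 𝓘(ℂ, E) ω M)
    (γ : J →₀ ℕ) (L : K →ₗ[ℂ] K') {V : Opens (TopCat.of M)} (hV : V ≤ chartDomain φ)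
    (f : rsec (holSheaf E M K).ring V) :
    ((holChart K' b hφ).π.p γ).ev hV (secMap L V f) =
      secMap L V (((holChart K b hφ).π.p γ).ev hV f) := by
  let c := holChart K b hφ
  let c' := holChart K' b hφ
  change (c'.π.p γ).ev hV (secMap L V f) = secMap L V ((c.π.p γ).ev hV f)
  induction γ using multiIndex_induction generalizing f with
  | zero =>
    refine (congrArg (fun A => DSec.ev A hV (secMap L V f)) c'.π.p_zero).trans ?_
    exact (congrArg (fun A => secMap L V (DSec.ev A hV f)) c.π.p_zero).symm
  | add γ i ih =>
    refine nsmul_germSheaf_injective (X := TopCat.of M) (𝒢 := holGerms E M K') V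
      (Nat.succ_ne_zero (γ i)) ?_
    have h₁ := c'.p_ev_d γ i hV (secMap L V f)
    have h₂ := congrArg (secMap L V) (c.p_ev_d γ i hV f)
    have h₃ : (c'.d i).ev hV (secMap L V f) = secMap L V ((c.d i).ev hV f) :=
      chartDer_secMap hφ (b i) L hV f
    rw [h₃, ih] at h₁
    exact h₁.symm.trans (h₂.trans (map_nsmul (secMap L V) _ _))

end Linear

/-! ### The ring of the deformation parameter -/

section DefRing
variable (n : ℕ)

instance : Module.Finite ℂ (DefRing n) := (Polynomial.monic_X_pow (n + 1)).finite_quotient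

instance : IsAddTorsionFree (DefRing n) := .of_module_rat _

section Norm
attribute [local instance] Matrix.linftyOpNormedRing Matrix.linftyOpNormedAlgebra

/-- A norm, transported from the regular representation by matrices. -/
instance instNormedCommRingDefRing : NormedCommRing (DefRing n) :=
  NormedCommRing.induced _ _ (Algebra.leftMulMatrix (Module.finBasis ℂ (DefRing n)))
    (Algebra.leftMulMatrix_injective _)

/-- The norm makes the ring a normed algebra; as for all finite-dimensional algebras, the choice of
a norm does not matter for holomorphy. -/
instance instNormedAlgebraDefRing : NormedAlgebra ℂ (DefRing n) :=
  NormedAlgebra.induced _ _ _ (Algebra.leftMulMatrix (Module.finBasis ℂ (DefRing n)))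

end Norm

/-- The reduction modulo `ħ`. -/
def residue : DefRing n →ₐ[ℂ] ℂ :=
  Ideal.Quotient.liftₐ _ (Polynomial.aeval (0 : ℂ)) fun a ha => by
    obtain ⟨b, rfl⟩ := Ideal.mem_span_singleton'.1 ha
    simp

variable {n}

theorem residue_mk (a : Polynomial ℂ) :
    residue n (Ideal.Quotient.mk _ a) = Polynomial.aeval (0 : ℂ) a := rfl

theorem hbar_dvd_iff {k : DefRing n} : hbar n ∣ k ↔ residue n k = 0 := by
  constructor
  · rintro ⟨a, rfl⟩
    rw [map_mul, hbar, residue_mk, Polynomial.aeval_X, zero_mul]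
  · obtain ⟨a, rfl⟩ := Ideal.Quotient.mk_surjective k
    intro h
    rw [residue_mk] at h
    obtain ⟨b, rfl⟩ := Polynomial.X_dvd_iff.2 ((Polynomial.coeff_zero_eq_aeval_zero a).trans h)
    exact ⟨Ideal.Quotient.mk _ b, map_mul _ _ _⟩

theorem isNilpotent_hbar : IsNilpotent (hbar n) :=
  ⟨n + 1, by
    rw [hbar, ← map_pow]
    exact Ideal.Quotient.eq_zero_iff_mem.2 (Ideal.mem_span_singleton_self _)⟩

/-- A linear division by `ħ`. -/
theorem exists_hbar_mul : ∃ L : DefRing n →ₗ[ℂ] DefRing n, ∀ k, hbar n ∣ k → hbar n * L k = k := by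
  let m := LinearMap.mulLeft ℂ (hbar n)
  obtain ⟨g, hg⟩ := LinearMap.exists_rightInverse_of_surjective m.rangeRestrict
    m.range_rangeRestrict
  obtain ⟨L, hL⟩ := LinearMap.exists_extend g
  refine ⟨L, ?_⟩
  rintro _ ⟨a, rfl⟩
  have h₁ := LinearMap.congr_fun hL (m.rangeRestrict a)
  have h₂ := congrArg Subtype.val (LinearMap.congr_fun hg (m.rangeRestrict a))
  change hbar n * L (m.rangeRestrict a).1 = _
  exact (congrArg (hbar n * ·) h₁).trans h₂

end DefRing

/-! ### Symbols of sections of a quantization -/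

section StarTriv
open Filter Topology
variable {E : Type v} [NormedAddCommGroup E] [NormedSpace ℂ E] [FiniteDimensional ℂ E] {M : Type u}
  [TopologicalSpace M] [ChartedSpace E M] [IsManifold 𝓘(ℂ, E) ω M] {n : ℕ}
  {Q : AlgSheaf (DefRing n) (TopCat.of M)} {U V W : Opens (TopCat.of M)}

theorem holLift_eq_secMap (f : rsec (holSheaf E M ℂ).ring V) :
    holLift E n f = secMap (Algebra.linearMap ℂ (DefRing n)) V f :=
  valAt_ext fun z => (valAt_secMap (Algebra.linearMap ℂ (DefRing n)) f z).symm

theorem valAt_holLift (f : rsec (holSheaf E M ℂ).ring V) (z : V) :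
    valAt z (holLift E n f) = algebraMap ℂ (DefRing n) (valAt z f) := rfl

/-- Sections of `O_M ⊗ ℂ[ħ]/(ħ^(n+1))` are linear combinations of holomorphic functions. -/
theorem holLift_induction {P : rsec (holSheaf E M (DefRing n)).ring V → Prop}
    (lift : ∀ f, P (holLift E n f)) (add : ∀ f g, P f → P g → P (f + g))
    (smul : ∀ k f, P f → P ((holSheaf E M (DefRing n)).scalar V k * f))
    (f : rsec (holSheaf E M (DefRing n)).ring V) : P f := by
  let κ := Module.finBasis ℂ (DefRing n)
  have h : f = ∑ j, (holSheaf E M (DefRing n)).scalar V (κ j) *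
      holLift E n (secMap (κ.coord j) V f) := valAt_ext fun z => by
    rw [map_sum]
    refine (κ.sum_repr (valAt z f)).symm.trans (sum_congr rfl fun j _ => ?_)
    rw [map_mul, valAt_scalar, valAt_holLift, valAt_secMap, mul_comm, Algebra.smul_def]
    rfl
  rw [h]
  refine Finset.sum_induction _ P add ?_ fun j _ => smul _ _ (lift _)
  have := smul 0 _ (lift 0)
  rwa [map_zero, zero_mul] at this

/-- A function whose values are divisible by `ħ` is divisible by `ħ`, because division by `ħ` can be
chosen linear and is thus holomorphic. -/
theorem exists_hbar_mul_section (f : rsec (holSheaf E M (DefRing n)).ring V)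
    (h : ∀ z : V, residue n (valAt z f) = 0) :
    ∃ u, f = (holSheaf E M (DefRing n)).scalar V (hbar n) * u := by
  obtain ⟨L, hL⟩ := exists_hbar_mul (n := n)
  refine ⟨secMap L V f, valAt_ext fun z => ?_⟩
  rw [map_mul, valAt_scalar, valAt_secMap, hL _ (hbar_dvd_iff.2 (h z))]

variable (τ : StarTriv E Q U)

/-- Modulo `ħ` the star product is the product of functions, as `B₀(f, g) = f g`. -/
theorem StarTriv.residue_mul (hV : V ≤ U) (f g : rsec (holSheaf E M (DefRing n)).ring V) (z : V) :
    residue n (valAt z ((τ.θ ⟨V, hV⟩).symm (τ.θ ⟨V, hV⟩ f * τ.θ ⟨V, hV⟩ g))) =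
      residue n (valAt z f) * residue n (valAt z g) := by
  induction f using holLift_induction with
  | add f f' h h' => rw [map_add, add_mul, map_add, map_add, map_add, h, h', map_add,
    map_add, add_mul]
  | smul k f h =>
    rw [τ.linear, mul_assoc, ← (τ.θ ⟨V, hV⟩).apply_symm_apply (τ.θ ⟨V, hV⟩ f * _), ← τ.linear,
      AddEquiv.symm_apply_apply, map_mul, map_mul, h, map_mul, map_mul, mul_assoc]
  | lift f =>
    induction g using holLift_induction with
    | add g g' h h' =>
      rw [map_add, mul_add, map_add, map_add, map_add, h, h', map_add, map_add, mul_add]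
    | smul k g h =>
      rw [τ.linear, ← mul_assoc, ← Q.scalar_comm, mul_assoc,
        ← (τ.θ ⟨V, hV⟩).apply_symm_apply (_ * τ.θ ⟨V, hV⟩ g), ← τ.linear,
        AddEquiv.symm_apply_apply, map_mul, map_mul, h, map_mul, map_mul, mul_left_comm]
    | lift g =>
      rw [τ.mul, AddEquiv.symm_apply_apply, map_sum, map_sum, Fin.sum_univ_succ, τ.B_zero,
        Finset.sum_eq_zero fun i _ => ?_, add_zero, map_mul, map_mul, valAt_scalar, Fin.val_zero,
        pow_zero, map_one, one_mul, valAt_holLift, valAt_holLift, valAt_holLift, map_mul, map_mul,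
        map_mul]
      rw [map_mul, map_mul, valAt_scalar, map_pow, hbar_dvd_iff.1 dvd_rfl, Fin.val_succ,
        zero_pow (Nat.succ_ne_zero _), zero_mul]

/-- The value at `z` modulo `ħ` of a section of a star quantization. -/
def StarTriv.symbol (hV : V ≤ U) (z : V) : rsec Q.ring V →+* ℂ where
  toFun t := residue n (valAt z ((τ.θ ⟨V, hV⟩).symm t))
  map_zero' := by rw [map_zero, map_zero, map_zero]
  map_add' s t := by rw [map_add, map_add, map_add]
  map_mul' s t := by
    rw [← τ.residue_mul hV, AddEquiv.apply_symm_apply, AddEquiv.apply_symm_apply]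
  map_one' := by
    have h := τ.residue_mul hV 1 ((τ.θ ⟨V, hV⟩).symm 1) z
    rw [AddEquiv.apply_symm_apply, mul_one, AddEquiv.symm_apply_apply, map_one, map_one,
      one_mul] at h
    exact h.symm

theorem StarTriv.symbol_apply (hV : V ≤ U) (z : V) (f : rsec (holSheaf E M (DefRing n)).ring V) :
    τ.symbol hV z (τ.θ ⟨V, hV⟩ f) = residue n (valAt z f) := by
  change residue n (valAt z ((τ.θ ⟨V, hV⟩).symm _)) = _
  rw [AddEquiv.symm_apply_apply]

theorem StarTriv.symbol_scalar (hV : V ≤ U) (z : V) (k : DefRing n) :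
    τ.symbol hV z (Q.scalar V k) = residue n k := by
  have h := τ.symbol_apply hV z ((holSheaf E M (DefRing n)).scalar V k * (τ.θ ⟨V, hV⟩).symm 1)
  rw [τ.linear, AddEquiv.apply_symm_apply, mul_one] at h
  rw [h, map_mul, map_mul, valAt_scalar]
  exact (congrArg _ (map_one (τ.symbol hV z))).trans (mul_one _)

theorem StarTriv.symbol_res (hV : V ≤ U) (hW : W ≤ V) (z : W) (t : rsec Q.ring V) :
    τ.symbol (hW.trans hV) z (rres Q.ring hW t) = τ.symbol hV ⟨z.1, hW z.2⟩ t := by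
  obtain ⟨f, rfl⟩ := (τ.θ ⟨V, hV⟩).surjective t
  rw [τ.natural V W hV hW, τ.symbol_apply, τ.symbol_apply, valAt_rres]

theorem StarTriv.exists_hbar_mul (hV : V ≤ U) (t : rsec Q.ring V) (h : ∀ z, τ.symbol hV z t = 0) :
    ∃ q, t = Q.scalar V (hbar n) * q := by
  obtain ⟨f, rfl⟩ := (τ.θ ⟨V, hV⟩).surjective t
  obtain ⟨u, rfl⟩ := exists_hbar_mul_section f fun z => (τ.symbol_apply hV z f).symm.trans (h z)
  exact ⟨_, τ.linear ⟨V, hV⟩ _ _⟩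

/-- A section whose symbol does not vanish at a point is invertible modulo `ħ` near the point. -/
theorem StarTriv.exists_mul_eq (hV : V ≤ U) (t : rsec Q.ring V) (z : V) (h : τ.symbol hV z t ≠ 0) :
    ∃ (W : Opens (TopCat.of M)) (hW : W ≤ V) (s q : rsec Q.ring W), z.1 ∈ W ∧
      rres Q.ring hW t * s = 1 + Q.scalar W (hbar n) * q := by
  obtain ⟨f, rfl⟩ := (τ.θ ⟨V, hV⟩).surjective t
  rw [τ.symbol_apply] at h
  let g : M → ℂ := fun y => residue n (secExt f y)
  have hg : ∀ y ∈ V, ContMDiffAt 𝓘(ℂ, E) 𝓘(ℂ) ω g y := fun y hy =>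
    ((LinearMap.toContinuousLinearMap (residue n).toLinearMap).contDiff.contMDiff.contMDiffAt.comp y
      (mem_holGerms.1 (secExt_mem_holGerms f ⟨y, hy⟩)))
  have hz : g z.1 = residue n (valAt z f) := congrArg (residue n) (secExt_apply f z)
  obtain ⟨W, hWs, hWo, hzW⟩ := mem_nhds_iff.1 (((hg z.1 z.2).continuousAt.eventually_ne
    (hz ▸ h)).and (V.isOpen.mem_nhds z.2))
  let W' : Opens (TopCat.of M) := ⟨W, hWo⟩
  have hW : W' ≤ V := fun y hy => (hWs hy).2
  let k : rsec (holSheaf E M ℂ).ring W' := germSec W' (fun y => (g y)⁻¹) fun y hy =>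
    mem_holGerms.2 ((hg y (hW hy)).inv₀ (hWs hy).1)
  have hk : ∀ y : W', τ.symbol (hW.trans hV) y
      (rres Q.ring hW (τ.θ ⟨V, hV⟩ f) * τ.θ ⟨W', hW.trans hV⟩ (holLift E n k) - 1) = 0 :=
        fun y => by
    rw [map_sub, map_mul, map_one, τ.symbol_res hV, τ.symbol_apply, τ.symbol_apply, valAt_holLift,
      AlgHom.commutes]
    have h₁ : residue n (valAt (⟨y.1, hW y.2⟩ : V) f) = g y.1 :=
      (congrArg (residue n) (secExt_apply f ⟨y.1, hW y.2⟩)).symm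
    rw [h₁, sub_eq_zero]
    exact mul_inv_cancel₀ (hWs y.2).1
  obtain ⟨q, hq⟩ := τ.exists_hbar_mul (hW.trans hV) _ hk
  exact ⟨W', hW, _, q, hzW, eq_add_of_sub_eq' hq⟩

/-- The symbol does not depend on the trivialization: `t - c` is not invertible modulo `ħ` near `z`
for exactly one number `c`. -/
theorem StarTriv.symbol_eq {U' : Opens (TopCat.of M)} (σ : StarTriv E Q U') (hV : V ≤ U)
    (hV' : V ≤ U')
    (z : V) (t : rsec Q.ring V) : τ.symbol hV z t = σ.symbol hV' z t := by
  by_contra h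
  -- For the value `c` of one symbol, `t - c` has an inverse modulo `ħ` if the other symbol differs.
  let c := algebraMap ℂ (DefRing n) (σ.symbol hV' z t)
  have hc : residue n c = σ.symbol hV' z t := AlgHom.commutes _ _
  obtain ⟨W, hW, s, q, hz, e⟩ := τ.exists_mul_eq hV (t - Q.scalar V c) z (by
    rwa [map_sub, τ.symbol_scalar, hc, sub_ne_zero])
  have h₁ := congrArg (σ.symbol (hW.trans hV') ⟨z.1, hz⟩) e
  rw [map_mul, σ.symbol_res hV', map_sub, σ.symbol_scalar, hc, sub_self, zero_mul, map_add, map_one,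
    map_mul, σ.symbol_scalar, hbar_dvd_iff.1 dvd_rfl, zero_mul, add_zero] at h₁
  exact zero_ne_one h₁

/-- Equality modulo `ħ`, defined by means of all trivializations, can be tested in each one. -/
theorem StarTriv.modHbar_rel_iff (hV : V ≤ U) (s : rsec (holSheaf E M (DefRing n)).ring V)
    (t : rsec Q.ring V) : (modHbar E Q).rel V s t ↔
      ∃ u, (τ.θ ⟨V, hV⟩).symm t = s + (holSheaf E M (DefRing n)).scalar V (hbar n) * u := by
  constructor
  · intro h
    obtain ⟨u, hu⟩ := exists_hbar_mul_section ((τ.θ ⟨V, hV⟩).symm t - s) fun z => by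
      obtain ⟨U', W, hU', hW, σ, r, hz, e, hr⟩ := h z.1 z.2
      have h₁ := hbar_dvd_iff.1 (hr ⟨z.1, hz⟩)
      rw [map_sub, sub_eq_zero] at h₁
      rw [map_sub, map_sub, sub_eq_zero]
      have h₂ := τ.symbol_eq σ (hW.trans hV) hU' ⟨z.1, hz⟩ (rres Q.ring hW t)
      rw [τ.symbol_res hV, e, σ.symbol_apply] at h₂
      exact h₂.trans h₁
    exact ⟨u, eq_add_of_sub_eq' hu⟩
  · rintro ⟨u, hu⟩ x hx
    refine ⟨U, V, hV, le_rfl, τ, _, hx, (rres_self _ _ _).trans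
      ((τ.θ ⟨V, hV⟩).apply_symm_apply t).symm, fun y => ⟨valAt y u, ?_⟩⟩
    have h := congrArg (valAt y) hu
    rw [map_add, map_mul, valAt_scalar] at h
    exact sub_eq_of_eq_add' h

end StarTriv

/-! ### Quantizations in coordinates -/

section Quantization
variable {E : Type v} [NormedAddCommGroup E] [NormedSpace ℂ E] [FiniteDimensional ℂ E] {M : Type u}
  [TopologicalSpace M] [ChartedSpace E M] [IsManifold 𝓘(ℂ, E) ω M] {n : ℕ}
  {Q : AlgSheaf (DefRing n) (TopCat.of M)} {U : Opens (TopCat.of M)}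

/-- A formula for a star product holds if it holds for holomorphic functions. -/
theorem StarTriv.mul_eq_of_holLift (τ : StarTriv E Q U) {V : Opens (TopCat.of M)} (hV : V ≤ U)
    {ι : Type*} (Λ : Finset ι) (C : ι → rsec (holSheaf E M (DefRing n)).ring V)
    (D D' : ι → rsec (holSheaf E M (DefRing n)).ring V →+ rsec (holSheaf E M (DefRing n)).ring V)
    (hD : ∀ q k f, D q ((holSheaf E M (DefRing n)).scalar V k * f) =
      (holSheaf E M (DefRing n)).scalar V k * D q f)
    (hD' : ∀ q k f, D' q ((holSheaf E M (DefRing n)).scalar V k * f) =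
      (holSheaf E M (DefRing n)).scalar V k * D' q f) (R : _ → _ → _)
    (hR : R = fun f g : rsec (holSheaf E M (DefRing n)).ring V =>
      f * g + (holSheaf E M (DefRing n)).scalar V (hbar n) * ∑ q ∈ Λ, C q * (D q f * D' q g))
    (h : ∀ f g, τ.θ ⟨V, hV⟩ (holLift E n f) * τ.θ ⟨V, hV⟩ (holLift E n g) =
      τ.θ ⟨V, hV⟩ (R (holLift E n f) (holLift E n g)))
    (f g : rsec (holSheaf E M (DefRing n)).ring V) :
    τ.θ ⟨V, hV⟩ f * τ.θ ⟨V, hV⟩ g = τ.θ ⟨V, hV⟩ (R f g) := by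
  have hl : ∀ f f' g, R (f + f') g = R f g + R f' g := fun f f' g => valAt_ext fun z => by
    simp only [hR, map_add, map_mul, map_sum, add_mul, mul_add, Finset.sum_add_distrib]
    ring
  have hr : ∀ f g g', R f (g + g') = R f g + R f g' := fun f g g' => valAt_ext fun z => by
    simp only [hR, map_add, map_mul, map_sum, mul_add, Finset.sum_add_distrib]
    ring
  have hls : ∀ k f g, R ((holSheaf E M (DefRing n)).scalar V k * f) g =
      (holSheaf E M (DefRing n)).scalar V k * R f g := fun k f g => valAt_ext fun z => by
    simp only [hR, map_add, map_mul, map_sum, hD, mul_add, mul_sum]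
    refine congrArg₂ _ (mul_assoc _ _ _) (sum_congr rfl fun q _ => by ring)
  have hrs : ∀ k f g, R f ((holSheaf E M (DefRing n)).scalar V k * g) =
      (holSheaf E M (DefRing n)).scalar V k * R f g := fun k f g => valAt_ext fun z => by
    simp only [hR, map_add, map_mul, map_sum, hD', mul_add, mul_sum]
    refine congrArg₂ _ (mul_left_comm _ _ _) (sum_congr rfl fun q _ => by ring)
  induction f using holLift_induction with
  | add f f' h h' => rw [map_add, add_mul, h, h', ← map_add, hl]
  | smul k f h => rw [τ.linear, mul_assoc, h, ← τ.linear, hls]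
  | lift f =>
    induction g using holLift_induction with
    | add g g' h h' => rw [map_add, mul_add, h, h', ← map_add, hr]
    | smul k g h => rw [τ.linear, ← mul_assoc, ← Q.scalar_comm, mul_assoc, h, ← τ.linear, hrs]
    | lift g => exact h f g

/-- A star product is given by a formula in coordinates. -/
theorem StarTriv.nonempty_starData (τ : StarTriv E Q U) {x : M} (hx : x ∈ U) :
    ∃ (U₀ : Opens (TopCat.of M)) (c : Chart (X := TopCat.of M)
      (fun x => le_refl (holGerms E M (DefRing n) x)) U₀) (ħ : DefRing n), x ∈ U₀ ∧
      Nonempty (StarData (modHbar E Q) c ħ) := by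
  classical
  let hφ := IsManifold.chart_mem_maximalAtlas (I := 𝓘(ℂ, E)) (n := ω) x
  let J := Fin (Module.finrank ℂ E)
  let b : Module.Basis J ℂ E := Module.finBasis ℂ E
  let c := holChart (DefRing n) b hφ
  let p : (J →₀ ℕ) → DSec _ _ (chartDomain (chartAt E x)) := c.π.p
  let p₀ : (J →₀ ℕ) → DSec _ _ (chartDomain (chartAt E x)) := (holChart ℂ b hφ).π.p
  -- The operators `Bᵢ` with `i ≥ 1` are expanded in coordinates, and `C'` collects `∑ ħ^(i-1) Bᵢ`.
  have hB : ∀ i : Fin n, ∃ (V : Opens (TopCat.of M)) (hV : V ≤ U)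
      (hV₀ : V ≤ chartDomain (chartAt E x)) (F₀ : Finset (J →₀ ℕ))
      (C : (J →₀ ℕ) × (J →₀ ℕ) → rsec (holSheaf E M ℂ).ring V), x ∈ V ∧ ∀ F, F₀ ⊆ F →
      ∀ (W : Opens (TopCat.of M)) (hW : W ≤ V) (f g : rsec (holSheaf E M ℂ).ring W),
        (τ.B i.succ).toFun ⟨W, hW.trans hV⟩ f g = ∑ q ∈ F ×ˢ F, rres _ hW (C q) *
          ((p₀ q.1).ev (hW.trans hV₀) f * (p₀ q.2).ev (hW.trans hV₀) g) := fun i =>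
    (τ.B i.succ).exists_expansion (holChart ℂ b hφ) hx (mem_chart_source E x)
  choose V hV hV₀ F₀ C hxV hB using hB
  obtain ⟨W, hxW, hW⟩ := exists_common_nhd_of_finite
    (fun o : Option (Fin n) => o.elim (U ⊓ chartDomain (chartAt E x)) V)
    (Option.rec ⟨hx, mem_chart_source E x⟩ hxV)
  have hWU : W ≤ U := (hW none).trans inf_le_left
  have hW₀ : W ≤ chartDomain (chartAt E x) := (hW none).trans inf_le_right
  have hWV : ∀ i, W ≤ V i := fun i => hW (some i)
  let F := Finset.univ.biUnion F₀
  let C' : (J →₀ ℕ) × (J →₀ ℕ) → rsec (holSheaf E M (DefRing n)).ring W := fun q =>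
    ∑ i : Fin n, (holSheaf E M (DefRing n)).scalar W (hbar n ^ (i : ℕ)) *
      holLift E n (rres _ (hWV i) (C i q))
  refine ⟨W, c.restrict hW₀, hbar n, hxW, ⟨{
    nilpotent := isNilpotent_hbar
    θ := ⟨fun Ω hΩ => τ.θ ⟨Ω, hΩ.trans hWU⟩, fun Ω Ω' hΩ hΩ' f =>
      τ.natural Ω Ω' (hΩ.trans hWU) hΩ' f⟩
    linear := fun Ω hΩ k f => τ.linear ⟨Ω, hΩ.trans hWU⟩ k f
    Λ := F ×ˢ F
    C := C'
    mul := fun Ω hΩ f g => ?_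
    rel_iff := fun Ω hΩ s t => τ.modHbar_rel_iff (hΩ.trans hWU) s t }⟩⟩
  refine τ.mul_eq_of_holLift (hΩ.trans hWU) (F ×ˢ F) (fun q => rres _ hΩ (C' q))
    (fun q => DSec.homEv (p q.1) (hΩ.trans hW₀)) (fun q => DSec.homEv (p q.2) (hΩ.trans hW₀))
    (fun q k f => DSec.ev_scalar_mul (p q.1) (hΩ.trans hW₀) k f)
    (fun q k f => DSec.ev_scalar_mul (p q.2) (hΩ.trans hW₀) k f) _ rfl (fun f g => ?_) f g
  rw [τ.mul]
  refine congrArg _ (valAt_ext fun z => ?_)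
  have hι : ∀ γ (f : rsec (holSheaf E M ℂ).ring Ω),
      algebraMap ℂ (DefRing n) (valAt z ((p₀ γ).ev (hΩ.trans hW₀) f)) =
        valAt z (DSec.homEv (p γ) (hΩ.trans hW₀) (holLift E n f)) := fun γ f => by
    have h := divPow_secMap b hφ γ (Algebra.linearMap ℂ (DefRing n)) (hΩ.trans hW₀) f
    rw [← holLift_eq_secMap, ← holLift_eq_secMap] at h
    exact (congrArg (valAt z) h).symm
  have hC : ∀ q, valAt z (rres _ hΩ (C' q)) = ∑ i : Fin n, hbar n ^ (i : ℕ) *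
      algebraMap ℂ _ (valAt z (rres _ (hΩ.trans (hWV i)) (C i q))) := fun q => by
    rw [valAt_rres, map_sum]
    refine sum_congr rfl fun i _ => ?_
    rw [map_mul, valAt_scalar, valAt_holLift, valAt_rres, valAt_rres]
  have hB' : ∀ i : Fin n, valAt z (holLift E n ((τ.B i.succ).toFun ⟨Ω, hΩ.trans hWU⟩ f g)) =
      ∑ q ∈ F ×ˢ F, algebraMap ℂ _ (valAt z (rres _ (hΩ.trans (hWV i)) (C i q))) *
        (valAt z (DSec.homEv (p q.1) (hΩ.trans hW₀) (holLift E n f)) *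
          valAt z (DSec.homEv (p q.2) (hΩ.trans hW₀) (holLift E n g))) := fun i => by
    rw [valAt_holLift, hB i F (Finset.subset_biUnion_of_mem F₀ (Finset.mem_univ i)) Ω
      (hΩ.trans (hWV i)) f g, map_sum, map_sum]
    refine sum_congr rfl fun q _ => ?_
    rw [map_mul, map_mul, map_mul, map_mul, hι, hι]
  have hsum : ∀ (d : Fin n → (J →₀ ℕ) × (J →₀ ℕ) → DefRing n) (a : _ → DefRing n),
      ∑ i : Fin n, hbar n ^ ((i : ℕ) + 1) * ∑ q ∈ F ×ˢ F, d i q * a q =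
        hbar n * ∑ q ∈ F ×ˢ F, (∑ i : Fin n, hbar n ^ (i : ℕ) * d i q) * a q := fun d a => by
    simp only [mul_sum, sum_mul]
    rw [Finset.sum_comm]
    exact sum_congr rfl fun q _ => sum_congr rfl fun i _ => by ring
  rw [map_sum, Fin.sum_univ_succ, τ.B_zero, map_add, map_mul, map_mul, map_mul, valAt_scalar,
    valAt_scalar, Fin.val_zero, pow_zero, one_mul, valAt_holLift, valAt_holLift,
    valAt_holLift, map_mul, map_sum]
  simp only [map_mul, valAt_scalar, hB', hC, Fin.val_succ]
  rw [hsum]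

/-- The equivalence for neutralized star quantizations. -/
theorem inducesEquivalence_of_isStarQuantization (hQ : IsStarQuantization E Q) :
    InducesEquivalence (O := holSheaf E M (DefRing n)) (S := Q) (T := Q)
      (modHbar E Q).flip (modHbar E Q) (Corr.eq _)
      (postAct (holSheaf E M (DefRing n)) Q (modHbar E Q)) .right :=
  inducesEquivalence_of_starData (X := TopCat.of M) (𝒢 := holGerms E M (DefRing n))
    (fun x => exists_chart_holSheaf (DefRing n) x) fun x => by
      obtain ⟨U, hx, ⟨τ⟩⟩ := hQ x
      exact τ.nonempty_starData hx

end Quantization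

end DCom
end

theorem mainTheorem8 :
    (∀ (E : Type v) (M : Type u) [NormedAddCommGroup E] [NormedSpace ℂ E] [FiniteDimensional ℂ E]
      [TopologicalSpace M] [ChartedSpace E M] [IsManifold 𝓘(ℂ, E) ω M],
      InducesEquivalence (O := holSheaf E M ℂ) (S := holSheaf E M ℂ) (T := holSheaf E M ℂ)
        (Corr.eq _) (Corr.eq _) (Corr.eq _)
        (postAct (holSheaf E M ℂ) (holSheaf E M ℂ) (Corr.eq _)) .left) ∧
    (∀ (E : Type v) (M : Type u) [NormedAddCommGroup E] [NormedSpace ℂ E] [FiniteDimensional ℂ E]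
      [TopologicalSpace M] [ChartedSpace E M] [IsManifold 𝓘(ℂ, E) ω M] (n : ℕ)
      (Q : AlgSheaf (DefRing n) (TopCat.of M)), IsStarQuantization E Q →
      InducesEquivalence (O := holSheaf E M (DefRing n)) (S := Q) (T := Q)
        (modHbar E Q).flip (modHbar E Q) (Corr.eq _)
        (postAct (holSheaf E M (DefRing n)) Q (modHbar E Q)) .right) ∧
    (∀ (E : Type v) (F : Type w) (Z X : Type u)
      [NormedAddCommGroup E] [NormedSpace ℂ E] [FiniteDimensional ℂ E]
      [TopologicalSpace Z] [ChartedSpace E Z] [IsManifold 𝓘(ℂ, E) ω Z]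
      [NormedAddCommGroup F] [NormedSpace ℂ F] [FiniteDimensional ℂ F]
      [TopologicalSpace X] [ChartedSpace F X] [IsManifold 𝓘(ℂ, F) ω X]
      (p : Z → X) (hp : Manifold.IsSubmersion 𝓘(ℂ, E) 𝓘(ℂ, F) ω p),
      IsInverseImageOfD hp.contMDiff ∧
      InducesEquivalence (O := holSheaf E Z ℂ)
        (S := germSheaf (X := TopCat.of Z) (pullGerms F ℂ p)) (T := holSheaf E Z ℂ)
        (sameFn (X := TopCat.of Z) (pullGerms F ℂ p) (holGerms E Z ℂ)) (Corr.eq _)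
        (sameFn (X := TopCat.of Z) (pullGerms F ℂ p) (holGerms E Z ℂ))
        (preAct (holSheaf E Z ℂ) (overLin (X := TopCat.of Z) (holGerms E Z ℂ) (pullGerms F ℂ p))
          (overLin_scalar (X := TopCat.of Z) (holGerms E Z ℂ) (pullGerms F ℂ p))) .left) :=
  ⟨fun E M _ _ _ _ _ _ => inducesEquivalence_holSheaf E M,
    fun E M _ _ _ _ _ _ n Q hQ => inducesEquivalence_of_isStarQuantization hQ,
    fun E F Z X _ _ _ _ _ _ _ _ _ _ _ _ p hp =>
      ⟨isInverseImageOfD_of_isSubmersion hp, inducesEquivalence_of_isSubmersion hp⟩⟩
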